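/- Let $d\in\{2,3\}$, $T>0$, $a>0$, $\gamma>1$, $p(\varrho)=a\varrho^\gamma$, $P(\varrho)=\frac{a}{\gamma-1}\varrho^\gamma$. Let $\Omega$ be either a bounded domain in $\mathbb R^d$ of class $C^1$, with outer unit normal $\mathbf n$, or the flat torus $([-1,1]|_{\{-1,1\}})^d$ (then $\overline\Omega=\Omega$ and $\partial\Omega=\emptyset$). Let the initial data $[\varrho_0,\mathbf m_0]$ have finite energy: $$\varrho_0\in L^\gamma(\Omega),\quad \varrho_0\ge 0,\quad \mathbf m_0\in L^{\frac{2\gamma}{\gamma+1}}(\Omega;\mathbb R^d),\quad E_0:=\int_\Omega\Big[\tfrac12\tfrac{|\mathbf m_0|^2}{\varrho_0}+P(\varrho_0)\Big]\,dx<\infty ,$$ where $\frac{|\mathbf m|^2}{\varrho}$ is $0$ if $\mathbf m=0$ and $\infty$ if $\varrho=0$, $\mathbf m\neq0$. A dissipative solution of the Euler system starting from $[\varrho_0,\mathbf m_0]$ is a pair $\varrho\in C_{\rm weak}([0,T];L^\gamma(\Omega))$, $\varrho\ge0$, $\mathbf m\in C_{\rm weak}([0,T];L^{\frac{2\gamma}{\gamma+1}}(\Omega;\mathbb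 R^d))$ with $\varrho(0)=\varrho_0$, $\mathbf m(0)=\mathbf m_0$, together with turbulent defect measures $\mathfrak R_v\in L^\infty(0,T;\mathcal M^+(\overline\Omega;\mathbb R^{d\times d}_{\rm sym}))$ (matrix-valued measures with positive semidefinite values) and $\mathfrak R_p\in L^\infty(0,T;\mathcal M^+(\overline\Omega))$, such that: 1. for all $0<\tau<T$ and $\varphi\in C^1_c([0,T)\times\overline\Omega)$, $$\Big[\int_\Omega\varrho\varphi\,dx\Big]_{t=0}^{t=\tau}=\int_0^\tau\!\!\int_\Omega[\varrho\,\partial_t\varphi+\mathbf m\cdot\nabla_x\varphi]\,dx\,dt;$$ 2. for all $0<\tau<T$ and $\boldsymbol\varphi\in C^1_c([0,T)\times\overline\Omega;\mathbb R^d)$ with $\boldsymbol\varphi\cdot\mathbf n|_{\partial\Omega}=0$, $$\Big[\int_\Omega\mathbf m\cdot\boldsymbol\varphi\,dx\Big]_{t=0}^{t=\tau}=\int_0^\tau\!\!\int_\Omega\Big[\mathbf m\cdot\partial_t\boldsymbol\varphi+\frac{\mathbf m\otimes\mathbf m}{\varrho}:\nabla_x\boldsymbol\varphi+p(\varrho)\,{\rm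 div}_x\boldsymbol\varphi\Big]dx\,dt+\int_0^\tau\!\!\int_{\overline\Omega}\nabla_x\boldsymbol\varphi:d[\mathfrak R_v+\mathfrak R_p\mathbb I]\,dt;$$ 3. with $E(t)=\int_\Omega[\frac12\frac{|\mathbf m|^2}{\varrho}+P(\varrho)](t)\,dx+\int_{\overline\Omega}\frac12\,d\,{\rm trace}[\mathfrak R_v(t)]+\int_{\overline\Omega}\frac1{\gamma-1}\,d\mathfrak R_p(t)$, which is finite for a.e. $t\in(0,T)$ and integrable on $(0,T)$, the one-sided essential limits $E(\tau-)$ for $0<\tau<T$ and $E(\tau+)$ for $0\le\tau<T$ exist, and with $E(0-):=E_0$, $$\psi(\tau_2)E(\tau_2+)-\psi(\tau_1)E(\tau_1-)\le\int_{\tau_1}^{\tau_2}\partial_t\psi\,E\,dt$$ for all $0\le\tau_1\le\tau_2<T$ and $\psi\in C^1_c[0,T)$, $\psi\ge0$. For two dissipative solutions (with their defects) write $[\varrho_1,\mathbf m_1]\prec[\varrho_2,\mathbf m_2]$ if $$\tfrac12\tfrac{|\mathbf m_1|^2}{\varrho_1}+P(\varrho_1)+\tfrac12{\rm trace}[\mathfrak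 R_v^1]+\tfrac1{\gamma-1}\mathfrak R_p^1\le\tfrac12\tfrac{|\mathbf m_2|^2}{\varrho_2}+P(\varrho_2)+\tfrac12{\rm trace}[\mathfrak R_v^2]+\tfrac1{\gamma-1}\mathfrak R_p^2$$ in the sense of measures on $[0,T]\times\overline\Omega$. A dissipative solution $[\varrho,\mathbf m]$ is admissible if for every dissipative solution $[\widetilde\varrho,\widetilde{\mathbf m}]$ with the same initial data, $[\widetilde\varrho,\widetilde{\mathbf m}]\prec[\varrho,\mathbf m]$ implies that the two total energy measures above are equal on $[0,T]\times\overline\Omega$. Then there exists an admissible dissipative solution starting from $[\varrho_0,\mathbf m_0]$. Moreover, the time-integrated total energy $\int_0^T E(t)\,dt$ attains its minimum over all dissipative solutions (with their defects) starting from $[\varrho_0,\mathbf m_0]$, and every minimizer is admissible. -/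

import Mathlib

open MeasureTheory Set Filter Topology
open scoped ENNReal NNReal

namespace EulerDiss

/-- Points and vectors of `ℝ^d`, with the Euclidean norm. -/
abbrev Vec (d : ℕ) : Type := EuclideanSpace ℝ (Fin d)

/-- The standard basis vectors of `ℝ^d`. -/
noncomputable def basisVec {d : ℕ} (i : Fin d) : Vec d := EuclideanSpace.single i (1 : ℝ)

/-! ## The spatial region -/

/-- `g` is a `C¹` function with nonzero gradient at `x`, and near `x` the set `Ω` is `{g < 0}`. -/
def IsLocalDefiningFunction {d : ℕ} (Ω : Set (Vec d)) (x : Vec d) (g : Vec d → ℝ) : Prop :=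
  ContDiff ℝ 1 g ∧ gradient g x ≠ 0 ∧ ∃ U ∈ 𝓝 x, ∀ y ∈ U, (y ∈ Ω ↔ g y < 0)

/-- The (open) set `Ω` has a boundary of class `C¹`. -/
def HasC1Boundary {d : ℕ} (Ω : Set (Vec d)) : Prop :=
  ∀ x ∈ frontier Ω, ∃ g : Vec d → ℝ, IsLocalDefiningFunction Ω x g

/-- `n` is the outer unit normal of `Ω` at the boundary point `x`. -/
def IsOuterNormal {d : ℕ} (Ω : Set (Vec d)) (x n : Vec d) : Prop :=
  ∃ g : Vec d → ℝ, IsLocalDefiningFunction Ω x g ∧ n = ‖gradient g x‖⁻¹ • gradient g x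

/-- The region occupied by the fluid: either a bounded domain of class `C¹` (with impermeable
boundary), or the flat torus `([-1,1]|_{-1,1})^d` (periodic boundary conditions). -/
inductive FlowRegion (d : ℕ) : Type
  | domain (Ω : Set (Vec d)) (isOpen : IsOpen Ω) (isConnected : IsConnected Ω)
      (isBounded : Bornology.IsBounded Ω) (hasC1Boundary : HasC1Boundary Ω) : FlowRegion d
  | torus : FlowRegion d

/-- The half-open cell `[-1,1)^d`, in which every point of the flat torus has exactly one
representative. -/
def cell (d : ℕ) : Set (Vec d) := {x | ∀ i, x i ∈ Ico (-1 : ℝ) 1}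

namespace FlowRegion

/-- The set `Ω` that carries the Lebesgue measure. -/
def interiorSet {d : ℕ} : FlowRegion d → Set (Vec d)
  | domain Ω _ _ _ _ => Ω
  | torus => cell d

/-- The set `Ω̄` on which the defect measures live; measures on the torus are measures on its
cell of representatives. -/
def closedSet {d : ℕ} : FlowRegion d → Set (Vec d)
  | domain Ω _ _ _ _ => closure Ω
  | torus => cell d

/-- On the torus, functions are `2`-periodic in each space variable. -/
def IsPeriodic {d : ℕ} {F : Type} (D : FlowRegion d) (φ : ℝ → Vec d → F) : Prop :=
  match D with
  | domain _ _ _ _ _ => True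
  | torus => ∀ (t : ℝ) (x : Vec d) (i : Fin d), φ t (x + (2 : ℝ) • basisVec i) = φ t x

/-- `φ · n = 0` on `∂Ω` (no condition on the torus, which has no boundary). -/
def IsTangential {d : ℕ} (D : FlowRegion d) (T : ℝ) (φ : ℝ → Vec d → Vec d) : Prop :=
  match D with
  | domain Ω _ _ _ _ =>
      ∀ t ∈ Ico 0 T, ∀ x ∈ frontier Ω, ∀ n, IsOuterNormal Ω x n → inner ℝ (φ t x) n = 0
  | torus => True

/-- Lebesgue measure on `Ω`. -/
noncomputable def vol {d : ℕ} (D : FlowRegion d) : Measure (Vec d) :=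
  volume.restrict D.interiorSet

end FlowRegion

/-! ## Test functions

The class `C¹_c([0,T) × Ω̄)`, as restrictions of `C¹` functions on `ℝ × ℝ^d` that vanish for
all times `t ≥ T'`, for some `T' < T`. -/

/-- Scalar test functions for the continuity equation. -/
def IsScalarTest {d : ℕ} (D : FlowRegion d) (T : ℝ) (φ : ℝ → Vec d → ℝ) : Prop :=
  ContDiff ℝ 1 (fun z : ℝ × Vec d => φ z.1 z.2) ∧
    (∃ T' < T, ∀ t ≥ T', ∀ x, φ t x = 0) ∧ D.IsPeriodic φ

/-- Vector test functions for the momentum equation. -/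
def IsVectorTest {d : ℕ} (D : FlowRegion d) (T : ℝ) (φ : ℝ → Vec d → Vec d) : Prop :=
  ContDiff ℝ 1 (fun z : ℝ × Vec d => φ z.1 z.2) ∧
    (∃ T' < T, ∀ t ≥ T', ∀ x, φ t x = 0) ∧ D.IsPeriodic φ ∧ D.IsTangential T φ

/-- Nonnegative test functions of time for the energy inequality, of class `C¹_c[0,T)`. -/
def IsTimeTest (T : ℝ) (ψ : ℝ → ℝ) : Prop :=
  ContDiff ℝ 1 ψ ∧ (∃ T' < T, ∀ t ≥ T', ψ t = 0) ∧ ∀ t ∈ Ico 0 T, 0 ≤ ψ t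

/-- The partial derivative `∂_j φ_i (x)` of a vector field. -/
noncomputable def partialD {d : ℕ} (φ : Vec d → Vec d) (x : Vec d) (i j : Fin d) : ℝ :=
  (fderiv ℝ φ x (basisVec j)) i

/-- The divergence of a vector field. -/
noncomputable def divergence {d : ℕ} (φ : Vec d → Vec d) (x : Vec d) : ℝ :=
  ∑ i, partialD φ x i i

/-! ## State variables, pressure and energy -/

/-- The pressure `p(ϱ) = a ϱ^γ`. -/
noncomputable def pressure (a γ r : ℝ) : ℝ := a * r ^ γ

/-- The pressure potential `P(ϱ) = a / (γ - 1) ϱ^γ`. -/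
noncomputable def pressurePotential (a γ r : ℝ) : ℝ := a / (γ - 1) * r ^ γ

/-- The energy density `|m|² / (2 ϱ) + P(ϱ)`, for `ϱ ≥ 0`. The first summand is `0` where
`m = 0`, and `∞` where `ϱ = 0` and `m ≠ 0`; the division of `ℝ≥0∞` has this convention. -/
noncomputable def energyDensity {d : ℕ} (a γ r : ℝ) (v : Vec d) : ℝ≥0∞ :=
  ENNReal.ofReal (‖v‖ ^ 2 / 2) / ENNReal.ofReal r + ENNReal.ofReal (pressurePotential a γ r)

/-- A candidate: density `ϱ`, momentum `m`, and the time-dependent families of defect measures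
`R_v` (a matrix of signed measures) and `R_p` (a nonnegative measure). -/
structure Candidate (d : ℕ) where
  ρ : ℝ → Vec d → ℝ
  m : ℝ → Vec d → Vec d
  Rv : ℝ → Matrix (Fin d) (Fin d) (SignedMeasure (Vec d))
  Rp : ℝ → Measure (Vec d)

/-- `f ∈ C_weak([0,T]; L^p(Ω))`, for `1 < p < ∞`, tested with `g ∈ L^{p'}(Ω)`, `p' = p / (p - 1)`.
The joint measurability of `f` fixes a representative and is no further restriction. -/
structure IsWeaklyContinuous {d : ℕ} {F : Type} [NormedAddCommGroup F] [InnerProductSpace ℝ F]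
    (D : FlowRegion d) (T p : ℝ) (f : ℝ → Vec d → F) : Prop where
  aestronglyMeasurable : AEStronglyMeasurable (fun z : ℝ × Vec d => f z.1 z.2)
    ((volume.restrict (Ioo 0 T)).prod D.vol)
  memLp : ∀ t ∈ Icc 0 T, MemLp (f t) (ENNReal.ofReal p) D.vol
  continuousOn : ∀ g : Vec d → F, MemLp g (ENNReal.ofReal (p / (p - 1))) D.vol →
    ContinuousOn (fun t => ∫ x, inner ℝ (f t x) (g x) ∂D.vol) (Icc 0 T)

/-- `R_v ∈ L^∞(0,T; M⁺(Ω̄; ℝ^{d×d}_sym))` and `R_p ∈ L^∞(0,T; M⁺(Ω̄))`: weakly measurable,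
essentially bounded families of measures on `Ω̄`, those of `R_v` with values in the symmetric
positive semidefinite matrices. -/
structure AreDefectMeasures {d : ℕ} (D : FlowRegion d) (T : ℝ)
    (Rv : ℝ → Matrix (Fin d) (Fin d) (SignedMeasure (Vec d))) (Rp : ℝ → Measure (Vec d)) :
    Prop where
  measurable_v : ∀ (i j : Fin d) (B : Set (Vec d)), MeasurableSet B →
    AEMeasurable (fun t => Rv t i j B) (volume.restrict (Ioo 0 T))
  measurable_p : ∀ B : Set (Vec d), MeasurableSet B →
    AEMeasurable (fun t => Rp t B) (volume.restrict (Ioo 0 T))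
  bounded_v : ∃ C : ℝ≥0, ∀ᵐ t ∂volume.restrict (Ioo 0 T), ∀ i j : Fin d,
    (Rv t i j).variation univ ≤ C
  bounded_p : ∃ C : ℝ≥0, ∀ᵐ t ∂volume.restrict (Ioo 0 T), Rp t univ ≤ C
  support_v : ∀ᵐ t ∂volume.restrict (Ioo 0 T), ∀ (i j : Fin d) (B : Set (Vec d)),
    MeasurableSet B → Disjoint B D.closedSet → Rv t i j B = 0
  support_p : ∀ᵐ t ∂volume.restrict (Ioo 0 T), Rp t D.closedSetᶜ = 0
  posSemidef : ∀ᵐ t ∂volume.restrict (Ioo 0 T), ∀ B : Set (Vec d), MeasurableSet B →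
    (Matrix.of fun i j => Rv t i j B).PosSemidef

/-- The value on `B` of the total energy measure at time `t`,
`(|m|² / (2 ϱ) + P(ϱ)) dx + (1/2) trace R_v + 1 / (γ - 1) R_p`. -/
noncomputable def energyOn {d : ℕ} (D : FlowRegion d) (a γ : ℝ) (S : Candidate d) (t : ℝ)
    (B : Set (Vec d)) : ℝ≥0∞ :=
  (∫⁻ x in B, energyDensity a γ (S.ρ t x) (S.m t x) ∂D.vol) +
    ENNReal.ofReal (1 / 2 * ∑ i, S.Rv t i i B) + ENNReal.ofReal (1 / (γ - 1)) * S.Rp t B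

/-- The energy of the initial data. -/
noncomputable def initialEnergy {d : ℕ} (D : FlowRegion d) (a γ : ℝ) (ρ₀ : Vec d → ℝ)
    (m₀ : Vec d → Vec d) : ℝ≥0∞ :=
  ∫⁻ x, energyDensity a γ (ρ₀ x) (m₀ x) ∂D.vol

/-- Finite energy initial data. -/
structure IsFiniteEnergyData {d : ℕ} (D : FlowRegion d) (a γ : ℝ) (ρ₀ : Vec d → ℝ)
    (m₀ : Vec d → Vec d) : Prop where
  nonneg : ∀ᵐ x ∂D.vol, 0 ≤ ρ₀ x
  memLp_density : MemLp ρ₀ (ENNReal.ofReal γ) D.vol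
  memLp_momentum : MemLp m₀ (ENNReal.ofReal (2 * γ / (γ + 1))) D.vol
  energy_lt_top : initialEnergy D a γ ρ₀ m₀ < ∞

/-! ## Dissipative solutions -/

/-- The weak formulation of `∂_t ϱ + div m = 0`. -/
def ContinuityEquation {d : ℕ} (D : FlowRegion d) (T : ℝ) (S : Candidate d) : Prop :=
  ∀ φ : ℝ → Vec d → ℝ, IsScalarTest D T φ → ∀ τ ∈ Ioo 0 T,
    (∫ x, S.ρ τ x * φ τ x ∂D.vol) - (∫ x, S.ρ 0 x * φ 0 x ∂D.vol) =
      ∫ t in 0..τ, ∫ x, (S.ρ t x * deriv (fun s => φ s x) t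
        + inner ℝ (S.m t x) (gradient (φ t) x)) ∂D.vol

/-- The integral `∫_Ω̄ ∇φ : d[R_v + R_p 𝕀]`. -/
noncomputable def defectPairing {d : ℕ} (Rv : Matrix (Fin d) (Fin d) (SignedMeasure (Vec d)))
    (Rp : Measure (Vec d)) (φ : Vec d → Vec d) : ℝ :=
  (∑ i, ∑ j, (Rv i j).integral (fun x => partialD φ x i j) (ContinuousLinearMap.lsmul ℝ ℝ)) +
    ∫ x, divergence φ x ∂(Rp)

/-- The weak formulation of
`∂_t m + div (m ⊗ m / ϱ) + ∇ p(ϱ) = - div (R_v + R_p 𝕀)`. -/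
def MomentumEquation {d : ℕ} (D : FlowRegion d) (a γ T : ℝ) (S : Candidate d) : Prop :=
  ∀ φ : ℝ → Vec d → Vec d, IsVectorTest D T φ → ∀ τ ∈ Ioo 0 T,
    (∫ x, inner ℝ (S.m τ x) (φ τ x) ∂D.vol) - (∫ x, inner ℝ (S.m 0 x) (φ 0 x) ∂D.vol) =
      (∫ t in 0..τ, ∫ x, (inner ℝ (S.m t x) (deriv (fun s => φ s x) t)
        + (∑ i, ∑ j, S.m t x i * S.m t x j / S.ρ t x * partialD (φ t) x i j)
        + pressure a γ (S.ρ t x) * divergence (φ t) x) ∂D.vol)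
      + ∫ t in 0..τ, defectPairing (S.Rv t) (S.Rp t) (φ t)

/-- The total energy at time `t`, as a real number. -/
noncomputable def totalEnergy {d : ℕ} (D : FlowRegion d) (a γ : ℝ) (S : Candidate d) (t : ℝ) : ℝ :=
  (energyOn D a γ S t D.closedSet).toReal

/-- The energy inequality. The total energy is determined for almost every time only, so that the
values at `τ₁ -` and `τ₂ +` are one-sided essential limits; the value at `0 -` is the energy of the
initial data. -/
def EnergyInequality {d : ℕ} (D : FlowRegion d) (a γ T : ℝ) (ρ₀ : Vec d → ℝ) (m₀ : Vec d → Vec d)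
    (S : Candidate d) : Prop :=
  (∀ᵐ t ∂volume.restrict (Ioo 0 T), energyOn D a γ S t D.closedSet < ∞) ∧
  IntegrableOn (totalEnergy D a γ S) (Ioo 0 T) ∧
  ∃ Eleft Eright : ℝ → ℝ,
    Eleft 0 = (initialEnergy D a γ ρ₀ m₀).toReal ∧
    (∀ τ ∈ Ioo 0 T, Tendsto (totalEnergy D a γ S) (𝓝[<] τ ⊓ ae volume) (𝓝 (Eleft τ))) ∧
    (∀ τ ∈ Ico 0 T, Tendsto (totalEnergy D a γ S) (𝓝[>] τ ⊓ ae volume) (𝓝 (Eright τ))) ∧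
    ∀ ψ : ℝ → ℝ, IsTimeTest T ψ → ∀ τ₁ τ₂ : ℝ, 0 ≤ τ₁ → τ₁ ≤ τ₂ → τ₂ < T →
      ψ τ₂ * Eright τ₂ - ψ τ₁ * Eleft τ₁ ≤ ∫ t in τ₁..τ₂, deriv ψ t * totalEnergy D a γ S t

/-- `[ϱ, m]`, with associated turbulent defect measures `R_v`, `R_p`, is a dissipative solution of
the Euler system on `[0,T]` that starts from the initial data `[ϱ₀, m₀]`. -/
structure IsDissipativeSolution {d : ℕ} (D : FlowRegion d) (a γ T : ℝ) (ρ₀ : Vec d → ℝ)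
    (m₀ : Vec d → Vec d) (S : Candidate d) : Prop where
  density_weak : IsWeaklyContinuous D T γ S.ρ
  momentum_weak : IsWeaklyContinuous D T (2 * γ / (γ + 1)) S.m
  density_nonneg : ∀ t ∈ Icc 0 T, ∀ᵐ x ∂D.vol, 0 ≤ S.ρ t x
  initial_density : S.ρ 0 =ᵐ[D.vol] ρ₀
  initial_momentum : S.m 0 =ᵐ[D.vol] m₀
  defects : AreDefectMeasures D T S.Rv S.Rp
  continuity : ContinuityEquation D T S
  momentum : MomentumEquation D a γ T S
  energy : EnergyInequality D a γ T ρ₀ m₀ S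

/-! ## Admissible solutions -/

/-- The value on `A ⊆ [0,T] × Ω̄` of the total energy, as a measure on `[0,T] × Ω̄`. -/
noncomputable def spaceTimeEnergy {d : ℕ} (D : FlowRegion d) (a γ T : ℝ) (S : Candidate d)
    (A : Set (ℝ × Vec d)) : ℝ≥0∞ :=
  ∫⁻ t in Ioo 0 T, energyOn D a γ S t {x | (t, x) ∈ A}

/-- The relation `S₁ ≺ S₂`: the total energy of `S₁` is at most that of `S₂`, in the sense of
measures on `[0,T] × Ω̄`. -/
def Precedes {d : ℕ} (D : FlowRegion d) (a γ T : ℝ) (S₁ S₂ : Candidate d) : Prop :=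
  ∀ A : Set (ℝ × Vec d), MeasurableSet A → A ⊆ Icc 0 T ×ˢ D.closedSet →
    spaceTimeEnergy D a γ T S₁ A ≤ spaceTimeEnergy D a γ T S₂ A

/-- The total energies of `S₁` and `S₂` are equal as measures on `[0,T] × Ω̄`. -/
def SameEnergy {d : ℕ} (D : FlowRegion d) (a γ T : ℝ) (S₁ S₂ : Candidate d) : Prop :=
  ∀ A : Set (ℝ × Vec d), MeasurableSet A → A ⊆ Icc 0 T ×ˢ D.closedSet →
    spaceTimeEnergy D a γ T S₁ A = spaceTimeEnergy D a γ T S₂ A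

/-- An admissible solution: a dissipative solution that is minimal with respect to `≺` among the
dissipative solutions with the same initial data. -/
def IsAdmissible {d : ℕ} (D : FlowRegion d) (a γ T : ℝ) (ρ₀ : Vec d → ℝ) (m₀ : Vec d → Vec d)
    (S : Candidate d) : Prop :=
  IsDissipativeSolution D a γ T ρ₀ m₀ S ∧
    ∀ S' : Candidate d, IsDissipativeSolution D a γ T ρ₀ m₀ S' →
      Precedes D a γ T S' S → SameEnergy D a γ T S S'

/-- The total energy (with the defects) integrated over the time interval. -/
noncomputable def energyFunctional {d : ℕ} (D : FlowRegion d) (a γ T : ℝ) (S : Candidate d) :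
    ℝ≥0∞ :=
  ∫⁻ t in Ioo 0 T, energyOn D a γ S t D.closedSet

/-- `S` minimizes the time-integrated total energy over all dissipative solutions, with all their
associated defect measures, that start from the given initial data. -/
def IsEnergyMinimizer {d : ℕ} (D : FlowRegion d) (a γ T : ℝ) (ρ₀ : Vec d → ℝ)
    (m₀ : Vec d → Vec d) (S : Candidate d) : Prop :=
  IsDissipativeSolution D a γ T ρ₀ m₀ S ∧
    ∀ S' : Candidate d, IsDissipativeSolution D a γ T ρ₀ m₀ S' →
      energyFunctional D a γ T S ≤ energyFunctional D a γ T S'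

end EulerDiss

open EulerDiss

/-!
All conditions on a dissipative solution are convex once the nonlinear terms are replaced by
measures. A *relaxed state* consists of a positive semidefinite matrix of functionals, whose blocks
stand for `ϱ`, `m` and `m ⊗ m / ϱ + R_v`, and of a functional for `p(ϱ) + R_p` that dominates the
tangents of `ϱ ↦ a ϱ^γ`. The weak equations and the energy inequality, with initial data included,
are affine conditions on a relaxed state, one for each `ConstraintTest`; the relaxed states that
satisfy all of them are the `relaxedSolutions`. They have bounded energy, hence are compact for
pointwise convergence (`isCompact_relaxed`, by Tychonoff's theorem), and the time-integrated energy
is continuous. The theorem follows once relaxed solutions exist and are identified with dissipative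
solutions. The proof has no approximation scheme for the Euler system.

*Existence.* By separation of convex sets in finite dimension
(`exists_forall_le_of_combination`) and by compactness, it suffices to satisfy one constraint at a
time, since nonnegative combinations of constraints are constraints. Given test functions `φ`, `Φ`
and a weight `w > 0`, let `(ϱ, m)` minimize `w E(ϱ, m) - ϱ φ - m · Φ` at every point, where `E` is
the energy density; explicitly, `P'(ϱ) = max (φ / w + |Φ|² / (2 w²)) 0` and `m = ϱ Φ / w`. At this
state the constraint is the integral of `∂_t (w p(ϱ)) + div (p(ϱ) Φ)`, plus the initial data. The divergence integrates to zero because `Φ` is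
tangential to the boundary (`FlowRegion.integral_divergence_eq_zero`), `p(ϱ)` vanishes at the final
time, and the contribution of the initial time is controlled by Young's inequality
(`residual_dual_nonpos`).

*From relaxed to dissipative solutions.* Positivity represents the functionals by measures. The
tangent inequalities for the pressure force `ϱ` to be absolutely continuous, and the Schur complement
of the matrix is the turbulent defect (`IsRelaxed.exists_representation`). The energy inequality
bounds the marginal in time of the defects, so that they disintegrate into measures on space. Limits
of time slices provide values at every time, which are weakly continuous
(`IsRepresentation.exists_trajectory`). The weak form of the energy inequality says that the energy
has a nonincreasing representative, hence one-sided essential limits (`WeakDecay.exists_limits`). On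
the torus the closed cube is mapped to the cell of representatives.

*From dissipative to relaxed solutions.* Integration over time makes relaxed states of dissipative
solutions, with the same time-integrated energy (`IsDissipativeSolution.exists_relaxed`). So the
minimum over the relaxed solutions is the minimum over the dissipative solutions. A solution that
precedes a minimizer has an energy measure below that of the minimizer, with the same finite total
mass, and two such measures agree (`IsEnergyMinimizer.isAdmissible`).
-/

set_option linter.unusedSectionVars false

namespace EulerDiss

/-! ### Relaxed states and their compactness -/

/-- A family of functionals on the continuous functions on `X`. The first component is a symmetric
block matrix, indexed by `Option (Fin d)`, with the blocks `ϱ` (index `none`), `m` and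
`m ⊗ m / ϱ + R_v`; the second component is `p(ϱ) + R_p`. -/
abbrev RelaxedState (X : Type) [TopologicalSpace X] (d : ℕ) : Type :=
  (Option (Fin d) → Option (Fin d) → C(X, ℝ) → ℝ) × (C(X, ℝ) → ℝ)

/-- The convex constraints on a relaxed state over the compact set `Q`: the block matrix is positive
semidefinite, as a matrix of measures, and the pressure component dominates every tangent of the
convex function `ϱ ↦ a ϱ^γ`, the density being taken with respect to `lam`. -/
structure IsRelaxed {X : Type} [TopologicalSpace X] [MeasurableSpace X] {d : ℕ} (Q : Set X)
    (lam : Measure X) (a γ : ℝ) (S : RelaxedState X d) : Prop where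
  linear_block : ∀ i j, IsLinearMap ℝ (S.1 i j)
  linear_pressure : IsLinearMap ℝ S.2
  symm : ∀ i j f, S.1 i j f = S.1 j i f
  psd : ∀ (ξ : Option (Fin d) → ℝ) (f : C(X, ℝ)), (∀ z ∈ Q, 0 ≤ f z) →
    0 ≤ ∑ i, ∑ j, ξ i * ξ j * S.1 i j f
  pressure : ∀ s : ℝ, 0 ≤ s → ∀ f : C(X, ℝ), (∀ z ∈ Q, 0 ≤ f z) →
    a * γ * s ^ (γ - 1) * S.1 none none f ≤ S.2 f + a * (γ - 1) * s ^ γ * ∫ z, f z ∂lam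

/-- The total energy of a relaxed state, tested with `f`. -/
noncomputable def RelaxedState.energy {X : Type} [TopologicalSpace X] {d : ℕ} (γ : ℝ)
    (S : RelaxedState X d) (f : C(X, ℝ)) : ℝ :=
  1 / 2 * ∑ i : Fin d, S.1 (some i) (some i) f + 1 / (γ - 1) * S.2 f

section Relaxed

variable {X : Type} [TopologicalSpace X] [MeasurableSpace X] {d : ℕ} {Q : Set X}
  {lam : Measure X} {a γ : ℝ} {S : RelaxedState X d}

lemma IsRelaxed.diag_nonneg (hS : IsRelaxed Q lam a γ S) (i : Option (Fin d)) {f : C(X, ℝ)}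
    (hf : ∀ z ∈ Q, 0 ≤ f z) : 0 ≤ S.1 i i f := by
  classical
  have h := hS.psd (Pi.single i 1) f hf
  rw [Finset.sum_eq_single i] at h
  · rw [Finset.sum_eq_single i] at h
    · simpa using h
    · intro j _ hj; simp [hj]
    · simp
  · intro j _ hj; simp [hj]
  · simp

/-- The quadratic form of the block matrix at `x e_i + y e_j`. -/
lemma IsRelaxed.pair_nonneg (hS : IsRelaxed Q lam a γ S) (i j : Option (Fin d))
    (x y : ℝ) {f : C(X, ℝ)} (hf : ∀ z ∈ Q, 0 ≤ f z) :
    0 ≤ x ^ 2 * S.1 i i f + 2 * x * y * S.1 i j f + y ^ 2 * S.1 j j f := by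
  classical
  have h := hS.psd (Pi.single i x + Pi.single j y) f hf
  have e : ∀ k : Option (Fin d), (Pi.single i x + Pi.single j y : Option (Fin d) → ℝ) k
      = (if k = i then x else 0) + (if k = j then y else 0) := by
    intro k
    simp [Pi.single_apply]
  simp only [e, add_mul, mul_add, Finset.sum_add_distrib, ite_mul, mul_ite, zero_mul, mul_zero,
    Finset.sum_ite_eq', Finset.mem_univ, if_true] at h
  rw [hS.symm j i] at h
  linarith

lemma IsRelaxed.pressure_nonneg (hγ : 1 < γ) (hS : IsRelaxed Q lam a γ S) {f : C(X, ℝ)}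
    (hf : ∀ z ∈ Q, 0 ≤ f z) : 0 ≤ S.2 f := by
  have h := hS.pressure 0 le_rfl f hf
  rw [Real.zero_rpow (by linarith), Real.zero_rpow (by linarith)] at h
  linarith

/-- A linear functional that is nonnegative on functions nonnegative on `Q` is bounded by its value
on constants. -/
lemma abs_le_of_nonneg_on {F : C(X, ℝ) → ℝ} (hF : IsLinearMap ℝ F)
    (hpos : ∀ f : C(X, ℝ), (∀ z ∈ Q, 0 ≤ f z) → 0 ≤ F f) {f : C(X, ℝ)} {B : ℝ}
    (hB : ∀ z ∈ Q, |f z| ≤ B) : |F f| ≤ B * F 1 := by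
  have h1 := hpos (B • 1 + f) (fun z hz => by
    have := neg_abs_le (f z); have := hB z hz; simp; linarith)
  have h2 := hpos (B • 1 - f) (fun z hz => by
    have := le_abs_self (f z); have := hB z hz; simp; linarith)
  rw [hF.map_add, hF.map_smul] at h1
  rw [hF.map_sub, hF.map_smul] at h2
  simp only [smul_eq_mul] at h1 h2
  rw [abs_le]; constructor <;> linarith

lemma IsRelaxed.energy_nonneg (hγ : 1 < γ) (hS : IsRelaxed Q lam a γ S) {f : C(X, ℝ)}
    (hf : ∀ z ∈ Q, 0 ≤ f z) : 0 ≤ S.energy γ f := by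
  have h1 := hS.pressure_nonneg hγ hf
  have h2 : 0 ≤ ∑ i : Fin d, S.1 (some i) (some i) f :=
    Finset.sum_nonneg fun i _ => hS.diag_nonneg _ hf
  have : 0 ≤ 1 / (γ - 1) := by apply div_nonneg <;> linarith
  unfold RelaxedState.energy
  positivity

lemma IsRelaxed.density_le (ha : 0 < a) (hγ : 1 < γ) (hS : IsRelaxed Q lam a γ S) {f : C(X, ℝ)}
    (hf : ∀ z ∈ Q, 0 ≤ f z) :
    S.1 none none f ≤ (S.2 f + a * (γ - 1) * ∫ z, f z ∂lam) / (a * γ) := by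
  have h := hS.pressure 1 zero_le_one f hf
  rw [Real.one_rpow, Real.one_rpow] at h
  rw [le_div_iff₀ (by positivity)]
  linarith

lemma IsRelaxed.pressure_le_energy (hγ : 1 < γ) (hS : IsRelaxed Q lam a γ S) {f : C(X, ℝ)}
    (hf : ∀ z ∈ Q, 0 ≤ f z) : S.2 f ≤ (γ - 1) * S.energy γ f := by
  have h2 : 0 ≤ ∑ i : Fin d, S.1 (some i) (some i) f :=
    Finset.sum_nonneg fun i _ => hS.diag_nonneg _ hf
  have h3 : 0 < γ - 1 := by linarith
  have : (γ - 1) * S.energy γ f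
      = (γ - 1) * (1 / 2 * ∑ i : Fin d, S.1 (some i) (some i) f) + S.2 f := by
    unfold RelaxedState.energy; field_simp
  rw [this]
  have : 0 ≤ (γ - 1) * (1 / 2 * ∑ i : Fin d, S.1 (some i) (some i) f) := by positivity
  linarith

lemma IsRelaxed.diag_le_energy (hγ : 1 < γ) (hS : IsRelaxed Q lam a γ S) {f : C(X, ℝ)}
    (hf : ∀ z ∈ Q, 0 ≤ f z) (i : Fin d) : S.1 (some i) (some i) f ≤ 2 * S.energy γ f := by
  have h2 := Finset.single_le_sum (f := fun i : Fin d => S.1 (some i) (some i) f)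
    (fun i _ => hS.diag_nonneg (some i) hf) (Finset.mem_univ i)
  have h3 := hS.pressure_nonneg hγ hf
  have : 0 ≤ 1 / (γ - 1) * S.2 f := mul_nonneg (div_nonneg zero_le_one (by linarith)) h3
  unfold RelaxedState.energy
  linarith

lemma IsRelaxed.diag_le (ha : 0 < a) (hγ : 1 < γ) (hS : IsRelaxed Q lam a γ S) {C : ℝ}
    (hC : S.energy γ 1 ≤ C) (i : Option (Fin d)) :
    S.1 i i 1 ≤ 2 * C + ((γ - 1) * C + a * (γ - 1) * lam.real univ) / (a * γ) := by
  have h1 : ∀ z ∈ Q, 0 ≤ (1 : C(X, ℝ)) z := fun _ _ => by simp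
  have hE := hS.energy_nonneg hγ h1
  have h3 : 0 < γ - 1 := by linarith
  have hC0 : 0 ≤ C := hE.trans hC
  rcases i with _ | i
  · have hp : 0 ≤ 2 * C := by positivity
    have h := hS.density_le ha hγ h1
    have h2 := hS.pressure_le_energy hγ h1
    have h4 : (γ - 1) * S.energy γ 1 ≤ (γ - 1) * C := by gcongr
    have : (S.2 1 + a * (γ - 1) * ∫ z, (1 : C(X, ℝ)) z ∂lam) / (a * γ)
        ≤ ((γ - 1) * C + a * (γ - 1) * lam.real univ) / (a * γ) := by
      have e : ∫ z, (1 : C(X, ℝ)) z ∂lam = lam.real univ := by simp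
      rw [e]
      gcongr
      linarith
    linarith
  · have h := hS.diag_le_energy hγ h1 i
    have : 0 ≤ ((γ - 1) * C + a * (γ - 1) * lam.real univ) / (a * γ) := by positivity
    linarith

lemma IsRelaxed.abs_block_le (hS : IsRelaxed Q lam a γ S)
    {f : C(X, ℝ)} {B : ℝ} (hB0 : 0 ≤ B) (hB : ∀ z ∈ Q, |f z| ≤ B) (i j : Option (Fin d)) :
    |S.1 i j f| ≤ 3 * B * (S.1 i i 1 + S.1 j j 1) := by
  have h1 : ∀ z ∈ Q, 0 ≤ (1 : C(X, ℝ)) z := fun _ _ => by simp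
  have hi := hS.diag_nonneg i h1
  have hj := hS.diag_nonneg j h1
  have key : ∀ k, |S.1 k k f| ≤ B * S.1 k k 1 := fun k =>
    abs_le_of_nonneg_on (hS.linear_block k k) (fun f hf => hS.diag_nonneg k hf) hB
  by_cases hij : i = j
  · subst hij
    refine (key i).trans ?_
    have : 0 ≤ B * S.1 i i 1 := by positivity
    linarith
  · have habs : ∀ g : C(X, ℝ), (∀ z ∈ Q, 0 ≤ g z) →
        |S.1 i j g| ≤ 1 / 2 * (S.1 i i g + S.1 j j g) := by
      intro g hg
      have h1 := hS.pair_nonneg i j 1 1 hg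
      have h2 := hS.pair_nonneg i j 1 (-1) hg
      rw [abs_le]; constructor <;> linarith
    have e : f = (f + B • 1) - B • 1 := by simp
    have ha1 := habs (f + B • 1) (fun z hz => by
      have := neg_abs_le (f z); have := hB z hz; simp; linarith)
    have ha2 := habs (B • 1) (fun z hz => by simpa using hB0)
    have e2 : S.1 i j f = S.1 i j (f + B • 1) - S.1 i j (B • 1) := by
      rw [← (hS.linear_block i j).map_sub, ← e]
    rw [e2]
    rw [(hS.linear_block i i).map_add, (hS.linear_block j j).map_add,
      (hS.linear_block i i).map_smul, (hS.linear_block j j).map_smul] at ha1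
    rw [(hS.linear_block i i).map_smul, (hS.linear_block j j).map_smul] at ha2
    have ki := (abs_le.mp (key i)).2
    have kj := (abs_le.mp (key j)).2
    simp only [smul_eq_mul] at ha1 ha2
    have := abs_sub (S.1 i j (f + B • 1)) (S.1 i j (B • 1))
    have p1 : 0 ≤ B * S.1 i i 1 := by positivity
    have p2 : 0 ≤ B * S.1 j j 1 := by positivity
    linarith

lemma isClosed_isLinearMap {E : Type} [AddCommGroup E] [Module ℝ E] {Y : Type}
    [TopologicalSpace Y] {F : Y → E → ℝ} (hF : ∀ f, Continuous fun S => F S f) :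
    IsClosed {S | IsLinearMap ℝ (F S)} := by
  have : {S | IsLinearMap ℝ (F S)} = (⋂ (f : E) (g : E), {S | F S (f + g) = F S f + F S g}) ∩
      ⋂ (c : ℝ) (f : E), {S | F S (c • f) = c • F S f} := by
    ext S
    simp only [mem_ofPred_eq, mem_inter_iff, mem_iInter]
    exact ⟨fun h => ⟨h.1, h.2⟩, fun h => ⟨h.1, h.2⟩⟩
  rw [this]
  refine IsClosed.inter ?_ ?_
  · exact isClosed_iInter fun f => isClosed_iInter fun g =>
      isClosed_eq (hF _) ((hF _).add (hF _))
  · exact isClosed_iInter fun f => isClosed_iInter fun g =>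
      isClosed_eq (hF _) (continuous_const.mul (hF _))

lemma continuous_block (i j : Option (Fin d)) (f : C(X, ℝ)) :
    Continuous fun S : RelaxedState X d => S.1 i j f :=
  (continuous_apply f).comp ((continuous_apply j).comp ((continuous_apply i).comp continuous_fst))

lemma continuous_pressure (f : C(X, ℝ)) :
    Continuous fun S : RelaxedState X d => S.2 f :=
  (continuous_apply f).comp continuous_snd

lemma continuous_energy (γ : ℝ) (f : C(X, ℝ)) :
    Continuous fun S : RelaxedState X d => S.energy γ f := by
  unfold RelaxedState.energy
  have := fun i j => continuous_block (d := d) i j f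
  have := continuous_pressure (d := d) f
  fun_prop

lemma isClosed_isRelaxed (Q : Set X) (lam : Measure X) (a γ : ℝ) :
    IsClosed {S : RelaxedState X d | IsRelaxed Q lam a γ S} := by
  have : {S : RelaxedState X d | IsRelaxed Q lam a γ S} =
      (⋂ (i) (j), {S : RelaxedState X d | IsLinearMap ℝ (S.1 i j)}) ∩
      {S | IsLinearMap ℝ S.2} ∩ (⋂ (i) (j) (f), {S | S.1 i j f = S.1 j i f}) ∩
      (⋂ (ξ : Option (Fin d) → ℝ) (f : C(X, ℝ)) (_ : ∀ z ∈ Q, 0 ≤ f z),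
        {S | 0 ≤ ∑ i, ∑ j, ξ i * ξ j * S.1 i j f}) ∩
      (⋂ (s : ℝ) (_ : 0 ≤ s) (f : C(X, ℝ)) (_ : ∀ z ∈ Q, 0 ≤ f z),
        {S | a * γ * s ^ (γ - 1) * S.1 none none f
          ≤ S.2 f + a * (γ - 1) * s ^ γ * ∫ z, f z ∂lam}) := by
    ext S
    simp only [mem_ofPred_eq, mem_inter_iff, mem_iInter]
    exact ⟨fun h => ⟨⟨⟨⟨h.1, h.2⟩, h.3⟩, h.4⟩, h.5⟩, fun h => ⟨h.1.1.1.1, h.1.1.1.2, h.1.1.2,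
        h.1.2, h.2⟩⟩
  rw [this]
  have hb := fun i j f => continuous_block (X := X) (d := d) i j f
  have hp := fun f => continuous_pressure (X := X) (d := d) f
  refine (((IsClosed.inter ?_ ?_).inter ?_).inter ?_).inter ?_
  · exact isClosed_iInter fun i => isClosed_iInter fun j => isClosed_isLinearMap (hb i j)
  · exact isClosed_isLinearMap hp
  · exact isClosed_iInter fun i => isClosed_iInter fun j => isClosed_iInter fun f =>
      isClosed_eq (hb i j f) (hb j i f)
  · exact isClosed_iInter fun ξ => isClosed_iInter fun f => isClosed_iInter fun _ =>
      isClosed_le continuous_const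
        (continuous_finsetSum _ fun i _ => continuous_finsetSum _ fun j _ =>
          continuous_const.mul (hb i j f))
  · exact isClosed_iInter fun s => isClosed_iInter fun _ => isClosed_iInter fun f =>
      isClosed_iInter fun _ =>
      isClosed_le (continuous_const.mul (hb _ _ f)) ((hp f).add continuous_const)

/-- Relaxed states of bounded energy form a compact set, for pointwise convergence on continuous
functions: each functional is bounded by the energy, so Tychonoff's theorem applies. -/
theorem isCompact_relaxed (ha : 0 < a) (hγ : 1 < γ) (hQ : IsCompact Q) (C : ℝ) :
    IsCompact {S : RelaxedState X d | IsRelaxed Q lam a γ S ∧ S.energy γ 1 ≤ C} := by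
  have hbd : ∀ f : C(X, ℝ), ∃ B, 0 ≤ B ∧ ∀ z ∈ Q, |f z| ≤ B := by
    intro f
    obtain ⟨B, hB⟩ := hQ.exists_bound_of_continuousOn f.continuous.continuousOn
    exact ⟨max B 0, le_max_right _ _, fun z hz => (hB z hz).trans (le_max_left _ _)⟩
  choose B hB0 hB using hbd
  set A := 2 * C + ((γ - 1) * C + a * (γ - 1) * lam.real univ) / (a * γ) with hA
  have hK : IsCompact ((Set.univ.pi fun _ : Option (Fin d) => Set.univ.pi fun _ : Option (Fin d) =>
      Set.univ.pi fun f : C(X, ℝ) => Icc (-(3 * B f * (A + A))) (3 * B f * (A + A))) ×ˢ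
      (Set.univ.pi fun f : C(X, ℝ) => Icc (-(B f * ((γ - 1) * C))) (B f * ((γ - 1) * C)))) := by
    refine IsCompact.prod ?_ ?_
    · exact isCompact_univ_pi fun _ => isCompact_univ_pi fun _ => isCompact_univ_pi fun _ =>
        isCompact_Icc
    · exact isCompact_univ_pi fun _ => isCompact_Icc
  refine hK.of_isClosed_subset ?_ ?_
  · exact (isClosed_isRelaxed Q lam a γ).inter
      (isClosed_le (continuous_energy γ 1) continuous_const)
  · rintro S ⟨hS, hSC⟩
    have h1 : ∀ z ∈ Q, 0 ≤ (1 : C(X, ℝ)) z := fun _ _ => by simp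
    refine ⟨fun i _ j _ f _ => ?_, fun f _ => ?_⟩
    · refine abs_le.mp ?_
      refine (hS.abs_block_le (hB0 f) (hB f) i j).trans ?_
      have := hS.diag_le ha hγ hSC i
      have := hS.diag_le ha hγ hSC j
      have := hB0 f
      gcongr
    · refine abs_le.mp ?_
      refine (abs_le_of_nonneg_on hS.linear_pressure (fun f hf => hS.pressure_nonneg hγ hf)
        (hB f)).trans ?_
      have h2 := hS.pressure_le_energy hγ h1
      have h4 : (γ - 1) * RelaxedState.energy γ S 1 ≤ (γ - 1) * C := by
        have : 0 < γ - 1 := by linarith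
        gcongr
      have := hB0 f
      exact mul_le_mul_of_nonneg_left (h2.trans h4) (hB0 f)

end Relaxed

/-! ### Measures that represent positive functionals -/

section Riesz

variable {X : Type} [MetricSpace X] [ProperSpace X] [MeasurableSpace X] [BorelSpace X] {Q : Set X}

lemma integrable_continuousMap {μ : Measure X} [IsFiniteMeasure μ] (hQ : IsCompact Q)
    (hμ : μ Qᶜ = 0) (f : C(X, ℝ)) : Integrable f μ := by
  have h := f.continuous.continuousOn.integrableOn_compact (μ := μ) hQ
  rwa [IntegrableOn, Measure.restrict_eq_self_of_ae_mem] at h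
  exact mem_ae_iff.mpr hμ

lemma integrable_continuousMap_mul {μ : Measure X} (hQ : IsCompact Q)
    (hμ : μ Qᶜ = 0) (f : C(X, ℝ)) {h : X → ℝ} (hh : Integrable h μ) :
    Integrable (fun z => f z * h z) μ := by
  obtain ⟨B, hB⟩ := hQ.exists_bound_of_continuousOn f.continuous.continuousOn
  refine hh.bdd_mul (c := B) f.continuous.aestronglyMeasurable ?_
  filter_upwards [mem_ae_iff.mpr hμ] with z hz using hB z hz

lemma exists_cutoff (hQ : IsCompact Q) : ∃ χ : C(X, ℝ), HasCompactSupport χ ∧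
    (∀ z ∈ Q, χ z = 1) := by
  obtain ⟨f, h1, h2, h3, h4⟩ := exists_continuous_one_zero_of_isCompact hQ
    (isClosed_empty) (disjoint_empty Q)
  exact ⟨f, h3, h1⟩

/-- A linear functional on the continuous functions that is nonnegative on the functions which are
nonnegative on the compact set `Q` is the integral against a finite measure on `Q`. -/
lemma exists_measure_of_nonneg_on (hQ : IsCompact Q) {F : C(X, ℝ) → ℝ} (hF : IsLinearMap ℝ F)
    (hpos : ∀ f : C(X, ℝ), (∀ z ∈ Q, 0 ≤ f z) → 0 ≤ F f) :
    ∃ ν : Measure X, IsFiniteMeasure ν ∧ ν Qᶜ = 0 ∧ ∀ f : C(X, ℝ), F f = ∫ z, f z ∂ν := by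
  have hzero : ∀ f : C(X, ℝ), (∀ z ∈ Q, f z = 0) → F f = 0 := by
    intro f hf
    have h1 := hpos f (fun z hz => (hf z hz).ge)
    have h2 := hpos (-f) (fun z hz => by simp [hf z hz])
    rw [hF.map_neg] at h2
    linarith
  let Λ : CompactlySupportedContinuousMap X ℝ →ₚ[ℝ] ℝ :=
    { toFun := fun f => F f.toContinuousMap
      map_add' := fun f g => hF.map_add _ _
      map_smul' := fun c f => hF.map_smul _ _
      monotone' := fun f g hfg => by
        have h : 0 ≤ F (g.toContinuousMap - f.toContinuousMap) := hpos _ (fun z _ => by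
          have := hfg z
          simp only [ContinuousMap.sub_apply, sub_nonneg]
          exact this)
        rw [hF.map_sub] at h
        exact sub_nonneg.mp h }
  set ν := RealRMK.rieszMeasure Λ with hν
  have hνQ : ν Qᶜ = 0 := by
    rw [hQ.isClosed.isOpen_compl.measure_eq_iSup_isCompact]
    simp only [ENNReal.iSup_eq_zero]
    intro K hK hKc
    obtain ⟨f, h1, h2, h3, h4⟩ := exists_continuous_one_zero_of_isCompact hKc hQ.isClosed
      (disjoint_left.mpr fun x hx => hK hx)
    have := RealRMK.rieszMeasure_le_of_eq_one Λ (f := ⟨f, h3⟩) (fun x => (h4 x).1) hKc h1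
    have h0 : Λ ⟨f, h3⟩ = 0 := hzero f h2
    rw [h0] at this
    simpa using this
  have hfin : IsFiniteMeasure ν := ⟨by
    calc ν univ = ν (Q ∪ Qᶜ) := by simp
      _ ≤ ν Q + ν Qᶜ := measure_union_le _ _
      _ < ∞ := by rw [hνQ, add_zero]; exact hQ.measure_lt_top⟩
  refine ⟨ν, hfin, hνQ, fun f => ?_⟩
  obtain ⟨χ, hχc, hχ⟩ := exists_cutoff hQ
  have hs : HasCompactSupport (f * χ) := hχc.mul_left
  have h1 : F f = F (f * χ) := by
    have := hzero (f - f * χ) (fun z hz => by simp [hχ z hz])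
    rw [hF.map_sub] at this
    linarith
  have h2 := RealRMK.integral_rieszMeasure Λ ⟨f * χ, hs⟩
  have h3 : Λ ⟨f * χ, hs⟩ = F (f * χ) := rfl
  rw [h1, ← h3, ← h2]
  refine integral_congr_ae ?_
  filter_upwards [mem_ae_iff.mpr hνQ] with z hz
  simp [hχ z hz]

/-- A density is nonnegative if its integrals against nonnegative continuous functions are. -/
lemma ae_nonneg_of_integral_continuousMap {μ : Measure X} [IsFiniteMeasure μ] {h : X → ℝ}
    (hh : Integrable h μ)
    (hpos : ∀ f : C(X, ℝ), (∀ z, 0 ≤ f z) → 0 ≤ ∫ z, f z * h z ∂μ) : 0 ≤ᵐ[μ] h := by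
  have hclosed : ∀ C : Set X, IsClosed C → 0 ≤ ∫ z in C, h z ∂μ := by
    intro C hC
    have hlim : Tendsto (fun n : ℕ => ∫ z, (thickenedIndicator
        (one_div_pos.mpr (Nat.cast_add_one_pos n)) C z : ℝ) * h z ∂μ) atTop
        (𝓝 (∫ z, C.indicator h z ∂μ)) := by
      refine tendsto_integral_of_dominated_convergence (fun z => |h z|) ?_ hh.abs ?_ ?_
      · intro n
        exact ((NNReal.continuous_coe.comp
            (thickenedIndicator _ C).continuous).aestronglyMeasurable).mul
          hh.aestronglyMeasurable
      · intro n
        refine Eventually.of_forall fun z => ?_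
        rw [norm_mul, Real.norm_eq_abs, Real.norm_eq_abs]
        have h1 : (thickenedIndicator (one_div_pos.mpr (Nat.cast_add_one_pos n)) C z : ℝ) ≤ 1 := by
          exact_mod_cast thickenedIndicator_le_one _ C z
        rw [abs_of_nonneg (NNReal.coe_nonneg _)]
        nlinarith [abs_nonneg (h z)]
      · refine Eventually.of_forall fun z => ?_
        have h2 := (tendsto_pi_nhds.mp (thickenedIndicator_tendsto_indicator_closure
          (δseq := fun n : ℕ => 1 / ((n : ℝ) + 1)) (fun n => one_div_pos.mpr
              (Nat.cast_add_one_pos n))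
          tendsto_one_div_add_atTop_nhds_zero_nat C)) z
        rw [hC.closure_eq] at h2
        have h3 := ((NNReal.continuous_coe.tendsto _).comp h2).mul_const (h z)
        refine h3.congr' ?_ |>.trans (le_of_eq ?_)
        · exact Eventually.of_forall fun n => rfl
        · by_cases hz : z ∈ C <;> simp [hz]
    rw [integral_indicator hC.measurableSet] at hlim
    exact ge_of_tendsto' hlim fun n => hpos ⟨fun z => _, NNReal.continuous_coe.comp
      (thickenedIndicator _ C).continuous⟩ (fun z => NNReal.coe_nonneg _)
  refine ae_nonneg_of_forall_setIntegral_nonneg hh fun s hs _ => ?_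
  set ν := μ.withDensity (fun z => ‖h z‖ₑ) with hν
  have hνfin : IsFiniteMeasure ν := isFiniteMeasure_withDensity hh.2.ne
  refine le_of_forall_pos_le_add fun ε hε => ?_
  obtain ⟨C, hCs, hC, hlt⟩ := hs.exists_isClosed_sdiff_lt (μ := ν) (measure_ne_top _ _)
    (ε := ENNReal.ofReal ε) (by simpa using hε)
  have h1 : ∫ z in s, h z ∂μ = ∫ z in C, h z ∂μ + ∫ z in s \ C, h z ∂μ := by
    rw [← setIntegral_union disjoint_sdiff_self_right (hs.diff hC.measurableSet)
      hh.integrableOn hh.integrableOn, union_sdiff_cancel hCs]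
  have h2 : ‖∫ z in s \ C, h z ∂μ‖ ≤ ε := by
    have h3 : ‖∫ z in s \ C, h z ∂μ‖ₑ ≤ ENNReal.ofReal ε := by
      refine (enorm_integral_le_lintegral_enorm _).trans ?_
      rw [← withDensity_apply _ (hs.diff hC.measurableSet)]
      exact hlt.le
    rwa [← ofReal_norm, ENNReal.ofReal_le_ofReal_iff hε.le] at h3
  have h4 := hclosed C hC
  rw [Real.norm_eq_abs, abs_le] at h2
  linarith [h2.1]

/-- Comparison of finite measures by nonnegative continuous functions. -/
lemma measure_le_of_integral_continuousMap {μ ν : Measure X} [IsFiniteMeasure μ]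
    [IsFiniteMeasure ν] (hQ : IsCompact Q) (hμ : μ Qᶜ = 0) (hν : ν Qᶜ = 0)
    (h : ∀ f : C(X, ℝ), (∀ z, 0 ≤ f z) → ∫ z, f z ∂μ ≤ ∫ z, f z ∂ν) : μ ≤ ν := by
  have h1 : μ ≪ μ + ν := Measure.AbsolutelyContinuous.add_right
    (Measure.AbsolutelyContinuous.refl μ) ν
  have h2 : ν ≪ μ + ν := by
    rw [add_comm]; exact Measure.AbsolutelyContinuous.add_right
        (Measure.AbsolutelyContinuous.refl ν) μ
  set π := μ + ν with hπ
  have hπQ : π Qᶜ = 0 := by simp [hπ, hμ, hν]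
  have i1 : Integrable (fun z => (μ.rnDeriv π z).toReal) π := Measure.integrable_toReal_rnDeriv
  have i2 : Integrable (fun z => (ν.rnDeriv π z).toReal) π := Measure.integrable_toReal_rnDeriv
  have key := ae_nonneg_of_integral_continuousMap (i2.sub i1) (fun f hf => by
    have e1 := integral_rnDeriv_smul h1 (f := f)
    have e2 := integral_rnDeriv_smul h2 (f := f)
    have j1 := integrable_continuousMap_mul hQ hπQ f i1
    have j2 := integrable_continuousMap_mul hQ hπQ f i2
    have : ∫ z, f z * ((fun z => (ν.rnDeriv π z).toReal) - (fun z => (μ.rnDeriv π z).toReal)) z ∂π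
        = ∫ z, f z ∂ν - ∫ z, f z ∂μ := by
      rw [← e1, ← e2, ← integral_sub]
      · refine integral_congr_ae (Eventually.of_forall fun z => ?_)
        simp; ring
      · exact j2.congr (Eventually.of_forall fun z => by simp [mul_comm])
      · exact j1.congr (Eventually.of_forall fun z => by simp [mul_comm])
    rw [this]
    exact sub_nonneg.mpr (h f hf))
  refine Measure.le_iff.mpr fun s hs => ?_
  rw [← Measure.setLIntegral_rnDeriv h1, ← Measure.setLIntegral_rnDeriv h2]
  refine lintegral_mono_ae (ae_restrict_of_ae ?_)
  filter_upwards [key, μ.rnDeriv_lt_top π, ν.rnDeriv_lt_top π] with z h1 h2 h3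
  simp only [Pi.zero_apply, Pi.sub_apply, sub_nonneg] at h1
  exact (ENNReal.toReal_le_toReal h2.ne h3.ne).mp h1

end Riesz

/-! ### Representation of relaxed states by densities and defects -/

/-- The relaxed state `S` is given by a density `ρ` and a momentum `m` with respect to `lam`, and by
defects with densities `r`, `s` with respect to a finite measure `μ` on `Q`. The measure `μ` is
normalized to be the energy of the defects. -/
structure IsRepresentation {X : Type} [TopologicalSpace X] [MeasurableSpace X] {d : ℕ} (Q : Set X)
    (lam : Measure X) (a γ : ℝ) (S : RelaxedState X d) (μ : Measure X) (ρ : X → ℝ) (m : X → Vec d)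
    (r : X → Matrix (Fin d) (Fin d) ℝ) (s : X → ℝ) : Prop where
  finite : IsFiniteMeasure μ
  null_compl : μ Qᶜ = 0
  measurable_density : Measurable ρ
  measurable_momentum : Measurable m
  measurable_defect : ∀ i j, Measurable fun z => r z i j
  measurable_pressureDefect : Measurable s
  density_nonneg : ∀ z, 0 ≤ ρ z
  momentum_eq_zero : ∀ z, ρ z = 0 → m z = 0
  posSemidef : ∀ z, (r z).PosSemidef
  pressureDefect_nonneg : ∀ z, 0 ≤ s z
  normalized : ∀ z, 1 / 2 * ∑ i, r z i i + 1 / (γ - 1) * s z = 1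
  integrable_density : Integrable ρ lam
  integrable_momentum : ∀ i, Integrable (fun z => m z i) lam
  integrable_flux : ∀ i j, Integrable (fun z => m z i * m z j / ρ z) lam
  integrable_pressure : Integrable (fun z => ρ z ^ γ) lam
  density_eq : ∀ f, S.1 none none f = ∫ z, f z * ρ z ∂lam
  momentum_eq : ∀ i f, S.1 none (some i) f = ∫ z, f z * m z i ∂lam
  flux_eq : ∀ i j f, S.1 (some i) (some j) f =
    ∫ z, f z * (m z i * m z j / ρ z) ∂lam + ∫ z, f z * r z i j ∂μ
  pressure_eq : ∀ f, S.2 f = ∫ z, f z * (a * ρ z ^ γ) ∂lam + ∫ z, f z * s z ∂μ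

/-- A real quadratic form that is nonnegative on rational vectors is nonnegative. -/
lemma quadratic_nonneg_of_rat {J : Type} [Fintype J] {k : J → J → ℝ}
    (h : ∀ ξ : J → ℚ, 0 ≤ ∑ i, ∑ j, (ξ i : ℝ) * ξ j * k i j) (ξ : J → ℝ) :
    0 ≤ ∑ i, ∑ j, ξ i * ξ j * k i j := by
  have hd : DenseRange (fun (η : J → ℚ) (i : J) => (η i : ℝ)) := by
    have := DenseRange.piMap (fun _ : J => Rat.denseRange_cast (𝕜 := ℝ))
    exact this
  have hc : IsClosed {ξ : J → ℝ | 0 ≤ ∑ i, ∑ j, ξ i * ξ j * k i j} :=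
    isClosed_le continuous_const (by fun_prop)
  have : univ ⊆ {ξ : J → ℝ | 0 ≤ ∑ i, ∑ j, ξ i * ξ j * k i j} := by
    rw [← hd.closure_range]
    exact hc.closure_subset_iff.mpr (by rintro _ ⟨η, rfl⟩; exact h η)
  exact this (mem_univ ξ)

lemma pressure_tangent_of_rat {a γ k κ g : ℝ} (hγ : 1 < γ)
    (h : ∀ s : ℚ, (0 : ℝ) ≤ s → a * γ * (s : ℝ) ^ (γ - 1) * k ≤ κ + a * (γ - 1) * (s : ℝ) ^ γ * g)
    (s : ℝ) (hs : 0 ≤ s) : a * γ * s ^ (γ - 1) * k ≤ κ + a * (γ - 1) * s ^ γ * g := by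
  have hc : IsClosed {s : ℝ | a * γ * |s| ^ (γ - 1) * k ≤ κ + a * (γ - 1) * |s| ^ γ * g} := by
    have h1 : Continuous fun s : ℝ => |s| ^ (γ - 1) :=
      continuous_abs.rpow_const (fun _ => Or.inr (by linarith))
    have h2 : Continuous fun s : ℝ => |s| ^ γ :=
      continuous_abs.rpow_const (fun _ => Or.inr (by linarith))
    exact isClosed_le (by fun_prop) (by fun_prop)
  have : univ ⊆ {s : ℝ | a * γ * |s| ^ (γ - 1) * k ≤ κ + a * (γ - 1) * |s| ^ γ * g} := by
    rw [← (Rat.denseRange_cast (𝕜 := ℝ)).closure_range]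
    refine hc.closure_subset_iff.mpr ?_
    rintro _ ⟨q, rfl⟩
    have := h |q| (by positivity)
    simpa using this
  have := this (mem_univ s)
  simpa [abs_of_nonneg hs] using this

section PointwiseAlgebra

variable {d : ℕ} {k : Option (Fin d) → Option (Fin d) → ℝ}

lemma psd_diag_nonneg (hpsd : ∀ ξ : Option (Fin d) → ℝ, 0 ≤ ∑ i, ∑ j, ξ i * ξ j * k i j)
    (i : Option (Fin d)) : 0 ≤ k i i := by
  classical
  simpa [Pi.single_apply] using hpsd (Pi.single i 1)

lemma psd_expand (hsymm : ∀ i j, k i j = k j i)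
    (hpsd : ∀ ξ : Option (Fin d) → ℝ, 0 ≤ ∑ i, ∑ j, ξ i * ξ j * k i j) (t : ℝ) (η : Fin d → ℝ) :
    0 ≤ t ^ 2 * k none none + 2 * t * ∑ i, η i * k none (some i)
      + ∑ i, ∑ j, η i * η j * k (some i) (some j) := by
  have h := hpsd (fun i => i.elim t η)
  simp only [Fintype.sum_option, Option.elim_none, Option.elim_some] at h
  have e : ∑ x, η x * t * k (some x) none = t * ∑ i, η i * k none (some i) := by
    rw [Finset.mul_sum]
    exact Finset.sum_congr rfl fun i _ => by rw [hsymm (some i) none]; ring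
  have e2 : ∑ x, t * η x * k none (some x) = t * ∑ i, η i * k none (some i) := by
    rw [Finset.mul_sum]
    exact Finset.sum_congr rfl fun i _ => by ring
  rw [Finset.sum_add_distrib, e, e2] at h
  linarith

lemma psd_row_eq_zero (hsymm : ∀ i j, k i j = k j i)
    (hpsd : ∀ ξ : Option (Fin d) → ℝ, 0 ≤ ∑ i, ∑ j, ξ i * ξ j * k i j)
    (h0 : k none none = 0) (i : Fin d) : k none (some i) = 0 := by
  classical
  have h := fun t => psd_expand hsymm hpsd t (Pi.single i 1)
  simp only [h0, mul_zero, zero_add, Pi.single_apply, ite_mul, one_mul, zero_mul,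
    Finset.sum_ite_eq', Finset.mem_univ, if_true, mul_ite] at h
  by_contra hne
  have := h (-(k (some i) (some i) + 1) / (2 * k none (some i)))
  have e : 2 * (-(k (some i) (some i) + 1) / (2 * k none (some i))) * k none (some i)
      = -(k (some i) (some i) + 1) := by field_simp
  rw [e] at this
  simp at this
  linarith

/-- The Schur complement of a positive semidefinite block matrix is positive semidefinite. -/
lemma psd_schur (hsymm : ∀ i j, k i j = k j i)
    (hpsd : ∀ ξ : Option (Fin d) → ℝ, 0 ≤ ∑ i, ∑ j, ξ i * ξ j * k i j) :
    (Matrix.of fun i j : Fin d => k (some i) (some j)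
      - k none (some i) * k none (some j) / k none none).PosSemidef := by
  refine Matrix.PosSemidef.of_dotProduct_mulVec_nonneg ?_ ?_
  · ext i j
    simp [Matrix.conjTranspose_apply, hsymm (some j) (some i), mul_comm]
  · intro η
    have h := psd_expand hsymm hpsd (-(∑ i, η i * k none (some i)) / k none none) η
    have e : star η ⬝ᵥ (Matrix.of fun i j : Fin d => k (some i) (some j)
        - k none (some i) * k none (some j) / k none none).mulVec η
        = ∑ i, ∑ j, η i * η j * k (some i) (some j)
          - (∑ i, η i * k none (some i)) ^ 2 / k none none := by
      have e1 : (∑ i, η i * k none (some i)) ^ 2 / k none none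
          = ∑ i, ∑ j, η i * η j * (k none (some i) * k none (some j) / k none none) := by
        rw [sq, Finset.sum_mul_sum, Finset.sum_div]
        refine Finset.sum_congr rfl fun i _ => ?_
        rw [Finset.sum_div]
        exact Finset.sum_congr rfl fun j _ => by ring
      rw [e1, ← Finset.sum_sub_distrib]
      simp only [dotProduct, Matrix.mulVec, Matrix.of_apply, Pi.star_apply, star_trivial]
      refine Finset.sum_congr rfl fun i _ => ?_
      rw [Finset.mul_sum, ← Finset.sum_sub_distrib]
      exact Finset.sum_congr rfl fun j _ => by ring
    rw [e]
    by_cases h0 : k none none = 0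
    · rw [h0] at h ⊢
      simpa using h
    · refine h.trans (le_of_eq ?_)
      field_simp
      ring

/-- The tangent inequalities for the pressure force the density to be absolutely continuous and
integrate to the pointwise inequality `a ϱ^γ ≤ κ`. -/
lemma pressure_density {a γ k κ g : ℝ} (ha : 0 < a) (hγ : 1 < γ) (hg : 0 ≤ g) (hk : 0 ≤ k)
    (h : ∀ s : ℝ, 0 ≤ s → a * γ * s ^ (γ - 1) * k ≤ κ + a * (γ - 1) * s ^ γ * g) :
    k = k / g * g ∧ a * (k / g) ^ γ * g ≤ κ := by
  rcases hg.eq_or_lt with h0 | h0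
  · subst h0
    have hκ : 0 ≤ κ := by
      have := h 0 le_rfl
      rw [Real.zero_rpow (by linarith), Real.zero_rpow (by linarith)] at this
      linarith
    have hk0 : k = 0 := by
      by_contra hne
      have hkpos : 0 < k := lt_of_le_of_ne hk (Ne.symm hne)
      have := h (((κ + 1) / (a * γ * k)) ^ (1 / (γ - 1))) (by positivity)
      rw [← Real.rpow_mul (by positivity), one_div_mul_cancel (by linarith), Real.rpow_one] at this
      have e : a * γ * ((κ + 1) / (a * γ * k)) * k = κ + 1 := by
        field_simp
      rw [e] at this
      simp at this
      linarith
    subst hk0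
    simpa using hκ
  · have e : k = k / g * g := by field_simp
    refine ⟨e, ?_⟩
    have hr : 0 ≤ k / g := by positivity
    have := h (k / g) hr
    have e2 : a * γ * (k / g) ^ (γ - 1) * k = a * γ * (k / g) ^ γ * g := by
      have : (k / g) ^ γ = (k / g) ^ (γ - 1) * (k / g) := by
        rcases hr.eq_or_lt with h1 | h1
        · rw [← h1, Real.zero_rpow (by linarith), mul_zero]
        · rw [← Real.rpow_add_one h1.ne']; ring_nf
      rw [this]
      field_simp
    rw [e2] at this
    linarith

end PointwiseAlgebra

section Representation

variable {X : Type} [MetricSpace X] [ProperSpace X] [MeasurableSpace X] [BorelSpace X] {d : ℕ}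
  {Q : Set X} {lam : Measure X} {a γ : ℝ} {S : RelaxedState X d}

/-- All components of a relaxed state, and the measure `lam`, have densities with respect to one
finite measure, and the convex constraints hold pointwise. -/
lemma IsRelaxed.exists_densities (hQ : IsCompact Q) (hγ : 1 < γ) [IsFiniteMeasure lam]
    (hlam : lam Qᶜ = 0) (hS : IsRelaxed Q lam a γ S) :
    ∃ (μ : Measure X) (k : X → Option (Fin d) → Option (Fin d) → ℝ) (κ g : X → ℝ),
      IsFiniteMeasure μ ∧ μ Qᶜ = 0 ∧ (∀ i j, Measurable fun z => k z i j) ∧ Measurable κ ∧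
      Measurable g ∧ (∀ i j, Integrable (fun z => k z i j) μ) ∧ Integrable κ μ ∧
      (∀ z i j, k z i j = k z j i) ∧ (∀ z, 0 ≤ g z) ∧ (∀ z, 0 ≤ κ z) ∧
      (∀ z (ξ : Option (Fin d) → ℝ), 0 ≤ ∑ i, ∑ j, ξ i * ξ j * k z i j) ∧
      (∀ z (s : ℝ), 0 ≤ s →
        a * γ * s ^ (γ - 1) * k z none none ≤ κ z + a * (γ - 1) * s ^ γ * g z) ∧
      (∀ i j f, S.1 i j f = ∫ z, f z * k z i j ∂μ) ∧ (∀ f, S.2 f = ∫ z, f z * κ z ∂μ) ∧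
      (∀ h : X → ℝ, ∫ z, h z ∂lam = ∫ z, h z * g z ∂μ) ∧
      (∀ h : X → ℝ, Integrable h lam ↔ Integrable (fun z => h z * g z) μ) := by
  classical
  -- The off-diagonal components need not be nonnegative; the quadratic form at `e_i + e_j` is, and
  -- the components are recovered by polarization.
  have hex : ∀ i j : Option (Fin d), ∃ ν : Measure X, IsFiniteMeasure ν ∧ ν Qᶜ = 0 ∧
      ∀ f : C(X, ℝ), S.1 i i f + 2 * S.1 i j f + S.1 j j f = ∫ z, f z ∂ν := by
    intro i j
    refine exists_measure_of_nonneg_on hQ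
      (F := fun f => S.1 i i f + 2 * S.1 i j f + S.1 j j f) ⟨?_, ?_⟩ ?_
    · intro f g
      simp only [(hS.linear_block _ _).map_add]; ring
    · intro c f
      simp only [(hS.linear_block _ _).map_smul, smul_eq_mul]; ring
    · intro f hf
      have := hS.pair_nonneg i j 1 1 hf
      linarith
  choose ν hνfin hνQ hν using hex
  obtain ⟨νq, hqfin, hqQ, hq⟩ := exists_measure_of_nonneg_on hQ hS.linear_pressure
    (fun f hf => hS.pressure_nonneg hγ hf)
  set μ : Measure X := (∑ p : Option (Fin d) × Option (Fin d), ν p.1 p.2) + νq + lam with hμ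
  have hsumfin : IsFiniteMeasure (∑ p : Option (Fin d) × Option (Fin d), ν p.1 p.2) := ⟨by
    rw [Measure.finsetSum_apply]
    exact ENNReal.sum_lt_top.mpr fun p _ => measure_lt_top _ _⟩
  have hμfin : IsFiniteMeasure μ := by infer_instance
  have hμQ : μ Qᶜ = 0 := by
    simp [hμ, Measure.add_apply, Measure.finsetSum_apply, hνQ, hqQ, hlam]
  have hac : ∀ i j, ν i j ≪ μ := by
    intro i j
    refine Measure.absolutelyContinuous_of_le ?_
    rw [hμ, add_assoc]
    refine le_trans ?_ (Measure.le_add_right le_rfl)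
    exact Finset.single_le_sum (f := fun p : Option (Fin d) × Option (Fin d) => ν p.1 p.2)
      (fun p _ => Measure.zero_le _) (Finset.mem_univ (i, j))
  have hacq : νq ≪ μ := Measure.absolutelyContinuous_of_le
    ((Measure.le_add_left le_rfl).trans (Measure.le_add_right le_rfl))
  have hacl : lam ≪ μ := Measure.absolutelyContinuous_of_le (Measure.le_add_left le_rfl)
  set n : Option (Fin d) → Option (Fin d) → X → ℝ :=
    fun i j z => ((ν i j).rnDeriv μ z).toReal with hn
  have hnint : ∀ i j, Integrable (n i j) μ := fun i j => Measure.integrable_toReal_rnDeriv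
  have hnmeas : ∀ i j, Measurable (n i j) := fun i j =>
    (Measure.measurable_rnDeriv _ _).ennreal_toReal
  have hnf : ∀ i j (f : C(X, ℝ)), ∫ z, f z ∂(ν i j) = ∫ z, f z * n i j z ∂μ := by
    intro i j f
    rw [← integral_rnDeriv_smul (hac i j)]
    exact integral_congr_ae (Eventually.of_forall fun z => by simp [hn, mul_comm])
  -- Polarization, symmetrized in `i` and `j`; the entry `n i i` is the density of `4 M_ii`.
  set k0 : X → Option (Fin d) → Option (Fin d) → ℝ := fun z i j =>
    1 / 4 * (n i j z + n j i z - 1 / 2 * n i i z - 1 / 2 * n j j z) with hk0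
  have hk0meas : ∀ i j, Measurable fun z => k0 z i j := by
    intro i j
    have h1 := hnmeas i j
    have h2 := hnmeas j i
    have h3 := hnmeas i i
    have h4 := hnmeas j j
    fun_prop
  have hk0int : ∀ i j, Integrable (fun z => k0 z i j) μ := by
    intro i j
    exact ((((hnint i j).add (hnint j i)).sub ((hnint i i).const_mul (1 / 2))).sub
      ((hnint j j).const_mul (1 / 2))).const_mul (1 / 4)
  have hfn := fun (f : C(X, ℝ)) i j => integrable_continuousMap_mul hQ hμQ f (hnint i j)
  have hk0f : ∀ i j f, S.1 i j f = ∫ z, f z * k0 z i j ∂μ := by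
    intro i j f
    have e : ∫ z, f z * k0 z i j ∂μ = 1 / 4 * (∫ z, f z * n i j z ∂μ + ∫ z, f z * n j i z ∂μ
        - 1 / 2 * ∫ z, f z * n i i z ∂μ - 1 / 2 * ∫ z, f z * n j j z ∂μ) := by
      have h1 : Integrable (fun z => f z * n i j z + f z * n j i z) μ := (hfn f _ _).add (hfn f _ _)
      have h2 : Integrable (fun z => f z * n i j z + f z * n j i z - 1 / 2 * (f z * n i i z)) μ :=
        h1.sub ((hfn f _ _).const_mul _)
      rw [← integral_const_mul, ← integral_const_mul, ← integral_add (hfn f _ _) (hfn f _ _),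
        ← integral_sub h1 ((hfn f _ _).const_mul _),
        ← integral_sub h2 ((hfn f _ _).const_mul _), ← integral_const_mul]
      exact integral_congr_ae (Eventually.of_forall fun z => by simp only [hk0]; ring)
    rw [e, ← hnf, ← hnf, ← hnf, ← hnf, ← hν, ← hν, ← hν, ← hν, hS.symm j i]
    ring
  set κ0 : X → ℝ := fun z => (νq.rnDeriv μ z).toReal with hκ0
  have hκ0int : Integrable κ0 μ := Measure.integrable_toReal_rnDeriv
  have hκ0meas : Measurable κ0 := (Measure.measurable_rnDeriv _ _).ennreal_toReal
  have hκ0f : ∀ f : C(X, ℝ), S.2 f = ∫ z, f z * κ0 z ∂μ := by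
    intro f
    rw [hq, ← integral_rnDeriv_smul hacq]
    exact integral_congr_ae (Eventually.of_forall fun z => by simp [hκ0, mul_comm])
  set g0 : X → ℝ := fun z => (lam.rnDeriv μ z).toReal with hg0
  have hg0meas : Measurable g0 := (Measure.measurable_rnDeriv _ _).ennreal_toReal
  have hg0int : Integrable g0 μ := Measure.integrable_toReal_rnDeriv
  have hg0f : ∀ h : X → ℝ, ∫ z, h z ∂lam = ∫ z, h z * g0 z ∂μ := by
    intro h
    rw [← integral_rnDeriv_smul hacl]
    exact integral_congr_ae (Eventually.of_forall fun z => by simp [hg0, mul_comm])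
  have hg0i : ∀ h : X → ℝ, Integrable h lam ↔ Integrable (fun z => h z * g0 z) μ := by
    intro h
    rw [← integrable_rnDeriv_smul_iff hacl]
    exact integrable_congr (Eventually.of_forall fun z => by simp [hg0, mul_comm])
  -- Rational vectors and rational tangent points make the exceptional set a null set; all real
  -- ones follow by density.
  have hpsd : ∀ᵐ z ∂μ, ∀ ξ : Option (Fin d) → ℚ,
      0 ≤ ∑ i, ∑ j, (ξ i : ℝ) * ξ j * k0 z i j := by
    rw [ae_all_iff]
    intro ξ
    refine ae_nonneg_of_integral_continuousMap (h := fun z => ∑ i, ∑ j, (ξ i : ℝ) * ξ j * k0 z i j)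
      ?_ ?_
    · exact integrable_finsetSum _ fun i _ => integrable_finsetSum _ fun j _ =>
        (hk0int i j).const_mul _
    · intro f hf
      have hfk := fun i j => integrable_continuousMap_mul hQ hμQ f (hk0int i j)
      have e : ∫ z, f z * ∑ i, ∑ j, (ξ i : ℝ) * ξ j * k0 z i j ∂μ
          = ∑ i, ∑ j, (ξ i : ℝ) * ξ j * S.1 i j f := by
        simp only [hk0f]
        simp_rw [← integral_const_mul]
        simp_rw [← integral_finsetSum Finset.univ fun j _ => (hfk _ j).const_mul _]
        rw [← integral_finsetSum]
        · refine integral_congr_ae (Eventually.of_forall fun z => ?_)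
          simp only [Finset.mul_sum]
          exact Finset.sum_congr rfl fun i _ => Finset.sum_congr rfl fun j _ => by ring
        · intro i _
          exact integrable_finsetSum _ fun j _ => (hfk i j).const_mul _
      rw [e]
      exact hS.psd _ f fun z _ => hf z
  have hpress : ∀ᵐ z ∂μ, ∀ s : ℚ, (0 : ℝ) ≤ s →
      a * γ * (s : ℝ) ^ (γ - 1) * k0 z none none ≤ κ0 z + a * (γ - 1) * (s : ℝ) ^ γ * g0 z := by
    rw [ae_all_iff]
    intro s
    by_cases hs : (0 : ℝ) ≤ s
    swap
    · exact Eventually.of_forall fun z h => absurd h hs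
    have := ae_nonneg_of_integral_continuousMap (μ := μ)
      (h := fun z => κ0 z + a * (γ - 1) * (s : ℝ) ^ γ * g0 z
        - a * γ * (s : ℝ) ^ (γ - 1) * k0 z none none) ?_ ?_
    · filter_upwards [this] with z hz _
      simpa using hz
    · exact (hκ0int.add (hg0int.const_mul _)).sub ((hk0int _ _).const_mul _)
    · intro f hf
      have hfk := integrable_continuousMap_mul hQ hμQ f (hk0int none none)
      have hfκ := integrable_continuousMap_mul hQ hμQ f hκ0int
      have hfg := integrable_continuousMap_mul hQ hμQ f hg0int
      have e : ∫ z, f z * (κ0 z + a * (γ - 1) * (s : ℝ) ^ γ * g0 z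
          - a * γ * (s : ℝ) ^ (γ - 1) * k0 z none none) ∂μ
          = S.2 f + a * (γ - 1) * (s : ℝ) ^ γ * ∫ z, f z ∂lam
            - a * γ * (s : ℝ) ^ (γ - 1) * S.1 none none f := by
        have h1 : Integrable (fun z => f z * κ0 z + a * (γ - 1) * (s : ℝ) ^ γ * (f z * g0 z)) μ :=
          hfκ.add (hfg.const_mul _)
        rw [hk0f, hκ0f, hg0f, ← integral_const_mul, ← integral_const_mul,
          ← integral_add hfκ (hfg.const_mul _), ← integral_sub h1 (hfk.const_mul _)]
        exact integral_congr_ae (Eventually.of_forall fun z => by ring)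
      rw [e]
      have := hS.pressure s hs f fun z _ => hf z
      linarith
  -- All densities are set to zero on a null set, so that the constraints hold at every point.
  obtain ⟨N, hNsub, hNmeas, hN0⟩ := exists_measurable_superset_of_null
    (mem_ae_iff.mp (hpsd.and hpress))
  have hN : ∀ z ∉ N, (∀ ξ : Option (Fin d) → ℚ, 0 ≤ ∑ i, ∑ j, (ξ i : ℝ) * ξ j * k0 z i j) ∧
      ∀ s : ℚ, (0 : ℝ) ≤ s →
      a * γ * (s : ℝ) ^ (γ - 1) * k0 z none none ≤ κ0 z + a * (γ - 1) * (s : ℝ) ^ γ * g0 z := by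
    intro z hz
    by_contra hcon
    exact hz (hNsub hcon)
  have hNae : ∀ᵐ z ∂μ, z ∈ Nᶜ := by
    rw [ae_iff]; simpa using hN0
  refine ⟨μ, fun z i j => Nᶜ.indicator (fun z => k0 z i j) z, Nᶜ.indicator κ0, Nᶜ.indicator g0,
    hμfin, hμQ, fun i j => (hk0meas i j).indicator hNmeas.compl, hκ0meas.indicator hNmeas.compl,
    hg0meas.indicator hNmeas.compl, fun i j => (hk0int i j).indicator hNmeas.compl,
    hκ0int.indicator hNmeas.compl, ?_, ?_, ?_, ?_, ?_, ?_, ?_, ?_, ?_⟩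
  · intro z i j
    by_cases hz : z ∈ N
    · simp [hz]
    · simp only [mem_compl_iff, hz, not_false_eq_true, indicator_of_mem, hk0]
      ring
  · intro z
    exact indicator_nonneg (fun z _ => ENNReal.toReal_nonneg) z
  · intro z
    exact indicator_nonneg (fun z _ => ENNReal.toReal_nonneg) z
  · intro z
    by_cases hz : z ∈ N
    · simp [hz]
    · intro ξ
      simp only [mem_compl_iff, hz, not_false_eq_true, indicator_of_mem]
      exact quadratic_nonneg_of_rat (hN z hz).1 ξ
  · intro z s hs
    by_cases hz : z ∈ N
    · simp [hz]
    · simp only [mem_compl_iff, hz, not_false_eq_true, indicator_of_mem]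
      exact pressure_tangent_of_rat hγ (hN z hz).2 s hs
  · intro i j f
    rw [hk0f]
    refine integral_congr_ae ?_
    filter_upwards [hNae] with z hz
    simp [indicator_of_mem hz]
  · intro f
    rw [hκ0f]
    refine integral_congr_ae ?_
    filter_upwards [hNae] with z hz
    simp [indicator_of_mem hz]
  · intro h
    rw [hg0f]
    refine integral_congr_ae ?_
    filter_upwards [hNae] with z hz
    simp [indicator_of_mem hz]
  · intro h
    rw [hg0i]
    refine integrable_congr ?_
    filter_upwards [hNae] with z hz
    simp [indicator_of_mem hz]

end Representation

section Representation

variable {X : Type} [MetricSpace X] [ProperSpace X] [MeasurableSpace X] [BorelSpace X] {d : ℕ}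
  {Q : Set X} {lam : Measure X} {a γ : ℝ} {S : RelaxedState X d}

lemma posSemidef_eq_zero_of_diag {n : ℕ} {A : Matrix (Fin n) (Fin n) ℝ} (hA : A.PosSemidef)
    (h : ∑ i, A i i = 0) : A = 0 := by
  have : A.trace = 0 := h
  exact (hA.trace_eq_zero_iff).mp this

lemma posSemidef_abs_le {n : ℕ} {A : Matrix (Fin n) (Fin n) ℝ} (hA : A.PosSemidef) (i j : Fin n) :
    |A i j| ≤ ∑ k, A k k := by
  classical
  have hd : ∀ k, 0 ≤ A k k := fun k => hA.diag_nonneg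
  have hsym : A j i = A i j := by
    have := hA.isHermitian.apply i j
    simpa using this
  by_cases hij : i = j
  · subst hij
    rw [abs_of_nonneg (hd i)]
    exact Finset.single_le_sum (f := fun k => A k k) (fun k _ => hd k) (Finset.mem_univ i)
  have hq : ∀ x y : ℝ, 0 ≤ x ^ 2 * A i i + 2 * x * y * A i j + y ^ 2 * A j j := by
    intro x y
    have h := hA.dotProduct_mulVec_nonneg (Pi.single i x + Pi.single j y)
    simp only [star_trivial, Matrix.mulVec_add, add_dotProduct, dotProduct_add,
      Matrix.mulVec_single, single_dotProduct, Pi.smul_apply, Matrix.col_apply,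
      MulOpposite.smul_eq_mul_unop, MulOpposite.unop_op] at h
    rw [hsym] at h
    linarith
  have h1 := hq 1 1
  have h2 := hq 1 (-1)
  have h3 : A i i + A j j ≤ ∑ k, A k k := by
    rw [← Finset.sum_pair hij (f := fun k => A k k)]
    exact Finset.sum_le_sum_of_subset_of_nonneg (Finset.subset_univ _) (fun k _ _ => hd k)
  have := hd i
  have := hd j
  rw [abs_le]; constructor <;> linarith

lemma IsRepresentation.abs_defect_le {μ : Measure X} {ρ : X → ℝ} {m : X → Vec d}
    {r : X → Matrix (Fin d) (Fin d) ℝ} {s : X → ℝ} (hγ : 1 < γ)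
    (h : IsRepresentation Q lam a γ S μ ρ m r s) (z : X) (i j : Fin d) : |r z i j| ≤ 2 := by
  have h1 := posSemidef_abs_le (h.posSemidef z) i j
  have h2 := h.normalized z
  have h3 : 0 ≤ 1 / (γ - 1) * s z :=
    mul_nonneg (div_nonneg zero_le_one (by linarith)) (h.pressureDefect_nonneg z)
  linarith

lemma IsRepresentation.pressureDefect_le {μ : Measure X} {ρ : X → ℝ} {m : X → Vec d}
    {r : X → Matrix (Fin d) (Fin d) ℝ} {s : X → ℝ} (hγ : 1 < γ)
    (h : IsRepresentation Q lam a γ S μ ρ m r s) (z : X) : s z ≤ γ - 1 := by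
  have h1 : 0 ≤ ∑ i, r z i i := Finset.sum_nonneg fun i _ => (h.posSemidef z).diag_nonneg
  have h2 := h.normalized z
  have h4 : 0 < γ - 1 := by linarith
  have h3 : 1 / (γ - 1) * s z ≤ 1 := by linarith
  rw [one_div, inv_mul_le_iff₀ h4] at h3
  linarith

/-- Every relaxed state is represented by a density, a momentum and two defect measures. The
density and the momentum are the ratios of the densities of the block components and of `lam`; the
turbulent defect is the Schur complement of the block matrix. -/
theorem IsRelaxed.exists_representation (ha : 0 < a) (hγ : 1 < γ) (hQ : IsCompact Q)
    [IsFiniteMeasure lam] (hlam : lam Qᶜ = 0) (hS : IsRelaxed Q lam a γ S) :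
    ∃ (μ : Measure X) (ρ : X → ℝ) (m : X → Vec d) (r : X → Matrix (Fin d) (Fin d) ℝ) (s : X → ℝ),
      IsRepresentation Q lam a γ S μ ρ m r s := by
  classical
  obtain ⟨μ, k, κ, g, hfin, hμQ, hkm, hκm, hgm, hki, hκi, hsymm, hg, hκ, hpsd, hpress, hM, hq,
    hlamint, hlamint'⟩ := hS.exists_densities hQ hγ hlam
  have hγ1 : 0 < γ - 1 := by linarith
  have hk00 : ∀ z, 0 ≤ k z none none := fun z => psd_diag_nonneg (hpsd z) none
  have hpr := fun z => pressure_density ha hγ (hg z) (hk00 z) (hpress z)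
  have hrow := fun z => psd_row_eq_zero (hsymm z) (hpsd z)
  set ρ : X → ℝ := fun z => k z none none / g z with hρ
  set m : X → Vec d := fun z => WithLp.toLp 2 fun i => k z none (some i) / g z with hm
  have hmi : ∀ z i, m z i = k z none (some i) / g z := fun z i => rfl
  set r₀ : X → Matrix (Fin d) (Fin d) ℝ := fun z => Matrix.of fun i j => k z (some i) (some j)
      - k z none (some i) * k z none (some j) / k z none none with hr₀
  have hr₀psd : ∀ z, (r₀ z).PosSemidef := fun z => psd_schur (hsymm z) (hpsd z)
  set s₀ : X → ℝ := fun z => κ z - a * ρ z ^ γ * g z with hs₀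
  have hs₀nn : ∀ z, 0 ≤ s₀ z := fun z => sub_nonneg.mpr (hpr z).2
  set w : X → ℝ := fun z => 1 / 2 * ∑ i, r₀ z i i + 1 / (γ - 1) * s₀ z with hw
  have htr : ∀ z, 0 ≤ ∑ i, r₀ z i i := fun z => Finset.sum_nonneg fun i _ => (hr₀psd z).diag_nonneg
  have hγinv : 0 < 1 / (γ - 1) := by positivity
  have hwnn : ∀ z, 0 ≤ w z := fun z =>
    add_nonneg (mul_nonneg (by norm_num) (htr z)) (mul_nonneg hγinv.le (hs₀nn z))
  have hwzero : ∀ z, w z = 0 → r₀ z = 0 ∧ s₀ z = 0 := by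
    intro z hz
    have h1 := htr z
    have h2 : 0 ≤ 1 / (γ - 1) * s₀ z := mul_nonneg hγinv.le (hs₀nn z)
    have h3 : 1 / 2 * ∑ i, r₀ z i i + 1 / (γ - 1) * s₀ z = 0 := hz
    refine ⟨posSemidef_eq_zero_of_diag (hr₀psd z) (by linarith), ?_⟩
    have h4 : 1 / (γ - 1) * s₀ z = 0 := by linarith
    exact (mul_eq_zero.mp h4).resolve_left hγinv.ne'
  have hρm : Measurable ρ := (hkm none none).div hgm
  have hmim : ∀ i, Measurable fun z => m z i := fun i => (hkm none (some i)).div hgm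
  have hmm : Measurable m :=
    (WithLp.measurable_toLp 2 (Fin d → ℝ)).comp (measurable_pi_lambda _ fun i => hmim i)
  have hr₀m : ∀ i j, Measurable fun z => r₀ z i j := fun i j =>
    (hkm (some i) (some j)).sub (((hkm none (some i)).mul (hkm none (some j))).div (hkm none none))
  have hs₀m : Measurable s₀ := hκm.sub (((hρm.pow_const γ).const_mul a).mul hgm)
  have hwm : Measurable w :=
    ((Finset.measurable_fun_sum _ fun i _ => hr₀m i i).const_mul _).add (hs₀m.const_mul _)
  -- Where `g` vanishes, so do `k z none none` and the row of the momentum; the values of the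
  -- quotients by zero are therefore irrelevant.
  have hρg : ∀ z, ρ z * g z = k z none none := fun z => ((hpr z).1).symm
  have hmg : ∀ z i, m z i * g z = k z none (some i) := by
    intro z i
    rw [hmi]
    by_cases h0 : g z = 0
    · have : k z none none = 0 := by rw [← hρg z, h0, mul_zero]
      simp [hrow z this i]
    · field_simp
  have hfluxg : ∀ z i j, m z i * m z j / ρ z * g z
      = k z none (some i) * k z none (some j) / k z none none := by
    intro z i j
    by_cases h0 : g z = 0
    · have h00 : k z none none = 0 := by rw [← hρg z, h0, mul_zero]
      simp [h0, h00]
    · rw [hmi, hmi, hρ]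
      by_cases h1 : k z none none = 0
      · simp [h1]
      · simp only
        field_simp
  have hr₀i : ∀ i j, Integrable (fun z => r₀ z i j) μ := by
    intro i j
    have hdom : Integrable (fun z => ∑ l, k z (some l) (some l)) μ :=
      integrable_finsetSum _ fun l _ => hki _ _
    refine hdom.mono' (hr₀m i j).aestronglyMeasurable (Eventually.of_forall fun z => ?_)
    refine (posSemidef_abs_le (hr₀psd z) i j).trans (Finset.sum_le_sum fun l _ => ?_)
    simp only [hr₀, Matrix.of_apply]
    have := div_nonneg (mul_self_nonneg (k z none (some l))) (hk00 z)
    linarith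
  have hfluxi : ∀ i j, Integrable
      (fun z => k z none (some i) * k z none (some j) / k z none none) μ := by
    intro i j
    refine ((hki (some i) (some j)).sub (hr₀i i j)).congr (Eventually.of_forall fun z => ?_)
    simp [hr₀]
  have hρpg : Integrable (fun z => ρ z ^ γ * g z) μ := by
    refine (hκi.const_mul (1 / a)).mono' ((hρm.pow_const γ).mul hgm).aestronglyMeasurable
      (Eventually.of_forall fun z => ?_)
    have h1 := (hpr z).2
    have h2 : 0 ≤ ρ z ^ γ * g z :=
      mul_nonneg (Real.rpow_nonneg (div_nonneg (hk00 z) (hg z)) _) (hg z)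
    rw [Real.norm_eq_abs, abs_of_nonneg h2, one_div, le_inv_mul_iff₀ ha]
    linarith
  have hs₀i : Integrable s₀ μ := by
    refine (hκi.sub (hρpg.const_mul a)).congr (Eventually.of_forall fun z => ?_)
    simp [hs₀]; ring
  have hwi : Integrable w μ :=
    ((integrable_finsetSum _ fun i _ => hr₀i i i).const_mul _).add (hs₀i.const_mul _)
  -- The defects are normalized by their energy density `w`, which becomes the density of `μ'`.
  -- Where `w` vanishes, the value `s = γ - 1` keeps the normalization.
  set r : X → Matrix (Fin d) (Fin d) ℝ := fun z => (w z)⁻¹ • r₀ z with hr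
  set s : X → ℝ := fun z => if w z = 0 then γ - 1 else (w z)⁻¹ * s₀ z with hs
  have hwr : ∀ z i j, w z * r z i j = r₀ z i j := by
    intro z i j
    by_cases h0 : w z = 0
    · simp [hr, h0, (hwzero z h0).1]
    · simp only [hr, Matrix.smul_apply, smul_eq_mul]
      field_simp
  have hws : ∀ z, w z * s z = s₀ z := by
    intro z
    by_cases h0 : w z = 0
    · simp [h0, (hwzero z h0).2]
    · simp only [hs, h0, if_false]
      field_simp
  set μ' := μ.withDensity (fun z => ENNReal.ofReal (w z)) with hμ'
  have hμ'int : ∀ h : X → ℝ, ∫ z, h z ∂μ' = ∫ z, w z * h z ∂μ := by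
    intro h
    rw [hμ', integral_withDensity_eq_integral_toReal_smul hwm.ennreal_ofReal
      (Eventually.of_forall fun z => ENNReal.ofReal_lt_top)]
    refine integral_congr_ae (Eventually.of_forall fun z => ?_)
    simp [ENNReal.toReal_ofReal (hwnn z)]
  refine ⟨μ', ρ, m, r, s, ?_⟩
  refine
    { finite := isFiniteMeasure_withDensity_ofReal hwi.2
      null_compl := withDensity_absolutelyContinuous _ _ hμQ
      measurable_density := hρm
      measurable_momentum := hmm
      measurable_defect := fun i j => hwm.inv.mul (hr₀m i j)
      measurable_pressureDefect := Measurable.ite (hwm (measurableSet_singleton 0)) measurable_const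
        (hwm.inv.mul hs₀m)
      density_nonneg := fun z => div_nonneg (hk00 z) (hg z)
      momentum_eq_zero := ?_
      posSemidef := fun z => (hr₀psd z).smul (inv_nonneg.mpr (hwnn z))
      pressureDefect_nonneg := ?_
      normalized := ?_
      integrable_density := ?_
      integrable_momentum := ?_
      integrable_flux := ?_
      integrable_pressure := ?_
      density_eq := ?_
      momentum_eq := ?_
      flux_eq := ?_
      pressure_eq := ?_ }
  · intro z hz
    have h0 : k z none none = 0 := by rw [← hρg z, hz, zero_mul]
    ext i
    simp [hmi, hrow z h0 i]
  · intro z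
    simp only [hs]
    split_ifs
    · exact hγ1.le
    · exact mul_nonneg (inv_nonneg.mpr (hwnn z)) (hs₀nn z)
  · intro z
    by_cases h0 : w z = 0
    · have h1 : 1 / (γ - 1) * (γ - 1) = 1 := one_div_mul_cancel hγ1.ne'
      simp only [hr, hs, h0, inv_zero, zero_smul, Matrix.zero_apply, Finset.sum_const_zero,
        mul_zero, zero_add, if_true]
      exact h1
    · simp only [hr, hs, h0, if_false, Matrix.smul_apply, smul_eq_mul, ← Finset.mul_sum]
      have : 1 / 2 * ((w z)⁻¹ * ∑ i, r₀ z i i) + 1 / (γ - 1) * ((w z)⁻¹ * s₀ z)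
          = (w z)⁻¹ * w z := by simp only [hw]; ring
      rw [this, inv_mul_cancel₀ h0]
  · rw [hlamint']
    simpa only [hρg] using hki none none
  · intro i
    rw [hlamint']
    simpa only [hmg] using hki none (some i)
  · intro i j
    rw [hlamint']
    simpa only [hfluxg] using hfluxi i j
  · rw [hlamint']
    exact hρpg
  · intro f
    rw [hM, hlamint]
    simp only [mul_assoc, hρg]
  · intro i f
    rw [hM, hlamint]
    simp only [mul_assoc, hmg]
  · intro i j f
    rw [hM, hlamint, hμ'int]
    simp only [mul_assoc, hfluxg, mul_left_comm _ (f _), hwr]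
    rw [← integral_add (integrable_continuousMap_mul hQ hμQ f (hfluxi i j))
      (integrable_continuousMap_mul hQ hμQ f (hr₀i i j))]
    refine integral_congr_ae (Eventually.of_forall fun z => ?_)
    simp only [hr₀, Matrix.of_apply]
    ring
  · intro f
    rw [hq, hlamint, hμ'int]
    simp only [mul_assoc, mul_left_comm _ (f _), hws]
    rw [← integral_add (integrable_continuousMap_mul hQ hμQ f (hρpg.const_mul a))
      (integrable_continuousMap_mul hQ hμQ f hs₀i)]
    refine integral_congr_ae (Eventually.of_forall fun z => ?_)
    simp only [hs₀]
    ring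

end Representation

/-! ### Relaxed states without defects -/

/-- The block matrix `[[ϱ, m], [m, m ⊗ m / ϱ]]`, that is `u ⊗ u / ϱ` for `u = (ϱ, m)`. -/
noncomputable def blockMatrix {d : ℕ} (r : ℝ) (v : Vec d) (i j : Option (Fin d)) : ℝ :=
  i.elim r v * j.elim r v / r

/-- A density and a momentum of finite energy with respect to `lam`. -/
structure IsFlow {X : Type} [MeasurableSpace X] {d : ℕ} (lam : Measure X) (γ : ℝ) (ρ : X → ℝ)
    (m : X → Vec d) : Prop where
  nonneg : ∀ᵐ z ∂lam, 0 ≤ ρ z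
  eq_zero : ∀ᵐ z ∂lam, ρ z = 0 → m z = 0
  integrable_density : Integrable ρ lam
  integrable_momentum : ∀ i, Integrable (fun z => m z i) lam
  integrable_flux : ∀ i j, Integrable (fun z => m z i * m z j / ρ z) lam
  integrable_pressure : Integrable (fun z => ρ z ^ γ) lam

/-- The relaxed state of a density and a momentum, without defects. -/
noncomputable def pureState {X : Type} [TopologicalSpace X] [MeasurableSpace X] {d : ℕ}
    (lam : Measure X) (a γ : ℝ) (ρ : X → ℝ) (m : X → Vec d) : RelaxedState X d :=
  (fun i j f => ∫ z, f z * blockMatrix (ρ z) (m z) i j ∂lam, fun f => ∫ z, f z * (a * ρ z ^ γ) ∂lam)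

lemma blockMatrix_none_none {d : ℕ} (r : ℝ) (v : Vec d) : blockMatrix r v none none = r := by
  simp [blockMatrix]

lemma blockMatrix_none_some {d : ℕ} {r : ℝ} {v : Vec d} (h : r = 0 → v = 0) (i : Fin d) :
    blockMatrix r v none (some i) = v i := by
  by_cases hr : r = 0
  · simp [blockMatrix, h hr]
  · simp only [blockMatrix, Option.elim_none, Option.elim_some]
    field_simp

lemma blockMatrix_symm {d : ℕ} (r : ℝ) (v : Vec d) (i j : Option (Fin d)) :
    blockMatrix r v i j = blockMatrix r v j i := by
  simp [blockMatrix, mul_comm]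

lemma blockMatrix_psd {d : ℕ} {r : ℝ} (hr : 0 ≤ r) (v : Vec d) (ξ : Option (Fin d) → ℝ) :
    0 ≤ ∑ i, ∑ j, ξ i * ξ j * blockMatrix r v i j := by
  have : ∑ i, ∑ j, ξ i * ξ j * blockMatrix r v i j = (∑ i, ξ i * i.elim r v) ^ 2 / r := by
    rw [sq, Finset.sum_mul_sum, Finset.sum_div]
    refine Finset.sum_congr rfl fun i _ => ?_
    rw [Finset.sum_div]
    exact Finset.sum_congr rfl fun j _ => by simp only [blockMatrix]; ring
  rw [this]
  positivity

/-- The tangent inequality for the convex function `r ↦ r ^ γ`. -/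
lemma rpow_tangent_le {γ r s : ℝ} (hγ : 1 < γ) (hr : 0 ≤ r) (hs : 0 ≤ s) :
    γ * s ^ (γ - 1) * r ≤ r ^ γ + (γ - 1) * s ^ γ := by
  have hpq : γ.HolderConjugate (γ / (γ - 1)) := Real.HolderConjugate.conjExponent hγ
  have h := Real.young_inequality_of_nonneg hr (Real.rpow_nonneg hs (γ - 1)) hpq
  have hγ1 : γ - 1 ≠ 0 := by linarith
  have e : (s ^ (γ - 1)) ^ (γ / (γ - 1)) = s ^ γ := by
    rw [← Real.rpow_mul hs]; congr 1; field_simp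
  rw [e] at h
  have h2 : γ * (r * s ^ (γ - 1)) ≤ γ * (r ^ γ / γ + s ^ γ / (γ / (γ - 1))) := by gcongr
  have e2 : γ * (r ^ γ / γ + s ^ γ / (γ / (γ - 1))) = r ^ γ + (γ - 1) * s ^ γ := by
    have : γ ≠ 0 := by linarith
    field_simp
  rw [e2] at h2
  linarith

lemma energyDensity_eq_ofReal {d : ℕ} {a γ r : ℝ} {v : Vec d} (ha : 0 < a) (hγ : 1 < γ)
    (hr : 0 ≤ r) (h : r = 0 → v = 0) :
    energyDensity a γ r v
      = ENNReal.ofReal (1 / 2 * ∑ i, v i * v i / r + 1 / (γ - 1) * (a * r ^ γ)) := by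
  have hP : 0 ≤ 1 / (γ - 1) * (a * r ^ γ) := by
    have : 0 < γ - 1 := by linarith
    positivity
  have hP' : pressurePotential a γ r = 1 / (γ - 1) * (a * r ^ γ) := by
    unfold pressurePotential; ring
  have hs : ∑ i, v i * v i / r = ‖v‖ ^ 2 / r := by
    rw [← Finset.sum_div, EuclideanSpace.real_norm_sq_eq]
    simp [sq]
  unfold energyDensity
  rcases hr.eq_or_lt with h0 | h0
  · have hv := h h0.symm
    subst hv
    simp [hP']
  · rw [← ENNReal.ofReal_div_of_pos h0, ← ENNReal.ofReal_add (by positivity)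
      (by rw [hP']; exact hP),
      hs, hP']
    congr 1
    ring

section Pure

variable {X : Type} [MetricSpace X] [ProperSpace X] [MeasurableSpace X] [BorelSpace X] {d : ℕ}
  {Q : Set X} {lam : Measure X} {a γ : ℝ} {ρ : X → ℝ} {m : X → Vec d}

lemma IsFlow.integrable_blockMatrix (h : IsFlow lam γ ρ m) (i j : Option (Fin d)) :
    Integrable (fun z => blockMatrix (ρ z) (m z) i j) lam := by
  rcases i with _ | i
  · rcases j with _ | j
    · simpa only [blockMatrix_none_none] using h.integrable_density
    · refine (h.integrable_momentum j).congr ?_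
      filter_upwards [h.eq_zero] with z hz
      rw [blockMatrix_none_some hz]
  · rcases j with _ | j
    · refine (h.integrable_momentum i).congr ?_
      filter_upwards [h.eq_zero] with z hz
      rw [blockMatrix_symm, blockMatrix_none_some hz]
    · exact h.integrable_flux i j

lemma isLinearMap_integral_mul (hQ : IsCompact Q) (hlam : lam Qᶜ = 0) {h : X → ℝ}
    (hh : Integrable h lam) : IsLinearMap ℝ fun f : C(X, ℝ) => ∫ z, f z * h z ∂lam := by
  constructor
  · intro f g
    rw [← integral_add (integrable_continuousMap_mul hQ hlam f hh)
      (integrable_continuousMap_mul hQ hlam g hh)]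
    exact integral_congr_ae (Eventually.of_forall fun z => by simp [add_mul])
  · intro c f
    rw [smul_eq_mul, ← integral_const_mul]
    exact integral_congr_ae (Eventually.of_forall fun z => by simp [mul_assoc])

lemma IsFlow.isRelaxed_pureState (ha : 0 < a) (hγ : 1 < γ) (hQ : IsCompact Q)
    [IsFiniteMeasure lam] (hlam : lam Qᶜ = 0) (h : IsFlow lam γ ρ m) :
    IsRelaxed Q lam a γ (pureState lam a γ ρ m) := by
  have hQae : ∀ᵐ z ∂lam, z ∈ Q := mem_ae_iff.mpr hlam
  have hfb := fun (f : C(X, ℝ)) i j =>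
    integrable_continuousMap_mul hQ hlam f (h.integrable_blockMatrix i j)
  refine ⟨?_, ?_, ?_, ?_, ?_⟩
  · exact fun i j => isLinearMap_integral_mul hQ hlam (h.integrable_blockMatrix i j)
  · exact isLinearMap_integral_mul hQ hlam (h.integrable_pressure.const_mul a)
  · intro i j f
    simp only [pureState, blockMatrix_symm _ _ i j]
  · intro ξ f hf
    simp only [pureState]
    simp_rw [← integral_const_mul]
    simp_rw [← integral_finsetSum Finset.univ fun j _ => (hfb f _ j).const_mul _]
    rw [← integral_finsetSum]
    swap
    · intro i _
      exact integrable_finsetSum _ fun j _ => (hfb f i j).const_mul _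
    refine integral_nonneg_of_ae ?_
    filter_upwards [hQae, h.nonneg] with z hz hρ
    have := mul_nonneg (hf z hz) (blockMatrix_psd hρ (m z) ξ)
    simp only [Finset.mul_sum] at this
    refine this.trans (le_of_eq ?_)
    exact Finset.sum_congr rfl fun i _ => Finset.sum_congr rfl fun j _ => by ring
  · intro s hs f hf
    simp only [pureState, blockMatrix_none_none]
    have hfp := integrable_continuousMap_mul hQ hlam f (h.integrable_pressure.const_mul a)
    have hf1 := integrable_continuousMap hQ hlam f
    have hfρ := integrable_continuousMap_mul hQ hlam f h.integrable_density
    rw [← integral_const_mul, ← integral_const_mul, ← integral_add hfp (hf1.const_mul _)]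
    refine integral_mono_ae (hfρ.const_mul _) (hfp.add (hf1.const_mul _)) ?_
    filter_upwards [hQae, h.nonneg] with z hz hρ
    have := mul_le_mul_of_nonneg_left (rpow_tangent_le hγ hρ hs) (mul_nonneg ha.le (hf z hz))
    linarith

lemma IsFlow.energy_pureState (hQ : IsCompact Q) (hlam : lam Qᶜ = 0) (h : IsFlow lam γ ρ m)
    (f : C(X, ℝ)) : (pureState lam a γ ρ m).energy γ f
      = ∫ z, f z * (1 / 2 * ∑ i, m z i * m z i / ρ z + 1 / (γ - 1) * (a * ρ z ^ γ)) ∂lam := by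
  have hfp := integrable_continuousMap_mul hQ hlam f (h.integrable_pressure.const_mul a)
  have hfb := fun i => integrable_continuousMap_mul hQ hlam f (h.integrable_flux i i)
  have : (pureState lam a γ ρ m).energy γ f = 1 / 2 * ∑ i, ∫ z, f z * (m z i * m z i / ρ z) ∂lam
      + 1 / (γ - 1) * ∫ z, f z * (a * ρ z ^ γ) ∂lam := rfl
  rw [this, ← integral_finsetSum _ fun i _ => hfb i, ← integral_const_mul, ← integral_const_mul,
    ← integral_add ((integrable_finsetSum _ fun i _ => hfb i).const_mul _) (hfp.const_mul _)]
  refine integral_congr_ae (Eventually.of_forall fun z => ?_)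
  simp only [← Finset.mul_sum]
  ring

/-- Adding a positive semidefinite turbulent defect and a nonnegative pressure defect keeps a state
relaxed. -/
lemma IsRelaxed.add_defect {S : RelaxedState X d} (hS : IsRelaxed Q lam a γ S)
    {N : Fin d → Fin d → C(X, ℝ) → ℝ} {p : C(X, ℝ) → ℝ} (hN : ∀ i j, IsLinearMap ℝ (N i j))
    (hp : IsLinearMap ℝ p) (hsymm : ∀ i j f, N i j f = N j i f)
    (hpsd : ∀ (ξ : Fin d → ℝ) (f : C(X, ℝ)), (∀ z ∈ Q, 0 ≤ f z) →
      0 ≤ ∑ i, ∑ j, ξ i * ξ j * N i j f)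
    (hpn : ∀ f : C(X, ℝ), (∀ z ∈ Q, 0 ≤ f z) → 0 ≤ p f) :
    IsRelaxed Q lam a γ
      (fun i j f => S.1 i j f + i.elim 0 fun i => j.elim 0 fun j => N i j f,
        fun f => S.2 f + p f) := by
  refine ⟨?_, ?_, ?_, ?_, ?_⟩
  · intro i j
    constructor
    · intro f g
      rcases i with _ | i <;> rcases j with _ | j <;>
        simp [(hS.linear_block _ _).map_add, (hN _ _).map_add]
      ring
    · intro c f
      rcases i with _ | i <;> rcases j with _ | j <;>
        simp [(hS.linear_block _ _).map_smul, (hN _ _).map_smul, mul_add]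
  · constructor
    · intro f g
      simp only [hS.linear_pressure.map_add, hp.map_add]; ring
    · intro c f
      simp [hS.linear_pressure.map_smul, hp.map_smul, mul_add]
  · intro i j f
    rcases i with _ | i <;> rcases j with _ | j
    · rfl
    · simp [hS.symm none (some j)]
    · simp [hS.symm none (some i)]
    · simp [hS.symm (some i) (some j), hsymm i j]
  · intro ξ f hf
    have h1 := hS.psd ξ f hf
    have h2 := hpsd (fun i => ξ (some i)) f hf
    refine (add_nonneg h1 h2).trans (le_of_eq ?_)
    simp only [Fintype.sum_option, Option.elim_none, Option.elim_some, mul_add, mul_zero,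
      Finset.sum_const_zero, Finset.sum_add_distrib]
    ring
  · intro s hs f hf
    have h1 := hS.pressure s hs f hf
    have h2 := hpn f hf
    simp only [Option.elim_none, add_zero]
    linarith

lemma convex_isRelaxed (Q : Set X) (lam : Measure X) (a γ : ℝ) :
    Convex ℝ {S : RelaxedState X d | IsRelaxed Q lam a γ S} := by
  intro S hS S' hS' x y hx hy hxy
  refine ⟨?_, ?_, ?_, ?_, ?_⟩
  · intro i j
    constructor
    · intro f g
      simp [(hS.linear_block _ _).map_add, (hS'.linear_block _ _).map_add]
      ring
    · intro c f
      simp [(hS.linear_block _ _).map_smul, (hS'.linear_block _ _).map_smul]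
      ring
  · constructor
    · intro f g
      simp [hS.linear_pressure.map_add, hS'.linear_pressure.map_add]
      ring
    · intro c f
      simp [hS.linear_pressure.map_smul, hS'.linear_pressure.map_smul]
      ring
  · intro i j f
    simp [hS.symm i j, hS'.symm i j]
  · intro ξ f hf
    have h1 := mul_nonneg hx (hS.psd ξ f hf)
    have h2 := mul_nonneg hy (hS'.psd ξ f hf)
    refine (add_nonneg h1 h2).trans (le_of_eq ?_)
    simp only [Finset.mul_sum, ← Finset.sum_add_distrib]
    refine Finset.sum_congr rfl fun i _ => Finset.sum_congr rfl fun j _ => ?_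
    simp
    ring
  · intro s hs f hf
    have h1 := mul_le_mul_of_nonneg_left (hS.pressure s hs f hf) hx
    have h2 := mul_le_mul_of_nonneg_left (hS'.pressure s hs f hf) hy
    have e : a * (γ - 1) * s ^ γ * ∫ z, f z ∂lam
        = x * (a * (γ - 1) * s ^ γ * ∫ z, f z ∂lam)
          + y * (a * (γ - 1) * s ^ γ * ∫ z, f z ∂lam) := by
      rw [← add_mul, hxy, one_mul]
    simp only [Prod.fst_add, Prod.smul_fst, Prod.snd_add, Prod.smul_snd, Pi.add_apply,
      Pi.smul_apply, smul_eq_mul]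
    rw [e]
    linarith

end Pure

/-! ### A minimax principle -/

/-- If every nonnegative combination of finitely many affine functions takes values below any
positive number on a convex set, then the functions are simultaneously below any positive number at
some point of the set: otherwise a hyperplane separates the values from the negative orthant. -/
theorem exists_forall_le_of_combination {E ι : Type} [AddCommGroup E] [Module ℝ E] [Fintype ι]
    {C : Set E} (hC : Convex ℝ C) (R : ι → E → ℝ)
    (hR : ∀ i, ∀ x ∈ C, ∀ y ∈ C, ∀ s t : ℝ, 0 ≤ s → 0 ≤ t → s + t = 1 →
      R i (s • x + t • y) = s * R i x + t * R i y)
    (h : ∀ c : ι → ℝ, (∀ i, 0 ≤ c i) → ∀ ε > 0, ∃ x ∈ C, ∑ i, c i * R i x ≤ ε) {δ : ℝ}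
        (hδ : 0 < δ) :
    ∃ x ∈ C, ∀ i, R i x ≤ δ := by
  classical
  by_contra hcon
  push Not at hcon
  set A : Set (ι → ℝ) := {y | ∃ x ∈ C, ∀ i, R i x ≤ y i} with hA
  set B : Set (ι → ℝ) := {y | ∀ i, y i < δ} with hB
  have hAc : Convex ℝ A := by
    rintro y ⟨x, hx, hxy⟩ y' ⟨x', hx', hxy'⟩ s t hs ht hst
    refine ⟨s • x + t • x', hC hx hx' hs ht hst, fun i => ?_⟩
    rw [hR i x hx x' hx' s t hs ht hst]
    simp only [Pi.add_apply, Pi.smul_apply, smul_eq_mul]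
    have := mul_le_mul_of_nonneg_left (hxy i) hs
    have := mul_le_mul_of_nonneg_left (hxy' i) ht
    linarith
  have hBpi : B = Set.univ.pi fun _ => Iio δ := by ext y; simp [hB]
  have hBc : Convex ℝ B := by
    rw [hBpi]; exact convex_pi fun _ _ => convex_Iio δ
  have hBo : IsOpen B := by
    rw [hBpi]; exact isOpen_set_pi finite_univ fun _ _ => isOpen_Iio
  have hdisj : Disjoint B A := by
    rw [disjoint_left]
    rintro y hyB ⟨x, hx, hxy⟩
    obtain ⟨i, hi⟩ := hcon x hx
    exact absurd ((hxy i).trans_lt (hyB i)) (not_lt.mpr hi.le)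
  -- The set `A` of upper bounds of the values is separated from the open orthant `B`.
  obtain ⟨f, u, hfB, hfA⟩ := geometric_hahn_banach_open hBc hBo hAc hdisj
  set c : ι → ℝ := fun i => f (Pi.single i 1) with hc
  have hfc : ∀ y : ι → ℝ, f y = ∑ i, c i * y i := by
    intro y
    conv_lhs => rw [pi_eq_sum_univ' y]
    rw [map_sum]
    refine Finset.sum_congr rfl fun i _ => ?_
    rw [map_smul, smul_eq_mul, mul_comm]
  obtain ⟨x₀, hx₀, -⟩ := h 0 (fun _ => le_rfl) 1 one_pos
  -- `A` is stable under increasing a coordinate, so that the separating functional is nonnegative.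
  have hc0 : ∀ i, 0 ≤ c i := by
    intro i
    by_contra hneg
    push Not at hneg
    set t : ℝ := (f (fun j => R j x₀) - u + 1) / (-c i) with ht
    have hfx := hfA (fun j => R j x₀) ⟨x₀, hx₀, fun j => le_rfl⟩
    have htn : 0 ≤ t := div_nonneg (by linarith) (by linarith)
    have hmem : (fun j => R j x₀) + t • Pi.single i (1 : ℝ) ∈ A := by
      refine ⟨x₀, hx₀, fun j => ?_⟩
      simp only [Pi.add_apply, Pi.smul_apply, smul_eq_mul, Pi.single_apply]
      split_ifs <;> simp [htn]
    have := hfA _ hmem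
    rw [map_add, map_smul, smul_eq_mul] at this
    have e : t * f (Pi.single i 1) = -(f (fun j => R j x₀) - u + 1) := by
      have : f (Pi.single i 1) = c i := rfl
      have hne : c i ≠ 0 := hneg.ne
      rw [this, ht]
      field_simp
    rw [e] at this
    linarith
  have hb := hfB (fun _ => δ / 2) (fun i => by simp; linarith)
  rw [hfc, ← Finset.sum_mul] at hb
  have hcpos : 0 < ∑ i, c i := by
    refine lt_of_le_of_ne (Finset.sum_nonneg fun i _ => hc0 i) fun h0 => ?_
    have hall : ∀ i, c i = 0 := fun i =>
      (Finset.sum_eq_zero_iff_of_nonneg fun i _ => hc0 i).mp h0.symm i (Finset.mem_univ i)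
    have h2 := hfA _ ⟨x₀, hx₀, fun j => le_rfl⟩
    rw [hfc] at h2
    simp [hall] at h2 hb
    linarith
  obtain ⟨x, hx, hle⟩ := h c hc0 ((∑ i, c i) * (δ / 2)) (by positivity)
  have h2 := hfA _ ⟨x, hx, fun j => le_rfl⟩
  rw [hfc] at h2
  linarith

/-! ### The divergence theorem for tangential fields -/

section Divergence

variable {d : ℕ}

lemma sum_coord_smul_basisVec (v : Vec d) : ∑ i, v i • basisVec i = v := by
  ext j
  simp [basisVec, Pi.single_apply]

lemma continuous_partialD {v : Vec d → Vec d} (hv : ContDiff ℝ 1 v) (i j : Fin d) :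
    Continuous fun x => partialD v x i j := by
  have h : Continuous fun x => fderiv ℝ v x (basisVec j) :=
    (hv.continuous_fderiv one_ne_zero).clm_apply continuous_const
  unfold partialD
  fun_prop

lemma continuous_divergence {v : Vec d → Vec d} (hv : ContDiff ℝ 1 v) :
    Continuous fun x => divergence v x :=
  continuous_finsetSum _ fun i _ => continuous_partialD hv i i

lemma divergence_smul {ζ : Vec d → ℝ} {v : Vec d → Vec d} {x : Vec d}
    (hζ : DifferentiableAt ℝ ζ x) (hv : DifferentiableAt ℝ v x) :
    divergence (fun y => ζ y • v y) x = ζ x * divergence v x + fderiv ℝ ζ x (v x) := by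
  have h : fderiv ℝ (fun y => ζ y • v y) x = ζ x • fderiv ℝ v x + (fderiv ℝ ζ x).smulRight (v x) :=
    fderiv_fun_smul hζ hv
  have e : fderiv ℝ ζ x (v x) = ∑ i, v x i * fderiv ℝ ζ x (basisVec i) := by
    conv_lhs => rw [← sum_coord_smul_basisVec (v x)]
    simp [map_sum]
  rw [e]
  unfold divergence partialD
  simp only [h, _root_.add_apply, _root_.smul_apply,
    ContinuousLinearMap.smulRight_apply, PiLp.add_apply, PiLp.smul_apply, smul_eq_mul,
    Finset.sum_add_distrib, Finset.mul_sum]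
  congr 1
  exact Finset.sum_congr rfl fun i _ => mul_comm _ _

lemma divergence_eq_zero_of_notMem_tsupport {v : Vec d → Vec d} {x : Vec d}
    (hx : x ∉ tsupport v) : divergence v x = 0 := by
  have : fderiv ℝ v x = 0 :=
    image_eq_zero_of_notMem_tsupport (fun h => hx (tsupport_fderiv_subset ℝ h))
  simp [divergence, partialD, this]

lemma hasCompactSupport_divergence {v : Vec d → Vec d} (hv : HasCompactSupport v) :
    HasCompactSupport fun x => divergence v x :=
  HasCompactSupport.intro hv fun _ hx => divergence_eq_zero_of_notMem_tsupport hx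

lemma integral_divergence_of_hasCompactSupport {w : Vec d → Vec d} (hw : ContDiff ℝ 1 w)
    (hc : HasCompactSupport w) : ∫ x, divergence w x = 0 := by
  have hpart : ∀ i, HasCompactSupport fun x => partialD w x i i := fun i =>
    HasCompactSupport.intro hc fun x hx => by
      have : fderiv ℝ w x = 0 :=
        image_eq_zero_of_notMem_tsupport (fun h => hx (tsupport_fderiv_subset ℝ h))
      simp [partialD, this]
  have hint : ∀ i, Integrable fun x => partialD w x i i := fun i =>
    (continuous_partialD hw i i).integrable_of_hasCompactSupport (hpart i)
  unfold divergence
  rw [integral_finsetSum _ fun i _ => hint i]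
  refine Finset.sum_eq_zero fun i _ => ?_
  set g' : Vec d → Vec d →L[ℝ] ℝ := fun x => (EuclideanSpace.proj i).comp (fderiv ℝ w x) with hg'
  have hwi : Integrable fun x => w x i :=
    ((EuclideanSpace.proj (𝕜 := ℝ) i).continuous.comp hw.continuous).integrable_of_hasCompactSupport
      (hc.comp_left (g := fun v : Vec d => v i) rfl)
  have h := integral_bilinear_hasFDerivAt_right_eq_neg_left_of_integrable (μ := volume)
    (f := fun _ : Vec d => (1 : ℝ)) (f' := fun _ => 0) (g := fun x => w x i) (g' := g')
    (v := basisVec i) (B := ContinuousLinearMap.mul ℝ ℝ) (by simp)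
    (by simpa [hg', partialD] using hint i) (by simpa using hwi)
    (fun x _ => hasFDerivAt_const _ _) (fun x _ =>
      ((EuclideanSpace.proj (𝕜 := ℝ) i).hasFDerivAt).comp x
        ((hw.differentiable one_ne_zero) x).hasFDerivAt)
  simpa [hg', partialD] using h

set_option maxHeartbeats 1600000 in
/-- Near a boundary point of a `C¹` domain, fields of small support that are tangential to the
boundary have integral divergence zero. The divergence is tested with the cut-off functions
`θ(-g/ε)` of a local defining function `g`; the commutator is supported in a layer of volume
`O(ε)`, since the translates of the layer in a direction transversal to the boundary are disjoint,
and there the normal component of the field is small. -/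
lemma exists_ball_integral_divergence_boundary {Ω : Set (Vec d)} (hΩ : IsOpen Ω)
    {v : Vec d → Vec d} (hv : ContDiff ℝ 1 v)
    (htan : ∀ x ∈ frontier Ω, ∀ n, IsOuterNormal Ω x n → inner ℝ (v x) n = 0)
    {x₀ : Vec d} {g : Vec d → ℝ} (hg : IsLocalDefiningFunction Ω x₀ g) :
    ∃ r > 0, ∀ ζ : Vec d → ℝ, ContDiff ℝ 1 ζ → tsupport ζ ⊆ Metric.ball x₀ r →
      ∫ x in Ω, divergence (fun y => ζ y • v y) x = 0 := by
  obtain ⟨hgC, hgrad, U, hU, hUΩ⟩ := hg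
  -- On a small ball, `g` grows with slope at least `c` in the direction `e` of its gradient.
  set N := gradient g x₀ with hN
  have hNpos : 0 < ‖N‖ := norm_pos_iff.mpr hgrad
  set e : Vec d := ‖N‖⁻¹ • N with he
  have henorm : ‖e‖ = 1 := by
    rw [he, norm_smul, norm_inv, norm_norm, inv_mul_cancel₀ hNpos.ne']
  have hderiv0 : fderiv ℝ g x₀ e = ‖N‖ := by
    rw [← inner_gradient_left, ← hN, he, inner_smul_right, real_inner_self_eq_norm_sq]
    field_simp
  clear_value e
  set c := ‖N‖ / 2 with hc
  have hcpos : 0 < c := by positivity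
  have hcont : Continuous fun x => fderiv ℝ g x e :=
    (hgC.continuous_fderiv one_ne_zero).clm_apply continuous_const
  have hev : ∀ᶠ x in 𝓝 x₀, c < fderiv ℝ g x e :=
    hcont.continuousAt.eventually_const_lt (by simp only [hderiv0, hc]; linarith)
  obtain ⟨R, hR, hRsub⟩ := Metric.mem_nhds_iff.mp (inter_mem hU hev)
  have hball : ∀ x ∈ Metric.ball x₀ R, (x ∈ Ω ↔ g x < 0) ∧ c < fderiv ℝ g x e :=
    fun x hx => ⟨hUΩ x (hRsub hx).1, (hRsub hx).2⟩
  have hgrow : ∀ x s, 0 ≤ s → x ∈ Metric.ball x₀ R → x + s • e ∈ Metric.ball x₀ R →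
      g x + c * s ≤ g (x + s • e) := by
    intro x s hs hx hxs
    have hline : ∀ t : ℝ, HasDerivAt (fun t : ℝ => g (x + t • e)) (fderiv ℝ g (x + t • e) e) t := by
      intro t
      have h1 : HasDerivAt (fun t : ℝ => x + t • e) e t := by
        simpa using ((hasDerivAt_id t).smul_const e).const_add x
      exact ((hgC.differentiable one_ne_zero) (x + t • e)).hasFDerivAt.comp_hasDerivAt t h1
    have hmem : ∀ t ∈ Icc 0 s, x + t • e ∈ Metric.ball x₀ R := by
      intro t ht
      rcases hs.eq_or_lt with h0 | h0
      · have : t = 0 := le_antisymm (h0 ▸ ht.2) ht.1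
        simpa [this] using hx
      · have := (convex_ball x₀ R) hx hxs (a := 1 - t / s) (b := t / s)
          (sub_nonneg.mpr ((div_le_one h0).mpr ht.2)) (by have := ht.1; positivity) (by ring)
        convert this using 1
        have h1 : t • e = (t / s) • s • e := by rw [smul_smul, div_mul_cancel₀ _ h0.ne']
        rw [smul_add, ← add_assoc, ← add_smul, h1]
        simp
    have := (convex_Icc 0 s).mul_sub_le_image_sub_of_le_deriv (f := fun t : ℝ => g (x + t • e))
      (fun t _ => (hline t).continuousAt.continuousWithinAt)
      (fun t _ => (hline t).differentiableAt.differentiableWithinAt) (C := c)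
      (fun t ht => by
        rw [(hline t).deriv]
        exact (hball _ (hmem t (interior_subset ht))).2.le) 0 (by simp [hs]) s (by simp [hs]) hs
    simp at this
    linarith
  -- Zeros of `g` are boundary points, and the gradient of `g` is a multiple of the normal there.
  have hzero : ∀ y ∈ Metric.ball x₀ R, g y = 0 → fderiv ℝ g y (v y) = 0 := by
    intro y hy hgy
    have hgy' : gradient g y ≠ 0 := by
      intro h0
      have := (hball y hy).2
      rw [← inner_gradient_left, h0, inner_zero_left] at this
      linarith
    have hyΩ : y ∉ Ω := fun h => by
      have := (hball y hy).1.mp h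
      linarith
    have hycl : y ∈ closure Ω := by
      rw [Metric.mem_closure_iff]
      intro ε hε
      set δ := R - dist y x₀ with hδ
      have hδpos : 0 < δ := by
        have := Metric.mem_ball.mp hy
        linarith
      set s := min (ε / 2) (δ / 2) with hs
      have hspos : 0 < s := by positivity
      have hd : dist y (y - s • e) = s := by
        rw [dist_eq_norm]
        simp [norm_smul, henorm, abs_of_pos hspos]
      have hin : y - s • e ∈ Metric.ball x₀ R := by
        rw [Metric.mem_ball]
        have := dist_triangle (y - s • e) y x₀
        rw [dist_comm (y - s • e) y, hd] at this
        have : s ≤ δ / 2 := min_le_right _ _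
        linarith
      refine ⟨y - s • e, ?_, ?_⟩
      · have := hgrow (y - s • e) s hspos.le hin (by simpa using hy)
        rw [(hball _ hin).1]
        simp only [sub_add_cancel, hgy] at this
        have : 0 < c * s := by positivity
        linarith
      · rw [hd]
        have : s ≤ ε / 2 := min_le_left _ _
        linarith
    have hfr : y ∈ frontier Ω := by
      rw [hΩ.frontier_eq]; exact ⟨hycl, hyΩ⟩
    have hn := htan y hfr (‖gradient g y‖⁻¹ • gradient g y)
      ⟨g, ⟨hgC, hgy', Metric.ball x₀ R, Metric.isOpen_ball.mem_nhds hy, fun z hz => (hball z hz).1⟩,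
        rfl⟩
    rw [inner_smul_right, mul_eq_zero] at hn
    have h2 := hn.resolve_left (by simpa using hgy')
    rw [← inner_gradient_left, real_inner_comm]
    exact h2
  refine ⟨R / 4, by positivity, fun ζ hζ hζs => ?_⟩
  set r := R / 4 with hr
  have hrpos : 0 < r := by positivity
  set w : Vec d → Vec d := fun y => ζ y • v y with hw
  have hwC : ContDiff ℝ 1 w := hζ.smul hv
  have hζc : HasCompactSupport ζ :=
    HasCompactSupport.of_support_subset_isCompact (isCompact_closedBall x₀ r)
      ((subset_tsupport ζ).trans (hζs.trans Metric.ball_subset_closedBall))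
  have hwc : HasCompactSupport w := hζc.smul_right
  have hwts : tsupport w ⊆ Metric.ball x₀ r := (tsupport_smul_subset_left ζ v).trans hζs
  set h : Vec d → ℝ := fun y => fderiv ℝ g y (w y) with hh
  have hhC : Continuous h :=
    (hgC.continuous_fderiv one_ne_zero).clm_apply hwC.continuous
  have hhts : ∀ y, y ∉ Metric.ball x₀ r → h y = 0 := by
    intro y hy
    have : w y = 0 := image_eq_zero_of_notMem_tsupport fun hyt => hy (hwts hyt)
    simp [hh, this]
  have hhc : HasCompactSupport h :=
    HasCompactSupport.of_support_subset_isCompact (isCompact_closedBall x₀ r) (fun y hy => by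
      by_contra hcon
      exact hy (hhts y fun hb => hcon (Metric.ball_subset_closedBall hb)))
  have hhu := hhc.uniformContinuous_of_continuous hhC
  have hh0 : ∀ y ∈ Metric.ball x₀ R, g y = 0 → h y = 0 := by
    intro y hy hgy
    simp only [hh, hw, map_smul, hzero y hy hgy, smul_zero]
  set θ := Real.smoothTransition with hθ
  have hθC : ContDiff ℝ 1 θ := Real.smoothTransition.contDiff (n := 1)
  have hθ'C : Continuous (deriv θ) := hθC.continuous_deriv le_rfl
  have hθ' : ∀ y, y ∉ Icc (0 : ℝ) 1 → deriv θ y = 0 := by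
    intro y hy
    rw [mem_Icc, not_and_or, not_le, not_le] at hy
    rcases hy with hy | hy
    · have : θ =ᶠ[𝓝 y] fun _ => 0 := by
        filter_upwards [Iio_mem_nhds hy] with z hz
        exact Real.smoothTransition.zero_of_nonpos hz.le
      rw [this.deriv_eq, deriv_const]
    · have : θ =ᶠ[𝓝 y] fun _ => 1 := by
        filter_upwards [Ioi_mem_nhds hy] with z hz
        exact Real.smoothTransition.one_of_one_le hz.le
      rw [this.deriv_eq, deriv_const]
  obtain ⟨M, hM⟩ := (isCompact_Icc (a := (0 : ℝ)) (b := 1)).exists_bound_of_continuousOn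
    hθ'C.continuousOn
  have hMnn : 0 ≤ M := (norm_nonneg _).trans (hM 0 (by simp))
  have hMall : ∀ y, |deriv θ y| ≤ M := by
    intro y
    by_cases hy : y ∈ Icc (0 : ℝ) 1
    · exact hM y hy
    · simpa [hθ' y hy] using hMnn
  -- The cut-off functions `χ n = θ(-g / ε n)`.
  set ε : ℕ → ℝ := fun n => c * r / (2 * ((n : ℝ) + 1)) with hε
  have hεpos : ∀ n, 0 < ε n := fun n => by positivity
  have hεlim : Tendsto ε atTop (𝓝 0) := by
    have h1 : Tendsto (fun n : ℕ => c * r / 2 * (1 / ((n : ℝ) + 1))) atTop (𝓝 (c * r / 2 * 0)) :=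
      tendsto_one_div_add_atTop_nhds_zero_nat.const_mul _
    rw [mul_zero] at h1
    refine h1.congr fun n => ?_
    simp only [hε]
    field_simp
  set χ : ℕ → Vec d → ℝ := fun n y => θ (-g y / ε n) with hχ
  have hχC : ∀ n, ContDiff ℝ 1 (χ n) := fun n => hθC.comp (hgC.neg.div_const _)
  have hχd : ∀ n y, fderiv ℝ (χ n) y (w y) = -(1 / ε n) * deriv θ (-g y / ε n) * h y := by
    intro n y
    have h1 : HasFDerivAt (fun y => -g y / ε n) ((-(1 / ε n)) • fderiv ℝ g y) y := by
      have := (((hgC.differentiable one_ne_zero) y).hasFDerivAt).const_mul (-(1 / ε n))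
      refine this.congr_of_eventuallyEq (Eventually.of_forall fun z => ?_)
      simp only
      ring
    have h2 := ((hθC.differentiable one_ne_zero) (-g y / ε n)).hasDerivAt.comp_hasFDerivAt y h1
    have h3 : fderiv ℝ (χ n) y = _ := h2.fderiv
    rw [h3]
    simp only [_root_.smul_apply, smul_eq_mul, hh]
    ring
  have hid : ∀ n, ∫ x, χ n x * divergence w x
      = ∫ x, 1 / ε n * deriv θ (-g x / ε n) * h x := by
    intro n
    have hcs : HasCompactSupport fun y => χ n y • w y := HasCompactSupport.smul_left (f := χ n) hwc
    have h0 : ∫ x, divergence (fun y => χ n y • w y) x = 0 :=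
      integral_divergence_of_hasCompactSupport ((hχC n).smul hwC) hcs
    have h1 : ∀ x, divergence (fun y => χ n y • w y) x
        = χ n x * divergence w x - 1 / ε n * deriv θ (-g x / ε n) * h x := by
      intro x
      rw [divergence_smul ((hχC n).differentiable one_ne_zero x) (hwC.differentiable one_ne_zero x),
        hχd]
      ring
    have hi1 : Integrable fun x => χ n x * divergence w x :=
      ((hχC n).continuous.mul (continuous_divergence hwC)).integrable_of_hasCompactSupport
        (hasCompactSupport_divergence hwc).mul_left
    have hi2 : Integrable fun x => 1 / ε n * deriv θ (-g x / ε n) * h x :=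
      (((hθ'C.comp (hgC.continuous.neg.div_const _)).const_mul _).mul
        hhC).integrable_of_hasCompactSupport hhc.mul_left
    simp_rw [h1] at h0
    rw [integral_sub hi1 hi2] at h0
    linarith
  -- The cut-off functions converge to the indicator function of `Ω`.
  have hlim1 : Tendsto (fun n => ∫ x, χ n x * divergence w x) atTop
      (𝓝 (∫ x in Ω, divergence w x)) := by
    rw [← integral_indicator hΩ.measurableSet]
    refine tendsto_integral_of_dominated_convergence (fun x => |divergence w x|) ?_ ?_ ?_ ?_
    · exact fun n => ((hχC n).continuous.mul (continuous_divergence hwC)).aestronglyMeasurable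
    · exact ((continuous_divergence hwC).integrable_of_hasCompactSupport
        (hasCompactSupport_divergence hwc)).abs
    · refine fun n => Eventually.of_forall fun x => ?_
      rw [norm_mul, Real.norm_eq_abs, Real.norm_eq_abs,
        abs_of_nonneg (Real.smoothTransition.nonneg _)]
      exact mul_le_of_le_one_left (abs_nonneg _) (Real.smoothTransition.le_one _)
    · refine Eventually.of_forall fun x => ?_
      by_cases hx : x ∈ tsupport w
      swap
      · simp [divergence_eq_zero_of_notMem_tsupport hx, indicator]
      have hxR : x ∈ Metric.ball x₀ R := Metric.ball_subset_ball (by linarith) (hwts hx)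
      by_cases hxΩ : x ∈ Ω
      · rw [indicator_of_mem hxΩ]
        have hgx := (hball x hxR).1.mp hxΩ
        refine tendsto_const_nhds.congr' ?_
        filter_upwards [hεlim.eventually_lt_const (neg_pos.mpr hgx)] with n hn
        have : χ n x = 1 := Real.smoothTransition.one_of_one_le
          ((one_le_div (hεpos n)).mpr hn.le)
        rw [this, one_mul]
      · rw [indicator_of_notMem hxΩ]
        have hgx : 0 ≤ g x := not_lt.mp fun hlt => hxΩ ((hball x hxR).1.mpr hlt)
        refine tendsto_const_nhds.congr fun n => ?_
        have : χ n x = 0 := Real.smoothTransition.zero_of_nonpos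
          (div_nonpos_of_nonpos_of_nonneg (by linarith) (hεpos n).le)
        rw [this, zero_mul]
  -- The layer where the cut-off functions vary. Its translates by multiples of `σ • e` are
  -- disjoint, since `c * σ = 2 * ε n` exceeds the oscillation of `g` on the layer.
  set A : ℕ → Set (Vec d) := fun n => {x | x ∈ Metric.ball x₀ r ∧ -ε n ≤ g x ∧ g x ≤ 0} with hA
  have hAmeas : ∀ n, MeasurableSet (A n) := fun n =>
    Metric.isOpen_ball.measurableSet.inter
      ((measurableSet_le measurable_const hgC.continuous.measurable).inter
        (measurableSet_le hgC.continuous.measurable measurable_const))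
  set V := volume.real (Metric.ball x₀ (2 * r)) with hV
  have hmul : ∀ n : ℕ, ((n : ℝ) + 1) * volume.real (A n) ≤ V := by
    intro n
    set σ : ℝ := r / ((n : ℝ) + 1) with hσ
    have hσpos : 0 < σ := by positivity
    have hsub : ∀ k ∈ Finset.range (n + 1), (fun x => ((k : ℝ) * σ) • e + x) '' A n
        ⊆ Metric.ball x₀ (2 * r) := by
      rintro k hk _ ⟨x, hx, rfl⟩
      rw [Metric.mem_ball, dist_eq_norm]
      have h1 : (k : ℝ) * σ ≤ r := by
        have h2 : (k : ℝ) ≤ (n : ℝ) + 1 := by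
          have := Finset.mem_range.mp hk
          exact_mod_cast this.le
        rw [hσ, mul_div_assoc', div_le_iff₀ (by positivity), mul_comm r]
        gcongr
      have h3 := hx.1
      rw [Metric.mem_ball, dist_eq_norm] at h3
      calc ‖((k : ℝ) * σ) • e + x - x₀‖ = ‖((k : ℝ) * σ) • e + (x - x₀)‖ := by rw [add_sub_assoc]
        _ ≤ ‖((k : ℝ) * σ) • e‖ + ‖x - x₀‖ := norm_add_le _ _
        _ < 2 * r := by
          rw [norm_smul, henorm, mul_one, Real.norm_eq_abs, abs_of_nonneg (by positivity)]
          linarith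
    have hdisj : Set.PairwiseDisjoint (↑(Finset.range (n + 1)) : Set ℕ)
        (fun k : ℕ => (fun x => ((k : ℝ) * σ) • e + x) '' A n) := by
      have key : ∀ k l : ℕ, k < l → Disjoint ((fun x => ((k : ℝ) * σ) • e + x) '' A n)
          ((fun x => ((l : ℝ) * σ) • e + x) '' A n) := by
        intro k l hkl
        rw [disjoint_left]
        rintro _ ⟨x, hx, rfl⟩ ⟨y, hy, hxy⟩
        have e1 : x = y + (((l : ℝ) - k) * σ) • e := by
          have : x = ((l : ℝ) * σ) • e + y - ((k : ℝ) * σ) • e := by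
            simp only at hxy
            rw [hxy]; abel
          rw [this, sub_mul, sub_smul]; abel
        have hlk : (1 : ℝ) ≤ (l : ℝ) - k := by
          have : (k : ℝ) + 1 ≤ l := by exact_mod_cast hkl
          linarith
        have hxR : x ∈ Metric.ball x₀ R := Metric.ball_subset_ball (by linarith) hx.1
        have hyR : y ∈ Metric.ball x₀ R := Metric.ball_subset_ball (by linarith) hy.1
        have hg1 := hgrow y (((l : ℝ) - k) * σ) (by positivity) hyR (by rw [← e1]; exact hxR)
        rw [← e1] at hg1
        have h1 := hx.2.2
        have h2 := hy.2.1
        have h3 : 2 * ε n = c * σ := by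
          simp only [hε, hσ]; field_simp
        have h4 : c * σ ≤ c * (((l : ℝ) - k) * σ) := by
          have : σ ≤ ((l : ℝ) - k) * σ := le_mul_of_one_le_left hσpos.le hlk
          gcongr
        have := hεpos n
        linarith
      intro k _ l _ hkl
      rcases lt_or_gt_of_ne hkl with h1 | h1
      · exact key k l h1
      · exact (key l k h1).symm
    have hsum := measure_biUnion_finset (μ := (volume : Measure (Vec d))) hdisj (fun k _ => by
      rw [image_add_left]
      exact (measurable_const_add _) (hAmeas n))
    have hle : volume (⋃ k ∈ Finset.range (n + 1), (fun x => ((k : ℝ) * σ) • e + x) '' A n)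
        ≤ volume (Metric.ball x₀ (2 * r)) := measure_mono (iUnion₂_subset hsub)
    rw [hsum] at hle
    simp only [image_add_left, measure_preimage_add, Finset.sum_const, Finset.card_range,
      nsmul_eq_mul] at hle
    have := ENNReal.toReal_mono (measure_ball_lt_top.ne) hle
    rw [ENNReal.toReal_mul, ENNReal.toReal_natCast] at this
    rw [hV, measureReal_def, measureReal_def]
    exact_mod_cast this
  have hlim2 : Tendsto (fun n => ∫ x, 1 / ε n * deriv θ (-g x / ε n) * h x) atTop (𝓝 0) := by
    rw [Metric.tendsto_atTop]
    intro η hη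
    set C := 2 / (c * r) * M * V + 1 with hC
    have hVnn : 0 ≤ V := measureReal_nonneg
    have hCpos : 0 < C := by positivity
    obtain ⟨δ, hδ, hδu⟩ := Metric.uniformContinuous_iff.mp hhu (η / C) (by positivity)
    obtain ⟨n₀, hn₀⟩ := (Metric.tendsto_atTop.mp hεlim) (c * min δ r) (by positivity)
    refine ⟨n₀, fun n hn => ?_⟩
    have hεn : ε n < c * min δ r := by
      have := hn₀ n hn
      rwa [Real.dist_eq, sub_zero, abs_of_pos (hεpos n)] at this
    have hsmall : ∀ x ∈ A n, |h x| ≤ η / C := by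
      intro x hx
      set s := ε n / c with hs
      have hspos : 0 < s := div_pos (hεpos n) hcpos
      have hslt : s < min δ r := by rw [hs, div_lt_iff₀ hcpos]; linarith
      have hin : ∀ t ∈ Icc 0 s, x + t • e ∈ Metric.ball x₀ R := by
        intro t ht
        rw [Metric.mem_ball, dist_eq_norm]
        have h3 := hx.1
        rw [Metric.mem_ball, dist_eq_norm] at h3
        have h4 : t < r := ht.2.trans_lt (hslt.trans_le (min_le_right _ _))
        calc ‖x + t • e - x₀‖ = ‖(x - x₀) + t • e‖ := by congr 1; abel
          _ ≤ ‖x - x₀‖ + ‖t • e‖ := norm_add_le _ _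
          _ < R := by
            rw [norm_smul, henorm, mul_one, Real.norm_eq_abs, abs_of_nonneg ht.1]
            linarith
      have h0 : x ∈ Metric.ball x₀ R := by simpa using hin 0 (by simp [hspos.le])
      have h1 := hgrow x s hspos.le h0 (hin s (by simp [hspos.le]))
      have h2 : c * s = ε n := by rw [hs]; field_simp
      have hcont' : ContinuousOn (fun t : ℝ => g (x + t • e)) (Icc 0 s) :=
        (hgC.continuous.comp (by fun_prop)).continuousOn
      obtain ⟨t, ht, hgt⟩ := intermediate_value_Icc hspos.le hcont'
        (show (0 : ℝ) ∈ Icc _ _ from ⟨by simpa using hx.2.2, by have := hx.2.1; linarith⟩)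
      have h3 := hh0 _ (hin t ht) hgt
      have h4 : dist x (x + t • e) < δ := by
        rw [dist_eq_norm]
        have : ‖x - (x + t • e)‖ = t := by
          simp [norm_smul, henorm, abs_of_nonneg ht.1]
        rw [this]
        exact ht.2.trans_lt (hslt.trans_le (min_le_left _ _))
      have h5 := hδu h4
      rw [h3, Real.dist_eq, sub_zero] at h5
      exact h5.le
    have hsupp : ∀ x, x ∉ A n → 1 / ε n * deriv θ (-g x / ε n) * h x = 0 := by
      intro x hx
      by_cases hxr : x ∈ Metric.ball x₀ r
      · have : -g x / ε n ∉ Icc (0 : ℝ) 1 := by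
          rintro ⟨h1, h2⟩
          refine hx ⟨hxr, ?_, ?_⟩
          · rw [div_le_one (hεpos n)] at h2; linarith
          · by_contra hcon
            push Not at hcon
            have := div_neg_of_neg_of_pos (neg_neg_of_pos hcon) (hεpos n)
            linarith
        rw [hθ' _ this]; ring
      · rw [hhts x hxr]; ring
    have hAfin : volume (A n) < ∞ :=
      (measure_mono fun x hx => hx.1).trans_lt (measure_ball_lt_top (x := x₀) (r := r))
    rw [← setIntegral_eq_integral_of_forall_compl_eq_zero (s := A n) (fun x hx => hsupp x hx),
      Real.dist_eq, sub_zero, ← Real.norm_eq_abs]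
    have hbound : ∀ x ∈ A n, ‖1 / ε n * deriv θ (-g x / ε n) * h x‖ ≤ 1 / ε n * M * (η / C) := by
      intro x hx
      rw [norm_mul, norm_mul, Real.norm_eq_abs, Real.norm_eq_abs, Real.norm_eq_abs,
        abs_of_pos (one_div_pos.mpr (hεpos n))]
      have := hMall (-g x / ε n)
      have := hsmall x hx
      have := hεpos n
      gcongr
    have hfinal := norm_setIntegral_le_of_norm_le_const hAfin hbound
    refine hfinal.trans_lt ?_
    have h6 : 1 / ε n * volume.real (A n) ≤ 2 / (c * r) * V := by
      have : 1 / ε n * volume.real (A n) = 2 / (c * r) * (((n : ℝ) + 1) * volume.real (A n)) := by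
        simp only [hε]; field_simp
      rw [this]
      have := hmul n
      gcongr
    calc 1 / ε n * M * (η / C) * volume.real (A n)
        = (1 / ε n * volume.real (A n)) * (M * (η / C)) := by ring
      _ ≤ 2 / (c * r) * V * (M * (η / C)) := by gcongr
      _ = (2 / (c * r) * M * V) * (η / C) := by ring
      _ < C * (η / C) := by
        have : 0 < η / C := by positivity
        have h8 : 2 / (c * r) * M * V < C := by rw [hC]; linarith
        gcongr
      _ = η := by field_simp
  have : (fun n => ∫ x, χ n x * divergence w x)
      = fun n => ∫ x, 1 / ε n * deriv θ (-g x / ε n) * h x := funext hid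
  rw [this] at hlim1
  exact tendsto_nhds_unique hlim1 hlim2

end Divergence

section DivergenceGlobal

variable {d : ℕ}

lemma integrableOn_of_isBounded {Ω : Set (Vec d)} (hb : Bornology.IsBounded Ω) {f : Vec d → ℝ}
    (hf : Continuous f) : IntegrableOn f Ω :=
  (hf.continuousOn.integrableOn_compact hb.isCompact_closure).mono_set subset_closure

/-- The divergence theorem on a bounded `C¹` domain for fields that are tangential to the
boundary: a partition of unity reduces it to fields of small support. -/
lemma integral_divergence_domain {Ω : Set (Vec d)} (hΩ : IsOpen Ω) (hb : Bornology.IsBounded Ω)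
    (hC : HasC1Boundary Ω) {v : Vec d → Vec d} (hv : ContDiff ℝ 1 v)
    (htan : ∀ x ∈ frontier Ω, ∀ n, IsOuterNormal Ω x n → inner ℝ (v x) n = 0) :
    ∫ x in Ω, divergence v x = 0 := by
  have hloc : ∀ x ∈ closure Ω, ∃ r > 0, ∀ ζ : Vec d → ℝ, ContDiff ℝ 1 ζ →
      tsupport ζ ⊆ Metric.ball x r → ∫ y in Ω, divergence (fun y => ζ y • v y) y = 0 := by
    intro x hx
    by_cases hxΩ : x ∈ Ω
    · obtain ⟨r, hr, hrs⟩ := Metric.isOpen_iff.mp hΩ x hxΩ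
      refine ⟨r, hr, fun ζ hζ hζs => ?_⟩
      have hc : HasCompactSupport ζ :=
        HasCompactSupport.of_support_subset_isCompact (isCompact_closedBall x r)
          ((subset_tsupport ζ).trans (hζs.trans Metric.ball_subset_closedBall))
      rw [setIntegral_eq_integral_of_forall_compl_eq_zero]
      · exact integral_divergence_of_hasCompactSupport (hζ.smul hv)
          (HasCompactSupport.smul_right (f := ζ) hc)
      · intro y hy
        exact divergence_eq_zero_of_notMem_tsupport fun hyt =>
          hy (hrs (hζs (tsupport_smul_subset_left ζ v hyt)))
    · obtain ⟨g, hg⟩ := hC x (by rw [hΩ.frontier_eq]; exact ⟨hx, hxΩ⟩)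
      exact exists_ball_integral_divergence_boundary hΩ hv htan hg
  choose! r hr hζ using hloc
  obtain ⟨t, htsub, htcover⟩ := hb.isCompact_closure.elim_nhds_subcover
    (fun x => Metric.ball x (r x)) fun x hx => Metric.ball_mem_nhds x (hr x hx)
  obtain ⟨f, hf⟩ := SmoothPartitionOfUnity.exists_isSubordinate (modelWithCornersSelf ℝ (Vec d))
    (s := closure Ω) isClosed_closure (fun i : t => Metric.ball (i : Vec d) (r i))
    (fun i => Metric.isOpen_ball) (by
      intro y hy
      obtain ⟨x, hx, hyx⟩ := mem_iUnion₂.mp (htcover hy)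
      exact mem_iUnion.mpr ⟨⟨x, hx⟩, hyx⟩)
  have hfC : ∀ i, ContDiff ℝ 1 (f i) := fun i =>
    ((f i).contMDiff.contDiff).of_le (by exact_mod_cast le_top)
  have hsum : ∀ x ∈ Ω, divergence v x = ∑ i, divergence (fun y => f i y • v y) x := by
    intro x hx
    have hone : ∀ y ∈ Ω, ∑ i, f i y = 1 := fun y hy => by
      rw [← finsum_eq_sum_of_fintype]
      exact f.sum_eq_one (subset_closure hy)
    have hd : ∑ i, fderiv ℝ (f i) x (v x) = 0 := by
      have h1 : HasFDerivAt (fun y => ∑ i, f i y) (∑ i, fderiv ℝ (f i) x) x :=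
        HasFDerivAt.fun_sum fun i _ => ((hfC i).differentiable one_ne_zero x).hasFDerivAt
      have h2 : HasFDerivAt (fun y => ∑ i, f i y) (0 : Vec d →L[ℝ] ℝ) x :=
        (hasFDerivAt_const (1 : ℝ) x).congr_of_eventuallyEq (by
          filter_upwards [hΩ.mem_nhds hx] with y hy using hone y hy)
      have h3 := congrArg (fun L => L (v x)) (h1.unique h2)
      simpa using h3
    have h4 : ∀ i, divergence (fun y => f i y • v y) x
        = f i x * divergence v x + fderiv ℝ (f i) x (v x) := fun i =>
      divergence_smul ((hfC i).differentiable one_ne_zero x) (hv.differentiable one_ne_zero x)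
    simp only [h4, Finset.sum_add_distrib, hd, ← Finset.sum_mul, hone x hx, one_mul, add_zero]
  rw [setIntegral_congr_fun hΩ.measurableSet hsum, integral_finsetSum]
  · refine Finset.sum_eq_zero fun i _ => ?_
    exact hζ i (htsub i i.2) _ (hfC i) (hf i)
  · exact fun i _ => integrableOn_of_isBounded hb (continuous_divergence ((hfC i).smul hv))

lemma cell_eq_preimage : cell d = WithLp.ofLp ⁻¹' Set.pi univ fun _ : Fin d => Ico (-1 : ℝ) 1 := by
  ext x
  simp [cell]

lemma measurableSet_cell : MeasurableSet (cell d) := by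
  rw [cell_eq_preimage]
  exact (MeasurableSet.univ_pi fun _ => measurableSet_Ico).preimage
    (WithLp.measurable_ofLp 2 _)

lemma isBounded_cell : Bornology.IsBounded (cell d) := by
  rw [isBounded_iff_forall_norm_le]
  refine ⟨Real.sqrt d, fun x hx => ?_⟩
  rw [EuclideanSpace.norm_eq]
  refine Real.sqrt_le_sqrt ?_
  calc ∑ i, ‖x i‖ ^ 2 ≤ ∑ _i : Fin d, (1 : ℝ) := Finset.sum_le_sum fun i _ => by
        have := hx i
        rw [Real.norm_eq_abs, sq_abs]
        nlinarith [this.1, this.2]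
    _ = d := by simp

/-- The divergence theorem on the torus: the contributions of opposite faces of the cell cancel. -/
lemma integral_divergence_cell {v : Vec d → Vec d} (hv : ContDiff ℝ 1 v)
    (hper : ∀ x i, v (x + (2 : ℝ) • basisVec i) = v x) : ∫ x in cell d, divergence v x = 0 := by
  rcases d with _ | n
  · simp [divergence]
  have h1 : ∫ x in cell (n + 1), divergence v x
      = ∫ y in Set.pi univ fun _ : Fin (n + 1) => Ico (-1 : ℝ) 1,
          divergence v (WithLp.toLp 2 y) := by
    rw [cell_eq_preimage, ← (PiLp.volume_preserving_ofLp (Fin (n + 1))).setIntegral_preimage_emb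
      (MeasurableEquiv.toLp 2 (Fin (n + 1) → ℝ)).symm.measurableEmbedding]
  rw [h1, setIntegral_congr_set (t := Icc (fun _ => (-1 : ℝ)) fun _ => 1)
    (by rw [volume_pi]; exact Measure.univ_pi_Ico_ae_eq_Icc)]
  set L : (Fin (n + 1) → ℝ) →L[ℝ] Vec (n + 1) :=
    ((EuclideanSpace.equiv (Fin (n + 1)) ℝ).symm : (Fin (n + 1) → ℝ) →L[ℝ] Vec (n + 1)) with hL
  have hdiv : ∀ y : Fin (n + 1) → ℝ, divergence v (WithLp.toLp 2 y)
      = ∑ i, ((EuclideanSpace.proj (𝕜 := ℝ) i).comp ((fderiv ℝ v (L y)).comp L))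
          (Pi.single i 1) := by
    intro y
    rfl
  simp_rw [hdiv]
  rw [integral_divergence_of_hasFDerivAt_off_countable' (fun _ => (-1 : ℝ)) (fun _ => 1)
    (fun _ => by norm_num) (fun i y => v (L y) i)
    (fun i y => (EuclideanSpace.proj (𝕜 := ℝ) i).comp
        ((fderiv ℝ v (L y)).comp L)) ∅ countable_empty]
  · refine Finset.sum_eq_zero fun i _ => ?_
    rw [sub_eq_zero]
    refine integral_congr_ae (Eventually.of_forall fun y => ?_)
    have h2 : L (i.insertNth (1 : ℝ) y) = L (i.insertNth (-1 : ℝ) y) + (2 : ℝ) • basisVec i := by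
      ext j
      rcases Fin.eq_self_or_eq_succAbove i j with rfl | ⟨k, rfl⟩
      · simp [hL, basisVec]; norm_num
      · simp [hL, basisVec]
    simp only [h2, hper]
  · exact fun i => (((EuclideanSpace.proj (𝕜 := ℝ) i).continuous.comp
      (hv.continuous.comp L.continuous))).continuousOn
  · exact fun x _ i => (EuclideanSpace.proj (𝕜 := ℝ) i).hasFDerivAt.comp x
      (((hv.differentiable one_ne_zero) (L x)).hasFDerivAt.comp x L.hasFDerivAt)
  · refine ContinuousOn.integrableOn_compact isCompact_Icc (Continuous.continuousOn ?_)
    exact (continuous_divergence hv).comp L.continuous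

lemma FlowRegion.measurableSet_interiorSet (D : FlowRegion d) : MeasurableSet D.interiorSet := by
  cases D with
  | domain Ω h _ _ _ => exact h.measurableSet
  | torus => exact measurableSet_cell

lemma FlowRegion.isBounded_interiorSet (D : FlowRegion d) :
    Bornology.IsBounded D.interiorSet := by
  cases D with
  | domain Ω _ _ h _ => exact h
  | torus => exact isBounded_cell

/-- The divergence theorem on a flow region, for a field without normal component on the
boundary. -/
theorem FlowRegion.integral_divergence_eq_zero (D : FlowRegion d) {v : Vec d → Vec d}
    (hv : ContDiff ℝ 1 v) (hper : D.IsPeriodic fun _ => v) (htan : D.IsTangential 1 fun _ => v) :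
    ∫ x, divergence v x ∂D.vol = 0 := by
  cases D with
  | domain Ω h _ hb hC =>
    exact integral_divergence_domain h hb hC hv (htan 0 (by simp))
  | torus => exact integral_divergence_cell hv (hper 0)

end DivergenceGlobal

/-! ### The dual pressure -/

section Dual

variable {a γ : ℝ}

/-- The density `r` with `P'(r) = max x 0`, for the pressure potential `P(r) = a / (γ - 1) r ^ γ`.
The convex conjugate of `P` at `x` is the pressure `a r ^ γ` of this density. -/
noncomputable def dualDensity (a γ x : ℝ) : ℝ := ((γ - 1) / (a * γ) * max x 0) ^ (1 / (γ - 1))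

lemma dualDensity_nonneg (ha : 0 < a) (hγ : 1 < γ) (x : ℝ) : 0 ≤ dualDensity a γ x := by
  have : 0 < γ - 1 := by linarith
  unfold dualDensity
  positivity

lemma dualDensity_of_nonpos (hγ : 1 < γ) {x : ℝ} (hx : x ≤ 0) : dualDensity a γ x = 0 := by
  unfold dualDensity
  rw [max_eq_right hx, mul_zero, Real.zero_rpow]
  have : 0 < γ - 1 := by linarith
  positivity

lemma continuous_dualDensity (hγ : 1 < γ) : Continuous (dualDensity a γ) := by
  have : 0 < γ - 1 := by linarith
  unfold dualDensity
  exact (by fun_prop : Continuous fun x : ℝ => (γ - 1) / (a * γ) * max x 0).rpow_const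
    fun _ => Or.inr (by positivity)

lemma dualDensity_rpow_sub_one (ha : 0 < a) (hγ : 1 < γ) (x : ℝ) :
    a * γ * dualDensity a γ x ^ (γ - 1) = (γ - 1) * max x 0 := by
  have h1 : 0 < γ - 1 := by linarith
  unfold dualDensity
  rw [← Real.rpow_mul (by positivity), one_div_mul_cancel h1.ne', Real.rpow_one]
  field_simp

lemma dualDensity_mul_self (ha : 0 < a) (hγ : 1 < γ) (x : ℝ) :
    dualDensity a γ x * x = γ / (γ - 1) * (a * dualDensity a γ x ^ γ) := by
  have h1 : 0 < γ - 1 := by linarith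
  rcases le_or_gt x 0 with hx | hx
  · rw [dualDensity_of_nonpos hγ hx, Real.zero_rpow (by linarith)]
    ring
  · have hpos : 0 < dualDensity a γ x := by
      unfold dualDensity
      rw [max_eq_left hx.le]
      positivity
    have h2 := dualDensity_rpow_sub_one ha hγ x
    rw [max_eq_left hx.le] at h2
    have h3 : dualDensity a γ x ^ γ = dualDensity a γ x ^ (γ - 1) * dualDensity a γ x := by
      rw [← Real.rpow_add_one hpos.ne', sub_add_cancel]
    rw [h3, div_mul_eq_mul_div, eq_div_iff h1.ne']
    linear_combination (-dualDensity a γ x) * h2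

/-- The Fenchel inequality for the pressure potential. -/
lemma mul_le_potential_add_dualPressure (ha : 0 < a) (hγ : 1 < γ) {r : ℝ} (hr : 0 ≤ r) (x : ℝ) :
    r * x ≤ 1 / (γ - 1) * (a * r ^ γ) + a * dualDensity a γ x ^ γ := by
  have h1 : 0 < γ - 1 := by linarith
  have h2 := rpow_tangent_le hγ hr (dualDensity_nonneg ha hγ x)
  have h3 := dualDensity_rpow_sub_one ha hγ x
  have h4 : (γ - 1) * max x 0 * r ≤ a * r ^ γ + (γ - 1) * (a * dualDensity a γ x ^ γ) := by
    rw [← h3]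
    nlinarith
  have h5 : r * x ≤ r * max x 0 := by gcongr; exact le_max_left _ _
  have h6 : r * max x 0
      ≤ (a * r ^ γ + (γ - 1) * (a * dualDensity a γ x ^ γ)) / (γ - 1) := by
    rw [le_div_iff₀ h1]
    linarith
  refine h5.trans (h6.trans_eq ?_)
  field_simp

lemma hasDerivAt_dualPressure (ha : 0 < a) (hγ : 1 < γ) (x : ℝ) :
    HasDerivAt (fun x => a * dualDensity a γ x ^ γ) (dualDensity a γ x) x := by
  have h1 : 0 < γ - 1 := by linarith
  have hpos : ∀ y : ℝ, 0 < y → HasDerivAt (fun x => a * dualDensity a γ x ^ γ)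
      (dualDensity a γ y) y := by
    intro y hy
    have hc : 0 < (γ - 1) / (a * γ) := by positivity
    have h2 : HasDerivAt (fun x : ℝ => a * ((γ - 1) / (a * γ) * x) ^ (γ / (γ - 1)))
        (a * ((γ - 1) / (a * γ) * 1 * (γ / (γ - 1)) * ((γ - 1) / (a * γ) * y) ^ (γ / (γ - 1) - 1)))
        y :=
      (((hasDerivAt_id y).const_mul _).rpow_const (Or.inl (mul_pos hc hy).ne')).const_mul a
    have h3 : a * ((γ - 1) / (a * γ) * 1 * (γ / (γ - 1))
        * ((γ - 1) / (a * γ) * y) ^ (γ / (γ - 1) - 1)) = dualDensity a γ y := by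
      have h4 : γ / (γ - 1) - 1 = 1 / (γ - 1) := by field_simp; ring
      unfold dualDensity
      rw [h4, max_eq_left hy.le]
      field_simp
    rw [h3] at h2
    refine h2.congr_of_eventuallyEq ?_
    filter_upwards [lt_mem_nhds hy] with z hz
    unfold dualDensity
    rw [max_eq_left hz.le, ← Real.rpow_mul (by positivity)]
    congr 2
    ring
  have hneg : ∀ y : ℝ, y < 0 → HasDerivAt (fun x => a * dualDensity a γ x ^ γ)
      (dualDensity a γ y) y := by
    intro y hy
    rw [dualDensity_of_nonpos hγ hy.le]
    refine (hasDerivAt_const y (0 : ℝ)).congr_of_eventuallyEq ?_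
    filter_upwards [Iio_mem_nhds hy] with z hz
    rw [dualDensity_of_nonpos hγ (le_of_lt hz), Real.zero_rpow (by linarith), mul_zero]
  rcases lt_trichotomy x 0 with h | h | h
  · exact hneg x h
  · subst h
    refine hasDerivAt_of_hasDerivAt_of_ne (fun y hy => ?_) ?_
        (continuous_dualDensity hγ).continuousAt
    · rcases lt_or_gt_of_ne hy with h | h
      · exact hneg y h
      · exact hpos y h
    · exact (((continuous_dualDensity hγ).rpow_const fun _ => Or.inr (by linarith)).const_mul
        a).continuousAt
  · exact hpos x h

lemma contDiff_dualPressure (ha : 0 < a) (hγ : 1 < γ) :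
    ContDiff ℝ 1 fun x => a * dualDensity a γ x ^ γ := by
  rw [contDiff_one_iff_deriv]
  refine ⟨fun x => (hasDerivAt_dualPressure ha hγ x).differentiableAt, ?_⟩
  rw [funext fun x => (hasDerivAt_dualPressure ha hγ x).deriv]
  exact continuous_dualDensity hγ

end Dual

/-! ### Space-time and the constraints on relaxed states -/

section Slices

variable {d : ℕ} {F : Type} [NormedAddCommGroup F] [NormedSpace ℝ F] {φ : ℝ → Vec d → F}

lemma hasDerivAt_timeSlice (hφ : ContDiff ℝ 1 fun z : ℝ × Vec d => φ z.1 z.2) (t : ℝ) (x : Vec d) :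
    HasDerivAt (fun s => φ s x) (fderiv ℝ (fun z : ℝ × Vec d => φ z.1 z.2) (t, x) (1, 0)) t := by
  have h := (hφ.differentiable one_ne_zero (t, x)).hasFDerivAt
  exact h.comp_hasDerivAt (f := fun s : ℝ => (s, x)) t
    ((hasDerivAt_id t).prodMk (hasDerivAt_const t x))

lemma hasFDerivAt_spaceSlice (hφ : ContDiff ℝ 1 fun z : ℝ × Vec d => φ z.1 z.2) (t : ℝ)
    (x : Vec d) : HasFDerivAt (φ t) ((fderiv ℝ (fun z : ℝ × Vec d => φ z.1 z.2) (t, x)).comp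
      (ContinuousLinearMap.inr ℝ ℝ (Vec d))) x := by
  have h := (hφ.differentiable one_ne_zero (t, x)).hasFDerivAt
  exact h.comp (f := fun y : Vec d => (t, y)) x (hasFDerivAt_prodMk_right t x)

lemma contDiff_spaceSlice (hφ : ContDiff ℝ 1 fun z : ℝ × Vec d => φ z.1 z.2) (t : ℝ) :
    ContDiff ℝ 1 (φ t) :=
  hφ.comp (contDiff_const.prodMk contDiff_id)

lemma contDiff_timeSlice (hφ : ContDiff ℝ 1 fun z : ℝ × Vec d => φ z.1 z.2) (x : Vec d) :
    ContDiff ℝ 1 fun s => φ s x :=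
  hφ.comp (contDiff_id.prodMk contDiff_const)

lemma continuous_deriv_timeSlice (hφ : ContDiff ℝ 1 fun z : ℝ × Vec d => φ z.1 z.2) :
    Continuous fun z : ℝ × Vec d => deriv (fun s => φ s z.2) z.1 := by
  have : (fun z : ℝ × Vec d => deriv (fun s => φ s z.2) z.1)
      = fun z => fderiv ℝ (fun z : ℝ × Vec d => φ z.1 z.2) z (1, 0) :=
    funext fun z => (hasDerivAt_timeSlice hφ z.1 z.2).deriv
  rw [this]
  exact (hφ.continuous_fderiv one_ne_zero).clm_apply continuous_const

lemma continuous_fderiv_spaceSlice (hφ : ContDiff ℝ 1 fun z : ℝ × Vec d => φ z.1 z.2) (v : Vec d) :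
    Continuous fun z : ℝ × Vec d => fderiv ℝ (φ z.1) z.2 v := by
  have : (fun z : ℝ × Vec d => fderiv ℝ (φ z.1) z.2 v)
      = fun z => fderiv ℝ (fun z : ℝ × Vec d => φ z.1 z.2) z (0, v) :=
    funext fun z => by rw [(hasFDerivAt_spaceSlice hφ z.1 z.2).fderiv]; simp
  rw [this]
  exact (hφ.continuous_fderiv one_ne_zero).clm_apply continuous_const

lemma gradient_apply_coord (f : Vec d → ℝ) (x : Vec d) (i : Fin d) :
    gradient f x i = fderiv ℝ f x (basisVec i) := by
  rw [← inner_gradient_left, basisVec, EuclideanSpace.inner_single_right]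
  simp

lemma continuous_gradient_spaceSlice {φ : ℝ → Vec d → ℝ}
    (hφ : ContDiff ℝ 1 fun z : ℝ × Vec d => φ z.1 z.2) (i : Fin d) :
    Continuous fun z : ℝ × Vec d => gradient (φ z.1) z.2 i := by
  simp only [gradient_apply_coord]
  exact continuous_fderiv_spaceSlice hφ _

lemma continuous_partialD_spaceSlice {φ : ℝ → Vec d → Vec d}
    (hφ : ContDiff ℝ 1 fun z : ℝ × Vec d => φ z.1 z.2) (i j : Fin d) :
    Continuous fun z : ℝ × Vec d => partialD (φ z.1) z.2 i j :=
  (EuclideanSpace.proj (𝕜 := ℝ) i).continuous.comp (continuous_fderiv_spaceSlice hφ _)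

lemma continuous_divergence_spaceSlice {φ : ℝ → Vec d → Vec d}
    (hφ : ContDiff ℝ 1 fun z : ℝ × Vec d => φ z.1 z.2) :
    Continuous fun z : ℝ × Vec d => divergence (φ z.1) z.2 :=
  continuous_finsetSum _ fun i _ => continuous_partialD_spaceSlice hφ i i

end Slices

section Constraints

variable {d : ℕ}

/-- The closure of the region, a compact set. On the torus it is the closed cube. -/
def FlowRegion.closedRegion (D : FlowRegion d) : Set (Vec d) := closure D.interiorSet

/-- The closed space-time cylinder `[0,T] × Ω̄`. -/
def FlowRegion.cylinder (D : FlowRegion d) (T : ℝ) : Set (ℝ × Vec d) := Icc 0 T ×ˢ D.closedRegion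

/-- Lebesgue measure on `(0,T) × Ω`. -/
noncomputable def FlowRegion.spaceTime (D : FlowRegion d) (T : ℝ) : Measure (ℝ × Vec d) :=
  (volume.restrict (Ioo 0 T)).prod D.vol

lemma FlowRegion.isCompact_closedRegion (D : FlowRegion d) : IsCompact D.closedRegion :=
  D.isBounded_interiorSet.isCompact_closure

lemma FlowRegion.isCompact_cylinder (D : FlowRegion d) (T : ℝ) : IsCompact (D.cylinder T) :=
  isCompact_Icc.prod D.isCompact_closedRegion

instance (D : FlowRegion d) : IsFiniteMeasure D.vol := by
  constructor
  rw [FlowRegion.vol, Measure.restrict_apply_univ]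
  exact D.isBounded_interiorSet.measure_lt_top

instance (D : FlowRegion d) (T : ℝ) : IsFiniteMeasure (D.spaceTime T) := by
  unfold FlowRegion.spaceTime
  infer_instance

lemma FlowRegion.ae_mem_interiorSet (D : FlowRegion d) : ∀ᵐ x ∂D.vol, x ∈ D.interiorSet :=
  ae_restrict_mem D.measurableSet_interiorSet

lemma FlowRegion.vol_compl (D : FlowRegion d) : D.vol D.closedRegionᶜ = 0 := by
  rw [← mem_ae_iff]
  filter_upwards [D.ae_mem_interiorSet] with x hx using subset_closure hx

lemma FlowRegion.spaceTime_eq (D : FlowRegion d) (T : ℝ) :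
    D.spaceTime T = (volume : Measure (ℝ × Vec d)).restrict (Ioo 0 T ×ˢ D.interiorSet) := by
  unfold FlowRegion.spaceTime FlowRegion.vol
  rw [Measure.prod_restrict]
  rfl

lemma FlowRegion.spaceTime_compl (D : FlowRegion d) (T : ℝ) :
    D.spaceTime T (D.cylinder T)ᶜ = 0 := by
  rw [D.spaceTime_eq, ← mem_ae_iff]
  filter_upwards [ae_restrict_mem (measurableSet_Ioo.prod D.measurableSet_interiorSet)] with z hz
  exact ⟨Ioo_subset_Icc_self hz.1, subset_closure hz.2⟩

/-- A test for the constraints: test functions for the continuity and the momentum equation and a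
nonnegative weight of time for the energy inequality. -/
structure ConstraintTest (D : FlowRegion d) (T : ℝ) where
  φ : ℝ → Vec d → ℝ
  Φ : ℝ → Vec d → Vec d
  w : ℝ → ℝ
  scalar : IsScalarTest D T φ
  vector : IsVectorTest D T Φ
  contDiff_w : ContDiff ℝ 1 w
  w_nonneg : ∀ t ∈ Icc 0 T, 0 ≤ w t

namespace ConstraintTest

variable {D : FlowRegion d} {T : ℝ}

/-- The function against which a test integrates an entry of the block matrix. The momentum is
read off from the entries `(none, some i)`. -/
noncomputable def blockFun (τ : ConstraintTest D T) :
    Option (Fin d) → Option (Fin d) → ℝ × Vec d → ℝ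
  | none, none, z => deriv (fun s => τ.φ s z.2) z.1
  | none, some i, z => gradient (τ.φ z.1) z.2 i + deriv (fun s => τ.Φ s z.2) z.1 i
  | some _, none, _ => 0
  | some i, some j, z => partialD (τ.Φ z.1) z.2 i j - if i = j then deriv τ.w z.1 / 2 else 0

/-- The function against which a test integrates the pressure component. -/
noncomputable def pressureFun (γ : ℝ) (τ : ConstraintTest D T) (z : ℝ × Vec d) : ℝ :=
  divergence (τ.Φ z.1) z.2 - deriv τ.w z.1 / (γ - 1)

lemma continuous_deriv_w (τ : ConstraintTest D T) :
    Continuous fun z : ℝ × Vec d => deriv τ.w z.1 :=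
  (τ.contDiff_w.continuous_deriv le_rfl).comp continuous_fst

lemma continuous_blockFun (τ : ConstraintTest D T) (i j : Option (Fin d)) :
    Continuous (τ.blockFun i j) := by
  rcases i with _ | i <;> rcases j with _ | j
  · exact continuous_deriv_timeSlice τ.scalar.1
  · exact (continuous_gradient_spaceSlice τ.scalar.1 j).add
      ((EuclideanSpace.proj (𝕜 := ℝ) j).continuous.comp (continuous_deriv_timeSlice τ.vector.1))
  · exact continuous_const
  · refine (continuous_partialD_spaceSlice τ.vector.1 i j).sub ?_
    split_ifs
    · exact τ.continuous_deriv_w.div_const _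
    · exact continuous_const

lemma continuous_pressureFun (γ : ℝ) (τ : ConstraintTest D T) : Continuous (τ.pressureFun γ) :=
  (continuous_divergence_spaceSlice τ.vector.1).sub (τ.continuous_deriv_w.div_const _)

/-- The contribution of the initial data to a constraint. -/
noncomputable def initial (a γ : ℝ) (ρ₀ : Vec d → ℝ) (m₀ : Vec d → Vec d)
    (τ : ConstraintTest D T) : ℝ :=
  (∫ x, ρ₀ x * τ.φ 0 x ∂D.vol) + (∫ x, inner ℝ (m₀ x) (τ.Φ 0 x) ∂D.vol)
    - τ.w 0 * (initialEnergy D a γ ρ₀ m₀).toReal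

/-- The constraints on a relaxed state are that these affine functionals are nonpositive. For
`w = 0` this amounts to the weak formulations of the continuity and the momentum equation, as the
test functions can be replaced by their negatives; for `φ = 0` and `Φ = 0` it is the energy
inequality. -/
noncomputable def residual (a γ : ℝ) (ρ₀ : Vec d → ℝ) (m₀ : Vec d → Vec d)
    (τ : ConstraintTest D T) (S : RelaxedState (ℝ × Vec d) d) : ℝ :=
  ∑ i, ∑ j, S.1 i j ⟨τ.blockFun i j, τ.continuous_blockFun i j⟩
    + S.2 ⟨τ.pressureFun γ, τ.continuous_pressureFun γ⟩ + τ.initial a γ ρ₀ m₀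

end ConstraintTest

end Constraints

/-! ### Finite energy -/

/-- The energy density as a real number; see `energyDensity_eq_ofReal`. -/
noncomputable def realEnergy {d : ℕ} (a γ r : ℝ) (v : Vec d) : ℝ :=
  1 / 2 * ∑ i, v i * v i / r + 1 / (γ - 1) * (a * r ^ γ)

lemma sum_mul_self_div {d : ℕ} (v : Vec d) (r : ℝ) : ∑ i, v i * v i / r = ‖v‖ ^ 2 / r := by
  rw [← Finset.sum_div, EuclideanSpace.real_norm_sq_eq]
  simp [sq]

lemma realEnergy_nonneg {d : ℕ} {a γ r : ℝ} (ha : 0 < a) (hγ : 1 < γ) (hr : 0 ≤ r) (v : Vec d) :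
    0 ≤ realEnergy a γ r v := by
  have : 0 < γ - 1 := by linarith
  unfold realEnergy
  rw [sum_mul_self_div]
  positivity

lemma abs_coord_le_norm {d : ℕ} (v : Vec d) (i : Fin d) : |v i| ≤ ‖v‖ := by
  simpa using PiLp.norm_apply_le v i

/-- Young's inequality for the total energy. -/
lemma young_energy {d : ℕ} {a γ r b : ℝ} {v : Vec d} (ha : 0 < a) (hγ : 1 < γ) (hr : 0 ≤ r)
    (h : r = 0 → v = 0) (hb : 0 < b) (x : ℝ) (y : Vec d) :
    r * x + inner ℝ v y ≤ b * (realEnergy a γ r v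
      + a * dualDensity a γ (x / b + ‖y‖ ^ 2 / (2 * b ^ 2)) ^ γ) := by
  have h1 := mul_le_potential_add_dualPressure ha hγ hr (x / b + ‖y‖ ^ 2 / (2 * b ^ 2))
  have h2 : inner ℝ v y ≤ b * (1 / 2 * (‖v‖ ^ 2 / r)) + r * (‖y‖ ^ 2 / (2 * b)) := by
    rcases hr.eq_or_lt with h0 | h0
    · rw [h h0.symm, ← h0]; simp
    · refine (real_inner_le_norm v y).trans ?_
      have h3 : b * (1 / 2 * (‖v‖ ^ 2 / r)) + r * (‖y‖ ^ 2 / (2 * b)) - ‖v‖ * ‖y‖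
          = (b * ‖v‖ - r * ‖y‖) ^ 2 / (2 * b * r) := by
        field_simp
        ring
      have : 0 ≤ (b * ‖v‖ - r * ‖y‖) ^ 2 / (2 * b * r) := by positivity
      linarith
  have h4 : b * (r * (x / b + ‖y‖ ^ 2 / (2 * b ^ 2))) = r * x + r * (‖y‖ ^ 2 / (2 * b)) := by
    field_simp
  have h5 := mul_le_mul_of_nonneg_left h1 hb.le
  rw [h4] at h5
  unfold realEnergy
  rw [sum_mul_self_div]
  linarith

section FiniteEnergy

variable {X : Type} [MeasurableSpace X] {d : ℕ} {lam : Measure X} {a γ : ℝ} {ρ : X → ℝ}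
  {m : X → Vec d}

lemma IsFlow.ae_energyDensity_eq (ha : 0 < a) (hγ : 1 < γ) (h : IsFlow lam γ ρ m) :
    ∀ᵐ z ∂lam, energyDensity a γ (ρ z) (m z) = ENNReal.ofReal (realEnergy a γ (ρ z) (m z)) := by
  filter_upwards [h.nonneg, h.eq_zero] with z h1 h2
  exact energyDensity_eq_ofReal ha hγ h1 h2

lemma IsFlow.integrable_realEnergy (a : ℝ) (h : IsFlow lam γ ρ m) :
    Integrable (fun z => realEnergy a γ (ρ z) (m z)) lam :=
  ((integrable_finsetSum _ fun i _ => h.integrable_flux i i).const_mul _).add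
    ((h.integrable_pressure.const_mul a).const_mul _)

lemma IsFlow.lintegral_energyDensity (ha : 0 < a) (hγ : 1 < γ) (h : IsFlow lam γ ρ m) :
    ∫⁻ z, energyDensity a γ (ρ z) (m z) ∂lam
      = ENNReal.ofReal (∫ z, realEnergy a γ (ρ z) (m z) ∂lam) := by
  rw [lintegral_congr_ae (h.ae_energyDensity_eq ha hγ),
    ofReal_integral_eq_lintegral_ofReal (h.integrable_realEnergy a)]
  filter_upwards [h.nonneg] with z hz using realEnergy_nonneg ha hγ hz _

/-- Finite energy implies the integrability of the density, the momentum and the flux. -/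
lemma isFlow_of_lintegral_energyDensity [IsFiniteMeasure lam] (ha : 0 < a) (hγ : 1 < γ)
    (hρ : AEStronglyMeasurable ρ lam) (hm : AEStronglyMeasurable m lam)
    (hnn : ∀ᵐ z ∂lam, 0 ≤ ρ z) (hE : ∫⁻ z, energyDensity a γ (ρ z) (m z) ∂lam < ∞) :
    IsFlow lam γ ρ m := by
  have hγ1 : 0 < γ - 1 := by linarith
  have hmi : ∀ i, AEStronglyMeasurable (fun z => m z i) lam := fun i =>
    (EuclideanSpace.proj (𝕜 := ℝ) i).continuous.comp_aestronglyMeasurable hm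
  have hmeas : AEMeasurable (fun z => energyDensity a γ (ρ z) (m z)) lam := by
    unfold energyDensity pressurePotential
    have h1 := hρ.aemeasurable
    have h2 := hm.norm.aemeasurable
    fun_prop
  have hz : ∀ᵐ z ∂lam, ρ z = 0 → m z = 0 := by
    filter_upwards [ae_lt_top' hmeas hE.ne] with z hz h0
    by_contra hne
    refine hz.ne ?_
    have : 0 < ‖m z‖ := norm_pos_iff.mpr hne
    unfold energyDensity
    rw [h0, ENNReal.ofReal_zero, ENNReal.div_zero, top_add]
    simp only [ne_eq, ENNReal.ofReal_eq_zero, not_le]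
    positivity
  have hEr : Integrable (fun z => realEnergy a γ (ρ z) (m z)) lam := by
    have hb : AEStronglyMeasurable (fun z => realEnergy a γ (ρ z) (m z)) lam := by
      unfold realEnergy
      have h1 := hρ.aemeasurable
      have h2 := fun i => (hmi i).aemeasurable
      exact AEMeasurable.aestronglyMeasurable (by fun_prop)
    refine ⟨hb, ?_⟩
    rw [hasFiniteIntegral_iff_ofReal]
    · refine lt_of_eq_of_lt (lintegral_congr_ae ?_) hE
      filter_upwards [hnn, hz] with z h1 h2
      exact (energyDensity_eq_ofReal ha hγ h1 h2).symm
    · filter_upwards [hnn] with z h1 using realEnergy_nonneg ha hγ h1 _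
  have hp : Integrable (fun z => ρ z ^ γ) lam := by
    refine (hEr.const_mul ((γ - 1) / a)).mono'
      (hρ.aemeasurable.pow_const γ).aestronglyMeasurable ?_
    filter_upwards [hnn] with z h1
    rw [Real.norm_of_nonneg (by positivity)]
    unfold realEnergy
    rw [sum_mul_self_div]
    have : (γ - 1) / a * (1 / 2 * (‖m z‖ ^ 2 / ρ z) + 1 / (γ - 1) * (a * ρ z ^ γ))
        = (γ - 1) / a * (1 / 2 * (‖m z‖ ^ 2 / ρ z)) + ρ z ^ γ := by
      field_simp
    rw [this]
    have : 0 ≤ (γ - 1) / a * (1 / 2 * (‖m z‖ ^ 2 / ρ z)) := by positivity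
    linarith
  have hd : Integrable ρ lam := by
    refine ((integrable_const (1 : ℝ)).add hp).mono' hρ ?_
    filter_upwards [hnn] with z h1
    rw [Real.norm_of_nonneg h1]
    simp only [Pi.add_apply]
    rcases le_total (ρ z) 1 with h2 | h2
    · have : 0 ≤ ρ z ^ γ := by positivity
      linarith
    · have : ρ z ^ (1 : ℝ) ≤ ρ z ^ γ := Real.rpow_le_rpow_of_exponent_le h2 hγ.le
      rw [Real.rpow_one] at this
      linarith
  have hk : ∀ᵐ z ∂lam, ‖m z‖ ^ 2 / ρ z ≤ 2 * realEnergy a γ (ρ z) (m z) := by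
    filter_upwards [hnn] with z h1
    unfold realEnergy
    rw [sum_mul_self_div]
    have : 0 ≤ 1 / (γ - 1) * (a * ρ z ^ γ) := by positivity
    linarith
  refine ⟨hnn, hz, hd, fun i => ?_, fun i j => ?_, hp⟩
  · refine (hd.add (hEr.const_mul 2)).mono' (hmi i) ?_
    filter_upwards [hnn, hz, hk] with z h1 h2 h3
    simp only [Pi.add_apply]
    refine (abs_coord_le_norm _ _).trans (le_trans ?_ (add_le_add le_rfl h3))
    rcases h1.eq_or_lt with h0 | h0
    · rw [h2 h0.symm, ← h0]; simp
    · have : ρ z + ‖m z‖ ^ 2 / ρ z - ‖m z‖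
          = ((ρ z - ‖m z‖ / 2) ^ 2 + 3 / 4 * ‖m z‖ ^ 2) / ρ z := by
        field_simp; ring
      have : 0 ≤ ((ρ z - ‖m z‖ / 2) ^ 2 + 3 / 4 * ‖m z‖ ^ 2) / ρ z := by positivity
      linarith
  · refine (hEr.const_mul 2).mono' ?_ ?_
    · have h1 := hρ.aemeasurable
      have h2 := fun i => (hmi i).aemeasurable
      exact AEMeasurable.aestronglyMeasurable (by fun_prop)
    · filter_upwards [hnn, hk] with z h1 h3
      refine le_trans ?_ h3
      rw [norm_div, norm_mul, Real.norm_of_nonneg h1, sq]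
      have h4 := abs_coord_le_norm (m z) i
      have h5 := abs_coord_le_norm (m z) j
      simp only [Real.norm_eq_abs]
      gcongr

end FiniteEnergy

section Data

variable {d : ℕ} {D : FlowRegion d} {a γ : ℝ} {ρ₀ : Vec d → ℝ} {m₀ : Vec d → Vec d}

lemma IsFiniteEnergyData.isFlow (ha : 0 < a) (hγ : 1 < γ) (h : IsFiniteEnergyData D a γ ρ₀ m₀) :
    IsFlow D.vol γ ρ₀ m₀ :=
  isFlow_of_lintegral_energyDensity ha hγ h.memLp_density.1 h.memLp_momentum.1 h.nonneg
    h.energy_lt_top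

lemma IsFiniteEnergyData.initialEnergy_toReal (ha : 0 < a) (hγ : 1 < γ)
    (h : IsFiniteEnergyData D a γ ρ₀ m₀) :
    (initialEnergy D a γ ρ₀ m₀).toReal = ∫ x, realEnergy a γ (ρ₀ x) (m₀ x) ∂D.vol := by
  unfold initialEnergy
  rw [(h.isFlow ha hγ).lintegral_energyDensity ha hγ, ENNReal.toReal_ofReal]
  exact integral_nonneg_of_ae (by
    filter_upwards [h.nonneg] with x hx using realEnergy_nonneg ha hγ hx _)

end Data

/-! ### The dual candidate -/

section DualCandidate

variable {d : ℕ} {D : FlowRegion d} {T : ℝ}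

lemma IsFlow.integrable_density_mul {γ : ℝ} {ρ : Vec d → ℝ} {m : Vec d → Vec d}
    (h : IsFlow D.vol γ ρ m) {f : Vec d → ℝ} (hf : Continuous f) :
    Integrable (fun x => ρ x * f x) D.vol :=
  (integrable_continuousMap_mul D.isCompact_closedRegion D.vol_compl ⟨f, hf⟩
    h.integrable_density).congr (Eventually.of_forall fun _ => mul_comm _ _)

lemma IsFlow.integrable_inner {γ : ℝ} {ρ : Vec d → ℝ} {m : Vec d → Vec d}
    (h : IsFlow D.vol γ ρ m) {f : Vec d → Vec d} (hf : Continuous f) :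
    Integrable (fun x => (inner ℝ (m x) (f x) : ℝ)) D.vol := by
  simp only [PiLp.inner_apply]
  refine integrable_finsetSum _ fun i _ => ?_
  exact (integrable_continuousMap_mul D.isCompact_closedRegion D.vol_compl
    ⟨fun x => f x i, (EuclideanSpace.proj (𝕜 := ℝ) i).continuous.comp hf⟩
    (h.integrable_momentum i)).congr (Eventually.of_forall fun x => by
      simp only [RCLike.inner_apply, conj_trivial]
      rfl)

namespace ConstraintTest

/-- The variable dual to the density, for a test with positive weight. -/
noncomputable def dualVar (τ : ConstraintTest D T) (z : ℝ × Vec d) : ℝ :=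
  τ.φ z.1 z.2 / τ.w z.1 + ‖τ.Φ z.1 z.2‖ ^ 2 / (2 * τ.w z.1 ^ 2)

/-- The density `ϱ` at which `w E(ϱ, m) - ϱ φ - m · Φ` is minimal, for the energy density `E`. -/
noncomputable def dualRho (a γ : ℝ) (τ : ConstraintTest D T) (z : ℝ × Vec d) : ℝ :=
  dualDensity a γ (τ.dualVar z)

/-- The momentum `m` at which `w E(ϱ, m) - ϱ φ - m · Φ` is minimal. -/
noncomputable def dualMomentum (a γ : ℝ) (τ : ConstraintTest D T) (z : ℝ × Vec d) : Vec d :=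
  (τ.dualRho a γ z / τ.w z.1) • τ.Φ z.1 z.2

/-- The pressure of the dual density. -/
noncomputable def dualPressure (a γ : ℝ) (τ : ConstraintTest D T) (z : ℝ × Vec d) : ℝ :=
  a * τ.dualRho a γ z ^ γ

variable {a γ : ℝ} {τ : ConstraintTest D T}

lemma contDiff_dualVar (hw : ∀ t, 0 < τ.w t) : ContDiff ℝ 1 τ.dualVar := by
  have h1 : ContDiff ℝ 1 fun z : ℝ × Vec d => τ.w z.1 := τ.contDiff_w.comp contDiff_fst
  exact (τ.scalar.1.div h1 fun z => (hw _).ne').add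
    ((τ.vector.1.norm_sq ℝ).div (contDiff_const.mul (h1.pow 2))
      fun z => by have := hw z.1; positivity)

lemma contDiff_dualPressure (ha : 0 < a) (hγ : 1 < γ) (hw : ∀ t, 0 < τ.w t) :
    ContDiff ℝ 1 (τ.dualPressure a γ) :=
  (EulerDiss.contDiff_dualPressure ha hγ).comp (contDiff_dualVar hw)

lemma continuous_dualRho (hγ : 1 < γ) (hw : ∀ t, 0 < τ.w t) : Continuous (τ.dualRho a γ) :=
  (continuous_dualDensity hγ).comp (contDiff_dualVar hw).continuous

lemma continuous_dualMomentum (hγ : 1 < γ) (hw : ∀ t, 0 < τ.w t) :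
    Continuous (τ.dualMomentum a γ) :=
  ((continuous_dualRho hγ hw).div (τ.contDiff_w.continuous.comp continuous_fst)
    fun z => (hw z.1).ne').smul τ.vector.1.continuous

lemma dualMomentum_mul_div (τ : ConstraintTest D T) (z : ℝ × Vec d) (i j : Fin d) :
    τ.dualMomentum a γ z i * τ.dualMomentum a γ z j / τ.dualRho a γ z
      = τ.dualRho a γ z * (τ.Φ z.1 z.2 i / τ.w z.1) * (τ.Φ z.1 z.2 j / τ.w z.1) := by
  simp only [dualMomentum, PiLp.smul_apply, smul_eq_mul]
  by_cases h : τ.dualRho a γ z = 0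
  · simp [h]
  · field_simp

lemma integrable_of_continuous {f : ℝ × Vec d → ℝ} (hf : Continuous f) :
    Integrable f (D.spaceTime T) :=
  integrable_continuousMap (D.isCompact_cylinder T) (D.spaceTime_compl T) ⟨f, hf⟩

lemma isFlow_dual (ha : 0 < a) (hγ : 1 < γ) (hw : ∀ t, 0 < τ.w t) :
    IsFlow (D.spaceTime T) γ (τ.dualRho a γ) (τ.dualMomentum a γ) := by
  have hρ := continuous_dualRho (a := a) hγ hw
  have hΦ := fun i => (EuclideanSpace.proj (𝕜 := ℝ) i).continuous.comp τ.vector.1.continuous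
  have hwc : Continuous fun z : ℝ × Vec d => τ.w z.1 := τ.contDiff_w.continuous.comp continuous_fst
  have hc : ∀ i, Continuous fun z : ℝ × Vec d => τ.Φ z.1 z.2 i / τ.w z.1 :=
    fun i => (hΦ i).div hwc fun z => (hw z.1).ne'
  refine ⟨Eventually.of_forall fun z => dualDensity_nonneg ha hγ _,
    Eventually.of_forall fun z hz => by simp [dualMomentum, hz], integrable_of_continuous hρ,
    fun i => integrable_of_continuous ((EuclideanSpace.proj (𝕜 := ℝ) i).continuous.comp
      (continuous_dualMomentum hγ hw)), fun i j => ?_,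
    integrable_of_continuous (hρ.rpow_const fun _ => Or.inr (by linarith))⟩
  simp only [dualMomentum_mul_div]
  exact integrable_of_continuous ((hρ.mul (hc i)).mul (hc j))

/-- The integrand of the constraint at the dual candidate is a divergence in space-time. -/
lemma dual_integrand (ha : 0 < a) (hγ : 1 < γ) (hw : ∀ t, 0 < τ.w t) (z : ℝ × Vec d) :
    ∑ i, ∑ j, τ.blockFun i j z * blockMatrix (τ.dualRho a γ z) (τ.dualMomentum a γ z) i j
        + τ.pressureFun γ z * τ.dualPressure a γ z
      = deriv (fun s => τ.w s * τ.dualPressure a γ (s, z.2)) z.1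
        + divergence (fun y => τ.dualPressure a γ (z.1, y) • τ.Φ z.1 y) z.2 := by
  obtain ⟨t, x⟩ := z
  have hγ1 : γ - 1 ≠ 0 := by linarith
  have hw0 := (hw t).ne'
  set r := τ.dualRho a γ (t, x) with hr
  set P := τ.dualPressure a γ (t, x) with hP
  have hrP : r * τ.dualVar (t, x) = γ / (γ - 1) * P := dualDensity_mul_self ha hγ _
  have hdw : HasDerivAt τ.w (deriv τ.w t) t :=
    (τ.contDiff_w.differentiable one_ne_zero t).hasDerivAt
  have hdφ : HasDerivAt (fun s => τ.φ s x) (deriv (fun s => τ.φ s x) t) t :=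
    (hasDerivAt_timeSlice τ.scalar.1 t x).differentiableAt.hasDerivAt
  have hdΦ : HasDerivAt (fun s => τ.Φ s x) (deriv (fun s => τ.Φ s x) t) t :=
    (hasDerivAt_timeSlice τ.vector.1 t x).differentiableAt.hasDerivAt
  set φt := deriv (fun s => τ.φ s x) t
  set Φt := deriv (fun s => τ.Φ s x) t
  set wt := deriv τ.w t
  have hgt : HasDerivAt (fun s => τ.dualVar (s, x))
      ((φt * τ.w t - τ.φ t x * wt) / τ.w t ^ 2
        + (2 * inner ℝ (τ.Φ t x) Φt * (2 * τ.w t ^ 2)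
          - ‖τ.Φ t x‖ ^ 2 * (2 * (2 * τ.w t ^ (2 - 1) * wt))) / (2 * τ.w t ^ 2) ^ 2) t := by
    refine (hdφ.div hdw hw0).add ((hdΦ.norm_sq).div ((hdw.pow 2).const_mul 2) (by positivity))
  have hPt : HasDerivAt (fun s => τ.dualPressure a γ (s, x)) (r * _) t :=
    HasDerivAt.comp (h := fun s => τ.dualVar (s, x)) (h₂ := fun x => a * dualDensity a γ x ^ γ) t
      (hasDerivAt_dualPressure ha hγ (τ.dualVar (t, x))) hgt
  have hmul : deriv (fun s => τ.w s * τ.dualPressure a γ (s, x)) t = wt * P + τ.w t * (r * _) :=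
    (hdw.mul hPt).deriv
  dsimp only
  rw [hmul]
  have hφx : HasFDerivAt (τ.φ t) (fderiv ℝ (τ.φ t) x) x :=
    (hasFDerivAt_spaceSlice τ.scalar.1 t x).differentiableAt.hasFDerivAt
  have hΦx : HasFDerivAt (τ.Φ t) (fderiv ℝ (τ.Φ t) x) x :=
    (hasFDerivAt_spaceSlice τ.vector.1 t x).differentiableAt.hasFDerivAt
  have hgx : HasFDerivAt (fun y => τ.dualVar (t, y))
      ((τ.w t)⁻¹ • fderiv ℝ (τ.φ t) x + (2 * τ.w t ^ 2)⁻¹ •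
        (2 • (innerSL ℝ (τ.Φ t x)).comp (fderiv ℝ (τ.Φ t) x))) x := by
    have h1 := (hφx.const_mul (τ.w t)⁻¹).add ((hΦx.norm_sq).const_mul (2 * τ.w t ^ 2)⁻¹)
    refine h1.congr_of_eventuallyEq (Eventually.of_forall fun y => ?_)
    simp only [dualVar, Pi.add_apply]
    ring
  have hPx : HasFDerivAt (fun y => τ.dualPressure a γ (t, y)) (r • _) x :=
    HasDerivAt.comp_hasFDerivAt (f := fun y => τ.dualVar (t, y))
      (h₂ := fun x => a * dualDensity a γ x ^ γ) x
      (hasDerivAt_dualPressure ha hγ (τ.dualVar (t, x))) hgx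
  rw [divergence_smul hPx.differentiableAt hΦx.differentiableAt, hPx.fderiv]
  -- Both sides are polynomials in the derivatives of the test functions; the terms with the
  -- derivative of the weight cancel because of `hrP`.
  have hin : inner ℝ (τ.Φ t x) Φt = ∑ i, τ.Φ t x i * Φt i := by
    simp [PiLp.inner_apply, mul_comm]
  have hsq : ‖τ.Φ t x‖ ^ 2 = ∑ i, τ.Φ t x i * τ.Φ t x i := by
    rw [EuclideanSpace.real_norm_sq_eq]; simp [sq]
  have hgr : fderiv ℝ (τ.φ t) x (τ.Φ t x) = ∑ i, gradient (τ.φ t) x i * τ.Φ t x i := by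
    conv_lhs => rw [← sum_coord_smul_basisVec (τ.Φ t x)]
    simp [gradient_apply_coord, mul_comm]
  have hsp : inner ℝ (τ.Φ t x) (fderiv ℝ (τ.Φ t) x (τ.Φ t x))
      = ∑ i, ∑ j, partialD (τ.Φ t) x i j * (τ.Φ t x i * τ.Φ t x j) := by
    have h1 : fderiv ℝ (τ.Φ t) x (τ.Φ t x)
        = ∑ j, τ.Φ t x j • fderiv ℝ (τ.Φ t) x (basisVec j) := by
      conv_lhs => rw [← sum_coord_smul_basisVec (τ.Φ t x)]
      simp
    rw [h1, PiLp.inner_apply]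
    refine Finset.sum_congr rfl fun i _ => ?_
    simp only [WithLp.ofLp_sum, Finset.sum_apply, PiLp.smul_apply, smul_eq_mul, partialD,
      RCLike.inner_apply, conj_trivial, Finset.sum_mul]
    exact Finset.sum_congr rfl fun j _ => by ring
  have hblock : ∑ i, ∑ j, τ.blockFun i j (t, x)
      * blockMatrix r (τ.dualMomentum a γ (t, x)) i j
      = r * φt + (r / τ.w t) * ((∑ i, gradient (τ.φ t) x i * τ.Φ t x i)
          + ∑ i, τ.Φ t x i * Φt i)
        + (r / τ.w t ^ 2) * ((∑ i, ∑ j, partialD (τ.Φ t) x i j * (τ.Φ t x i * τ.Φ t x j))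
          - wt / 2 * ∑ i, τ.Φ t x i * τ.Φ t x i) := by
    have hm0 : r = 0 → τ.dualMomentum a γ (t, x) = 0 := fun h => by
      simp [dualMomentum, ← hr, h]
    have hmi : ∀ i, τ.dualMomentum a γ (t, x) i = r / τ.w t * τ.Φ t x i := fun i => rfl
    have hmm : ∀ i j, blockMatrix r (τ.dualMomentum a γ (t, x)) (some i) (some j)
        = r / τ.w t ^ 2 * (τ.Φ t x i * τ.Φ t x j) := fun i j => by
      have := dualMomentum_mul_div (a := a) (γ := γ) τ (t, x) i j
      rw [← hr] at this
      simp only [blockMatrix, Option.elim_some]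
      rw [this]
      ring
    have hsub : ∀ i j, (partialD (τ.Φ t) x i j - if i = j then wt / 2 else 0)
        * (r / τ.w t ^ 2 * (τ.Φ t x i * τ.Φ t x j))
        = r / τ.w t ^ 2 * (partialD (τ.Φ t) x i j * (τ.Φ t x i * τ.Φ t x j))
          - if i = j then r / τ.w t ^ 2 * (wt / 2 * (τ.Φ t x i * τ.Φ t x j)) else 0 := fun i j => by
      split_ifs <;> ring
    simp only [Fintype.sum_option, blockMatrix_none_none, blockMatrix_none_some hm0, hmm, hmi,
      blockFun, zero_mul, zero_add]
    have e1 : ∑ i, (gradient (τ.φ t) x i + Φt i) * (r / τ.w t * τ.Φ t x i)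
        = (r / τ.w t) * ((∑ i, gradient (τ.φ t) x i * τ.Φ t x i) + ∑ i, τ.Φ t x i * Φt i) := by
      rw [← Finset.sum_add_distrib, Finset.mul_sum]
      exact Finset.sum_congr rfl fun i _ => by ring
    have e2 : ∑ i, ∑ j, (partialD (τ.Φ t) x i j - if i = j then wt / 2 else 0)
          * (r / τ.w t ^ 2 * (τ.Φ t x i * τ.Φ t x j))
        = (r / τ.w t ^ 2) * ((∑ i, ∑ j, partialD (τ.Φ t) x i j * (τ.Φ t x i * τ.Φ t x j))
          - wt / 2 * ∑ i, τ.Φ t x i * τ.Φ t x i) := by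
      simp only [hsub, Finset.sum_sub_distrib, Finset.sum_ite_eq, Finset.mem_univ, if_true,
        ← Finset.mul_sum]
      ring
    rw [e1, e2]
    ring
  rw [hblock]
  simp only [pressureFun, FunLike.coe_smul, Pi.smul_apply,
    _root_.add_apply, ContinuousLinearMap.comp_apply, innerSL_apply_apply, smul_eq_mul,
    hgr, hsp, ← hP, hin, hsq, two_smul]
  have hvar : τ.dualVar (t, x)
      = τ.φ t x / τ.w t + (∑ i, τ.Φ t x i * τ.Φ t x i) / (2 * τ.w t ^ 2) := by
    rw [← hsq]; rfl
  rw [hvar] at hrP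
  generalize (∑ i, ∑ j, partialD (τ.Φ t) x i j * (τ.Φ t x i * τ.Φ t x j)) = A1 at *
  generalize (∑ i, τ.Φ t x i * τ.Φ t x i) = A2 at *
  generalize (∑ i, gradient (τ.φ t) x i * τ.Φ t x i) = A3 at *
  generalize (∑ i, τ.Φ t x i * Φt i) = A4 at *
  have hkey : wt * P / (γ - 1) = wt * (r * (τ.φ t x / τ.w t + A2 / (2 * τ.w t ^ 2))) - wt * P := by
    rw [hrP]
    field_simp
    ring
  field_simp
  field_simp at hkey
  linear_combination (-τ.w t) * hkey

/-- For a test with positive weight the relaxed state of the dual candidate has a nonpositive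
residual: the integrand is a space-time divergence, which leaves only a term at the initial time,
and that term is controlled by Young's inequality. -/
lemma residual_dual_nonpos (hT : 0 < T) (ha : 0 < a) (hγ : 1 < γ) (hw : ∀ t, 0 < τ.w t)
    {ρ₀ : Vec d → ℝ} {m₀ : Vec d → Vec d} (hdata : IsFiniteEnergyData D a γ ρ₀ m₀) :
    τ.residual a γ ρ₀ m₀ (pureState (D.spaceTime T) a γ (τ.dualRho a γ) (τ.dualMomentum a γ))
      ≤ 0 := by
  have hflow := isFlow_dual (τ := τ) ha hγ hw
  have hQ := D.isCompact_cylinder T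
  have hPC := contDiff_dualPressure (τ := τ) ha hγ hw
  have hwP : ContDiff ℝ 1 fun z : ℝ × Vec d => τ.w z.1 * τ.dualPressure a γ (z.1, z.2) :=
    (τ.contDiff_w.comp contDiff_fst).mul hPC
  have hPΦ : ContDiff ℝ 1 fun z : ℝ × Vec d => τ.dualPressure a γ (z.1, z.2) • τ.Φ z.1 z.2 :=
    hPC.smul τ.vector.1
  have hb : ∀ i j, Integrable (fun z => τ.blockFun i j z
      * blockMatrix (τ.dualRho a γ z) (τ.dualMomentum a γ z) i j) (D.spaceTime T) := fun i j =>
    integrable_continuousMap_mul hQ (D.spaceTime_compl T) ⟨_, τ.continuous_blockFun i j⟩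
      (hflow.integrable_blockMatrix i j)
  have hp : Integrable (fun z => τ.pressureFun γ z * τ.dualPressure a γ z) (D.spaceTime T) :=
    integrable_continuousMap_mul hQ (D.spaceTime_compl T) ⟨_, τ.continuous_pressureFun γ⟩
      (hflow.integrable_pressure.const_mul a)
  have hsum : τ.residual a γ ρ₀ m₀
        (pureState (D.spaceTime T) a γ (τ.dualRho a γ) (τ.dualMomentum a γ))
      = ∫ z, (deriv (fun s => τ.w s * τ.dualPressure a γ (s, z.2)) z.1
        + divergence (fun y => τ.dualPressure a γ (z.1, y) • τ.Φ z.1 y) z.2) ∂(D.spaceTime T)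
        + τ.initial a γ ρ₀ m₀ := by
    unfold residual
    congr 1
    simp_rw [← dual_integrand ha hγ hw]
    rw [integral_add (integrable_finsetSum _ fun i _ => integrable_finsetSum _ fun j _ =>
        hb i j) hp,
      integral_finsetSum _ fun i _ => integrable_finsetSum _ fun j _ => hb i j]
    simp_rw [integral_finsetSum _ fun j _ => hb _ j]
    rfl
  have hI1 : Integrable (fun z : ℝ × Vec d =>
      deriv (fun s => τ.w s * τ.dualPressure a γ (s, z.2)) z.1) (D.spaceTime T) :=
    integrable_of_continuous (continuous_deriv_timeSlice
      (φ := fun t x => τ.w t * τ.dualPressure a γ (t, x)) hwP)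
  have hI2 : Integrable (fun z : ℝ × Vec d =>
      divergence (fun y => τ.dualPressure a γ (z.1, y) • τ.Φ z.1 y) z.2) (D.spaceTime T) :=
    integrable_of_continuous (continuous_divergence_spaceSlice
      (φ := fun t x => τ.dualPressure a γ (t, x) • τ.Φ t x) hPΦ)
  -- The spatial divergence integrates to zero, as the field is tangential to the boundary.
  have hdiv : ∫ z, divergence (fun y => τ.dualPressure a γ (z.1, y) • τ.Φ z.1 y) z.2
      ∂(D.spaceTime T) = 0 := by
    rw [FlowRegion.spaceTime, integral_prod _ hI2]
    refine (setIntegral_congr_fun (g := fun _ => 0) measurableSet_Ioo fun t ht => ?_).trans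
      (by simp)
    refine D.integral_divergence_eq_zero (contDiff_spaceSlice
      (φ := fun t x => τ.dualPressure a γ (t, x) • τ.Φ t x) hPΦ t) ?_ ?_
    · have h1 := τ.scalar.2.2
      have h2 := τ.vector.2.2.1
      cases D with
      | domain => trivial
      | torus =>
        intro s x i
        simp only [dualPressure, dualRho, dualVar, h1 t x i, h2 t x i]
    · have h2 := τ.vector.2.2.2
      cases D with
      | domain =>
        intro s _ x hx n hn
        simp only [inner_smul_left, h2 t (Ioo_subset_Ico_self ht) x hx n hn, mul_zero]
      | torus => trivial
  -- The pressure vanishes at the time `T` with the test functions; the value at `0` remains.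
  have htime : ∫ z, deriv (fun s => τ.w s * τ.dualPressure a γ (s, z.2)) z.1 ∂(D.spaceTime T)
      = ∫ x, -(τ.w 0 * τ.dualPressure a γ (0, x)) ∂D.vol := by
    rw [FlowRegion.spaceTime, integral_prod_symm _ hI1]
    refine integral_congr_ae (Eventually.of_forall fun x => ?_)
    have hC : ContDiff ℝ 1 fun s => τ.w s * τ.dualPressure a γ (s, x) :=
      contDiff_timeSlice (φ := fun t x => τ.w t * τ.dualPressure a γ (t, x)) hwP x
    have hT0 : τ.dualPressure a γ (T, x) = 0 := by
      obtain ⟨T₁, hT₁, h1⟩ := τ.scalar.2.1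
      obtain ⟨T₂, hT₂, h2⟩ := τ.vector.2.1
      simp only [dualPressure, dualRho, dualVar, h1 T hT₁.le x, h2 T hT₂.le x]
      rw [dualDensity_of_nonpos hγ (by simp), Real.zero_rpow (by linarith), mul_zero]
    have h := intervalIntegral.integral_deriv_eq_sub' (a := 0) (b := T) _ rfl
      (fun s _ => hC.differentiable one_ne_zero s) (hC.continuous_deriv le_rfl).continuousOn
    rw [intervalIntegral.integral_of_le hT.le, integral_Ioc_eq_integral_Ioo] at h
    simp only [hT0, mul_zero, zero_sub] at h
    exact h
  rw [hsum, integral_add hI1 hI2, hdiv, htime, add_zero]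
  -- Young's inequality at the initial time bounds the pairing with the initial data.
  have hfl := hdata.isFlow ha hγ
  have hK := D.isCompact_closedRegion
  have hci : ∀ f : Vec d → ℝ, Continuous f → Integrable f D.vol := fun f hf =>
    integrable_continuousMap hK D.vol_compl ⟨f, hf⟩
  have hP0 : Integrable (fun x => τ.dualPressure a γ (0, x)) D.vol :=
    hci _ (hPC.continuous.comp (by fun_prop))
  have hρφ := hfl.integrable_density_mul (contDiff_spaceSlice τ.scalar.1 0).continuous
  have hmΦ := hfl.integrable_inner (contDiff_spaceSlice τ.vector.1 0).continuous
  unfold initial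
  rw [hdata.initialEnergy_toReal ha hγ, ← integral_add hρφ hmΦ, integral_neg,
    integral_const_mul]
  have hle : ∫ x, (ρ₀ x * τ.φ 0 x + inner ℝ (m₀ x) (τ.Φ 0 x)) ∂D.vol
      ≤ ∫ x, τ.w 0 * (realEnergy a γ (ρ₀ x) (m₀ x) + τ.dualPressure a γ (0, x)) ∂D.vol := by
    refine integral_mono_ae (hρφ.add hmΦ) (((hfl.integrable_realEnergy a).add hP0).const_mul _) ?_
    filter_upwards [hfl.nonneg, hfl.eq_zero] with x h1 h2
    exact young_energy ha hγ h1 h2 (hw 0) _ _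
  rw [integral_const_mul, integral_add (hfl.integrable_realEnergy a) hP0] at hle
  linarith

end ConstraintTest

end DualCandidate

/-! ### Existence of relaxed solutions -/

section Feasible

variable {d : ℕ} {D : FlowRegion d} {T a γ : ℝ} {ρ₀ : Vec d → ℝ} {m₀ : Vec d → Vec d}

/-- A function that is positive on `[0,T]`, up to a margin, agrees there with a globally positive
one. -/
lemma exists_pos_extension {w : ℝ → ℝ} (hw : ContDiff ℝ 1 w) {η : ℝ} (hη : 0 < η)
    (h : ∀ t ∈ Icc 0 T, η ≤ w t) :
    ∃ v : ℝ → ℝ, ContDiff ℝ 1 v ∧ (∀ t, 0 < v t) ∧ ∀ t ∈ Icc 0 T, v t = w t := by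
  set θ : ℝ → ℝ := fun y => Real.smoothTransition (2 * y / η - 1) with hθ
  have hθC : ContDiff ℝ 1 θ := by
    have : ContDiff ℝ 1 Real.smoothTransition := Real.smoothTransition.contDiff (n := 1)
    exact this.comp (by fun_prop)
  refine ⟨fun t => θ (w t) * w t + (1 - θ (w t)) * η,
    (((hθC.comp hw).mul hw).add ((contDiff_const.sub (hθC.comp hw)).mul contDiff_const)),
    fun t => ?_, fun t ht => ?_⟩
  · have h0 : 0 ≤ θ (w t) := Real.smoothTransition.nonneg _
    have h1 : θ (w t) ≤ 1 := Real.smoothTransition.le_one _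
    rcases le_or_gt (w t) (η / 2) with hle | hlt
    · have : θ (w t) = 0 := by
        refine Real.smoothTransition.zero_of_nonpos ?_
        rw [sub_nonpos, div_le_one hη]
        linarith
      simp only [this]
      linarith
    · nlinarith [mul_nonneg h0 (by linarith : (0 : ℝ) ≤ w t - η / 2),
        mul_nonneg (sub_nonneg.mpr h1) (by linarith : (0 : ℝ) ≤ η / 2)]
  · have : θ (w t) = 1 := by
      refine Real.smoothTransition.one_of_one_le ?_
      have := (one_le_div hη).mpr (h t ht)
      rw [mul_div_assoc]
      linarith
    simp only [this]
    ring

namespace ConstraintTest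

/-- The relaxed constraint for one test can be met up to an arbitrarily small error: a small
constant is added to the weight, so that the dual candidate is defined. -/
lemma exists_residual_le (hT : 0 < T) (ha : 0 < a) (hγ : 1 < γ)
    (hdata : IsFiniteEnergyData D a γ ρ₀ m₀) (τ : ConstraintTest D T) {ε : ℝ} (hε : 0 < ε) :
    ∃ S, IsRelaxed (D.cylinder T) (D.spaceTime T) a γ S ∧ τ.residual a γ ρ₀ m₀ S ≤ ε := by
  set E₀ := (initialEnergy D a γ ρ₀ m₀).toReal with hE₀
  have hE₀nn : 0 ≤ E₀ := ENNReal.toReal_nonneg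
  set η := ε / (E₀ + 1) with hη
  have hηpos : 0 < η := by positivity
  obtain ⟨v, hvC, hvpos, hv⟩ := exists_pos_extension (T := T) (w := fun t => τ.w t + η)
    (τ.contDiff_w.add contDiff_const) hηpos fun t ht => by linarith [τ.w_nonneg t ht]
  set τ' : ConstraintTest D T := ⟨τ.φ, τ.Φ, v, τ.scalar, τ.vector, hvC, fun t _ => (hvpos t).le⟩
    with hτ'
  have hfl := isFlow_dual (τ := τ') ha hγ hvpos
  refine ⟨_, hfl.isRelaxed_pureState ha hγ (D.isCompact_cylinder T) (D.spaceTime_compl T), ?_⟩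
  have hres := residual_dual_nonpos (τ := τ') hT ha hγ hvpos hdata
  have hdv : ∀ t ∈ Ioo 0 T, deriv v t = deriv τ.w t := by
    intro t ht
    have : v =ᶠ[𝓝 t] fun t => τ.w t + η := by
      filter_upwards [Ioo_mem_nhds ht.1 ht.2] with s hs using hv s (Ioo_subset_Icc_self hs)
    rw [this.deriv_eq, deriv_add_const]
  have hae : ∀ᵐ z ∂(D.spaceTime T), z.1 ∈ Ioo 0 T := by
    rw [D.spaceTime_eq]
    filter_upwards [ae_restrict_mem (measurableSet_Ioo.prod D.measurableSet_interiorSet)] with z hz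
    exact hz.1
  have h1 : ∀ i j, ∀ᵐ z ∂(D.spaceTime T), τ.blockFun i j z = τ'.blockFun i j z := by
    intro i j
    filter_upwards [hae] with z hz
    rcases i with _ | i <;> rcases j with _ | j <;> simp only [blockFun, hτ', hdv z.1 hz]
  have h2 : ∀ᵐ z ∂(D.spaceTime T), τ.pressureFun γ z = τ'.pressureFun γ z := by
    filter_upwards [hae] with z hz
    simp only [pressureFun, hτ', hdv z.1 hz]
  have h3 : τ.initial a γ ρ₀ m₀ = τ'.initial a γ ρ₀ m₀ + η * E₀ := by
    have : v 0 = τ.w 0 + η := hv 0 ⟨le_rfl, hT.le⟩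
    simp only [initial, hτ', this]
    ring
  have h4 : τ.residual a γ ρ₀ m₀ (pureState (D.spaceTime T) a γ (τ'.dualRho a γ)
      (τ'.dualMomentum a γ)) = τ'.residual a γ ρ₀ m₀ (pureState (D.spaceTime T) a γ
        (τ'.dualRho a γ) (τ'.dualMomentum a γ)) + η * E₀ := by
    unfold residual
    rw [h3, ← add_assoc]
    congr 3
    · refine Finset.sum_congr rfl fun i _ => Finset.sum_congr rfl fun j _ => integral_congr_ae ?_
      filter_upwards [h1 i j] with z hz
      simp only [ContinuousMap.coe_mk, hz]
    · refine integral_congr_ae ?_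
      filter_upwards [h2] with z hz
      simp only [ContinuousMap.coe_mk, hz]
  rw [h4]
  have : η * E₀ ≤ ε := by
    rw [hη, div_mul_eq_mul_div, div_le_iff₀ (by positivity)]
    nlinarith
  linarith

/-- The sum of two tests. -/
def add (τ σ : ConstraintTest D T) : ConstraintTest D T where
  φ t x := τ.φ t x + σ.φ t x
  Φ t x := τ.Φ t x + σ.Φ t x
  w t := τ.w t + σ.w t
  scalar := by
    obtain ⟨h1, ⟨T₁, hT₁, h2⟩, h3⟩ := τ.scalar
    obtain ⟨k1, ⟨T₂, hT₂, k2⟩, k3⟩ := σ.scalar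
    refine ⟨h1.add k1, ⟨max T₁ T₂, max_lt hT₁ hT₂, fun t ht x => ?_⟩, ?_⟩
    · simp only [h2 t (le_of_max_le_left ht), k2 t (le_of_max_le_right ht), add_zero]
    · cases D with
      | domain => trivial
      | torus => exact fun t x i => congrArg₂ (· + ·) (h3 t x i) (k3 t x i)
  vector := by
    obtain ⟨h1, ⟨T₁, hT₁, h2⟩, h3, h4⟩ := τ.vector
    obtain ⟨k1, ⟨T₂, hT₂, k2⟩, k3, k4⟩ := σ.vector
    refine ⟨h1.add k1, ⟨max T₁ T₂, max_lt hT₁ hT₂, fun t ht x => ?_⟩, ?_, ?_⟩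
    · simp only [h2 t (le_of_max_le_left ht), k2 t (le_of_max_le_right ht), add_zero]
    · cases D with
      | domain => trivial
      | torus => exact fun t x i => congrArg₂ (· + ·) (h3 t x i) (k3 t x i)
    · cases D with
      | domain =>
        intro t ht x hx n hn
        rw [inner_add_left, h4 t ht x hx n hn, k4 t ht x hx n hn, add_zero]
      | torus => trivial
  contDiff_w := τ.contDiff_w.add σ.contDiff_w
  w_nonneg t ht := add_nonneg (τ.w_nonneg t ht) (σ.w_nonneg t ht)

/-- A nonnegative multiple of a test. -/
def smul (c : ℝ) (hc : 0 ≤ c) (τ : ConstraintTest D T) : ConstraintTest D T where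
  φ t x := c * τ.φ t x
  Φ t x := c • τ.Φ t x
  w t := c * τ.w t
  scalar := by
    obtain ⟨h1, ⟨T₁, hT₁, h2⟩, h3⟩ := τ.scalar
    refine ⟨contDiff_const.mul h1, ⟨T₁, hT₁, fun t ht x => ?_⟩, ?_⟩
    · simp only [h2 t ht, mul_zero]
    · cases D with
      | domain => trivial
      | torus => exact fun t x i => congrArg (c * ·) (h3 t x i)
  vector := by
    obtain ⟨h1, ⟨T₁, hT₁, h2⟩, h3, h4⟩ := τ.vector
    refine ⟨h1.const_smul c, ⟨T₁, hT₁, fun t ht x => ?_⟩, ?_, ?_⟩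
    · simp only [h2 t ht, smul_zero]
    · cases D with
      | domain => trivial
      | torus => exact fun t x i => congrArg (c • ·) (h3 t x i)
    · cases D with
      | domain =>
        intro t ht x hx n hn
        rw [inner_smul_left, h4 t ht x hx n hn, mul_zero]
      | torus => trivial
  contDiff_w := contDiff_const.mul τ.contDiff_w
  w_nonneg t ht := mul_nonneg hc (τ.w_nonneg t ht)

lemma blockFun_add (τ σ : ConstraintTest D T) (i j : Option (Fin d)) (z : ℝ × Vec d) :
    (τ.add σ).blockFun i j z = τ.blockFun i j z + σ.blockFun i j z := by
  have hw : deriv (fun t => τ.w t + σ.w t) z.1 = deriv τ.w z.1 + deriv σ.w z.1 :=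
    deriv_fun_add (τ.contDiff_w.differentiable one_ne_zero _)
      (σ.contDiff_w.differentiable one_ne_zero _)
  rcases i with _ | i <;> rcases j with _ | j
  · exact deriv_fun_add (hasDerivAt_timeSlice τ.scalar.1 z.1 z.2).differentiableAt
      (hasDerivAt_timeSlice σ.scalar.1 z.1 z.2).differentiableAt
  · have h1 : deriv (fun s => τ.Φ s z.2 + σ.Φ s z.2) z.1
        = deriv (fun s => τ.Φ s z.2) z.1 + deriv (fun s => σ.Φ s z.2) z.1 :=
      deriv_fun_add (hasDerivAt_timeSlice τ.vector.1 z.1 z.2).differentiableAt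
        (hasDerivAt_timeSlice σ.vector.1 z.1 z.2).differentiableAt
    have h2 : fderiv ℝ (fun x => τ.φ z.1 x + σ.φ z.1 x) z.2
        = fderiv ℝ (τ.φ z.1) z.2 + fderiv ℝ (σ.φ z.1) z.2 :=
      fderiv_fun_add (hasFDerivAt_spaceSlice τ.scalar.1 z.1 z.2).differentiableAt
        (hasFDerivAt_spaceSlice σ.scalar.1 z.1 z.2).differentiableAt
    simp only [blockFun, add, gradient_apply_coord]
    rw [h1, h2]
    simp only [_root_.add_apply, PiLp.add_apply]
    ring
  · simp [blockFun]
  · have h2 : fderiv ℝ (fun x => τ.Φ z.1 x + σ.Φ z.1 x) z.2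
        = fderiv ℝ (τ.Φ z.1) z.2 + fderiv ℝ (σ.Φ z.1) z.2 :=
      fderiv_fun_add (hasFDerivAt_spaceSlice τ.vector.1 z.1 z.2).differentiableAt
        (hasFDerivAt_spaceSlice σ.vector.1 z.1 z.2).differentiableAt
    simp only [blockFun, add, partialD]
    rw [h2]
    simp only [hw, _root_.add_apply, PiLp.add_apply]
    split_ifs <;> ring

lemma pressureFun_add (γ : ℝ) (τ σ : ConstraintTest D T) (z : ℝ × Vec d) :
    (τ.add σ).pressureFun γ z = τ.pressureFun γ z + σ.pressureFun γ z := by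
  have hw : deriv (fun t => τ.w t + σ.w t) z.1 = deriv τ.w z.1 + deriv σ.w z.1 :=
    deriv_fun_add (τ.contDiff_w.differentiable one_ne_zero _)
      (σ.contDiff_w.differentiable one_ne_zero _)
  have h2 : fderiv ℝ (fun x => τ.Φ z.1 x + σ.Φ z.1 x) z.2
      = fderiv ℝ (τ.Φ z.1) z.2 + fderiv ℝ (σ.Φ z.1) z.2 :=
    fderiv_fun_add (hasFDerivAt_spaceSlice τ.vector.1 z.1 z.2).differentiableAt
      (hasFDerivAt_spaceSlice σ.vector.1 z.1 z.2).differentiableAt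
  simp only [pressureFun, add, divergence, partialD]
  rw [h2, hw]
  simp only [_root_.add_apply, PiLp.add_apply, Finset.sum_add_distrib]
  ring

lemma initial_add (ha : 0 < a) (hγ : 1 < γ) (hdata : IsFiniteEnergyData D a γ ρ₀ m₀)
    (τ σ : ConstraintTest D T) : (τ.add σ).initial a γ ρ₀ m₀
      = τ.initial a γ ρ₀ m₀ + σ.initial a γ ρ₀ m₀ := by
  have hfl := hdata.isFlow ha hγ
  have h1 : ∫ x, ρ₀ x * (τ.φ 0 x + σ.φ 0 x) ∂D.vol
      = (∫ x, ρ₀ x * τ.φ 0 x ∂D.vol) + ∫ x, ρ₀ x * σ.φ 0 x ∂D.vol := by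
    simp only [mul_add]
    exact integral_add (hfl.integrable_density_mul (contDiff_spaceSlice τ.scalar.1 0).continuous)
      (hfl.integrable_density_mul (contDiff_spaceSlice σ.scalar.1 0).continuous)
  have h2 : ∫ x, (inner ℝ (m₀ x) (τ.Φ 0 x + σ.Φ 0 x) : ℝ) ∂D.vol
      = (∫ x, (inner ℝ (m₀ x) (τ.Φ 0 x) : ℝ) ∂D.vol) + ∫ x, inner ℝ (m₀ x) (σ.Φ 0 x) ∂D.vol := by
    simp only [inner_add_right]
    exact integral_add (hfl.integrable_inner (contDiff_spaceSlice τ.vector.1 0).continuous)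
      (hfl.integrable_inner (contDiff_spaceSlice σ.vector.1 0).continuous)
  simp only [initial, add, h1, h2]
  ring

lemma blockFun_smul (c : ℝ) (hc : 0 ≤ c) (τ : ConstraintTest D T) (i j : Option (Fin d))
    (z : ℝ × Vec d) : (τ.smul c hc).blockFun i j z = c * τ.blockFun i j z := by
  have hw : deriv (fun t => c * τ.w t) z.1 = c * deriv τ.w z.1 :=
    deriv_const_mul c (τ.contDiff_w.differentiable one_ne_zero _)
  rcases i with _ | i <;> rcases j with _ | j
  · exact deriv_const_mul c (hasDerivAt_timeSlice τ.scalar.1 z.1 z.2).differentiableAt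
  · have h1 : deriv (fun s => c • τ.Φ s z.2) z.1 = c • deriv (fun s => τ.Φ s z.2) z.1 :=
      deriv_fun_const_smul c (hasDerivAt_timeSlice τ.vector.1 z.1 z.2).differentiableAt
    have h2 : fderiv ℝ (fun x => c * τ.φ z.1 x) z.2 = c • fderiv ℝ (τ.φ z.1) z.2 :=
      fderiv_const_mul (hasFDerivAt_spaceSlice τ.scalar.1 z.1 z.2).differentiableAt c
    simp only [blockFun, smul, gradient_apply_coord]
    rw [h1, h2]
    simp only [_root_.smul_apply, PiLp.smul_apply, smul_eq_mul]
    ring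
  · simp [blockFun]
  · have h2 : fderiv ℝ (fun x => c • τ.Φ z.1 x) z.2 = c • fderiv ℝ (τ.Φ z.1) z.2 :=
      fderiv_fun_const_smul (hasFDerivAt_spaceSlice τ.vector.1 z.1 z.2).differentiableAt c
    simp only [blockFun, smul, partialD]
    rw [h2]
    simp only [hw, _root_.smul_apply, PiLp.smul_apply, smul_eq_mul]
    split_ifs <;> ring

lemma pressureFun_smul (γ c : ℝ) (hc : 0 ≤ c) (τ : ConstraintTest D T) (z : ℝ × Vec d) :
    (τ.smul c hc).pressureFun γ z = c * τ.pressureFun γ z := by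
  have hw : deriv (fun t => c * τ.w t) z.1 = c * deriv τ.w z.1 :=
    deriv_const_mul c (τ.contDiff_w.differentiable one_ne_zero _)
  have h2 : fderiv ℝ (fun x => c • τ.Φ z.1 x) z.2 = c • fderiv ℝ (τ.Φ z.1) z.2 :=
    fderiv_fun_const_smul (hasFDerivAt_spaceSlice τ.vector.1 z.1 z.2).differentiableAt c
  simp only [pressureFun, smul, divergence, partialD]
  rw [h2, hw]
  simp only [_root_.smul_apply, PiLp.smul_apply, smul_eq_mul, ← Finset.mul_sum]
  ring

lemma initial_smul (c : ℝ) (hc : 0 ≤ c) (τ : ConstraintTest D T) :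
    (τ.smul c hc).initial a γ ρ₀ m₀ = c * τ.initial a γ ρ₀ m₀ := by
  simp only [initial, smul, inner_smul_right, mul_left_comm _ c, integral_const_mul]
  ring

lemma residual_add (ha : 0 < a) (hγ : 1 < γ) (hdata : IsFiniteEnergyData D a γ ρ₀ m₀)
    {Q : Set (ℝ × Vec d)} {lam : Measure (ℝ × Vec d)} {S : RelaxedState (ℝ × Vec d) d}
    (hS : IsRelaxed Q lam a γ S) (τ σ : ConstraintTest D T) :
    (τ.add σ).residual a γ ρ₀ m₀ S = τ.residual a γ ρ₀ m₀ S + σ.residual a γ ρ₀ m₀ S := by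
  have h1 : ∀ i j, (⟨(τ.add σ).blockFun i j, (τ.add σ).continuous_blockFun i j⟩ : C(ℝ × Vec d, ℝ))
      = ⟨τ.blockFun i j, τ.continuous_blockFun i j⟩
        + ⟨σ.blockFun i j, σ.continuous_blockFun i j⟩ := fun i j =>
    ContinuousMap.ext fun z => blockFun_add τ σ i j z
  have h2 : (⟨(τ.add σ).pressureFun γ, (τ.add σ).continuous_pressureFun γ⟩ : C(ℝ × Vec d, ℝ))
      = ⟨τ.pressureFun γ, τ.continuous_pressureFun γ⟩
        + ⟨σ.pressureFun γ, σ.continuous_pressureFun γ⟩ :=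
    ContinuousMap.ext fun z => pressureFun_add γ τ σ z
  unfold residual
  simp only [h1, h2, initial_add ha hγ hdata, (hS.linear_block _ _).map_add,
    hS.linear_pressure.map_add, Finset.sum_add_distrib]
  ring

lemma residual_smul {Q : Set (ℝ × Vec d)} {lam : Measure (ℝ × Vec d)}
    {S : RelaxedState (ℝ × Vec d) d} (hS : IsRelaxed Q lam a γ S) (c : ℝ) (hc : 0 ≤ c)
    (τ : ConstraintTest D T) :
    (τ.smul c hc).residual a γ ρ₀ m₀ S = c * τ.residual a γ ρ₀ m₀ S := by
  have h1 : ∀ i j, (⟨(τ.smul c hc).blockFun i j, (τ.smul c hc).continuous_blockFun i j⟩ :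
      C(ℝ × Vec d, ℝ)) = c • ⟨τ.blockFun i j, τ.continuous_blockFun i j⟩ := fun i j =>
    ContinuousMap.ext fun z => blockFun_smul c hc τ i j z
  have h2 : (⟨(τ.smul c hc).pressureFun γ, (τ.smul c hc).continuous_pressureFun γ⟩ :
      C(ℝ × Vec d, ℝ)) = c • ⟨τ.pressureFun γ, τ.continuous_pressureFun γ⟩ :=
    ContinuousMap.ext fun z => pressureFun_smul γ c hc τ z
  unfold residual
  simp only [h1, h2, initial_smul, (hS.linear_block _ _).map_smul, hS.linear_pressure.map_smul,
    smul_eq_mul, ← Finset.mul_sum]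
  ring

/-- The test that bounds the total energy. -/
def ofWeight (w : ℝ → ℝ) (hw : ContDiff ℝ 1 w) (h : ∀ t ∈ Icc 0 T, 0 ≤ w t) :
    ConstraintTest D T where
  φ _ _ := 0
  Φ _ _ := 0
  w := w
  scalar := ⟨contDiff_const, ⟨T - 1, by linarith, fun _ _ _ => rfl⟩,
      by cases D <;> simp [FlowRegion.IsPeriodic]⟩
  vector := ⟨contDiff_const, ⟨T - 1, by linarith, fun _ _ _ => rfl⟩,
    by cases D <;> simp [FlowRegion.IsPeriodic], by cases D <;> simp [FlowRegion.IsTangential]⟩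
  contDiff_w := hw
  w_nonneg := h

lemma residual_ofWeight {Q : Set (ℝ × Vec d)} {lam : Measure (ℝ × Vec d)}
    {S : RelaxedState (ℝ × Vec d) d} (hS : IsRelaxed Q lam a γ S) (w : ℝ → ℝ)
    (hw : ContDiff ℝ 1 w) (h : ∀ t ∈ Icc 0 T, 0 ≤ w t) :
    (ofWeight w hw h : ConstraintTest D T).residual a γ ρ₀ m₀ S
      = -S.energy γ ⟨fun z => deriv w z.1, (hw.continuous_deriv le_rfl).comp continuous_fst⟩
        - w 0 * (initialEnergy D a γ ρ₀ m₀).toReal := by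
  set τ : ConstraintTest D T := ofWeight w hw h with hτ
  set W : C(ℝ × Vec d, ℝ) :=
    ⟨fun z => deriv w z.1, (hw.continuous_deriv le_rfl).comp continuous_fst⟩ with hW
  have hpart : ∀ (x : Vec d) (i j : Fin d), partialD (fun _ : Vec d => (0 : Vec d)) x i j = 0 := by
    intro x i j
    simp [partialD]
  have h1 : ∀ i j, (⟨τ.blockFun i j, τ.continuous_blockFun i j⟩ : C(ℝ × Vec d, ℝ))
      = (i.elim 0 fun i => j.elim 0 fun j => if i = j then (-(1 / 2) : ℝ) else 0) • W := by
    intro i j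
    ext z
    rcases i with _ | i <;> rcases j with _ | j
    · simp [hτ, ofWeight, blockFun]
    · simp [hτ, ofWeight, blockFun]
    · simp [blockFun]
    · simp only [ContinuousMap.coe_mk, blockFun, hτ, ofWeight, hpart, Option.elim_some,
        ContinuousMap.coe_smul, Pi.smul_apply, hW, smul_eq_mul]
      split_ifs <;> ring
  have h2 : (⟨τ.pressureFun γ, τ.continuous_pressureFun γ⟩ : C(ℝ × Vec d, ℝ))
      = (-(1 / (γ - 1)) : ℝ) • W := by
    ext z
    simp only [ContinuousMap.coe_mk, pressureFun, hτ, ofWeight, divergence, hpart,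
      ContinuousMap.coe_smul, Pi.smul_apply, hW, smul_eq_mul, Finset.sum_const_zero]
    ring
  have h3 : τ.initial a γ ρ₀ m₀ = -(w 0 * (initialEnergy D a γ ρ₀ m₀).toReal) := by
    simp [initial, hτ, ofWeight]
  unfold residual RelaxedState.energy
  simp only [h1, h2, h3, (hS.linear_block _ _).map_smul, hS.linear_pressure.map_smul,
    Fintype.sum_option, Option.elim_none, Option.elim_some, zero_mul, smul_eq_mul,
    ite_mul, Finset.sum_ite_eq, Finset.mem_univ, if_true, Finset.sum_const_zero, zero_add,
    ← Finset.mul_sum]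
  ring

lemma continuous_residual (a γ : ℝ) (ρ₀ : Vec d → ℝ) (m₀ : Vec d → Vec d)
    (τ : ConstraintTest D T) : Continuous (τ.residual a γ ρ₀ m₀) := by
  unfold residual
  refine ((continuous_finsetSum _ fun i _ => continuous_finsetSum _ fun j _ => ?_).add ?_).add
    continuous_const
  · exact continuous_block i j _
  · exact continuous_pressure _

end ConstraintTest

/-- The relaxed solutions: the relaxed states that satisfy all constraints. -/
def relaxedSolutions (D : FlowRegion d) (a γ T : ℝ) (ρ₀ : Vec d → ℝ) (m₀ : Vec d → Vec d) :
    Set (RelaxedState (ℝ × Vec d) d) :=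
  {S | IsRelaxed (D.cylinder T) (D.spaceTime T) a γ S ∧
    ∀ τ : ConstraintTest D T, τ.residual a γ ρ₀ m₀ S ≤ 0}

lemma IsRelaxed.isLinearMap_energy {X : Type} [TopologicalSpace X] [MeasurableSpace X] {Q : Set X}
    {lam : Measure X} {S : RelaxedState X d} (hS : IsRelaxed Q lam a γ S) :
    IsLinearMap ℝ (S.energy γ) := by
  constructor
  · intro f g
    simp only [RelaxedState.energy, (hS.linear_block _ _).map_add, hS.linear_pressure.map_add,
      Finset.sum_add_distrib]
    ring
  · intro c f
    simp only [RelaxedState.energy, (hS.linear_block _ _).map_smul, hS.linear_pressure.map_smul,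
      smul_eq_mul, ← Finset.mul_sum]
    ring

/-- Nonnegative combinations of constraints are constraints. -/
lemma ConstraintTest.exists_combination (ha : 0 < a) (hγ : 1 < γ)
    (hdata : IsFiniteEnergyData D a γ ρ₀ m₀) {ι : Type} (s : Finset ι) (c : ι → ℝ)
    (hc : ∀ i, 0 ≤ c i) (τ : ι → ConstraintTest D T) :
    ∃ σ : ConstraintTest D T, ∀ S, IsRelaxed (D.cylinder T) (D.spaceTime T) a γ S →
      σ.residual a γ ρ₀ m₀ S = ∑ i ∈ s, c i * (τ i).residual a γ ρ₀ m₀ S := by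
  classical
  induction s using Finset.induction_on with
  | empty =>
    refine ⟨ConstraintTest.smul 0 le_rfl
      (ConstraintTest.ofWeight (fun _ => 0) contDiff_const fun _ _ => le_rfl), fun S hS => ?_⟩
    rw [ConstraintTest.residual_smul hS, zero_mul, Finset.sum_empty]
  | insert i s hi ih =>
    obtain ⟨σ, hσ⟩ := ih
    refine ⟨((τ i).smul (c i) (hc i)).add σ, fun S hS => ?_⟩
    rw [ConstraintTest.residual_add ha hγ hdata hS, ConstraintTest.residual_smul hS, hσ S hS,
      Finset.sum_insert hi]

lemma ConstraintTest.residual_convex_combination (τ : ConstraintTest D T)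
    (S₁ S₂ : RelaxedState (ℝ × Vec d) d) {s t : ℝ} (hst : s + t = 1) :
    τ.residual a γ ρ₀ m₀ (s • S₁ + t • S₂)
      = s * τ.residual a γ ρ₀ m₀ S₁ + t * τ.residual a γ ρ₀ m₀ S₂ := by
  unfold residual
  simp only [Prod.fst_add, Prod.snd_add, Prod.smul_fst, Prod.smul_snd, Pi.add_apply, Pi.smul_apply,
    smul_eq_mul, Finset.sum_add_distrib, ← Finset.mul_sum]
  linear_combination (-(τ.initial a γ ρ₀ m₀)) * hst

/-- The test with weight `T - t`, which bounds the time-integrated energy. -/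
def ConstraintTest.remainingTime (D : FlowRegion d) (T : ℝ) : ConstraintTest D T :=
  ConstraintTest.ofWeight (fun t => T - t) (by fun_prop) fun _ ht => sub_nonneg.mpr ht.2

lemma ConstraintTest.residual_remainingTime {Q : Set (ℝ × Vec d)} {lam : Measure (ℝ × Vec d)}
    {S : RelaxedState (ℝ × Vec d) d} (hS : IsRelaxed Q lam a γ S) :
    (ConstraintTest.remainingTime D T).residual a γ ρ₀ m₀ S
      = S.energy γ 1 - T * (initialEnergy D a γ ρ₀ m₀).toReal := by
  unfold remainingTime
  rw [residual_ofWeight hS]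
  have : (⟨fun z => deriv (fun t => T - t) z.1, ((by fun_prop : ContDiff ℝ 1 fun t => T - t
      ).continuous_deriv le_rfl).comp continuous_fst⟩ : C(ℝ × Vec d, ℝ)) = (-1 : ℝ) • 1 := by
    ext z
    simp
  rw [this, hS.isLinearMap_energy.map_smul]
  simp

lemma energy_le_of_mem_relaxedSolutions {S : RelaxedState (ℝ × Vec d) d}
    (hS : S ∈ relaxedSolutions D a γ T ρ₀ m₀) :
    RelaxedState.energy γ S 1 ≤ T * (initialEnergy D a γ ρ₀ m₀).toReal := by
  have := hS.2 (ConstraintTest.remainingTime D T)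
  rw [ConstraintTest.residual_remainingTime hS.1] at this
  linarith

lemma isCompact_relaxedSolutions (ha : 0 < a) (hγ : 1 < γ) :
    IsCompact (relaxedSolutions D a γ T ρ₀ m₀) := by
  have hK := isCompact_relaxed (d := d) (lam := D.spaceTime T) ha hγ (D.isCompact_cylinder T)
    (T * (initialEnergy D a γ ρ₀ m₀).toReal)
  refine hK.of_isClosed_subset ?_ fun S hS => ⟨hS.1, energy_le_of_mem_relaxedSolutions hS⟩
  have : relaxedSolutions D a γ T ρ₀ m₀ = {S | IsRelaxed (D.cylinder T) (D.spaceTime T) a γ S}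
      ∩ ⋂ τ : ConstraintTest D T, {S | τ.residual a γ ρ₀ m₀ S ≤ 0} := by
    ext S
    simp [relaxedSolutions]
  rw [this]
  exact (isClosed_isRelaxed _ _ a γ).inter (isClosed_iInter fun τ =>
    isClosed_le (τ.continuous_residual a γ ρ₀ m₀) continuous_const)

/-- Relaxed solutions exist: by the minimax lemma finitely many constraints can be met up to a small
error, and the relaxed states of bounded energy are compact. -/
theorem relaxedSolutions_nonempty (hT : 0 < T) (ha : 0 < a) (hγ : 1 < γ)
    (hdata : IsFiniteEnergyData D a γ ρ₀ m₀) : (relaxedSolutions D a γ T ρ₀ m₀).Nonempty := by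
  classical
  set E₀ := (initialEnergy D a γ ρ₀ m₀).toReal
  have hK := isCompact_relaxed (d := d) (lam := D.spaceTime T) ha hγ (D.isCompact_cylinder T)
    (T * E₀ + 1)
  set V : ConstraintTest D T × ℕ → Set (RelaxedState (ℝ × Vec d) d) := fun i =>
    {S | i.1.residual a γ ρ₀ m₀ S ≤ 1 / ((i.2 : ℝ) + 1)} with hV
  have hne := hK.inter_iInter_nonempty V
    (fun i => isClosed_le (i.1.continuous_residual a γ ρ₀ m₀) continuous_const) (by
      intro u
      set N := u.sup Prod.snd
      have hδ : (0 : ℝ) < 1 / ((N : ℝ) + 1) := by positivity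
      -- The test `none` is the one that bounds the energy.
      set R : Option u → RelaxedState (ℝ × Vec d) d → ℝ := fun i =>
        (i.elim (ConstraintTest.remainingTime D T) fun i => i.1.1).residual a γ ρ₀ m₀
      obtain ⟨S, hS, hSR⟩ := exists_forall_le_of_combination
        (convex_isRelaxed (d := d) (D.cylinder T) (D.spaceTime T) a γ) R
        (fun i S₁ _ S₂ _ s t _ _ hst => ConstraintTest.residual_convex_combination _ _ _ hst)
        (fun c hc ε hε => by
          obtain ⟨σ, hσ⟩ := ConstraintTest.exists_combination ha hγ hdata Finset.univ c hc
            fun i : Option u => i.elim (ConstraintTest.remainingTime D T) fun i => i.1.1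
          obtain ⟨S, hS, hle⟩ := σ.exists_residual_le hT ha hγ hdata hε
          exact ⟨S, hS, by rw [← hσ S hS]; exact hle⟩) hδ
      refine ⟨S, ⟨hS, ?_⟩, mem_iInter₂.mpr fun i hi => ?_⟩
      · have h1 := hSR none
        have h2 : R none S = S.energy γ 1 - T * E₀ := ConstraintTest.residual_remainingTime hS
        have h3 : 1 / ((N : ℝ) + 1) ≤ 1 := by
          rw [div_le_one (by positivity)]
          linarith [(Nat.cast_nonneg N : (0 : ℝ) ≤ N)]
        linarith
      · have h1 := hSR (some ⟨i, hi⟩)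
        refine le_trans h1 ?_
        have h2 : (i.2 : ℝ) ≤ N := by exact_mod_cast Finset.le_sup (f := Prod.snd) hi
        gcongr)
  obtain ⟨S, hS, hSV⟩ := hne
  refine ⟨S, hS.1, fun τ => ?_⟩
  refine ge_of_tendsto' tendsto_one_div_add_atTop_nhds_zero_nat fun n => ?_
  exact mem_iInter.mp hSV (τ, n)

/-- The time-integrated energy attains its minimum over the relaxed solutions. -/
theorem exists_minimal_relaxedSolution (hT : 0 < T) (ha : 0 < a) (hγ : 1 < γ)
    (hdata : IsFiniteEnergyData D a γ ρ₀ m₀) :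
    ∃ S ∈ relaxedSolutions D a γ T ρ₀ m₀, ∀ S' ∈ relaxedSolutions D a γ T ρ₀ m₀,
      RelaxedState.energy γ S 1 ≤ RelaxedState.energy γ S' 1 :=
  (isCompact_relaxedSolutions ha hγ).exists_isMinOn (relaxedSolutions_nonempty hT ha hγ hdata)
    (continuous_energy γ 1).continuousOn

end Feasible

/-! ### The energy inequality as a statement about functions of time -/

section Time

variable {T E₀ : ℝ} {E : ℝ → ℝ}

/-- The energy inequality in weak form, for nonnegative weights. -/
def WeakDecay (T E₀ : ℝ) (E : ℝ → ℝ) : Prop :=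
  ∀ w : ℝ → ℝ, ContDiff ℝ 1 w → (∀ t ∈ Icc 0 T, 0 ≤ w t) →
    -∫ t in Ioo 0 T, deriv w t * E t ≤ w 0 * E₀

lemma WeakDecay.integral_le (h : WeakDecay T E₀ E) {η : ℝ → ℝ} (hη : Continuous η)
    (hpos : ∀ x ∈ Icc 0 T, 0 ≤ ∫ t in x..T, η t) :
    ∫ t in Ioo 0 T, η t * E t ≤ (∫ t in (0 : ℝ)..T, η t) * E₀ := by
  have hd : ∀ x, HasDerivAt (fun x => ∫ t in x..T, η t) (-η x) x := fun x =>
    intervalIntegral.integral_hasDerivAt_left (hη.intervalIntegrable _ _)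
      (hη.stronglyMeasurableAtFilter _ _) hη.continuousAt
  have hd' : deriv (fun x => ∫ t in x..T, η t) = fun x => -η x := funext fun x => (hd x).deriv
  have := h (fun x => ∫ t in x..T, η t)
    (contDiff_one_iff_deriv.mpr ⟨fun x => (hd x).differentiableAt, by rw [hd']; exact hη.neg⟩) hpos
  simpa [hd', integral_neg] using this

/-- A sequence of bump functions that concentrates at the origin. -/
noncomputable def bumpSeq (n : ℕ) : ContDiffBump (0 : ℝ) where
  rIn := 1 / (2 * ((n : ℝ) + 1))
  rOut := 1 / ((n : ℝ) + 1)
  rIn_pos := by positivity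
  rIn_lt_rOut := by
    apply one_div_lt_one_div_of_lt <;> [positivity; linarith [(Nat.cast_nonneg n : (0 : ℝ) ≤ n)]]

lemma tendsto_bumpSeq_rOut : Tendsto (fun n => (bumpSeq n).rOut) atTop (𝓝 0) :=
  tendsto_one_div_add_atTop_nhds_zero_nat

/-- The smooth kernel centred at `t`. -/
noncomputable def bumpAt (n : ℕ) (t x : ℝ) : ℝ := (bumpSeq n).normed volume (t - x)

lemma continuous_bumpAt (n : ℕ) (t : ℝ) : Continuous (bumpAt n t) :=
  ((bumpSeq n).continuous_normed).comp (by fun_prop)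

lemma bumpAt_nonneg (n : ℕ) (t x : ℝ) : 0 ≤ bumpAt n t x := (bumpSeq n).nonneg_normed _

lemma integral_bumpAt (n : ℕ) (t : ℝ) : ∫ x, bumpAt n t x = 1 := by
  unfold bumpAt
  rw [integral_sub_left_eq_self (fun x => (bumpSeq n).normed volume x) volume t]
  exact (bumpSeq n).integral_normed

lemma integrable_bumpAt (n : ℕ) (t : ℝ) : Integrable (bumpAt n t) :=
  ((bumpSeq n).integrable_normed).comp_sub_left t

lemma bumpAt_eq_zero {n : ℕ} {t x : ℝ} (h : (bumpSeq n).rOut ≤ |t - x|) : bumpAt n t x = 0 := by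
  have : t - x ∉ Function.support ((bumpSeq n).normed volume) := by
    rw [ContDiffBump.support_normed_eq]
    simpa using h
  simpa [bumpAt] using this

/-- The mass of the kernel on an interval that contains its support. -/
lemma integral_bumpAt_eq_one {n : ℕ} {t a b : ℝ} (ha : a ≤ t - (bumpSeq n).rOut)
    (hb : t + (bumpSeq n).rOut ≤ b) : ∫ x in a..b, bumpAt n t x = 1 := by
  have hr := (bumpSeq n).rOut_pos
  rw [intervalIntegral.integral_of_le (by linarith),
      setIntegral_eq_integral_of_forall_compl_eq_zero,
    integral_bumpAt]
  intro x hx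
  refine bumpAt_eq_zero ?_
  rw [mem_Ioc, not_and_or, not_lt, not_le] at hx
  rcases hx with hx | hx
  · exact le_trans (by linarith) (le_abs_self _)
  · exact le_trans (by linarith) (neg_le_abs _)

lemma integral_bumpAt_le_one (n : ℕ) (t : ℝ) {a b : ℝ} (hab : a ≤ b) :
    ∫ x in a..b, bumpAt n t x ≤ 1 := by
  rw [intervalIntegral.integral_of_le hab, ← integral_bumpAt n t]
  exact setIntegral_le_integral (integrable_bumpAt n t) (Eventually.of_forall fun x =>
      bumpAt_nonneg n t x)

/-- Almost every time is a Lebesgue point of an integrable function. -/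
lemma ae_tendsto_integral_bumpAt {g : ℝ → ℝ} (hg : IntegrableOn g (Ioo 0 T)) :
    ∀ᵐ t ∂volume.restrict (Ioo 0 T),
      Tendsto (fun n => ∫ x in Ioo 0 T, bumpAt n t x * g x) atTop (𝓝 (g t)) := by
  have hgi : Integrable ((Ioo 0 T).indicator g) :=
      (integrable_indicator_iff measurableSet_Ioo).mpr hg
  have hconv := ContDiffBump.ae_convolution_tendsto_right_of_locallyIntegrable (μ := volume)
    (φ := bumpSeq) (K := 2) tendsto_bumpSeq_rOut (Eventually.of_forall fun n => by
      simp only [bumpSeq]; apply le_of_eq; field_simp) hgi.locallyIntegrable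
  have hconv' : ∀ n t, convolution ((bumpSeq n).normed volume) ((Ioo 0 T).indicator g)
      (ContinuousLinearMap.lsmul ℝ ℝ) volume t = ∫ x in Ioo 0 T, bumpAt n t x * g x := by
    intro n t
    rw [convolution_lsmul_swap, ← integral_indicator measurableSet_Ioo]
    refine integral_congr_ae (Eventually.of_forall fun x => ?_)
    by_cases hx : x ∈ Ioo 0 T <;> simp [hx, bumpAt]
  simp only [hconv'] at hconv
  filter_upwards [ae_restrict_of_ae hconv, ae_restrict_mem measurableSet_Ioo] with t h1 h3
  simpa only [indicator_of_mem h3] using h1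

lemma integrableOn_continuous_mul {k g : ℝ → ℝ} (hk : Continuous k)
    (hg : IntegrableOn g (Ioo 0 T)) :
    IntegrableOn (fun x => k x * g x) (Ioo 0 T) := by
  obtain ⟨M, hM⟩ := (isCompact_Icc (a := (0 : ℝ)) (b := T)).exists_bound_of_continuousOn
    hk.continuousOn
  exact hg.bdd_mul hk.aestronglyMeasurable ((ae_restrict_iff' measurableSet_Ioo).mpr
    (Eventually.of_forall fun x hx => hM x (Ioo_subset_Icc_self hx)))

/-- The weak energy inequality makes the energy nonincreasing, up to a null set: the weights are
primitives of differences of kernels at two Lebesgue points. -/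
lemma WeakDecay.exists_antitoneOn (hE : IntegrableOn E (Ioo 0 T))
    (hpos : ∀ᵐ t ∂volume.restrict (Ioo 0 T), 0 ≤ E t) (h : WeakDecay T E₀ E) :
    ∃ G ⊆ Ioo 0 T, (∀ᵐ t ∂volume.restrict (Ioo 0 T), t ∈ G) ∧ (∀ t ∈ G, 0 ≤ E t) ∧
      (∀ t ∈ G, E t ≤ E₀) ∧ AntitoneOn E G := by
  set G : Set ℝ := {t | t ∈ Ioo 0 T ∧ 0 ≤ E t ∧
    Tendsto (fun n => ∫ x in Ioo 0 T, bumpAt n t x * E x) atTop (𝓝 (E t))} with hG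
  have hsmall : ∀ δ > 0, ∀ᶠ n in atTop, (bumpSeq n).rOut ≤ δ := fun δ hδ =>
    tendsto_bumpSeq_rOut.eventually_le_const hδ
  refine ⟨G, fun t ht => ht.1, ?_, fun t ht => ht.2.1, fun t ht => ?_, fun s hs t ht hst => ?_⟩
  · filter_upwards [ae_tendsto_integral_bumpAt hE, hpos, ae_restrict_mem measurableSet_Ioo]
      with t h1 h2 h3 using ⟨h3, h2, h1⟩
  · refine le_of_tendsto ht.2.2 ?_
    filter_upwards [hsmall t ht.1.1, hsmall (T - t) (sub_pos.mpr ht.1.2)] with n h1 h2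
    have := h.integral_le (continuous_bumpAt n t) fun x hx =>
      intervalIntegral.integral_nonneg hx.2 fun y _ => bumpAt_nonneg n t y
    rwa [integral_bumpAt_eq_one (by linarith) (by linarith), one_mul] at this
  · rcases hst.eq_or_lt with rfl | hst
    · exact le_rfl
    refine le_of_tendsto_of_tendsto ht.2.2 hs.2.2 ?_
    filter_upwards [hsmall ((t - s) / 2) (by linarith), hsmall s hs.1.1,
      hsmall (T - t) (sub_pos.mpr ht.1.2)] with n h1 h2 h3
    have hci : ∀ r a b, IntervalIntegrable (bumpAt n r) volume a b := fun r a b =>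
      (continuous_bumpAt n r).intervalIntegrable a b
    have hr := (bumpSeq n).rOut_pos
    have := h.integral_le (η := fun x => bumpAt n t x - bumpAt n s x)
      ((continuous_bumpAt n t).sub (continuous_bumpAt n s)) (fun x hx => by
        rw [intervalIntegral.integral_sub (hci _ _ _) (hci _ _ _), sub_nonneg]
        rcases le_or_gt x ((s + t) / 2) with hx2 | hx2
        · rw [integral_bumpAt_eq_one (t := t) (by linarith) (by linarith)]
          exact integral_bumpAt_le_one n s hx.2
        · have : ∫ y in x..T, bumpAt n s y = 0 := by
            refine intervalIntegral.integral_zero_ae (Eventually.of_forall fun y hy => ?_)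
            rw [uIoc_of_le hx.2] at hy
            refine bumpAt_eq_zero (le_trans ?_ (neg_le_abs _))
            have := hy.1
            linarith
          rw [this]
          exact intervalIntegral.integral_nonneg hx.2 fun y _ => bumpAt_nonneg n t y)
    rw [intervalIntegral.integral_sub (hci _ _ _) (hci _ _ _),
      integral_bumpAt_eq_one (by linarith [hs.1.2]) (by linarith),
      integral_bumpAt_eq_one (by linarith) (by linarith [ht.1.2, hst]), sub_self, zero_mul] at this
    have e : ∫ x in Ioo 0 T, (bumpAt n t x - bumpAt n s x) * E x
        = (∫ x in Ioo 0 T, bumpAt n t x * E x) - ∫ x in Ioo 0 T, bumpAt n s x * E x := by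
      simp only [sub_mul]
      exact integral_sub (integrableOn_continuous_mul (continuous_bumpAt n t) hE)
        (integrableOn_continuous_mul (continuous_bumpAt n s) hE)
    rw [e] at this
    linarith

/-- Integration by parts against a nonincreasing function. -/
lemma Antitone.le_integral_deriv_mul {F ψ : ℝ → ℝ} (hF : Antitone F) (hψ : ContDiff ℝ 1 ψ)
    {s t : ℝ} (hst : s ≤ t) (hnn : ∀ x ∈ Icc s t, 0 ≤ ψ x) :
    ψ t * F t - ψ s * F s ≤ ∫ x in s..t, deriv ψ x * F x := by
  have hψ' := hψ.continuous_deriv le_rfl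
  have hint : ∀ u v, IntervalIntegrable (fun x => deriv ψ x * F x) volume u v := fun u v =>
    (hF.intervalIntegrable).continuousOn_mul hψ'.continuousOn
  have hftc : ∀ u v, ∫ x in u..v, deriv ψ x = ψ v - ψ u := fun u v =>
    intervalIntegral.integral_deriv_eq_sub (fun x _ => hψ.differentiable one_ne_zero x)
      (hψ'.intervalIntegrable _ _)
  obtain ⟨M, hM⟩ := (isCompact_Icc (a := s) (b := t)).exists_bound_of_continuousOn hψ'.continuousOn
  have hM0 : 0 ≤ M := (norm_nonneg _).trans (hM s ⟨le_rfl, hst⟩)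
  -- On a short interval the oscillation of `ψ` is at most `δ`, hence at most `ψ + δ`.
  have hshort : ∀ δ > 0, ∀ u v, s ≤ u → u ≤ v → v ≤ t → M * (v - u) ≤ δ →
      (ψ v + δ) * F v - (ψ u + δ) * F u ≤ ∫ x in u..v, deriv ψ x * F x := by
    intro δ hδ u v hu huv hv hMδ
    have h1 : (ψ v - ψ u) * F v - M * (v - u) * (F u - F v) ≤ ∫ x in u..v, deriv ψ x * F x := by
      have h2 : (ψ v - ψ u) * F v - M * (v - u) * (F u - F v)
          = ∫ x in u..v, (deriv ψ x * F v - M * (F u - F v)) := by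
        rw [intervalIntegral.integral_sub ((hψ'.intervalIntegrable _ _).mul_const _)
          intervalIntegrable_const, intervalIntegral.integral_mul_const, hftc,
          intervalIntegral.integral_const, smul_eq_mul]
        ring
      rw [h2]
      refine intervalIntegral.integral_mono_on huv (((hψ'.intervalIntegrable _ _).mul_const _).sub
        intervalIntegrable_const) (hint u v) fun x hx => ?_
      have h3 : F v ≤ F x := hF hx.2
      have h4 : F x ≤ F u := hF hx.1
      have h5 := hM x ⟨hu.trans hx.1, hx.2.trans hv⟩
      rw [Real.norm_eq_abs] at h5
      have h6 := neg_abs_le (deriv ψ x)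
      nlinarith [mul_nonneg (by linarith : 0 ≤ M + deriv ψ x) (sub_nonneg.mpr h3),
        mul_nonneg hM0 (sub_nonneg.mpr h4)]
    have h7 : 0 ≤ F u - F v := sub_nonneg.mpr (hF huv)
    have h8 := hnn u ⟨hu, huv.trans hv⟩
    nlinarith [mul_nonneg h7 (by linarith : 0 ≤ ψ u + δ - M * (v - u))]
  have hchain : ∀ δ > 0, ∀ n : ℕ, ∀ v, s ≤ v → v ≤ t → M * (v - s) ≤ n * δ →
      (ψ v + δ) * F v - (ψ s + δ) * F s ≤ ∫ x in s..v, deriv ψ x * F x := by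
    intro δ hδ n
    induction n with
    | zero =>
      intro v hv hvt hMn
      exact hshort δ hδ s v le_rfl hv hvt (by
        rw [Nat.cast_zero, zero_mul] at hMn
        linarith)
    | succ n ih =>
      intro v hv hvt hMn
      rcases hM0.eq_or_lt with h0 | h0
      · exact hshort δ hδ s v le_rfl hv hvt (by rw [← h0]; linarith)
      set u := max s (v - δ / M) with hu
      have huv : u ≤ v := max_le hv (by have : 0 < δ / M := by positivity
                                        linarith)
      have hsu : s ≤ u := le_max_left _ _
      have h1 := ih u hsu (huv.trans hvt) (by
        rcases max_cases s (v - δ / M) with ⟨h, -⟩ | ⟨h, -⟩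
        · rw [hu, h, sub_self, mul_zero]; positivity
        · rw [hu, h]
          push_cast at hMn
          have : M * (v - δ / M - s) = M * (v - s) - δ := by field_simp; ring
          linarith)
      have h2 := hshort δ hδ u v hsu huv hvt (by
        have : v - δ / M ≤ u := le_max_right _ _
        calc M * (v - u) ≤ M * (δ / M) := by gcongr; linarith
          _ = δ := by field_simp)
      rw [← intervalIntegral.integral_add_adjacent_intervals (hint s u) (hint u v)]
      linarith
  refine le_of_forall_pos_le_add fun ε hε => ?_
  set δ := ε / (F s - F t + 1) with hδ
  have h7 : 0 ≤ F s - F t := sub_nonneg.mpr (hF hst)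
  have hδpos : 0 < δ := by positivity
  obtain ⟨n, hn⟩ := exists_nat_ge (M * (t - s) / δ)
  have h1 := hchain δ hδpos n t hst le_rfl ((div_le_iff₀ hδpos).mp hn)
  have h2 : δ * (F s - F t) ≤ ε := by
    rw [hδ, div_mul_eq_mul_div, div_le_iff₀ (by positivity)]
    nlinarith
  linarith

/-- The weak energy inequality implies the existence of one-sided essential limits of the energy,
and the energy inequality between any two times. -/
theorem WeakDecay.exists_limits (hT : 0 < T) (hE : IntegrableOn E (Ioo 0 T))
    (hpos : ∀ᵐ t ∂volume.restrict (Ioo 0 T), 0 ≤ E t) (h : WeakDecay T E₀ E) :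
    (∀ᵐ t ∂volume.restrict (Ioo 0 T), E t ≤ E₀) ∧
    ∃ Eleft Eright : ℝ → ℝ, Eleft 0 = E₀ ∧
      (∀ τ ∈ Ioo 0 T, Tendsto E (𝓝[<] τ ⊓ ae volume) (𝓝 (Eleft τ))) ∧
      (∀ τ ∈ Ico 0 T, Tendsto E (𝓝[>] τ ⊓ ae volume) (𝓝 (Eright τ))) ∧
      ∀ ψ : ℝ → ℝ, IsTimeTest T ψ → ∀ τ₁ τ₂ : ℝ, 0 ≤ τ₁ → τ₁ ≤ τ₂ → τ₂ < T →
        ψ τ₂ * Eright τ₂ - ψ τ₁ * Eleft τ₁ ≤ ∫ t in τ₁..τ₂, deriv ψ t * E t := by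
  obtain ⟨G, hGsub, hGae, hG0, hGE, hGanti⟩ := h.exists_antitoneOn hE hpos
  -- A monotone representative of the energy on the whole line has one-sided limits everywhere.
  obtain ⟨F, hF, hFG⟩ := hGanti.exists_antitone_extension
    ⟨0, by rintro _ ⟨t, ht, rfl⟩; exact hG0 t ht⟩ ⟨E₀, by rintro _ ⟨t, ht, rfl⟩; exact hGE t ht⟩
  have hEF : ∀ᵐ t ∂volume, t ∈ Ioo 0 T → E t = F t := by
    filter_upwards [(ae_restrict_iff' measurableSet_Ioo).mp hGae] with t ht h1 using hFG (ht h1)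
  have hnear : ∀ τ ∈ Ioo 0 T, ∀ᶠ t in 𝓝 τ, t ∈ Ioo 0 T := fun τ hτ => Ioo_mem_nhds hτ.1 hτ.2
  have hFE : ∀ t ∈ Ioo 0 T, F t ≤ E₀ := by
    intro t ht
    have hne : (volume.restrict (Ioo 0 T)) (Ioo 0 t) ≠ 0 := by
      rw [Measure.restrict_apply measurableSet_Ioo,
        inter_eq_left.mpr (Ioo_subset_Ioo_right ht.2.le)]
      simp [ht.1]
    obtain ⟨s, hs, hsG⟩ := (frequently_ae_mem_iff.mpr hne).and_eventually hGae |>.exists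
    exact (hF hs.2.le).trans ((hFG hsG).symm.le.trans (hGE s hsG))
  have hcongr : ∀ a b, 0 ≤ a → b ≤ T → a ≤ b → ∀ ψ : ℝ → ℝ,
      ∫ t in a..b, deriv ψ t * E t = ∫ t in a..b, deriv ψ t * F t := by
    intro a b ha hb hab ψ
    refine intervalIntegral.integral_congr_ae ?_
    have hbT : ∀ᵐ t ∂(volume : Measure ℝ), t ≠ T := by simp [ae_iff]
    filter_upwards [hEF, hbT] with t h1 h2 ht
    rw [uIoc_of_le hab] at ht
    rw [h1 ⟨ha.trans_lt ht.1, lt_of_le_of_ne (ht.2.trans hb) h2⟩]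
  refine ⟨by filter_upwards [hGae] with t ht using hGE t ht,
    fun τ => if τ = 0 then E₀ else Function.leftLim F τ, Function.rightLim F, by simp,
    fun τ hτ => ?_, fun τ hτ => ?_, fun ψ hψ τ₁ τ₂ h1 h12 h2 => ?_⟩
  · simp only [hτ.1.ne', if_false]
    refine Tendsto.congr' ?_ ((hF.tendsto_leftLim τ).mono_left inf_le_left)
    filter_upwards [mem_inf_of_left (mem_nhdsWithin_of_mem_nhds (hnear τ hτ)),
      mem_inf_of_right hEF] with t h1 h2 using (h2 h1).symm
  · refine Tendsto.congr' ?_ ((hF.tendsto_rightLim τ).mono_left inf_le_left)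
    filter_upwards [mem_inf_of_left (Ioo_mem_nhdsGT hτ.2), mem_inf_of_right hEF] with t h1 h2
    exact (h2 ⟨hτ.1.trans_lt h1.1, h1.2⟩).symm
  · have hψ' := hψ.1.continuous_deriv le_rfl
    have hint : ∀ u v, IntervalIntegrable (fun x => deriv ψ x * F x) volume u v := fun u v =>
      (hF.intervalIntegrable).continuousOn_mul hψ'.continuousOn
    have hprim : Continuous fun t => ∫ x in (0 : ℝ)..t, deriv ψ x * F x :=
      intervalIntegral.continuous_primitive hint 0
    have hsplit : ∀ u v, ∫ x in u..v, deriv ψ x * F x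
        = (∫ x in (0 : ℝ)..v, deriv ψ x * F x) - ∫ x in (0 : ℝ)..u, deriv ψ x * F x := fun u v => by
      rw [← intervalIntegral.integral_interval_sub_left (hint 0 v) (hint 0 u)]
    have hbase : ∀ s t, 0 < s → s ≤ t → t < T →
        ψ t * F t - ψ s * F s ≤ ∫ x in s..t, deriv ψ x * F x := fun s t hs hst ht =>
      Antitone.le_integral_deriv_mul hF hψ.1 hst fun x hx =>
        hψ.2.2 x ⟨hs.le.trans hx.1, hx.2.trans_lt ht⟩
    have hright : ∀ s, 0 < s → s ≤ τ₂ →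
        ψ τ₂ * Function.rightLim F τ₂ - ψ s * F s ≤ ∫ x in s..τ₂, deriv ψ x * F x := by
      intro s hs hsτ
      have hl : Tendsto (fun t => ψ t * F t - ψ s * F s) (𝓝[>] τ₂)
          (𝓝 (ψ τ₂ * Function.rightLim F τ₂ - ψ s * F s)) :=
        ((hψ.1.continuous.continuousWithinAt.tendsto).mul (hF.tendsto_rightLim τ₂)).sub_const _
      have hr : Tendsto (fun t => ∫ x in s..t, deriv ψ x * F x) (𝓝[>] τ₂)
          (𝓝 (∫ x in s..τ₂, deriv ψ x * F x)) :=
        (intervalIntegral.continuous_primitive hint s).continuousWithinAt.tendsto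
      refine le_of_tendsto_of_tendsto hl hr ?_
      filter_upwards [Ioo_mem_nhdsGT h2] with t ht using hbase s t hs (hsτ.trans ht.1.le) ht.2
    rw [hcongr τ₁ τ₂ h1 h2.le h12]
    rcases h1.eq_or_lt with h0 | h0
    · subst h0
      beta_reduce
      rw [if_pos rfl]
      rcases h12.eq_or_lt with h3 | h3
      · subst h3
        have h4 : Function.rightLim F 0 ≤ E₀ := by
          refine le_of_tendsto (hF.tendsto_rightLim 0) ?_
          filter_upwards [Ioo_mem_nhdsGT hT] with t ht using hFE t ht
        have h5 := hψ.2.2 0 ⟨le_rfl, hT⟩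
        rw [intervalIntegral.integral_same]
        nlinarith
      · have hl : Tendsto (fun s => ψ τ₂ * Function.rightLim F τ₂ - ψ s * E₀) (𝓝[>] 0)
            (𝓝 (ψ τ₂ * Function.rightLim F τ₂ - ψ 0 * E₀)) :=
          ((hψ.1.continuous.continuousWithinAt.tendsto).mul_const _).const_sub _
        have hr : Tendsto (fun s => ∫ x in s..τ₂, deriv ψ x * F x) (𝓝[>] 0)
            (𝓝 (∫ x in (0 : ℝ)..τ₂, deriv ψ x * F x)) := by
          have : Continuous fun s => ∫ x in s..τ₂, deriv ψ x * F x := by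
            rw [funext fun s => hsplit s τ₂]
            exact continuous_const.sub hprim
          exact this.continuousWithinAt.tendsto
        refine le_of_tendsto_of_tendsto hl hr ?_
        filter_upwards [Ioo_mem_nhdsGT h3] with s hs
        have h6 := hright s hs.1 hs.2.le
        have h7 := hψ.2.2 s ⟨hs.1.le, hs.2.trans h2⟩
        have h8 := hFE s ⟨hs.1, hs.2.trans h2⟩
        nlinarith
    · beta_reduce
      rw [if_neg h0.ne']
      have hl : Tendsto (fun s => ψ τ₂ * Function.rightLim F τ₂ - ψ s * F s) (𝓝[<] τ₁)
          (𝓝 (ψ τ₂ * Function.rightLim F τ₂ - ψ τ₁ * Function.leftLim F τ₁)) :=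
        ((hψ.1.continuous.continuousWithinAt.tendsto).mul (hF.tendsto_leftLim τ₁)).const_sub _
      have hr : Tendsto (fun s => ∫ x in s..τ₂, deriv ψ x * F x) (𝓝[<] τ₁)
          (𝓝 (∫ x in τ₁..τ₂, deriv ψ x * F x)) := by
        have : Continuous fun s => ∫ x in s..τ₂, deriv ψ x * F x := by
          rw [funext fun s => hsplit s τ₂]
          exact continuous_const.sub hprim
        exact this.continuousWithinAt.tendsto
      refine le_of_tendsto_of_tendsto hl hr ?_
      filter_upwards [Ioo_mem_nhdsLT h0] with s hs using hright s hs.1 (hs.2.le.trans h12)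

/-- The lemma of du Bois-Reymond: a weak form of `a' = b`, `a(0) = A` holds pointwise almost
everywhere. -/
theorem ae_eq_add_integral_of_weak {a b : ℝ → ℝ} {A : ℝ} (ha : IntegrableOn a (Ioo 0 T))
    (hb : IntegrableOn b (Ioo 0 T))
    (h : ∀ ψ : ℝ → ℝ, ContDiff ℝ 1 ψ → (∃ T' < T, ∀ t ≥ T', ψ t = 0) →
      (∫ t in Ioo 0 T, deriv ψ t * a t) + (∫ t in Ioo 0 T, ψ t * b t) = -(ψ 0 * A)) :
    ∀ᵐ t ∂volume.restrict (Ioo 0 T), a t = A + ∫ s in (0 : ℝ)..t, b s := by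
  filter_upwards [ae_tendsto_integral_bumpAt ha, ae_restrict_mem measurableSet_Ioo] with t hlim ht
  set ψ : ℕ → ℝ → ℝ := fun n x => ∫ y in x..T, bumpAt n t y with hψ
  have hd : ∀ n x, HasDerivAt (ψ n) (-bumpAt n t x) x := fun n x =>
    intervalIntegral.integral_hasDerivAt_left ((continuous_bumpAt n t).intervalIntegrable _ _)
      ((continuous_bumpAt n t).stronglyMeasurableAtFilter _ _) (continuous_bumpAt n t).continuousAt
  have hd' : ∀ n, deriv (ψ n) = fun x => -bumpAt n t x := fun n => funext fun x => (hd n x).deriv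
  have hC : ∀ n, ContDiff ℝ 1 (ψ n) := fun n => contDiff_one_iff_deriv.mpr
    ⟨fun x => (hd n x).differentiableAt, by rw [hd']; exact (continuous_bumpAt n t).neg⟩
  have hsmall : ∀ δ > 0, ∀ᶠ n in atTop, (bumpSeq n).rOut ≤ δ := fun δ hδ =>
    tendsto_bumpSeq_rOut.eventually_le_const hδ
  have hafter : ∀ n x, t + (bumpSeq n).rOut ≤ x → t + (bumpSeq n).rOut ≤ T → ψ n x = 0 := by
    intro n x hx hxT
    refine intervalIntegral.integral_zero_ae (Eventually.of_forall fun y hy => ?_)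
    have hy1 : t + (bumpSeq n).rOut ≤ y := by
      rw [mem_uIoc] at hy
      rcases hy with hy | hy <;> linarith [hy.1]
    exact bumpAt_eq_zero (le_trans (by linarith) (neg_le_abs _))
  have hψlim : Tendsto (fun n => ∫ x in Ioo 0 T, ψ n x * b x) atTop
      (𝓝 (∫ s in (0 : ℝ)..t, b s)) := by
    have e : ∫ s in (0 : ℝ)..t, b s = ∫ x in Ioo 0 T, (Iio t).indicator (fun _ => 1) x * b x := by
      have h1 : ∀ x, (Iio t).indicator (fun _ => (1 : ℝ)) x * b x = (Iio t).indicator b x :=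
          fun x => by
        by_cases hx : x ∈ Iio t <;> simp [indicator, hx]
      simp only [h1]
      rw [setIntegral_indicator measurableSet_Iio, intervalIntegral.integral_of_le ht.1.le,
        integral_Ioc_eq_integral_Ioo]
      congr 2
      ext x
      simp only [mem_Ioo, mem_inter_iff, mem_Iio]
      exact ⟨fun h => ⟨⟨h.1, h.2.trans ht.2⟩, h.2⟩, fun h => ⟨h.1.1, h.2⟩⟩
    rw [e]
    refine tendsto_integral_of_dominated_convergence (fun x => |b x|) (fun n =>
      (integrableOn_continuous_mul (hC n).continuous hb).aestronglyMeasurable) hb.abs ?_ ?_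
    · intro n
      filter_upwards [ae_restrict_mem measurableSet_Ioo] with x hx
      rw [norm_mul, Real.norm_eq_abs, Real.norm_eq_abs]
      refine mul_le_of_le_one_left (abs_nonneg _) ?_
      rw [abs_of_nonneg (intervalIntegral.integral_nonneg hx.2.le fun y _ => bumpAt_nonneg n t y)]
      exact integral_bumpAt_le_one n t hx.2.le
    · have hne : ∀ᵐ x ∂volume.restrict (Ioo 0 T), x ≠ t := ae_restrict_of_ae (by simp [ae_iff])
      filter_upwards [ae_restrict_mem measurableSet_Ioo, hne] with x hx hxt
      refine Tendsto.mul_const _ (tendsto_const_nhds.congr' ?_)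
      rcases lt_or_gt_of_ne hxt with hlt | hlt
      · filter_upwards [hsmall (t - x) (by linarith), hsmall (T - t) (by linarith [ht.2])]
          with n h1 h2
        rw [indicator_of_mem (by exact hlt), hψ]
        exact (integral_bumpAt_eq_one (by linarith) (by linarith)).symm
      · filter_upwards [hsmall (x - t) (by linarith), hsmall (T - t) (by linarith [ht.2])]
          with n h1 h2
        rw [indicator_of_notMem (by simpa using hlt.le)]
        exact (hafter n x (by linarith) (by linarith)).symm
  have hev : ∀ᶠ n in atTop, ∫ x in Ioo 0 T, bumpAt n t x * a x
      = A + ∫ x in Ioo 0 T, ψ n x * b x := by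
    filter_upwards [hsmall (t / 2) (by linarith [ht.1]), hsmall ((T - t) / 2) (by linarith [ht.2])]
      with n h1 h2
    have h3 := h (ψ n) (hC n) ⟨t + (bumpSeq n).rOut, by linarith [ht.2], fun x hx =>
      hafter n x hx (by linarith [ht.2])⟩
    have h4 : ψ n 0 = 1 := integral_bumpAt_eq_one (by linarith [ht.1]) (by linarith [ht.2])
    rw [hd', h4] at h3
    simp only [neg_mul, integral_neg] at h3
    linarith
  exact tendsto_nhds_unique hlim ((hψlim.const_add A).congr' (hev.mono fun n hn => hn.symm))

end Time

/-! ### Representatives on the torus -/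

section Wrap

variable {d : ℕ}

/-- The point of the cell `[-1,1)^d` that represents the same point of the torus as `x`. -/
noncomputable def cellPoint (x : Vec d) : Vec d :=
  WithLp.toLp 2 fun i => toIcoMod (zero_lt_two : (0 : ℝ) < 2) (-1) (x i)

lemma cellPoint_apply (x : Vec d) (i : Fin d) :
    cellPoint x i = toIcoMod (zero_lt_two : (0 : ℝ) < 2) (-1) (x i) := rfl

lemma cellPoint_mem_Ico (x : Vec d) (i : Fin d) : cellPoint x i ∈ Ico (-1 : ℝ) 1 := by
  have := toIcoMod_mem_Ico (zero_lt_two : (0 : ℝ) < 2) (-1) (x i)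
  rw [cellPoint_apply]
  convert! this using 2
  norm_num

lemma cellPoint_mem (x : Vec d) : cellPoint x ∈ cell d := fun i => cellPoint_mem_Ico x i

lemma measurable_cellPoint : Measurable (cellPoint : Vec d → Vec d) := by
  refine (WithLp.measurable_toLp 2 _).comp (measurable_pi_lambda _ fun i => ?_)
  simp only [toIcoMod_eq_add_fract_mul]
  have : Measurable fun x : Vec d => x i := (EuclideanSpace.proj (𝕜 := ℝ) i).continuous.measurable
  exact measurable_const.add ((measurable_fract.comp ((this.sub_const _).div_const _)).mul_const _)

/-- The lattice vector by which `x` differs from its representative. -/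
lemma exists_cellPoint_eq (x : Vec d) :
    ∃ k : Fin d → ℤ, x = cellPoint x + ∑ i, (k i : ℝ) • ((2 : ℝ) • basisVec i) := by
  refine ⟨fun i => toIcoDiv (zero_lt_two : (0 : ℝ) < 2) (-1) (x i), ?_⟩
  ext j
  have h := toIcoMod_add_toIcoDiv_zsmul (zero_lt_two : (0 : ℝ) < 2) (-1) (x j)
  simp only [zsmul_eq_mul] at h
  simp only [PiLp.add_apply, cellPoint_apply, WithLp.ofLp_sum, Finset.sum_apply, PiLp.smul_apply,
    basisVec, PiLp.single_apply, smul_eq_mul, mul_ite, mul_one, mul_zero,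
    Finset.sum_ite_eq, Finset.mem_univ, if_true]
  exact h.symm

lemma cellPoint_eq_of_mem {x y : Vec d} (hy : y ∈ cell d) (k : Fin d → ℤ)
    (h : ∀ i, x i = y i + k i * 2) : cellPoint x = y := by
  ext i
  rw [cellPoint_apply, toIcoMod_eq_iff]
  refine ⟨by have := hy i; convert! this using 2; norm_num, k i, ?_⟩
  rw [h i, zsmul_eq_mul]

lemma cellPoint_eq_self {x : Vec d} (hx : x ∈ cell d) : cellPoint x = x :=
  cellPoint_eq_of_mem hx 0 fun i => by simp

lemma cellPoint_add_two_smul (x : Vec d) (i : Fin d) :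
    cellPoint (x + (2 : ℝ) • basisVec i) = cellPoint x := by
  ext j
  rw [cellPoint_apply, cellPoint_apply, PiLp.add_apply, PiLp.smul_apply, basisVec,
    PiLp.single_apply]
  split_ifs
  · simp
  · simp

/-- A function with period `2` in every variable takes the same value at representatives of a point
of the torus. -/
lemma eq_comp_cellPoint {F : Type} {f : Vec d → F}
    (hf : ∀ x i, f (x + (2 : ℝ) • basisVec i) = f x) (x : Vec d) : f (cellPoint x) = f x := by
  obtain ⟨k, hk⟩ := exists_cellPoint_eq x
  have h1 : ∀ (i : Fin d) (n : ℤ) (y : Vec d), f (y + (n : ℝ) • ((2 : ℝ) • basisVec i)) = f y := by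
    intro i n y
    have := (show Function.Periodic f ((2 : ℝ) • basisVec i) from fun y => hf y i).zsmul n y
    rwa [← Int.cast_smul_eq_zsmul ℝ] at this
  have h2 : ∀ (s : Finset (Fin d)) (y : Vec d),
      f (y + ∑ i ∈ s, (k i : ℝ) • ((2 : ℝ) • basisVec i)) = f y := by
    classical
    intro s
    induction s using Finset.induction_on with
    | empty => simp
    | insert i s hi ih =>
      intro y
      rw [Finset.sum_insert hi, ← add_assoc, ih, h1]
  conv_rhs => rw [hk]
  exact (h2 _ _).symm

/-- A function with compact support in the open cell extends periodically, with the same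
regularity. -/
lemma contDiff_comp_cellPoint {g : Vec d → ℝ} (hg : ContDiff ℝ 1 g) (hc : HasCompactSupport g)
    (hsupp : tsupport g ⊆ {x | ∀ i, x i ∈ Ioo (-1 : ℝ) 1}) : ContDiff ℝ 1 (g ∘ cellPoint) := by
  have hcoord : ∀ i : Fin d, Continuous fun x : Vec d => x i :=
    fun i => (EuclideanSpace.proj (𝕜 := ℝ) i).continuous
  refine contDiff_iff_contDiffAt.mpr fun x => ?_
  by_cases hx : ∀ i, cellPoint x i ∈ Ioo (-1 : ℝ) 1
  · obtain ⟨k, hk⟩ := exists_cellPoint_eq x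
    set v := ∑ i, (k i : ℝ) • ((2 : ℝ) • basisVec (d := d) i) with hv
    have hvi : ∀ i, v i = k i * 2 := fun j => by
      simp only [hv, WithLp.ofLp_sum, Finset.sum_apply, PiLp.smul_apply, basisVec,
        PiLp.single_apply, smul_eq_mul, mul_ite, mul_one, mul_zero, Finset.sum_ite_eq,
        Finset.mem_univ, if_true]
    have hev : ∀ᶠ y in 𝓝 x, ∀ i, (y - v) i ∈ Ioo (-1 : ℝ) 1 := by
      refine eventually_all.mpr fun i => ?_
      have h1 : x - v = cellPoint x := by rw [sub_eq_iff_eq_add]; exact hk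
      have h2 : ContinuousAt (fun y : Vec d => (y - v) i) x :=
        ((hcoord i).comp (continuous_id.sub continuous_const)).continuousAt
      exact h2.eventually (isOpen_Ioo.mem_nhds (by beta_reduce; rw [h1]; exact hx i))
    have : (g ∘ cellPoint) =ᶠ[𝓝 x] fun y => g (y - v) := by
      filter_upwards [hev] with y hy
      rw [Function.comp, cellPoint_eq_of_mem (y := y - v) (fun i => Ioo_subset_Ico_self (hy i)) k]
      intro i
      simp [hvi]
    exact (hg.comp (contDiff_id.sub contDiff_const)).contDiffAt.congr_of_eventuallyEq this
  · push Not at hx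
    obtain ⟨i, hi⟩ := hx
    have hxi : cellPoint x i = -1 := by
      have h1 := cellPoint_mem_Ico x i
      by_contra hne
      exact hi ⟨lt_of_le_of_ne h1.1 (Ne.symm hne), h1.2⟩
    have hcos : ∀ y : Vec d, Real.cos (Real.pi * cellPoint y i) = Real.cos (Real.pi * y i) := by
      intro y
      have h := toIcoMod_add_toIcoDiv_zsmul (zero_lt_two : (0 : ℝ) < 2) (-1) (y i)
      rw [← cellPoint_apply, zsmul_eq_mul] at h
      rw [← h, mul_add, show Real.pi * ((toIcoDiv (zero_lt_two : (0 : ℝ) < 2) (-1) (y i) : ℝ) * 2)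
        = (toIcoDiv (zero_lt_two : (0 : ℝ) < 2) (-1) (y i) : ℝ) * (2 * Real.pi) by ring,
        Real.cos_add_int_mul_two_pi]
    -- On the support, `cos (π y_i)` stays away from the value `-1` at the boundary of the cell.
    obtain ⟨c, hc1, hcK⟩ : ∃ c : ℝ, -1 < c ∧ ∀ y ∈ tsupport g, c ≤ Real.cos (Real.pi * y i) := by
      rcases (tsupport g).eq_empty_or_nonempty with he | hne
      · exact ⟨0, by norm_num, by simp [he]⟩
      · obtain ⟨y, hy, hmin⟩ := hc.isCompact.exists_isMinOn hne
          (Real.continuous_cos.comp (continuous_const.mul (hcoord i))).continuousOn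
        refine ⟨_, ?_, fun z hz => hmin hz⟩
        have hyi := hsupp hy i
        refine lt_of_le_of_ne (Real.neg_one_le_cos _) fun h => ?_
        obtain ⟨n, hn⟩ := Real.cos_eq_neg_one_iff.mp h.symm
        have h2 : y i = 1 + n * 2 := by
          refine mul_left_cancel₀ Real.pi_pos.ne' (Eq.trans hn.symm ?_)
          ring
        have h3 : (-2 : ℝ) < n * 2 := by linarith [hyi.1]
        have h4 : (n : ℝ) * 2 < 0 := by linarith [hyi.2]
        have h5 : (-1 : ℝ) < n := by linarith
        have h6 : (n : ℝ) < 0 := by linarith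
        have h7 : (-1 : ℤ) < n := by exact_mod_cast h5
        have h8 : n < (0 : ℤ) := by exact_mod_cast h6
        omega
    have hev : ∀ᶠ y in 𝓝 x, Real.cos (Real.pi * y i) < c := by
      have h1 : ContinuousAt (fun y : Vec d => Real.cos (Real.pi * y i)) x :=
        (Real.continuous_cos.comp (continuous_const.mul (hcoord i))).continuousAt
      refine h1.eventually (isOpen_Iio.mem_nhds ?_)
      beta_reduce
      rw [← hcos x, hxi, mem_Iio]
      simpa using hc1
    have : (g ∘ cellPoint) =ᶠ[𝓝 x] fun _ => 0 := by
      filter_upwards [hev] with y hy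
      by_contra hne
      have := hcK _ (subset_tsupport g hne)
      rw [hcos] at this
      linarith
    exact contDiffAt_const.congr_of_eventuallyEq this

namespace FlowRegion

/-- The map that identifies the points of the closed region that represent the same point of the
flow region. -/
noncomputable def wrap (D : FlowRegion d) : Vec d → Vec d :=
  match D with
  | domain _ _ _ _ _ => id
  | torus => cellPoint

lemma measurable_wrap (D : FlowRegion d) : Measurable D.wrap := by
  cases D
  · exact measurable_id
  · exact measurable_cellPoint

lemma wrap_mem (D : FlowRegion d) {x : Vec d} (hx : x ∈ D.closedRegion) :
    D.wrap x ∈ D.closedSet := by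
  cases D
  · exact hx
  · exact cellPoint_mem x

lemma measurableSet_closedSet (D : FlowRegion d) : MeasurableSet D.closedSet := by
  cases D
  · exact isClosed_closure.measurableSet
  · exact measurableSet_cell

lemma interiorSet_subset_closedSet (D : FlowRegion d) : D.interiorSet ⊆ D.closedSet := by
  cases D
  · exact subset_closure
  · exact subset_rfl

lemma closedSet_subset_closedRegion (D : FlowRegion d) : D.closedSet ⊆ D.closedRegion := by
  cases D
  · exact subset_rfl
  · exact subset_closure

lemma IsPeriodic.comp_wrap {D : FlowRegion d} {F : Type} {φ : ℝ → Vec d → F}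
    (h : D.IsPeriodic φ) (t : ℝ) (x : Vec d) : φ t (D.wrap x) = φ t x := by
  cases D
  · rfl
  · exact eq_comp_cellPoint (h t) x

lemma IsPeriodic.partialD {D : FlowRegion d} {φ : ℝ → Vec d → Vec d} (h : D.IsPeriodic φ)
    (i j : Fin d) : D.IsPeriodic fun t x => EulerDiss.partialD (φ t) x i j := by
  cases D
  · trivial
  · intro t x k
    have : (fun y => φ t (y + (2 : ℝ) • basisVec k)) = φ t := funext fun y => h t y k
    simp only [EulerDiss.partialD]
    rw [← fderiv_comp_add_right, this]

lemma IsPeriodic.divergence {D : FlowRegion d} {φ : ℝ → Vec d → Vec d} (h : D.IsPeriodic φ) :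
    D.IsPeriodic fun t x => EulerDiss.divergence (φ t) x := by
  cases D
  · trivial
  · exact fun t x k => Finset.sum_congr rfl fun i _ => IsPeriodic.partialD (D := torus) h i i t x k

/-- The open set that agrees with the flow region up to a null set. -/
def openSet (D : FlowRegion d) : Set (Vec d) :=
  match D with
  | domain Ω _ _ _ _ => Ω
  | torus => {x | ∀ i, x i ∈ Ioo (-1 : ℝ) 1}

lemma isOpen_openSet (D : FlowRegion d) : IsOpen D.openSet := by
  cases D
  · assumption
  · simp only [openSet, Set.ofPred_forall]
    exact isOpen_iInter_of_finite fun i =>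
      isOpen_Ioo.preimage (EuclideanSpace.proj (𝕜 := ℝ) i).continuous

lemma openSet_subset (D : FlowRegion d) : D.openSet ⊆ D.interiorSet := by
  cases D
  · exact subset_rfl
  · exact fun x hx i => Ioo_subset_Ico_self (hx i)

lemma ae_mem_openSet (D : FlowRegion d) : ∀ᵐ x ∂D.vol, x ∈ D.openSet := by
  cases D with
  | domain Ω h => exact ae_restrict_mem h.measurableSet
  | torus =>
    have h : ∀ i : Fin d, ∀ᵐ x : Vec d, x i ≠ -1 := by
      intro i
      have h1 := (Measure.ae_eval_ne (fun _ : Fin d => (volume : Measure ℝ)) i (-1))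
      have h2 := (EuclideanSpace.volume_preserving_symm_measurableEquiv_toLp
          (Fin d)).quasiMeasurePreserving.ae h1
      exact h2
    have h' : ∀ᵐ x ∂(torus : FlowRegion d).vol, ∀ i : Fin d, x i ≠ -1 :=
      ae_restrict_of_ae (ae_all_iff.mpr h)
    filter_upwards [h', (torus : FlowRegion d).ae_mem_interiorSet] with x hx hx2 i
    exact ⟨lt_of_le_of_ne (hx2 i).1 (Ne.symm (hx i)), (hx2 i).2⟩

/-- Functions with compact support in the flow region are, up to their values outside, admissible
test functions in space. -/
lemma exists_spatialTest (D : FlowRegion d) {g : Vec d → ℝ} (hg : ContDiff ℝ 1 g)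
    (hc : HasCompactSupport g) (hsupp : tsupport g ⊆ D.openSet) :
    ∃ g' : Vec d → ℝ, ContDiff ℝ 1 g' ∧ (∀ x ∈ D.interiorSet, g' x = g x) ∧
      (D.IsPeriodic fun _ => g') ∧ ∀ (T : ℝ) (v : Vec d), D.IsPeriodic (fun _ x => g' x • v) ∧
        D.IsTangential T fun _ x => g' x • v := by
  cases D with
  | domain Ω h1 h2 h3 h4 =>
    refine ⟨g, hg, fun _ _ => rfl, trivial, fun T v => ⟨trivial, ?_⟩⟩
    intro t _ x hx n _
    have : g x = 0 := by
      by_contra hne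
      exact (h1.frontier_eq ▸ hx).2 (hsupp (subset_tsupport g hne))
    simp [this]
  | torus =>
    refine ⟨g ∘ cellPoint, contDiff_comp_cellPoint hg hc hsupp,
      fun x hx => congrArg g (cellPoint_eq_self hx), fun _ x i => ?_,
      fun T v => ⟨fun _ x i => ?_, trivial⟩⟩ <;>
    simp only [Function.comp, cellPoint_add_two_smul]

end FlowRegion

end Wrap

/-! ### Smooth functions with compact support in the flow region -/

section TestFunctions

variable {d : ℕ} {D : FlowRegion d}

/-- Smooth functions with compact support in the flow region. -/
structure FlowRegion.IsBump (D : FlowRegion d) (g : Vec d → ℝ) : Prop where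
  contDiff : ContDiff ℝ (⊤ : ℕ∞) g
  compact : HasCompactSupport g
  support : tsupport g ⊆ D.openSet

lemma FlowRegion.exists_isBump_eLpNorm_le (D : FlowRegion d) {q : ℝ≥0∞} (hq : q ≠ ∞) (hq1 : 1 ≤ q)
    {g : Vec d → ℝ} (hg : MemLp g q D.vol) {ε : ℝ} (hε : 0 < ε) :
    ∃ g', D.IsBump g' ∧ eLpNorm (g - g') q D.vol ≤ ENNReal.ofReal ε := by
  obtain ⟨g₁, hc₁, hs₁, hle₁⟩ := hg.exist_eLpNorm_sub_le hq hq1 (half_pos hε)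
  obtain ⟨M, hM⟩ := hc₁.exists_bound_of_continuous hs₁.continuous
  obtain ⟨η, hη, hη'⟩ := exists_eLpNorm_indicator_le (μ := D.vol) hq M
    (ε := ENNReal.ofReal (ε / 2)) (by simpa using hε)
  obtain ⟨K, hKsub, hK, hKη⟩ := D.isOpen_openSet.measurableSet.exists_isCompact_sdiff_lt
    (μ := D.vol) (measure_ne_top _ _) (ENNReal.coe_pos.mpr hη).ne'
  obtain ⟨L, hL, hKL, hLsub⟩ := exists_compact_between hK D.isOpen_openSet hKsub
  obtain ⟨χ, hχ0, hχ1, hχ⟩ := exists_contMDiffMap_zero_one_of_isClosed (n := (⊤ : ℕ∞))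
    (modelWithCornersSelf ℝ (Vec d)) (s := (interior L)ᶜ) (t := K) isOpen_interior.isClosed_compl
    hK.isClosed (disjoint_compl_left_iff_subset.mpr hKL)
  have hsuppχ : tsupport (χ : Vec d → ℝ) ⊆ L := by
    refine closure_minimal (fun x hx => ?_) hL.isClosed
    by_contra hxL
    exact hx (hχ0 fun h => hxL (interior_subset h))
  have hsupp : tsupport (fun x => χ x * g₁ x) ⊆ L :=
    (tsupport_mul_subset_left (f := (χ : Vec d → ℝ)) (g := g₁)).trans hsuppχ
  refine ⟨fun x => χ x * g₁ x, ⟨χ.contMDiff.contDiff.mul hs₁,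
    hL.of_isClosed_subset (isClosed_tsupport _) hsupp, hsupp.trans hLsub⟩, ?_⟩
  have e : g - (fun x => χ x * g₁ x) = (g - g₁) + fun x => (1 - χ x) * g₁ x := by
    ext x; simp; ring
  rw [e]
  have hcont : Continuous fun x => (1 - χ x) * g₁ x :=
    (continuous_const.sub χ.contMDiff.continuous).mul hs₁.continuous
  refine (eLpNorm_add_le (hg.aestronglyMeasurable.sub hs₁.continuous.aestronglyMeasurable)
    hcont.aestronglyMeasurable hq1).trans ?_
  have h2 : eLpNorm (fun x => (1 - χ x) * g₁ x) q D.vol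
      ≤ eLpNorm ((D.openSet \ K).indicator fun _ => M) q D.vol := by
    refine eLpNorm_mono_ae ?_
    filter_upwards [D.ae_mem_openSet] with x hx
    by_cases hxK : x ∈ K
    · simp [hχ1 hxK]
    · rw [indicator_of_mem (show x ∈ D.openSet \ K from ⟨hx, hxK⟩), norm_mul]
      have h3 := hχ x
      have h4 : ‖1 - χ x‖ ≤ 1 := by
        rw [Real.norm_eq_abs, abs_le]; constructor <;> linarith [h3.1, h3.2]
      calc ‖1 - χ x‖ * ‖g₁ x‖ ≤ 1 * M := by gcongr; exact hM x
        _ ≤ ‖M‖ := by rw [one_mul]; exact le_abs_self M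
  calc _ ≤ ENNReal.ofReal (ε / 2) + ENNReal.ofReal (ε / 2) :=
        add_le_add hle₁ (h2.trans (hη' _ hKη.le))
    _ = ENNReal.ofReal ε := by
        rw [← ENNReal.ofReal_add (half_pos hε).le (half_pos hε).le, add_halves]

/-- Hölder's inequality in terms of `eLpNorm`. -/
lemma abs_integral_mul_le {α : Type} [MeasurableSpace α] {μ : Measure α} {p q : ℝ}
    (hpq : p.HolderConjugate q) {f g : α → ℝ} (hf : MemLp f (ENNReal.ofReal p) μ)
    (hg : MemLp g (ENNReal.ofReal q) μ) :
    |∫ x, f x * g x ∂μ|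
      ≤ (eLpNorm f (ENNReal.ofReal p) μ).toReal * (eLpNorm g (ENNReal.ofReal q) μ).toReal := by
  have : ENNReal.HolderTriple (ENNReal.ofReal p) (ENNReal.ofReal q) 1 := hpq.ennrealOfReal
  have h1 : eLpNorm (f • g) 1 μ
      ≤ eLpNorm f (ENNReal.ofReal p) μ * eLpNorm g (ENNReal.ofReal q) μ :=
    eLpNorm_smul_le_mul_eLpNorm hg.aestronglyMeasurable hf.aestronglyMeasurable
  have h2 : ‖∫ x, f x * g x ∂μ‖ₑ ≤ eLpNorm (f • g) 1 μ := by
    rw [eLpNorm_one_eq_lintegral_enorm]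
    exact enorm_integral_le_lintegral_enorm _
  have h3 := h2.trans h1
  rw [← ENNReal.toReal_mul]
  have h4 := ENNReal.toReal_mono (ENNReal.mul_ne_top hf.eLpNorm_ne_top hg.eLpNorm_ne_top) h3
  rwa [toReal_enorm] at h4

/-- A bounded family in `L^p` whose integrals against smooth functions depend continuously on time
is weakly continuous. -/
lemma continuousOn_integral_mul {p q : ℝ} (hpq : p.HolderConjugate q) {f : ℝ → Vec d → ℝ}
    {s : Set ℝ} {C : ℝ} (hf : ∀ t ∈ s, MemLp (f t) (ENNReal.ofReal p) D.vol)
    (hC : ∀ t ∈ s, (eLpNorm (f t) (ENNReal.ofReal p) D.vol).toReal ≤ C)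
    (hcont : ∀ g, D.IsBump g → ContinuousOn (fun t => ∫ x, f t x * g x ∂D.vol) s)
    {g : Vec d → ℝ} (hg : MemLp g (ENNReal.ofReal q) D.vol) :
    ContinuousOn (fun t => ∫ x, f t x * g x ∂D.vol) s := by
  refine continuousOn_of_uniform_approx_of_continuousOn fun u hu => ?_
  obtain ⟨ε, hε, hεu⟩ := Metric.mem_uniformity_dist.mp hu
  have hC' : 0 < |C| + 1 := by positivity
  have hq1 : 1 ≤ ENNReal.ofReal q := by
    rw [← ENNReal.ofReal_one]; exact ENNReal.ofReal_le_ofReal hpq.symm.lt.le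
  obtain ⟨g', hg', hle⟩ := D.exists_isBump_eLpNorm_le ENNReal.ofReal_ne_top hq1 hg
    (ε := ε / 2 / (|C| + 1)) (by positivity)
  refine ⟨fun t => ∫ x, f t x * g' x ∂D.vol, hcont g' hg', fun t ht => hεu ?_⟩
  have hg'm : MemLp g' (ENNReal.ofReal q) D.vol :=
    hg'.contDiff.continuous.memLp_of_hasCompactSupport hg'.compact
  have : ENNReal.HolderTriple (ENNReal.ofReal p) (ENNReal.ofReal q) 1 := hpq.ennrealOfReal
  have hi : Integrable (fun x => f t x * g x) D.vol := (hf t ht).integrable_mul hg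
  have hi' : Integrable (fun x => f t x * g' x) D.vol := (hf t ht).integrable_mul hg'm
  rw [Real.dist_eq, ← integral_sub hi hi']
  have e : ∫ x, (f t x * g x - f t x * g' x) ∂D.vol = ∫ x, f t x * (g - g') x ∂D.vol :=
    integral_congr_ae (.of_forall fun x => by simp only [Pi.sub_apply]; ring)
  rw [e]
  have h2 : (eLpNorm (g - g') (ENNReal.ofReal q) D.vol).toReal ≤ ε / 2 / (|C| + 1) :=
    ENNReal.toReal_le_of_le_ofReal (by positivity) hle
  calc _ ≤ _ := abs_integral_mul_le hpq (hf t ht) (hg.sub hg'm)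
    _ ≤ (|C| + 1) * (ε / 2 / (|C| + 1)) := by
        gcongr
        exact (hC t ht).trans ((le_abs_self C).trans (by linarith))
    _ = ε / 2 := by field_simp
    _ < ε := half_lt_self hε

/-- Countably many test functions suffice to recognize that a function vanishes. -/
lemma FlowRegion.exists_countable_isBump (D : FlowRegion d) :
    ∃ G : Set (Vec d → ℝ), G.Countable ∧ (∀ g ∈ G, D.IsBump g) ∧
      ∀ h : Vec d → ℝ, Integrable h D.vol → (∀ g ∈ G, ∫ x, h x * g x ∂D.vol = 0) →
        h =ᵐ[D.vol] 0 := by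
  obtain ⟨c, hcsub, hcc, hcdense⟩ := (TopologicalSpace.IsSeparable.of_separableSpace
    {g : C(Vec d, ℝ) | D.IsBump g}).exists_countable_dense_subset
  refine ⟨(fun g : C(Vec d, ℝ) => (g : Vec d → ℝ)) '' c, hcc.image _, ?_, fun h hh h0 => ?_⟩
  · rintro _ ⟨g, hg, rfl⟩
    exact hcsub hg
  -- The bumps are a subset of the separable space of continuous functions, so that a countable
  -- set of them is dense for uniform convergence on the closed region.
  have hzero : ∀ g, D.IsBump g → ∫ x, h x * g x ∂D.vol = 0 := by
    intro g hg
    set g₀ : C(Vec d, ℝ) := ⟨g, hg.contDiff.continuous⟩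
    have hmem : g₀ ∈ closure c := hcdense hg
    by_contra hne
    set I := ∫ x, ‖h x‖ ∂D.vol with hI
    have hI0 : 0 ≤ I := integral_nonneg fun x => norm_nonneg _
    set ε := |∫ x, h x * g x ∂D.vol| / (I + 1) with hε
    have hεpos : 0 < ε := div_pos (abs_pos.mpr hne) (by linarith)
    have hev : ∀ᶠ g' : C(Vec d, ℝ) in 𝓝 g₀, ∀ x ∈ D.closedRegion, dist (g₀ x) (g' x) < ε :=
      Metric.tendstoUniformlyOn_iff.mp
        (ContinuousMap.tendsto_iff_forall_isCompact_tendstoUniformlyOn.mp tendsto_id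
          D.closedRegion D.isCompact_closedRegion) ε hεpos
    obtain ⟨g', hg', hg'c⟩ := (mem_closure_iff_frequently.mp hmem).and_eventually hev |>.exists
    have hi : ∀ k : C(Vec d, ℝ), Integrable (fun x => h x * k x) D.vol := fun k => by
      simpa [mul_comm] using integrable_continuousMap_mul D.isCompact_closedRegion D.vol_compl k hh
    have h1 : ∫ x, h x * g x ∂D.vol = ∫ x, h x * (g₀ x - g' x) ∂D.vol := by
      have h2 := h0 _ ⟨g', hg', rfl⟩
      have h3 : ∫ x, (h x * g₀ x - h x * g' x) ∂D.vol
          = ∫ x, h x * g₀ x ∂D.vol - ∫ x, h x * g' x ∂D.vol := integral_sub (hi g₀) (hi g')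
      simp only [mul_sub]
      rw [h3, h2, sub_zero]
      rfl
    have h4 : |∫ x, h x * g x ∂D.vol| ≤ I * ε := by
      rw [h1, ← Real.norm_eq_abs, hI, ← integral_mul_const]
      refine norm_integral_le_of_norm_le (hh.norm.mul_const _) ?_
      filter_upwards [D.ae_mem_interiorSet] with x hx
      rw [norm_mul, Real.norm_eq_abs (g₀ x - g' x)]
      exact mul_le_mul_of_nonneg_left (hg'c x (subset_closure hx)).le (norm_nonneg _)
    have h5 : |∫ x, h x * g x ∂D.vol| = (I + 1) * ε := by rw [hε]; field_simp
    nlinarith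
  have hloc : LocallyIntegrableOn h D.openSet (volume : Measure (Vec d)) := by
    have : IntegrableOn h D.openSet := by
      have h1 : IntegrableOn h D.interiorSet := hh
      exact h1.mono_set D.openSet_subset
    exact this.locallyIntegrableOn
  have hae := D.isOpen_openSet.ae_eq_zero_of_integral_contDiff_smul_eq_zero hloc
    fun g hg hgc hgs => by
      have hz := hzero g ⟨hg, hgc, hgs⟩
      rw [FlowRegion.vol, setIntegral_eq_integral_of_forall_compl_eq_zero] at hz
      · simpa [mul_comm] using hz
      · intro x hx
        have : g x = 0 := by
          by_contra hne
          exact hx (D.openSet_subset (hgs (subset_tsupport g hne)))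
        simp [this]
  filter_upwards [ae_restrict_of_ae (s := D.interiorSet) hae, D.ae_mem_openSet] with x hx hx'
  exact hx hx'

end TestFunctions

/-! ### Disintegration of the defects in time -/

section Disintegration

open ProbabilityTheory

variable {d : ℕ}

/-- A measure on space-time whose time marginal is bounded by a multiple of `lam` is a family of
bounded measures on space, integrated with respect to `lam`. -/
lemma exists_kernel_of_fst_le {μ : Measure (ℝ × Vec d)} [IsFiniteMeasure μ] {lam : Measure ℝ}
    [IsFiniteMeasure lam] {C : ℝ≥0} (h : μ.fst ≤ C • lam) :
    ∃ ν : Kernel ℝ (Vec d), (∀ t, ν t univ ≤ C) ∧ μ = lam ⊗ₘ ν := by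
  set θ : ℝ → ℝ≥0∞ := fun t => min (μ.fst.rnDeriv lam t) C with hθ
  have hθm : Measurable θ := (Measure.measurable_rnDeriv _ _).min measurable_const
  have hac : μ.fst ≪ lam := (Measure.absolutelyContinuous_of_le h).trans
    Measure.smul_absolutelyContinuous
  have hle : μ.fst.rnDeriv lam ≤ᵐ[lam] fun _ => (C : ℝ≥0∞) := by
    refine ae_le_of_forall_setLIntegral_le_of_sigmaFinite₀
      (Measure.measurable_rnDeriv _ _).aemeasurable fun s hs _ => ?_
    rw [Measure.setLIntegral_rnDeriv hac, setLIntegral_const]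
    simpa using h s
  have hfst : μ.fst = lam.withDensity θ := by
    refine (Measure.withDensity_rnDeriv_eq _ _ hac).symm.trans (withDensity_congr_ae ?_)
    filter_upwards [hle] with t ht using (min_eq_left ht).symm
  let ν : Kernel ℝ (Vec d) :=
    { toFun := fun t => θ t • μ.condKernel t
      measurable' := Measure.measurable_of_measurable_coe _ fun s hs => by
        simp only [Measure.smul_apply, smul_eq_mul]
        exact hθm.mul (Kernel.measurable_coe _ hs) }
  have hν : ∀ t s, ν t s = θ t * μ.condKernel t s := fun t s => by
    change (θ t • μ.condKernel t) s = _
    simp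
  have hνle : ∀ t, ν t univ ≤ C := fun t => by
    rw [hν, measure_univ, mul_one]; exact min_le_right _ _
  have : IsFiniteKernel ν := ⟨C, ENNReal.coe_lt_top, hνle⟩
  refine ⟨ν, hνle, ?_⟩
  ext s hs
  conv_lhs => rw [← μ.disintegrate μ.condKernel]
  have hmeas : Measurable fun t => μ.condKernel t (Prod.mk t ⁻¹' s) :=
    Kernel.measurable_kernel_prodMk_left hs
  rw [Measure.compProd_apply hs, Measure.compProd_apply hs, hfst,
    lintegral_withDensity_eq_lintegral_mul _ hθm hmeas]
  simp only [hν, Pi.mul_apply]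

end Disintegration

section Energy

variable {X : Type} [MetricSpace X] [ProperSpace X] [MeasurableSpace X] [BorelSpace X] {d : ℕ}
  {Q : Set X} {lam : Measure X} {a γ : ℝ} {S : RelaxedState X d} {μ : Measure X} {ρ : X → ℝ}
  {m : X → Vec d} {r : X → Matrix (Fin d) (Fin d) ℝ} {s : X → ℝ}

lemma IsRepresentation.isFlow (h : IsRepresentation Q lam a γ S μ ρ m r s) : IsFlow lam γ ρ m :=
  ⟨.of_forall h.density_nonneg, .of_forall h.momentum_eq_zero, h.integrable_density,
    h.integrable_momentum, h.integrable_flux, h.integrable_pressure⟩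

/-- The energy of a relaxed state consists of the energy of its density and momentum, and of the
total defect. -/
lemma IsRepresentation.energy_eq (hγ : 1 < γ) (hQ : IsCompact Q) (hlam : lam Qᶜ = 0)
    (h : IsRepresentation Q lam a γ S μ ρ m r s) (f : C(X, ℝ)) :
    S.energy γ f = ∫ z, f z * realEnergy a γ (ρ z) (m z) ∂lam + ∫ z, f z ∂μ := by
  have := h.finite
  have hr : ∀ i j, Integrable (fun z => r z i j) μ := fun i j =>
    Integrable.of_bound (h.measurable_defect i j).aestronglyMeasurable 2
      (.of_forall fun z => h.abs_defect_le hγ z i j)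
  have hs : Integrable s μ := Integrable.of_bound h.measurable_pressureDefect.aestronglyMeasurable
    (γ - 1) (.of_forall fun z => by
      rw [Real.norm_of_nonneg (h.pressureDefect_nonneg z)]; exact h.pressureDefect_le hγ z)
  have i1 := fun i => integrable_continuousMap_mul hQ hlam f (h.integrable_flux i i)
  have i2 := fun i => integrable_continuousMap_mul hQ h.null_compl f (hr i i)
  have i3 := integrable_continuousMap_mul hQ hlam f (h.integrable_pressure.const_mul a)
  have i4 := integrable_continuousMap_mul hQ h.null_compl f hs
  have e1 : ∫ z, f z * realEnergy a γ (ρ z) (m z) ∂lam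
      = 1 / 2 * ∑ i, ∫ z, f z * (m z i * m z i / ρ z) ∂lam
        + 1 / (γ - 1) * ∫ z, f z * (a * ρ z ^ γ) ∂lam := by
    rw [← integral_finsetSum _ fun i _ => i1 i, ← integral_const_mul, ← integral_const_mul,
      ← integral_add ((integrable_finsetSum _ fun i _ => i1 i).const_mul _) (i3.const_mul _)]
    refine integral_congr_ae (.of_forall fun z => ?_)
    simp only [realEnergy, mul_add, Finset.mul_sum]
    congr 1
    · exact Finset.sum_congr rfl fun i _ => by ring
    · ring
  have e2 : ∫ z, f z ∂μ = 1 / 2 * ∑ i, ∫ z, f z * r z i i ∂μ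
      + 1 / (γ - 1) * ∫ z, f z * s z ∂μ := by
    rw [← integral_finsetSum _ fun i _ => i2 i, ← integral_const_mul, ← integral_const_mul,
      ← integral_add ((integrable_finsetSum _ fun i _ => i2 i).const_mul _) (i4.const_mul _)]
    refine integral_congr_ae (.of_forall fun z => ?_)
    have := h.normalized z
    simp only [← Finset.mul_sum]
    linear_combination (-f z) * this
  unfold RelaxedState.energy
  simp only [h.flux_eq, h.pressure_eq, Finset.sum_add_distrib]
  rw [e1, e2]
  ring

end Energy

section SpaceTime

open ProbabilityTheory

variable {d : ℕ} {D : FlowRegion d} {a γ T : ℝ} {ρ₀ : Vec d → ℝ} {m₀ : Vec d → Vec d}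
  {S : RelaxedState (ℝ × Vec d) d} {μ : Measure (ℝ × Vec d)} {ρ : ℝ × Vec d → ℝ}
  {m : ℝ × Vec d → Vec d} {r : ℝ × Vec d → Matrix (Fin d) (Fin d) ℝ} {s : ℝ × Vec d → ℝ}

/-- The energy inequality for the weight `∫ s in t..T, f s`, which has the derivative `-f`. -/
lemma energy_comp_fst_le (hS : S ∈ relaxedSolutions D a γ T ρ₀ m₀) (f : C(ℝ, ℝ))
    (hf : ∀ t, 0 ≤ f t) :
    RelaxedState.energy γ S (f.comp ⟨Prod.fst, continuous_fst⟩)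
      ≤ (∫ t in (0 : ℝ)..T, f t) * (initialEnergy D a γ ρ₀ m₀).toReal := by
  have hd : ∀ x, HasDerivAt (fun x => ∫ t in x..T, f t) (-f x) x := fun x =>
    intervalIntegral.integral_hasDerivAt_left (f.continuous.intervalIntegrable _ _)
      (f.continuous.stronglyMeasurableAtFilter _ _) f.continuous.continuousAt
  have hd' : deriv (fun x => ∫ t in x..T, f t) = fun x => -f x := funext fun x => (hd x).deriv
  have hw : ContDiff ℝ 1 fun x => ∫ t in x..T, f t :=
    contDiff_one_iff_deriv.mpr ⟨fun x => (hd x).differentiableAt, by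
      rw [hd']; exact f.continuous.neg⟩
  have hpos : ∀ t ∈ Icc 0 T, 0 ≤ ∫ t in t..T, f t := fun t ht =>
    intervalIntegral.integral_nonneg ht.2 fun u _ => hf u
  have h := hS.2 (ConstraintTest.ofWeight _ hw hpos)
  rw [ConstraintTest.residual_ofWeight hS.1] at h
  have e : (⟨fun z => deriv (fun x => ∫ t in x..T, f t) z.1,
      (hw.continuous_deriv le_rfl).comp continuous_fst⟩ : C(ℝ × Vec d, ℝ))
      = (-1 : ℝ) • f.comp ⟨Prod.fst, continuous_fst⟩ := by
    ext z
    simp [hd']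
  rw [e, hS.1.isLinearMap_energy.map_smul] at h
  simp only [smul_eq_mul] at h
  linarith

/-- The defects of a relaxed solution are a bounded family of measures on space. -/
lemma exists_kernel_of_mem_relaxedSolutions (hT : 0 < T) (ha : 0 < a) (hγ : 1 < γ)
    (hS : S ∈ relaxedSolutions D a γ T ρ₀ m₀)
    (h : IsRepresentation (D.cylinder T) (D.spaceTime T) a γ S μ ρ m r s) :
    ∃ ν : Kernel ℝ (Vec d), (∀ t, ν t univ ≤ ENNReal.ofReal (initialEnergy D a γ ρ₀ m₀).toReal) ∧
      μ = volume.restrict (Ioo 0 T) ⊗ₘ ν := by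
  have := h.finite
  set C : ℝ≥0 := (initialEnergy D a γ ρ₀ m₀).toReal.toNNReal with hC
  refine exists_kernel_of_fst_le (C := C) ?_
  have hnull : (C • volume.restrict (Ioo 0 T)) (Icc 0 T)ᶜ = 0 := by
    rw [Measure.smul_apply, Measure.restrict_apply measurableSet_Icc.compl]
    have : (Icc 0 T)ᶜ ∩ Ioo 0 T = ∅ := by
      ext x; simp only [mem_inter_iff, mem_compl_iff, mem_empty_iff_false, iff_false]
      exact fun hx => hx.1 (Ioo_subset_Icc_self hx.2)
    simp [this]
  have hnull' : μ.fst (Icc 0 T)ᶜ = 0 := by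
    rw [Measure.fst_apply measurableSet_Icc.compl]
    have hsub : Prod.fst ⁻¹' (Icc 0 T)ᶜ ⊆ (D.cylinder T)ᶜ := fun z hz hz' => hz hz'.1
    exact measure_mono_null hsub h.null_compl
  refine measure_le_of_integral_continuousMap isCompact_Icc hnull' hnull fun f hf => ?_
  have h1 := energy_comp_fst_le hS f hf
  rw [h.energy_eq hγ (D.isCompact_cylinder T) (D.spaceTime_compl T)] at h1
  have h2 : 0 ≤ ∫ z, (f.comp ⟨Prod.fst, continuous_fst⟩ : C(ℝ × Vec d, ℝ)) z
      * realEnergy a γ (ρ z) (m z) ∂D.spaceTime T :=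
    integral_nonneg fun z => mul_nonneg (hf _) (realEnergy_nonneg ha hγ (h.density_nonneg z) _)
  rw [Measure.fst, integral_map measurable_fst.aemeasurable f.continuous.aestronglyMeasurable]
  rw [integral_smul_nnreal_measure, ← integral_Ioc_eq_integral_Ioo,
    ← intervalIntegral.integral_of_le hT.le, NNReal.smul_def, smul_eq_mul, hC,
    Real.coe_toNNReal _ ENNReal.toReal_nonneg]
  simp only [ContinuousMap.comp_apply, ContinuousMap.coe_mk] at h1 h2
  linarith

end SpaceTime

/-! ### The weak formulation in terms of densities and defects -/

section Transport

variable {d : ℕ}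

/-- The integrand of the sum of the weak continuity and the weak momentum equation. -/
noncomputable def transport (a γ : ℝ) (φ : ℝ → Vec d → ℝ) (Φ : ℝ → Vec d → Vec d) (r : ℝ)
    (v : Vec d) (z : ℝ × Vec d) : ℝ :=
  (r * deriv (fun s => φ s z.2) z.1 + inner ℝ v (gradient (φ z.1) z.2))
    + (inner ℝ v (deriv (fun s => Φ s z.2) z.1)
      + (∑ i, ∑ j, v i * v j / r * partialD (Φ z.1) z.2 i j)
      + pressure a γ r * divergence (Φ z.1) z.2)

/-- The contribution of the defects to the weak momentum equation. -/
noncomputable def defectFlux (Φ : ℝ → Vec d → Vec d) (r : Matrix (Fin d) (Fin d) ℝ) (s : ℝ)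
    (z : ℝ × Vec d) : ℝ :=
  (∑ i, ∑ j, partialD (Φ z.1) z.2 i j * r i j) + divergence (Φ z.1) z.2 * s

lemma inner_eq_sum (v w : Vec d) : inner ℝ v w = ∑ i, v i * w i := by
  simp [PiLp.inner_apply, mul_comm]

variable {a γ T : ℝ} {D : FlowRegion d}

lemma sum_blockFun_mul_blockMatrix (τ : ConstraintTest D T) {r : ℝ} {v : Vec d}
    (h : r = 0 → v = 0) (z : ℝ × Vec d) :
    ∑ i, ∑ j, τ.blockFun i j z * blockMatrix r v i j + τ.pressureFun γ z * (a * r ^ γ)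
      = transport a γ τ.φ τ.Φ r v z - deriv τ.w z.1 * realEnergy a γ r v := by
  have hss : ∀ i j : Fin d, blockMatrix r v (some i) (some j) = v i * v j / r := fun _ _ => rfl
  simp only [Fintype.sum_option, blockMatrix_none_none, blockMatrix_none_some h,
    ConstraintTest.blockFun, ConstraintTest.pressureFun, transport, inner_eq_sum, realEnergy,
    pressure, sub_mul, add_mul, Finset.sum_add_distrib, Finset.sum_sub_distrib, ite_mul,
    zero_mul, Finset.sum_ite_eq, Finset.mem_univ, if_true, Finset.sum_const_zero,
    hss, mul_add, Finset.mul_sum]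
  have e1 : ∑ i, ∑ j, partialD (τ.Φ z.1) z.2 i j * (v i * v j / r)
      = ∑ i, ∑ j, v i * v j / r * partialD (τ.Φ z.1) z.2 i j :=
    Finset.sum_congr rfl fun i _ => Finset.sum_congr rfl fun j _ => mul_comm _ _
  have e2 : ∑ i, gradient (τ.φ z.1) z.2 i * v i = ∑ i, v i * gradient (τ.φ z.1) z.2 i :=
    Finset.sum_congr rfl fun i _ => mul_comm _ _
  have e3 : ∑ i, deriv (fun s => τ.Φ s z.2) z.1 i * v i
      = ∑ i, v i * deriv (fun s => τ.Φ s z.2) z.1 i :=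
    Finset.sum_congr rfl fun i _ => mul_comm _ _
  have e4 : ∑ i, deriv τ.w z.1 / 2 * (v i * v i / r)
      = ∑ i, deriv τ.w z.1 * (1 / 2 * (v i * v i / r)) :=
    Finset.sum_congr rfl fun i _ => by ring
  rw [e1, e2, e3, e4]
  ring

lemma sum_blockFun_mul_defect (τ : ConstraintTest D T) (r : Matrix (Fin d) (Fin d) ℝ) (s : ℝ)
    (z : ℝ × Vec d) :
    ∑ i, ∑ j, τ.blockFun (some i) (some j) z * r i j + τ.pressureFun γ z * s
      = defectFlux τ.Φ r s z - deriv τ.w z.1 * (1 / 2 * ∑ i, r i i + 1 / (γ - 1) * s) := by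
  simp only [ConstraintTest.blockFun, ConstraintTest.pressureFun, defectFlux, sub_mul,
    Finset.sum_sub_distrib, ite_mul, zero_mul, Finset.sum_ite_eq, Finset.mem_univ, if_true,
    ← Finset.mul_sum]
  ring

variable {φ : ℝ → Vec d → ℝ} {Φ : ℝ → Vec d → Vec d} {ψ : ℝ → ℝ}

lemma deriv_mul_timeSlice (hφ : ContDiff ℝ 1 fun z : ℝ × Vec d => φ z.1 z.2)
    (hψ : ContDiff ℝ 1 ψ) (z : ℝ × Vec d) :
    deriv (fun s => ψ s * φ s z.2) z.1
      = deriv ψ z.1 * φ z.1 z.2 + ψ z.1 * deriv (fun s => φ s z.2) z.1 :=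
  ((hψ.differentiable one_ne_zero z.1).hasDerivAt.mul
    ((contDiff_timeSlice hφ z.2).differentiable one_ne_zero z.1).hasDerivAt).deriv

lemma deriv_smul_timeSlice (hΦ : ContDiff ℝ 1 fun z : ℝ × Vec d => Φ z.1 z.2)
    (hψ : ContDiff ℝ 1 ψ) (z : ℝ × Vec d) :
    deriv (fun s => ψ s • Φ s z.2) z.1
      = ψ z.1 • deriv (fun s => Φ s z.2) z.1 + deriv ψ z.1 • Φ z.1 z.2 :=
  ((hψ.differentiable one_ne_zero z.1).hasDerivAt.smul
    ((contDiff_timeSlice hΦ z.2).differentiable one_ne_zero z.1).hasDerivAt).deriv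

lemma partialD_const_smul (hΦ : ContDiff ℝ 1 fun z : ℝ × Vec d => Φ z.1 z.2) (c : ℝ)
    (z : ℝ × Vec d) (i j : Fin d) :
    partialD (fun x => c • Φ z.1 x) z.2 i j = c * partialD (Φ z.1) z.2 i j := by
  have h := ((contDiff_spaceSlice hΦ z.1).differentiable one_ne_zero z.2).hasFDerivAt
  simp [partialD, fderiv_fun_const_smul h.differentiableAt]

lemma gradient_const_mul (hφ : ContDiff ℝ 1 fun z : ℝ × Vec d => φ z.1 z.2) (c : ℝ)
    (z : ℝ × Vec d) : gradient (fun x => c * φ z.1 x) z.2 = c • gradient (φ z.1) z.2 := by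
  have h := ((contDiff_spaceSlice hφ z.1).differentiable one_ne_zero z.2)
  ext i
  rw [gradient_apply_coord, PiLp.smul_apply, gradient_apply_coord, fderiv_const_mul h]
  simp

/-- The product rule for test functions multiplied by a function of time. -/
lemma transport_mul (hφ : ContDiff ℝ 1 fun z : ℝ × Vec d => φ z.1 z.2)
    (hΦ : ContDiff ℝ 1 fun z : ℝ × Vec d => Φ z.1 z.2) (hψ : ContDiff ℝ 1 ψ) (r : ℝ) (v : Vec d)
    (z : ℝ × Vec d) :
    transport a γ (fun t x => ψ t * φ t x) (fun t x => ψ t • Φ t x) r v z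
      = deriv ψ z.1 * (r * φ z.1 z.2 + inner ℝ v (Φ z.1 z.2))
        + ψ z.1 * transport a γ φ Φ r v z := by
  simp only [transport, divergence, deriv_mul_timeSlice hφ hψ, deriv_smul_timeSlice hΦ hψ,
    partialD_const_smul hΦ, gradient_const_mul hφ, inner_add_right, inner_smul_right,
    ← Finset.mul_sum, mul_left_comm _ (ψ z.1)]
  ring

lemma defectFlux_mul (hΦ : ContDiff ℝ 1 fun z : ℝ × Vec d => Φ z.1 z.2)
    (r : Matrix (Fin d) (Fin d) ℝ) (s : ℝ) (z : ℝ × Vec d) :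
    defectFlux (fun t x => ψ t • Φ t x) r s z = ψ z.1 * defectFlux Φ r s z := by
  simp only [defectFlux, divergence, partialD_const_smul hΦ, mul_assoc, ← Finset.mul_sum]
  ring

end Transport

section WeakForm

open ProbabilityTheory

variable {d : ℕ} {D : FlowRegion d} {a γ T : ℝ} {ρ₀ : Vec d → ℝ} {m₀ : Vec d → Vec d}
  {S : RelaxedState (ℝ × Vec d) d} {μ : Measure (ℝ × Vec d)} {ρ : ℝ × Vec d → ℝ}
  {m : ℝ × Vec d → Vec d} {r : ℝ × Vec d → Matrix (Fin d) (Fin d) ℝ} {s : ℝ × Vec d → ℝ}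

lemma IsFlow.residual_pureState {lam : Measure (ℝ × Vec d)} {Q : Set (ℝ × Vec d)}
    (hQ : IsCompact Q) (hlam : lam Qᶜ = 0) (h : IsFlow lam γ ρ m) (τ : ConstraintTest D T) :
    ∑ i, ∑ j, (pureState lam a γ ρ m).1 i j ⟨τ.blockFun i j, τ.continuous_blockFun i j⟩
        + (pureState lam a γ ρ m).2 ⟨τ.pressureFun γ, τ.continuous_pressureFun γ⟩
      = ∫ z, (transport a γ τ.φ τ.Φ (ρ z) (m z) z
          - deriv τ.w z.1 * realEnergy a γ (ρ z) (m z)) ∂lam := by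
  have i1 := fun i j => integrable_continuousMap_mul hQ hlam
    ⟨_, τ.continuous_blockFun i j⟩ (h.integrable_blockMatrix i j)
  have i2 := integrable_continuousMap_mul hQ hlam ⟨_, τ.continuous_pressureFun γ⟩
    (h.integrable_pressure.const_mul a)
  simp only [pureState]
  rw [← Finset.sum_congr rfl fun i _ => integral_finsetSum _ fun j _ => i1 i j,
    ← integral_finsetSum _ fun i _ => integrable_finsetSum _ fun j _ => i1 i j,
    ← integral_add (integrable_finsetSum _ fun i _ => integrable_finsetSum _ fun j _ => i1 i j) i2]
  refine integral_congr_ae ?_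
  filter_upwards [h.eq_zero] with z hz using sum_blockFun_mul_blockMatrix τ hz z

lemma IsRepresentation.integrable_defect {X : Type} [MetricSpace X] [ProperSpace X]
    [MeasurableSpace X] [BorelSpace X] {Q : Set X} {lam : Measure X} {S : RelaxedState X d}
    {μ : Measure X} {ρ : X → ℝ}
    {m : X → Vec d} {r : X → Matrix (Fin d) (Fin d) ℝ} {s : X → ℝ} (hγ : 1 < γ)
    (h : IsRepresentation Q lam a γ S μ ρ m r s) (i j : Fin d) :
    Integrable (fun z => r z i j) μ :=
  have := h.finite
  Integrable.of_bound (h.measurable_defect i j).aestronglyMeasurable 2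
    (.of_forall fun z => h.abs_defect_le hγ z i j)

lemma IsRepresentation.integrable_pressureDefect {X : Type} [MetricSpace X] [ProperSpace X]
    [MeasurableSpace X] [BorelSpace X] {Q : Set X} {lam : Measure X} {S : RelaxedState X d}
    {μ : Measure X}
    {ρ : X → ℝ} {m : X → Vec d} {r : X → Matrix (Fin d) (Fin d) ℝ} {s : X → ℝ} (hγ : 1 < γ)
    (h : IsRepresentation Q lam a γ S μ ρ m r s) : Integrable s μ :=
  have := h.finite
  Integrable.of_bound h.measurable_pressureDefect.aestronglyMeasurable (γ - 1)
    (.of_forall fun z => by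
      rw [Real.norm_of_nonneg (h.pressureDefect_nonneg z)]; exact h.pressureDefect_le hγ z)

/-- The constraints on a relaxed state in terms of its representation. -/
lemma IsRepresentation.residual_eq (hγ : 1 < γ)
    (h : IsRepresentation (D.cylinder T) (D.spaceTime T) a γ S μ ρ m r s)
    (hS : IsRelaxed (D.cylinder T) (D.spaceTime T) a γ S) (τ : ConstraintTest D T) :
    τ.residual a γ ρ₀ m₀ S
      = (∫ z, (transport a γ τ.φ τ.Φ (ρ z) (m z) z
          - deriv τ.w z.1 * realEnergy a γ (ρ z) (m z)) ∂D.spaceTime T)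
        + (∫ z, (defectFlux τ.Φ (r z) (s z) z - deriv τ.w z.1) ∂μ) + τ.initial a γ ρ₀ m₀ := by
  have hQ := D.isCompact_cylinder T
  rw [← h.isFlow.residual_pureState hQ (D.spaceTime_compl T) τ]
  have i1 : ∀ i j, Integrable (fun z => τ.blockFun (some i) (some j) z * r z i j) μ :=
    fun i j => integrable_continuousMap_mul hQ h.null_compl
      ⟨_, τ.continuous_blockFun (some i) (some j)⟩ (h.integrable_defect hγ i j)
  have i2 : Integrable (fun z => τ.pressureFun γ z * s z) μ :=
    integrable_continuousMap_mul hQ h.null_compl ⟨_, τ.continuous_pressureFun γ⟩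
      (h.integrable_pressureDefect hγ)
  have e : ∫ z, (defectFlux τ.Φ (r z) (s z) z - deriv τ.w z.1) ∂μ
      = ∑ i, ∑ j, ∫ z, τ.blockFun (some i) (some j) z * r z i j ∂μ
        + ∫ z, τ.pressureFun γ z * s z ∂μ := by
    rw [← Finset.sum_congr rfl fun i _ => integral_finsetSum _ fun j _ => i1 i j,
      ← integral_finsetSum _ fun i _ => integrable_finsetSum _ fun j _ => i1 i j,
      ← integral_add (integrable_finsetSum _ fun i _ => integrable_finsetSum _ fun j _ => i1 i j)
        i2]
    refine integral_congr_ae (.of_forall fun z => ?_)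
    have := sum_blockFun_mul_defect (γ := γ) τ (r z) (s z) z
    rw [h.normalized, mul_one] at this
    exact this.symm
  have hn : ∀ (v : Vec d) (q : ℝ) (i : Fin d),
      blockMatrix q v (some i) none = blockMatrix q v none (some i) := fun v q i =>
    blockMatrix_symm _ _ _ _
  have hzero : ∀ i : Fin d, S.1 (some i) none ⟨τ.blockFun (some i) none,
      τ.continuous_blockFun (some i) none⟩ = 0 := fun i => (hS.linear_block _ _).map_zero
  rw [e, ConstraintTest.residual]
  simp only [Fintype.sum_option, h.density_eq, h.momentum_eq, h.flux_eq, h.pressure_eq, hzero,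
    pureState, blockMatrix_none_none, blockMatrix_none_some (h.momentum_eq_zero _), hn,
    ContinuousMap.coe_mk, Finset.sum_add_distrib]
  have hz : ∀ i : Fin d, ∫ z, τ.blockFun (some i) none z * m z i ∂D.spaceTime T = 0 := by
    intro i; simp [ConstraintTest.blockFun]
  simp only [hz, blockMatrix, Option.elim_some]
  ring

end WeakForm

section WeakFormInTime

open ProbabilityTheory

lemma integrable_integral_kernel {d : ℕ} {lam : Measure ℝ} [SFinite lam]
    {ν : Kernel ℝ (Vec d)} [IsSFiniteKernel ν] {f : ℝ × Vec d → ℝ} (hf : Integrable f (lam ⊗ₘ ν)) :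
    Integrable (fun t => ∫ x, f (t, x) ∂ν t) lam := by
  have h := Integrable.integral_compProd (κ := Kernel.const Unit lam)
    (η := Kernel.prodMkLeft Unit ν) (a := ()) hf
  simpa using h

variable {d : ℕ} {D : FlowRegion d} {a γ T : ℝ} {ρ₀ : Vec d → ℝ} {m₀ : Vec d → Vec d}
  {S : RelaxedState (ℝ × Vec d) d} {μ : Measure (ℝ × Vec d)} {ρ : ℝ × Vec d → ℝ}
  {m : ℝ × Vec d → Vec d} {r : ℝ × Vec d → Matrix (Fin d) (Fin d) ℝ} {s : ℝ × Vec d → ℝ}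
  {φ : ℝ → Vec d → ℝ} {Φ : ℝ → Vec d → Vec d} {ν : Kernel ℝ (Vec d)} [IsFiniteKernel ν]

/-- The integral of the density and the momentum against test functions. -/
noncomputable def FlowRegion.pairing (D : FlowRegion d) (ρ : Vec d → ℝ) (m : Vec d → Vec d)
    (f : Vec d → ℝ) (F : Vec d → Vec d) : ℝ :=
  ∫ x, (ρ x * f x + inner ℝ (m x) (F x)) ∂D.vol

/-- The rate at which the integral of the density and the momentum against test functions
changes. -/
noncomputable def FlowRegion.rate (D : FlowRegion d) (a γ : ℝ) (φ : ℝ → Vec d → ℝ)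
    (Φ : ℝ → Vec d → Vec d) (ρ : ℝ × Vec d → ℝ) (m : ℝ × Vec d → Vec d)
    (r : ℝ × Vec d → Matrix (Fin d) (Fin d) ℝ) (s : ℝ × Vec d → ℝ) (ν : Kernel ℝ (Vec d))
    (t : ℝ) : ℝ :=
  (∫ x, transport a γ φ Φ (ρ (t, x)) (m (t, x)) (t, x) ∂D.vol)
    + ∫ x, defectFlux Φ (r (t, x)) (s (t, x)) (t, x) ∂ν t

lemma IsFlow.integrable_transport_of_contDiff {lam : Measure (ℝ × Vec d)} {Q : Set (ℝ × Vec d)}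
    (hQ : IsCompact Q) (hlam : lam Qᶜ = 0) (h : IsFlow lam γ ρ m)
    (hφ : ContDiff ℝ 1 fun z : ℝ × Vec d => φ z.1 z.2)
    (hΦ : ContDiff ℝ 1 fun z : ℝ × Vec d => Φ z.1 z.2) :
    Integrable (fun z => transport a γ φ Φ (ρ z) (m z) z) lam := by
  have hc : ∀ {f : ℝ × Vec d → ℝ} (_ : Continuous f) {g : ℝ × Vec d → ℝ}, Integrable g lam →
      Integrable (fun z => g z * f z) lam := fun {f} hf {g} hg => by
    simpa [mul_comm] using integrable_continuousMap_mul hQ hlam ⟨f, hf⟩ hg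
  simp only [transport, inner_eq_sum, pressure]
  refine ((hc (continuous_deriv_timeSlice hφ) h.integrable_density).add
    (integrable_finsetSum _ fun i _ => hc (continuous_gradient_spaceSlice hφ i)
      (h.integrable_momentum i))).add (((integrable_finsetSum _ fun i _ =>
      hc ((EuclideanSpace.proj (𝕜 := ℝ) i).continuous.comp (continuous_deriv_timeSlice hΦ))
        (h.integrable_momentum i)).add (integrable_finsetSum _ fun i _ =>
          integrable_finsetSum _ fun j _ => hc (continuous_partialD_spaceSlice hΦ i j)
            (h.integrable_flux i j))).add (hc (continuous_divergence_spaceSlice hΦ)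
          (h.integrable_pressure.const_mul a)))

lemma IsFlow.integrable_pairing {X : Type} [MetricSpace X] [ProperSpace X]
    [MeasurableSpace X] [BorelSpace X] {ρ : X → ℝ} {m : X → Vec d} {lam : Measure X} {Q : Set X}
    (hQ : IsCompact Q) (hlam : lam Qᶜ = 0) (h : IsFlow lam γ ρ m) {f : X → ℝ} {F : X → Vec d}
    (hf : Continuous f) (hF : Continuous F) :
    Integrable (fun z => ρ z * f z + inner ℝ (m z) (F z)) lam := by
  have hc : ∀ {f : X → ℝ} (_ : Continuous f) {g : X → ℝ}, Integrable g lam →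
      Integrable (fun z => g z * f z) lam := fun {f} hf {g} hg => by
    simpa [mul_comm] using integrable_continuousMap_mul hQ hlam ⟨f, hf⟩ hg
  simp only [inner_eq_sum]
  exact (hc hf h.integrable_density).add (integrable_finsetSum _ fun i _ =>
    hc ((EuclideanSpace.proj (𝕜 := ℝ) i).continuous.comp hF) (h.integrable_momentum i))

lemma IsRepresentation.integrable_defectFlux_of_contDiff (hγ : 1 < γ)
    (h : IsRepresentation (D.cylinder T) (D.spaceTime T) a γ S μ ρ m r s)
    (hΦ : ContDiff ℝ 1 fun z : ℝ × Vec d => Φ z.1 z.2) :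
    Integrable (fun z => defectFlux Φ (r z) (s z) z) μ := by
  have hQ := D.isCompact_cylinder T
  exact (integrable_finsetSum _ fun i _ => integrable_finsetSum _ fun j _ =>
      integrable_continuousMap_mul hQ h.null_compl ⟨_, continuous_partialD_spaceSlice hΦ i j⟩
        (h.integrable_defect hγ i j)).add
      (integrable_continuousMap_mul hQ h.null_compl ⟨_, continuous_divergence_spaceSlice hΦ⟩
        (h.integrable_pressureDefect hγ))

lemma IsFlow.ae_slice (h : IsFlow (D.spaceTime T) γ ρ m) :
    ∀ᵐ t ∂volume.restrict (Ioo 0 T),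
      IsFlow D.vol γ (fun x => ρ (t, x)) (fun x => m (t, x)) := by
  have h1 := Measure.ae_ae_of_ae_prod h.nonneg
  have h2 := Measure.ae_ae_of_ae_prod h.eq_zero
  have h3 := h.integrable_density.prod_right_ae
  have h4 := ae_all_iff.mpr fun i => (h.integrable_momentum i).prod_right_ae
  have h5 := ae_all_iff.mpr fun i => ae_all_iff.mpr fun j => (h.integrable_flux i j).prod_right_ae
  have h6 := h.integrable_pressure.prod_right_ae
  filter_upwards [h1, h2, h3, h4, h5, h6] with t h1 h2 h3 h4 h5 h6
  exact ⟨h1, h2, h3, h4, h5, h6⟩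

/-- The total energy of a relaxed solution satisfies the energy inequality in weak form. -/
lemma IsRepresentation.weakDecay (hγ : 1 < γ) (hS : S ∈ relaxedSolutions D a γ T ρ₀ m₀)
    (h : IsRepresentation (D.cylinder T) (D.spaceTime T) a γ S μ ρ m r s)
    (hν : μ = volume.restrict (Ioo 0 T) ⊗ₘ ν) :
    IntegrableOn (fun t => ∫ x, realEnergy a γ (ρ (t, x)) (m (t, x)) ∂D.vol + (ν t).real univ)
      (Ioo 0 T) ∧
    WeakDecay T (initialEnergy D a γ ρ₀ m₀).toReal
      fun t => ∫ x, realEnergy a γ (ρ (t, x)) (m (t, x)) ∂D.vol + (ν t).real univ := by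
  have := h.finite
  have hQ := D.isCompact_cylinder T
  have i1 : IntegrableOn (fun t => ∫ x, realEnergy a γ (ρ (t, x)) (m (t, x)) ∂D.vol)
      (Ioo 0 T) := (h.isFlow.integrable_realEnergy a).integral_prod_left
  have i2 : IntegrableOn (fun t => (ν t).real univ) (Ioo 0 T) := by
    obtain ⟨C, hC, hC'⟩ := IsFiniteKernel.exists_univ_le (κ := ν)
    refine Integrable.of_bound (C := C.toReal)
      ((Kernel.measurable_coe ν MeasurableSet.univ).ennreal_toReal).aestronglyMeasurable
      (.of_forall fun t => ?_)
    rw [Real.norm_of_nonneg measureReal_nonneg]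
    exact ENNReal.toReal_mono hC.ne (hC' t)
  refine ⟨i1.add i2, fun w hw hw0 => ?_⟩
  have hres := hS.2 (ConstraintTest.ofWeight w hw hw0)
  have hw' := hw.continuous_deriv le_rfl
  rw [ConstraintTest.residual_ofWeight hS.1, h.energy_eq hγ hQ (D.spaceTime_compl T)] at hres
  have j1 := integrable_continuousMap_mul hQ (D.spaceTime_compl T)
    ⟨fun z => deriv w z.1, hw'.comp continuous_fst⟩ (h.isFlow.integrable_realEnergy a)
  have j2 := integrable_continuousMap hQ h.null_compl
    (⟨fun z => deriv w z.1, hw'.comp continuous_fst⟩ : C(ℝ × Vec d, ℝ))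
  have e1 : ∫ z, deriv w z.1 * realEnergy a γ (ρ z) (m z) ∂D.spaceTime T
      = ∫ t in Ioo 0 T, deriv w t * ∫ x, realEnergy a γ (ρ (t, x)) (m (t, x)) ∂D.vol := by
    refine (integral_prod _ j1).trans (integral_congr_ae (.of_forall fun t => ?_))
    exact integral_const_mul (deriv w t) _
  have e2 : ∫ z, deriv w z.1 ∂μ = ∫ t in Ioo 0 T, deriv w t * (ν t).real univ := by
    rw [hν] at j2 ⊢
    refine (Measure.integral_compProd j2).trans (integral_congr_ae (.of_forall fun t => ?_))
    simp [mul_comm]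
  simp only [ContinuousMap.coe_mk] at hres
  have e3 : ∫ t in Ioo 0 T, deriv w t * (∫ x, realEnergy a γ (ρ (t, x)) (m (t, x)) ∂D.vol
      + (ν t).real univ) = (∫ t in Ioo 0 T, deriv w t *
        ∫ x, realEnergy a γ (ρ (t, x)) (m (t, x)) ∂D.vol)
      + ∫ t in Ioo 0 T, deriv w t * (ν t).real univ := by
    rw [← integral_add (integrableOn_continuous_mul hw' i1) (integrableOn_continuous_mul hw' i2)]
    exact integral_congr_ae (.of_forall fun t => mul_add _ _ _)
  rw [e3, ← e1, ← e2]
  linarith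

/-- The energy of almost every time slice is bounded by the initial energy. -/
lemma IsRepresentation.ae_energy_le (hT : 0 < T) (ha : 0 < a) (hγ : 1 < γ)
    (hS : S ∈ relaxedSolutions D a γ T ρ₀ m₀)
    (h : IsRepresentation (D.cylinder T) (D.spaceTime T) a γ S μ ρ m r s)
    (hν : μ = volume.restrict (Ioo 0 T) ⊗ₘ ν) :
    ∀ᵐ t ∂volume.restrict (Ioo 0 T), ∫ x, realEnergy a γ (ρ (t, x)) (m (t, x)) ∂D.vol
      ≤ (initialEnergy D a γ ρ₀ m₀).toReal := by
  obtain ⟨hi, hdecay⟩ := h.weakDecay hγ hS hν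
  have hpos : ∀ᵐ t ∂volume.restrict (Ioo 0 T),
      0 ≤ ∫ x, realEnergy a γ (ρ (t, x)) (m (t, x)) ∂D.vol + (ν t).real univ :=
    .of_forall fun t => add_nonneg (integral_nonneg fun x =>
      realEnergy_nonneg ha hγ (h.density_nonneg _) _) measureReal_nonneg
  filter_upwards [(hdecay.exists_limits hT hi hpos).1] with t ht
  exact (le_add_of_nonneg_right measureReal_nonneg).trans ht

lemma IsRepresentation.integrableOn_rate (hγ : 1 < γ)
    (h : IsRepresentation (D.cylinder T) (D.spaceTime T) a γ S μ ρ m r s)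
    (hν : μ = volume.restrict (Ioo 0 T) ⊗ₘ ν)
    (hφ : ContDiff ℝ 1 fun z : ℝ × Vec d => φ z.1 z.2)
    (hΦ : ContDiff ℝ 1 fun z : ℝ × Vec d => Φ z.1 z.2) :
    IntegrableOn (D.rate a γ φ Φ ρ m r s ν) (Ioo 0 T) := by
  have h1 := h.isFlow.integrable_transport_of_contDiff (a := a) (D.isCompact_cylinder T)
    (D.spaceTime_compl T) hφ hΦ
  have h2 := h.integrable_defectFlux_of_contDiff hγ hΦ
  rw [hν] at h2
  exact h1.integral_prod_left.add (integrable_integral_kernel h2)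

/-- The weak formulations of the continuity and the momentum equation, integrated in time. -/
theorem IsRepresentation.ae_pairing_eq (hγ : 1 < γ)
    (hS : S ∈ relaxedSolutions D a γ T ρ₀ m₀)
    (h : IsRepresentation (D.cylinder T) (D.spaceTime T) a γ S μ ρ m r s)
    (hν : μ = volume.restrict (Ioo 0 T) ⊗ₘ ν)
    (hρ₀ : IsFlow D.vol γ ρ₀ m₀)
    (hφ : ContDiff ℝ 1 fun z : ℝ × Vec d => φ z.1 z.2) (hφp : D.IsPeriodic φ)
    (hΦ : ContDiff ℝ 1 fun z : ℝ × Vec d => Φ z.1 z.2) (hΦp : D.IsPeriodic Φ)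
    (hΦt : D.IsTangential T Φ) :
    ∀ᵐ t ∂volume.restrict (Ioo 0 T),
      D.pairing (fun x => ρ (t, x)) (fun x => m (t, x)) (φ t) (Φ t)
        = D.pairing ρ₀ m₀ (φ 0) (Φ 0) + ∫ s' in (0 : ℝ)..t, D.rate a γ φ Φ ρ m r s ν s' := by
  have hQ := D.isCompact_cylinder T
  have i0 := h.isFlow.integrable_pairing hQ (D.spaceTime_compl T) hφ.continuous hΦ.continuous
  have i1 := h.isFlow.integrable_transport_of_contDiff (a := a) hQ (D.spaceTime_compl T) hφ hΦ
  have i2 := h.integrable_defectFlux_of_contDiff hγ hΦ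
  have i2' := i2
  rw [hν] at i2'
  refine ae_eq_add_integral_of_weak i0.integral_prod_left (h.integrableOn_rate hγ hν hφ hΦ)
    fun ψ hψ ⟨T', hT', hψ0⟩ => ?_
  have hψ' := hψ.continuous_deriv le_rfl
  -- The constraint holds for a test function and for its negative.
  have key : ∀ c : ℝ, c * ((∫ t in Ioo 0 T, deriv ψ t
        * D.pairing (fun x => ρ (t, x)) (fun x => m (t, x)) (φ t) (Φ t))
      + (∫ t in Ioo 0 T, ψ t * D.rate a γ φ Φ ρ m r s ν t)
      + ψ 0 * D.pairing ρ₀ m₀ (φ 0) (Φ 0)) ≤ 0 := by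
    intro c
    have hcψ : ContDiff ℝ 1 fun t => c * ψ t := contDiff_const.mul hψ
    let τ : ConstraintTest D T :=
      { φ := fun t x => (c * ψ t) * φ t x
        Φ := fun t x => (c * ψ t) • Φ t x
        w := fun _ => 0
        scalar := ⟨(hcψ.comp contDiff_fst).mul hφ, ⟨T', hT', fun t ht x => by simp [hψ0 t ht]⟩, by
          cases D
          · trivial
          · exact fun t x i => congrArg (c * ψ t * ·) (hφp t x i)⟩
        vector := ⟨(hcψ.comp contDiff_fst).smul hΦ, ⟨T', hT', fun t ht x => by simp [hψ0 t ht]⟩, by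
          cases D
          · trivial
          · exact fun t x i => congrArg ((c * ψ t) • ·) (hΦp t x i), by
          cases D
          · intro t ht x hx n hn
            rw [inner_smul_left, hΦt t ht x hx n hn, mul_zero]
          · trivial⟩
        contDiff_w := contDiff_const
        w_nonneg := fun _ _ => le_rfl }
    have hres := hS.2 τ
    rw [h.residual_eq hγ hS.1] at hres
    have hw : ∀ t, deriv τ.w t = 0 := fun t => by simp [τ]
    simp only [hw, zero_mul, sub_zero] at hres
    have e1 : ∀ z, transport a γ τ.φ τ.Φ (ρ z) (m z) z
        = c * (deriv ψ z.1 * (ρ z * φ z.1 z.2 + inner ℝ (m z) (Φ z.1 z.2))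
          + ψ z.1 * transport a γ φ Φ (ρ z) (m z) z) := by
      intro z
      have hd : deriv (fun t => c * ψ t) z.1 = c * deriv ψ z.1 :=
        deriv_const_mul _ (hψ.differentiable one_ne_zero z.1)
      rw [transport_mul hφ hΦ hcψ, hd]
      ring
    have e2 : ∀ z, defectFlux τ.Φ (r z) (s z) z = c * (ψ z.1 * defectFlux Φ (r z) (s z) z) := by
      intro z
      rw [← mul_assoc]
      exact defectFlux_mul (ψ := fun t => c * ψ t) hΦ _ _ z
    have e3 : τ.initial a γ ρ₀ m₀ = c * (ψ 0 * D.pairing ρ₀ m₀ (φ 0) (Φ 0)) := by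
      have hφ0 : Continuous (φ 0) := (contDiff_spaceSlice hφ 0).continuous
      have hΦ0 : Continuous (Φ 0) := (contDiff_spaceSlice hΦ 0).continuous
      simp only [ConstraintTest.initial, τ, zero_mul, sub_zero, FlowRegion.pairing,
        inner_smul_right]
      have hcomm : ∀ x, ρ₀ x * (c * ψ 0 * φ 0 x) = c * ψ 0 * (ρ₀ x * φ 0 x) := fun x => by ring
      simp only [hcomm, integral_const_mul]
      rw [integral_add (hρ₀.integrable_density_mul hφ0) (hρ₀.integrable_inner hΦ0)]
      ring
    simp only [e1, e2, e3, integral_const_mul] at hres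
    have j0 := integrable_continuousMap_mul hQ (D.spaceTime_compl T)
      ⟨fun z => deriv ψ z.1, hψ'.comp continuous_fst⟩ i0
    have j1 := integrable_continuousMap_mul hQ (D.spaceTime_compl T)
      ⟨fun z => ψ z.1, hψ.continuous.comp continuous_fst⟩ i1
    have j2 := integrable_continuousMap_mul hQ h.null_compl
      ⟨fun z => ψ z.1, hψ.continuous.comp continuous_fst⟩ i2
    simp only [ContinuousMap.coe_mk] at j0 j1 j2
    rw [integral_add j0 j1] at hres
    have f0 : ∫ z, deriv ψ z.1 * (ρ z * φ z.1 z.2 + inner ℝ (m z) (Φ z.1 z.2)) ∂D.spaceTime T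
        = ∫ t in Ioo 0 T, deriv ψ t
          * D.pairing (fun x => ρ (t, x)) (fun x => m (t, x)) (φ t) (Φ t) :=
      (integral_prod _ j0).trans (integral_congr_ae (.of_forall fun t =>
        integral_const_mul (deriv ψ t) _))
    have f1 : ∫ z, ψ z.1 * transport a γ φ Φ (ρ z) (m z) z ∂D.spaceTime T
        = ∫ t in Ioo 0 T, ψ t * ∫ x, transport a γ φ Φ (ρ (t, x)) (m (t, x)) (t, x) ∂D.vol :=
      (integral_prod _ j1).trans (integral_congr_ae (.of_forall fun t =>
        integral_const_mul (ψ t) _))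
    have f2 : ∫ z, ψ z.1 * defectFlux Φ (r z) (s z) z ∂μ
        = ∫ t in Ioo 0 T, ψ t * ∫ x, defectFlux Φ (r (t, x)) (s (t, x)) (t, x) ∂ν t := by
      rw [hν] at j2 ⊢
      exact (Measure.integral_compProd j2).trans
        (integral_congr_ae (.of_forall fun t => integral_const_mul (ψ t) _))
    have f3 : ∫ t in Ioo 0 T, ψ t * D.rate a γ φ Φ ρ m r s ν t
        = (∫ t in Ioo 0 T, ψ t * ∫ x, transport a γ φ Φ (ρ (t, x)) (m (t, x)) (t, x) ∂D.vol)
          + ∫ t in Ioo 0 T, ψ t * ∫ x, defectFlux Φ (r (t, x)) (s (t, x)) (t, x) ∂ν t := by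
      rw [← integral_add (integrableOn_continuous_mul hψ.continuous i1.integral_prod_left)
        (integrableOn_continuous_mul hψ.continuous (integrable_integral_kernel i2'))]
      exact integral_congr_ae (.of_forall fun t => mul_add _ _ _)
    rw [f0, f1, f2] at hres
    rw [f3]
    linarith
  have k1 := key 1
  have k2 := key (-1)
  linarith

end WeakFormInTime

/-! ### Values at every time -/

section EnergyBounds

variable {d : ℕ} {a γ r : ℝ} {v : Vec d}

lemma rpow_le_realEnergy (ha : 0 < a) (hγ : 1 < γ) (hr : 0 ≤ r) :
    r ^ γ ≤ (γ - 1) / a * realEnergy a γ r v := by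
  have h1 : 0 < γ - 1 := by linarith
  have h2 : 0 ≤ (γ - 1) / a * (1 / 2 * (‖v‖ ^ 2 / r)) := by positivity
  have h3 : realEnergy a γ r v = 1 / 2 * (‖v‖ ^ 2 / r) + 1 / (γ - 1) * (a * r ^ γ) := by
    rw [realEnergy, sum_mul_self_div]
  rw [h3, mul_add]
  have h4 : (γ - 1) / a * (1 / (γ - 1) * (a * r ^ γ)) = r ^ γ := by field_simp
  linarith

/-- The energy controls the momentum in `L^(2γ/(γ+1))`, by the inequality between the geometric and
the arithmetic mean of `|m|² / ϱ` and `ϱ ^ γ`. -/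
lemma norm_rpow_le_realEnergy (ha : 0 < a) (hγ : 1 < γ) (hr : 0 ≤ r) (h : r = 0 → v = 0) :
    ‖v‖ ^ (2 * γ / (γ + 1)) ≤ (2 + (γ - 1) / a) * realEnergy a γ r v := by
  have h1 : 0 < γ - 1 := by linarith
  have h0 : 0 < γ + 1 := by linarith
  have hE := realEnergy_nonneg ha hγ hr v
  rcases hr.eq_or_lt with h' | hr
  · rw [h h'.symm, norm_zero, Real.zero_rpow (by positivity)]
    rw [h h'.symm] at hE
    positivity
  have hX : 0 ≤ ‖v‖ ^ 2 / r := by positivity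
  have h3 := Real.geom_mean_le_arith_mean2_weighted (w₁ := γ / (γ + 1)) (w₂ := 1 / (γ + 1))
    (by positivity) (by positivity) hX (Real.rpow_nonneg hr.le γ) (by field_simp)
  have h4 : (‖v‖ ^ 2 / r) ^ (γ / (γ + 1)) * (r ^ γ) ^ (1 / (γ + 1)) = ‖v‖ ^ (2 * γ / (γ + 1)) := by
    rw [Real.div_rpow (by positivity) hr.le, ← Real.rpow_mul hr.le, ← Real.rpow_natCast ‖v‖ 2,
      ← Real.rpow_mul (norm_nonneg v), mul_one_div, div_mul_cancel₀ _
          (Real.rpow_pos_of_pos hr _).ne']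
    congr 1
    push_cast
    ring
  have h5 := rpow_le_realEnergy (v := v) ha hγ hr.le
  have h6 : ‖v‖ ^ 2 / r ≤ 2 * realEnergy a γ r v := by
    rw [realEnergy, sum_mul_self_div]
    have : 0 ≤ 1 / (γ - 1) * (a * r ^ γ) := by positivity
    linarith
  have h7 : γ / (γ + 1) ≤ 1 := by rw [div_le_one h0]; linarith
  have h8 : 1 / (γ + 1) ≤ 1 := by rw [div_le_one h0]; linarith
  rw [← h4]
  refine h3.trans ?_
  have h9 := mul_le_mul_of_nonneg_right h7 hX
  have h10 := mul_le_mul_of_nonneg_right h8 (Real.rpow_nonneg hr.le γ)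
  linarith

lemma le_one_add_rpow {x p : ℝ} (hx : 0 ≤ x) (hp : 1 ≤ p) : x ≤ 1 + x ^ p := by
  rcases le_total x 1 with h | h
  · linarith [Real.rpow_nonneg hx p]
  · have := Real.self_le_rpow_of_one_le h hp
    linarith

/-- A bound for the density and the momentum by the energy. -/
noncomputable def energyConst (a γ : ℝ) : ℝ := 2 + (γ - 1) / a

lemma le_energyConst (ha : 0 < a) (hγ : 1 < γ) (hr : 0 ≤ r) (h : r = 0 → v = 0) :
    |r| ≤ 1 + energyConst a γ * realEnergy a γ r v ∧
      ∀ i, |v i| ≤ 1 + energyConst a γ * realEnergy a γ r v := by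
  have hE := realEnergy_nonneg ha hγ hr v
  have hp : 1 ≤ 2 * γ / (γ + 1) := by rw [le_div_iff₀ (by linarith)]; linarith
  refine ⟨?_, fun i => ?_⟩
  · rw [abs_of_nonneg hr]
    have h1 := le_one_add_rpow hr hγ.le
    have h2 := rpow_le_realEnergy (v := v) ha hγ hr
    simp only [energyConst]
    linarith
  · exact (abs_coord_le_norm v i).trans ((le_one_add_rpow (norm_nonneg v) hp).trans
      (add_le_add_right (norm_rpow_le_realEnergy ha hγ hr h) 1))

end EnergyBounds

section Traces

open ProbabilityTheory

variable {d : ℕ} {D : FlowRegion d} {a γ T E₀ : ℝ}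

lemma IsFlow.congr {X : Type} [MeasurableSpace X] {lam : Measure X} {ρ ρ' : X → ℝ}
    {m m' : X → Vec d} (h : IsFlow lam γ ρ m) (hρ : ρ' =ᵐ[lam] ρ) (hm : m' =ᵐ[lam] m) :
    IsFlow lam γ ρ' m' where
  nonneg := by filter_upwards [h.nonneg, hρ] with x h1 h2; rwa [h2]
  eq_zero := by filter_upwards [h.eq_zero, hρ, hm] with x h1 h2 h3; rwa [h2, h3]
  integrable_density := h.integrable_density.congr hρ.symm
  integrable_momentum i := (h.integrable_momentum i).congr (by
    filter_upwards [hm] with x h1; rw [h1])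
  integrable_flux i j := (h.integrable_flux i j).congr (by
    filter_upwards [hm, hρ] with x h1 h2; rw [h1, h2])
  integrable_pressure := h.integrable_pressure.congr (by
    filter_upwards [hρ] with x h2; rw [h2])

/-- Integrals against a test function that depends continuously on time. -/
lemma tendsto_integral_mul {l : Filter ℝ} {t : ℝ} (hl : l ≤ 𝓝 t) {u : ℝ → Vec d → ℝ} {C L : ℝ}
    (hu : ∀ᶠ s in l, Integrable (u s) D.vol ∧ ∫ x, |u s x| ∂D.vol ≤ C) {G : ℝ → Vec d → ℝ}
    (hG : Continuous fun z : ℝ × Vec d => G z.1 z.2)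
    (h : Tendsto (fun s => ∫ x, u s x * G t x ∂D.vol) l (𝓝 L)) :
    Tendsto (fun s => ∫ x, u s x * G s x ∂D.vol) l (𝓝 L) := by
  have hGs : ∀ s, Continuous (G s) := fun s => hG.comp (continuous_const.prodMk continuous_id)
  have hint : ∀ s s', Integrable (u s) D.vol → Integrable (fun x => u s x * G s' x) D.vol :=
    fun s s' hs => by
      simpa [mul_comm] using integrable_continuousMap_mul D.isCompact_closedRegion D.vol_compl
        ⟨G s', hGs s'⟩ hs
  have hunif : Tendsto (fun s => ContinuousMap.curry ⟨fun z : ℝ × Vec d => G z.1 z.2, hG⟩ s) l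
      (𝓝 (ContinuousMap.curry ⟨fun z : ℝ × Vec d => G z.1 z.2, hG⟩ t)) :=
    ((ContinuousMap.curry ⟨fun z : ℝ × Vec d => G z.1 z.2, hG⟩).continuous.tendsto t).mono_left hl
  rw [ContinuousMap.tendsto_iff_forall_isCompact_tendstoUniformlyOn] at hunif
  have hunif := Metric.tendstoUniformlyOn_iff.mp (hunif D.closedRegion D.isCompact_closedRegion)
  have hdiff : Tendsto (fun s => ∫ x, u s x * G s x ∂D.vol - ∫ x, u s x * G t x ∂D.vol) l
      (𝓝 0) := by
    rw [Metric.tendsto_nhds]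
    intro ε hε
    have hC : 0 < |C| + 1 := by positivity
    filter_upwards [hu, hunif (ε / (|C| + 1)) (by positivity)] with s hs hs'
    rw [Real.dist_eq, sub_zero, ← integral_sub (hint s s hs.1) (hint s t hs.1)]
    have h1 : |∫ x, (u s x * G s x - u s x * G t x) ∂D.vol|
        ≤ ∫ x, |u s x| * (ε / (|C| + 1)) ∂D.vol := by
      refine norm_integral_le_of_norm_le (f := fun x => u s x * G s x - u s x * G t x)
        (hs.1.abs.mul_const _) ?_
      filter_upwards [D.ae_mem_interiorSet] with x hx
      have h2 := (hs' x (subset_closure hx)).le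
      rw [dist_comm, Real.dist_eq] at h2
      rw [← mul_sub, Real.norm_eq_abs, abs_mul]
      exact mul_le_mul_of_nonneg_left h2 (abs_nonneg _)
    rw [integral_mul_const] at h1
    calc _ ≤ (∫ x, |u s x| ∂D.vol) * (ε / (|C| + 1)) := h1
      _ < (|C| + 1) * (ε / (|C| + 1)) := by
          gcongr
          exact hs.2.trans_lt ((le_abs_self C).trans_lt (lt_add_one _))
      _ = ε := by field_simp
  have := hdiff.add h
  simpa using this

/-- Every time of `[0,T]` is a limit of times at which the slice is controlled, along which the
slices converge weakly: the slices are relaxed states on space without defects, which form a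
relatively compact set, and the density and the momentum of a limit are those of its
representation. The energy of the limit is bounded, as defects only add to it. -/
lemma exists_trace (hT : 0 < T) (ha : 0 < a) (hγ : 1 < γ) {ρ : ℝ × Vec d → ℝ}
    {m : ℝ × Vec d → Vec d} (hflow : ∀ᵐ t ∂volume.restrict (Ioo 0 T),
      IsFlow D.vol γ (fun x => ρ (t, x)) (fun x => m (t, x)))
    (hE : ∀ᵐ t ∂volume.restrict (Ioo 0 T),
      ∫ x, realEnergy a γ (ρ (t, x)) (m (t, x)) ∂D.vol ≤ E₀) {t : ℝ} (ht : t ∈ Icc 0 T) :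
    ∃ (ρ' : Vec d → ℝ) (m' : Vec d → Vec d), IsFlow D.vol γ ρ' m' ∧
      ∫ x, realEnergy a γ (ρ' x) (m' x) ∂D.vol ≤ E₀ ∧
      ∃ l : Filter ℝ, l.NeBot ∧ l ≤ 𝓝 t ∧ l ≤ ae (volume.restrict (Ioo 0 T)) ∧
        ∀ f : Vec d → ℝ, Continuous f →
          Tendsto (fun s => ∫ x, ρ (s, x) * f x ∂D.vol) l (𝓝 (∫ x, ρ' x * f x ∂D.vol)) ∧
          ∀ i, Tendsto (fun s => ∫ x, m (s, x) i * f x ∂D.vol) l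
            (𝓝 (∫ x, m' x i * f x ∂D.vol)) := by
  have hne : (𝓝 t ⊓ ae (volume.restrict (Ioo 0 T))).NeBot := by
    refine inf_neBot_iff.mpr fun {U} hU {V} hV => ?_
    obtain ⟨W, hWU, hW, htW⟩ := mem_nhds_iff.mp hU
    have h1 : (W ∩ Ioo 0 T).Nonempty :=
      mem_closure_iff.mp (by rw [closure_Ioo hT.ne]; exact ht) W hW htW
    have h2 : 0 < volume.restrict (Ioo 0 T) W := by
      rw [Measure.restrict_apply hW.measurableSet]
      exact (hW.inter isOpen_Ioo).measure_pos _ h1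
    by_contra hemp
    rw [not_nonempty_iff_eq_empty] at hemp
    have h3 : W ⊆ Vᶜ := fun x hx hxV => by
      have : x ∈ U ∩ V := ⟨hWU hx, hxV⟩
      rw [hemp] at this
      exact this
    exact h2.ne' (measure_mono_null h3 (mem_ae_iff.mp hV))
  set l₀ := Ultrafilter.of (𝓝 t ⊓ ae (volume.restrict (Ioo 0 T))) with hl₀
  have hle : (l₀ : Filter ℝ) ≤ 𝓝 t ⊓ ae (volume.restrict (Ioo 0 T)) := Ultrafilter.of_le _
  have hKc := D.isCompact_closedRegion
  have hcompact := isCompact_relaxed (d := d) (lam := D.vol) ha hγ hKc E₀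
  set P : ℝ → RelaxedState (Vec d) d :=
    fun s => pureState D.vol a γ (fun x => ρ (s, x)) (fun x => m (s, x)) with hP
  have hlae : (l₀ : Filter ℝ) ≤ ae (volume.restrict (Ioo 0 T)) := hle.trans inf_le_right
  have hmem : ∀ᶠ s in (l₀ : Filter ℝ), P s ∈ {S : RelaxedState (Vec d) d |
      IsRelaxed D.closedRegion D.vol a γ S ∧ S.energy γ 1 ≤ E₀} := by
    filter_upwards [hlae hflow, hlae hE] with s h1 h2
    refine ⟨h1.isRelaxed_pureState ha hγ hKc D.vol_compl, ?_⟩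
    rw [hP, h1.energy_pureState hKc D.vol_compl]
    simpa [realEnergy] using h2
  obtain ⟨S', hS', hlim⟩ := hcompact.ultrafilter_le_nhds (l₀.map P) (by
    rw [le_principal_iff]; exact hmem)
  obtain ⟨μ', ρ', m', r', s', hrep⟩ := hS'.1.exists_representation ha hγ hKc D.vol_compl
  refine ⟨ρ', m', hrep.isFlow, ?_, l₀, inferInstance, hle.trans inf_le_left, hlae, fun f hf => ?_⟩
  · have h1 := hS'.2
    rw [hrep.energy_eq hγ hKc D.vol_compl] at h1
    simp only [ContinuousMap.one_apply, one_mul] at h1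
    have h2 : 0 ≤ ∫ _, (1 : ℝ) ∂μ' := integral_nonneg fun _ => zero_le_one
    linarith
  · have hblock : ∀ j, Tendsto (fun s => (P s).1 none j ⟨f, hf⟩) l₀ (𝓝 (S'.1 none j ⟨f, hf⟩)) :=
      fun j => ((continuous_block none j (⟨f, hf⟩ : C(Vec d, ℝ))).tendsto S').comp hlim
    constructor
    · have h1 := hblock none
      rw [hrep.density_eq] at h1
      simpa [hP, pureState, blockMatrix_none_none, mul_comm] using h1
    · intro i
      have h1 := hblock (some i)
      rw [hrep.momentum_eq] at h1
      simp only [ContinuousMap.coe_mk, mul_comm (f _)] at h1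
      refine h1.congr' ?_
      filter_upwards [hlae hflow] with s hs
      refine integral_congr_ae ?_
      filter_upwards [hs.eq_zero] with x hx
      rw [ContinuousMap.coe_mk, blockMatrix_none_some hx, mul_comm]

end Traces

section Trajectory

open ProbabilityTheory

variable {d : ℕ} {D : FlowRegion d} {a γ T : ℝ} {ρ₀ : Vec d → ℝ} {m₀ : Vec d → Vec d}
  {S : RelaxedState (ℝ × Vec d) d} {μ : Measure (ℝ × Vec d)} {ρ : ℝ × Vec d → ℝ}
  {m : ℝ × Vec d → Vec d} {r : ℝ × Vec d → Matrix (Fin d) (Fin d) ℝ} {s : ℝ × Vec d → ℝ}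
  {ν : Kernel ℝ (Vec d)} [IsFiniteKernel ν]

lemma IsFlow.pairing_eq {ρ : Vec d → ℝ} {m : Vec d → Vec d} (h : IsFlow D.vol γ ρ m)
    {f : Vec d → ℝ} {F : Vec d → Vec d} (hf : Continuous f) (hF : Continuous F) :
    D.pairing ρ m f F = ∫ x, ρ x * f x ∂D.vol + ∑ i, ∫ x, m x i * F x i ∂D.vol := by
  have hFi : ∀ i, Continuous fun x => F x i := fun i =>
    (EuclideanSpace.proj (𝕜 := ℝ) i).continuous.comp hF
  have hi : ∀ i, Integrable (fun x => m x i * F x i) D.vol := fun i => by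
    simpa [mul_comm] using integrable_continuousMap_mul D.isCompact_closedRegion D.vol_compl
      ⟨_, hFi i⟩ (h.integrable_momentum i)
  rw [FlowRegion.pairing, integral_add (h.integrable_density_mul hf) (h.integrable_inner hF),
    ← integral_finsetSum _ fun i _ => hi i]
  simp only [inner_eq_sum]

lemma FlowRegion.pairing_congr {ρ ρ' : Vec d → ℝ} {m m' : Vec d → Vec d} (hρ : ρ =ᵐ[D.vol] ρ')
    (hm : m =ᵐ[D.vol] m') (f : Vec d → ℝ) (F : Vec d → Vec d) :
    D.pairing ρ m f F = D.pairing ρ' m' f F :=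
  integral_congr_ae (by filter_upwards [hρ, hm] with x h1 h2; rw [h1, h2])

lemma IsFlow.integral_abs_le {ρ : Vec d → ℝ} {m : Vec d → Vec d} (ha : 0 < a) (hγ : 1 < γ)
    {E₀ : ℝ} (h : IsFlow D.vol γ ρ m) (hE : ∫ x, realEnergy a γ (ρ x) (m x) ∂D.vol ≤ E₀) :
    ∫ x, |ρ x| ∂D.vol ≤ D.vol.real univ + energyConst a γ * E₀ ∧
      ∀ i, ∫ x, |m x i| ∂D.vol ≤ D.vol.real univ + energyConst a γ * E₀ := by
  have hi : Integrable (fun x => 1 + energyConst a γ * realEnergy a γ (ρ x) (m x)) D.vol :=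
    (integrable_const _).add ((h.integrable_realEnergy a).const_mul _)
  have hc : 0 ≤ energyConst a γ := by
    have : 0 < γ - 1 := by linarith
    unfold energyConst
    positivity
  have hle : ∫ x, (1 + energyConst a γ * realEnergy a γ (ρ x) (m x)) ∂D.vol
      ≤ D.vol.real univ + energyConst a γ * E₀ := by
    rw [integral_add (integrable_const _) ((h.integrable_realEnergy a).const_mul _),
      integral_const_mul]
    simp only [integral_const, smul_eq_mul, mul_one]
    gcongr
  constructor
  · refine (integral_mono_ae h.integrable_density.abs hi ?_).trans hle
    filter_upwards [h.nonneg, h.eq_zero] with x h1 h2 using (le_energyConst ha hγ h1 h2).1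
  · intro i
    refine (integral_mono_ae (h.integrable_momentum i).abs hi ?_).trans hle
    filter_upwards [h.nonneg, h.eq_zero] with x h1 h2 using (le_energyConst ha hγ h1 h2).2 i

lemma IsRepresentation.continuousOn_primitive_rate (hT : 0 < T) (hγ : 1 < γ)
    (h : IsRepresentation (D.cylinder T) (D.spaceTime T) a γ S μ ρ m r s)
    (hν : μ = volume.restrict (Ioo 0 T) ⊗ₘ ν) {φ : ℝ → Vec d → ℝ} {Φ : ℝ → Vec d → Vec d}
    (hφ : ContDiff ℝ 1 fun z : ℝ × Vec d => φ z.1 z.2)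
    (hΦ : ContDiff ℝ 1 fun z : ℝ × Vec d => Φ z.1 z.2) :
    ContinuousOn (fun t => ∫ s' in (0 : ℝ)..t, D.rate a γ φ Φ ρ m r s ν s') (Icc 0 T) := by
  have h1 := h.integrableOn_rate hγ hν hφ hΦ
  rw [← integrableOn_Icc_iff_integrableOn_Ioo] at h1
  have := intervalIntegral.continuousOn_primitive_interval (a := 0) (b := T)
    (μ := volume) (by rwa [uIcc_of_le hT.le])
  rwa [uIcc_of_le hT.le] at this

/-- Countably many test functions of space determine the density and the momentum. -/
lemma FlowRegion.exists_countable_spatialTest (D : FlowRegion d) (T : ℝ) :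
    ∃ G : Set ((Vec d → ℝ) × (Vec d → Vec d)), G.Countable ∧
      (∀ P ∈ G, ContDiff ℝ 1 (fun z : ℝ × Vec d => P.1 z.2) ∧ (D.IsPeriodic fun _ => P.1) ∧
        ContDiff ℝ 1 (fun z : ℝ × Vec d => P.2 z.2) ∧ (D.IsPeriodic fun _ => P.2) ∧
        D.IsTangential T fun _ => P.2) ∧
      ∀ (ρ ρ' : Vec d → ℝ) (m m' : Vec d → Vec d), IsFlow D.vol γ ρ m → IsFlow D.vol γ ρ' m' →
        (∀ P ∈ G, D.pairing ρ m P.1 P.2 = D.pairing ρ' m' P.1 P.2) →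
        ρ =ᵐ[D.vol] ρ' ∧ m =ᵐ[D.vol] m' := by
  obtain ⟨G, hGc, hGb, hG⟩ := D.exists_countable_isBump
  choose! g' hg' hgeq hgp hgv using fun g (hg : g ∈ G) => D.exists_spatialTest
    ((hGb g hg).contDiff.of_le (by exact_mod_cast le_top)) (hGb g hg).compact (hGb g hg).support
  have hc2 : ∀ g ∈ G, ContDiff ℝ 1 fun z : ℝ × Vec d => g' g z.2 := fun g hg =>
    (hg' g hg).comp contDiff_snd
  refine ⟨(fun g => (g' g, fun _ => 0)) '' G ∪
    ⋃ i, (fun g => (fun _ => 0, fun x => g' g x • basisVec i)) '' G,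
    (hGc.image _).union (countable_iUnion fun i => hGc.image _), ?_,
    fun ρ ρ' m m' h h' hP => ?_⟩
  · rintro P (⟨g, hg, rfl⟩ | hP)
    · have := hgv g hg T 0
      simp only [smul_zero] at this
      exact ⟨hc2 g hg, hgp g hg, contDiff_const, this.1, this.2⟩
    · obtain ⟨i, g, hg, rfl⟩ := mem_iUnion.mp hP
      refine ⟨contDiff_const, ?_, (hc2 g hg).smul contDiff_const, (hgv g hg T _).1,
        (hgv g hg T _).2⟩
      cases D
      · trivial
      · exact fun _ _ _ => rfl
  · have hmulint : ∀ (u : Vec d → ℝ), Integrable u D.vol → ∀ g ∈ G,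
        Integrable (fun x => u x * g x) D.vol := fun u hu g hg => by
      simpa [mul_comm] using integrable_continuousMap_mul D.isCompact_closedRegion D.vol_compl
        ⟨g, (hGb g hg).contDiff.continuous⟩ hu
    have heq : ∀ (u u' : Vec d → ℝ), Integrable u D.vol → Integrable u' D.vol →
        (∀ g ∈ G, ∫ x, u x * g' g x ∂D.vol = ∫ x, u' x * g' g x ∂D.vol) → u =ᵐ[D.vol] u' := by
      intro u u' hu hu' hg
      have hcongr : ∀ g ∈ G, ∀ u : Vec d → ℝ, ∫ x, u x * g x ∂D.vol = ∫ x, u x * g' g x ∂D.vol :=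
        fun g hg u => integral_congr_ae (by
          filter_upwards [D.ae_mem_interiorSet] with x hx; rw [hgeq g hg x hx])
      have := hG (u - u') (hu.sub hu') fun g hgG => by
        simp only [Pi.sub_apply, sub_mul]
        rw [integral_sub (hmulint u hu g hgG) (hmulint u' hu' g hgG), hcongr g hgG,
          hcongr g hgG, hg g hgG, sub_self]
      filter_upwards [this] with x hx using sub_eq_zero.mp hx
    refine ⟨heq _ _ h.integrable_density h'.integrable_density fun g hg => ?_, ?_⟩
    · simpa [FlowRegion.pairing] using hP _ (Or.inl ⟨g, hg, rfl⟩)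
    · have hi := ae_all_iff.mpr fun i => heq _ _ (h.integrable_momentum i)
        (h'.integrable_momentum i) fun g hg => by
          have k := hP _ (Or.inr (mem_iUnion.mpr ⟨i, g, hg, rfl⟩))
          simpa [FlowRegion.pairing, inner_smul_right, basisVec,
            EuclideanSpace.inner_single_right, mul_comm] using k
      filter_upwards [hi] with x hx
      ext i
      exact hx i

/-- A relaxed solution has values at every time, with bounded energy, for which the weak
formulations hold; for almost every time they are the time slices. -/
theorem IsRepresentation.exists_trajectory (hT : 0 < T) (ha : 0 < a) (hγ : 1 < γ)
    (hS : S ∈ relaxedSolutions D a γ T ρ₀ m₀)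
    (h : IsRepresentation (D.cylinder T) (D.spaceTime T) a γ S μ ρ m r s)
    (hν : μ = volume.restrict (Ioo 0 T) ⊗ₘ ν) (hρ₀ : IsFlow D.vol γ ρ₀ m₀) :
    ∃ (ρ' : ℝ → Vec d → ℝ) (m' : ℝ → Vec d → Vec d),
      (∀ᵐ t ∂volume.restrict (Ioo 0 T), (∀ x, ρ' t x = ρ (t, x)) ∧ ∀ x, m' t x = m (t, x)) ∧
      ∀ t ∈ Icc 0 T, IsFlow D.vol γ (ρ' t) (m' t) ∧
        ∫ x, realEnergy a γ (ρ' t x) (m' t x) ∂D.vol ≤ (initialEnergy D a γ ρ₀ m₀).toReal ∧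
        ∀ (φ : ℝ → Vec d → ℝ) (Φ : ℝ → Vec d → Vec d),
          ContDiff ℝ 1 (fun z : ℝ × Vec d => φ z.1 z.2) → D.IsPeriodic φ →
          ContDiff ℝ 1 (fun z : ℝ × Vec d => Φ z.1 z.2) → D.IsPeriodic Φ → D.IsTangential T Φ →
          D.pairing (ρ' t) (m' t) (φ t) (Φ t) = D.pairing ρ₀ m₀ (φ 0) (Φ 0)
            + ∫ s' in (0 : ℝ)..t, D.rate a γ φ Φ ρ m r s ν s' := by
  classical
  have hflow := h.isFlow.ae_slice
  have hE := h.ae_energy_le hT ha hγ hS hν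
  choose! ρ' m' hflow' hE' l hne hl hlae hconv using
    fun t (ht : t ∈ Icc 0 T) => exists_trace hT ha hγ hflow hE ht
  have hpair : ∀ t ∈ Icc 0 T, ∀ (φ : ℝ → Vec d → ℝ) (Φ : ℝ → Vec d → Vec d),
      ContDiff ℝ 1 (fun z : ℝ × Vec d => φ z.1 z.2) → D.IsPeriodic φ →
      ContDiff ℝ 1 (fun z : ℝ × Vec d => Φ z.1 z.2) → D.IsPeriodic Φ → D.IsTangential T Φ →
      D.pairing (ρ' t) (m' t) (φ t) (Φ t) = D.pairing ρ₀ m₀ (φ 0) (Φ 0)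
        + ∫ s' in (0 : ℝ)..t, D.rate a γ φ Φ ρ m r s ν s' := by
    intro t ht φ Φ hφ hφp hΦ hΦp hΦt
    have := hne t ht
    have hcφ : ∀ t, Continuous (φ t) := fun t => (contDiff_spaceSlice hφ t).continuous
    have hcΦ : ∀ t, Continuous (Φ t) := fun t => (contDiff_spaceSlice hΦ t).continuous
    have hbd : ∀ᶠ s in l t, IsFlow D.vol γ (fun x => ρ (s, x)) (fun x => m (s, x)) ∧
        ∫ x, realEnergy a γ (ρ (s, x)) (m (s, x)) ∂D.vol
          ≤ (initialEnergy D a γ ρ₀ m₀).toReal := by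
      filter_upwards [hlae t ht hflow, hlae t ht hE] with s h1 h2 using ⟨h1, h2⟩
    have h1 : Tendsto (fun s => D.pairing (fun x => ρ (s, x)) (fun x => m (s, x)) (φ s) (Φ s))
        (l t) (𝓝 (D.pairing (ρ' t) (m' t) (φ t) (Φ t))) := by
      rw [(hflow' t ht).pairing_eq (hcφ t) (hcΦ t)]
      refine Tendsto.congr' (f₁ := fun s => ∫ x, ρ (s, x) * φ s x ∂D.vol
        + ∑ i, ∫ x, m (s, x) i * Φ s x i ∂D.vol) ?_ (Tendsto.add ?_ ?_)
      · filter_upwards [hbd] with s hs using (hs.1.pairing_eq (hcφ s) (hcΦ s)).symm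
      · refine tendsto_integral_mul (hl t ht) (C := D.vol.real univ
          + energyConst a γ * (initialEnergy D a γ ρ₀ m₀).toReal)
          (u := fun s x => ρ (s, x)) ?_ hφ.continuous
          (hconv t ht _ (hcφ t)).1
        filter_upwards [hbd] with s hs
        exact ⟨hs.1.integrable_density, (hs.1.integral_abs_le ha hγ hs.2).1⟩
      · refine tendsto_finsetSum _ fun i _ => tendsto_integral_mul (hl t ht)
          (C := D.vol.real univ + energyConst a γ * (initialEnergy D a γ ρ₀ m₀).toReal)
          (u := fun s x => m (s, x) i) (G := fun s x => Φ s x i) ?_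
          ((EuclideanSpace.proj (𝕜 := ℝ) i).continuous.comp hΦ.continuous)
          ((hconv t ht _ ((EuclideanSpace.proj (𝕜 := ℝ) i).continuous.comp (hcΦ t))).2 i)
        filter_upwards [hbd] with s hs
        exact ⟨hs.1.integrable_momentum i, (hs.1.integral_abs_le ha hγ hs.2).2 i⟩
    have h2 : Tendsto (fun t => D.pairing ρ₀ m₀ (φ 0) (Φ 0)
        + ∫ s' in (0 : ℝ)..t, D.rate a γ φ Φ ρ m r s ν s') (l t)
        (𝓝 (D.pairing ρ₀ m₀ (φ 0) (Φ 0)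
          + ∫ s' in (0 : ℝ)..t, D.rate a γ φ Φ ρ m r s ν s')) := by
      refine tendsto_const_nhds.add ((h.continuousOn_primitive_rate hT hγ hν hφ hΦ t ht).mono_left
        (le_inf (hl t ht) (le_principal_iff.mpr ?_)))
      filter_upwards [(hlae t ht) (ae_restrict_mem measurableSet_Ioo)] with s hs
        using Ioo_subset_Icc_self hs
    refine tendsto_nhds_unique h1 (h2.congr' ?_)
    filter_upwards [(hlae t ht) (h.ae_pairing_eq hγ hS hν hρ₀ hφ hφp hΦ hΦp hΦt)] with s hs
    exact hs.symm
  -- Countably many test functions identify the slices with the limits.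
  have hae : ∀ᵐ t ∂volume.restrict (Ioo 0 T), (fun x => ρ (t, x)) =ᵐ[D.vol] ρ' t ∧
      (fun x => m (t, x)) =ᵐ[D.vol] m' t := by
    obtain ⟨G, hGc, hGt, hG⟩ := D.exists_countable_spatialTest T
    have htest : ∀ P ∈ G, ∀ᵐ t ∂volume.restrict (Ioo 0 T),
        D.pairing (fun x => ρ (t, x)) (fun x => m (t, x)) P.1 P.2
          = D.pairing (ρ' t) (m' t) P.1 P.2 := by
      intro P hP
      obtain ⟨h1, h2, h3, h4, h5⟩ := hGt P hP
      filter_upwards [h.ae_pairing_eq hγ hS hν hρ₀ h1 h2 h3 h4 h5,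
        ae_restrict_mem measurableSet_Ioo] with t k ht
      exact k.trans (hpair t (Ioo_subset_Icc_self ht) _ _ h1 h2 h3 h4 h5).symm
    filter_upwards [(ae_ball_iff hGc).mpr htest, hflow, ae_restrict_mem measurableSet_Ioo]
      with t h1 h2 ht
    exact hG _ _ _ _ h2 (hflow' t (Ioo_subset_Icc_self ht)) h1
  -- The slices are kept wherever they agree with the limits, which makes the result jointly
  -- measurable.
  set P : ℝ → Prop := fun t => (fun x => ρ (t, x)) =ᵐ[D.vol] ρ' t ∧
      (fun x => m (t, x)) =ᵐ[D.vol] m' t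
  have e1 : ∀ t, (if P t then fun x => ρ (t, x) else ρ' t) =ᵐ[D.vol] ρ' t := fun t => by
    split_ifs with hP
    · exact hP.1
    · rfl
  have e2 : ∀ t, (if P t then fun x => m (t, x) else m' t) =ᵐ[D.vol] m' t := fun t => by
    split_ifs with hP
    · exact hP.2
    · rfl
  refine ⟨fun t => if P t then fun x => ρ (t, x) else ρ' t,
    fun t => if P t then fun x => m (t, x) else m' t, ?_, fun t ht => ⟨?_, ?_, ?_⟩⟩
  · filter_upwards [hae] with t ht
    simp [show P t from ht]
  · exact (hflow' t ht).congr (e1 t) (e2 t)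
  · refine le_of_eq_of_le (integral_congr_ae ?_) (hE' t ht)
    filter_upwards [e1 t, e2 t] with x h1 h2
    rw [h1, h2]
  · intro φ Φ hφ hφp hΦ hΦp hΦt
    rw [FlowRegion.pairing_congr (e1 t) (e2 t)]
    exact hpair t ht φ Φ hφ hφp hΦ hΦp hΦt

end Trajectory

/-! ### The defect measures of a relaxed solution -/

section DefectMeasures

open ProbabilityTheory

lemma integral_lsmul_toSignedMeasure {X : Type} [MeasurableSpace X] (μ : Measure X)
    [IsFiniteMeasure μ] (f : X → ℝ) :
    μ.toSignedMeasure.integral f (ContinuousLinearMap.lsmul ℝ ℝ) = ∫ x, f x ∂μ := by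
  have hflip : ContinuousLinearMap.lsmul ℝ ℝ
      = (ContinuousLinearMap.lsmul ℝ ℝ : ℝ →L[ℝ] ℝ →L[ℝ] ℝ).flip := by
    ext
    simp
  rw [hflip, VectorMeasure.integral_toSignedMeasure]

/-- The integral against a signed measure given as a difference of two finite measures. -/
lemma integral_signedMeasure_eq_sub {X : Type} [MeasurableSpace X] {σ : SignedMeasure X}
    {μ ν : Measure X} [IsFiniteMeasure μ] [IsFiniteMeasure ν]
    (h : ∀ B, MeasurableSet B → σ B = μ.real B - ν.real B) {f : X → ℝ}
    (hμ : Integrable f μ) (hν : Integrable f ν) :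
    σ.Integrable f ∧
      σ.integral f (ContinuousLinearMap.lsmul ℝ ℝ) = ∫ x, f x ∂μ - ∫ x, f x ∂ν := by
  have hσ : σ = μ.toSignedMeasure - ν.toSignedMeasure := by
    ext B hB
    rw [h B hB, _root_.sub_apply, Measure.toSignedMeasure_apply_measurable hB,
      Measure.toSignedMeasure_apply_measurable hB]
  have i1 : μ.toSignedMeasure.Integrable f := by simpa [VectorMeasure.Integrable] using hμ
  have i2 : ν.toSignedMeasure.Integrable f := by simpa [VectorMeasure.Integrable] using hν
  rw [hσ]
  refine ⟨i1.sub_vectorMeasure i2, ?_⟩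
  rw [VectorMeasure.integral_sub_vectorMeasure i1 i2, integral_lsmul_toSignedMeasure,
    integral_lsmul_toSignedMeasure]

variable {d : ℕ} {D : FlowRegion d} {n : Measure (Vec d)} [IsFiniteMeasure n]

/-- The signed measure with density `u` on the closed region, carried over to the set of
representatives `Ω̄`. -/
noncomputable def FlowRegion.wrapDensity (D : FlowRegion d) (n : Measure (Vec d)) (u : Vec d → ℝ) :
    SignedMeasure (Vec d) := (n.withDensityᵥ u).map D.wrap

/-- The measure with the nonnegative density `s` on the closed region, carried over to the set of
representatives `Ω̄`. -/
noncomputable def FlowRegion.wrapMeasure (D : FlowRegion d) (n : Measure (Vec d)) (s : Vec d → ℝ) :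
    Measure (Vec d) := (n.withDensity fun x => ENNReal.ofReal (s x)).map D.wrap

variable {u : Vec d → ℝ} {C : ℝ}

lemma integrable_of_abs_le (hu : Measurable u) (hC : ∀ x, |u x| ≤ C) : Integrable u n :=
  Integrable.of_bound hu.aestronglyMeasurable C (.of_forall hC)

lemma FlowRegion.wrapDensity_apply (hu : Measurable u) (hC : ∀ x, |u x| ≤ C)
    {B : Set (Vec d)} (hB : MeasurableSet B) :
    D.wrapDensity n u B = ∫ x in D.wrap ⁻¹' B, u x ∂n := by
  rw [FlowRegion.wrapDensity, VectorMeasure.map_apply _ D.measurable_wrap hB,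
    withDensityᵥ_apply (integrable_of_abs_le hu hC) (D.measurable_wrap hB)]

lemma FlowRegion.wrapMeasure_apply {B : Set (Vec d)} (hB : MeasurableSet B) :
    D.wrapMeasure n u B = ∫⁻ x in D.wrap ⁻¹' B, ENNReal.ofReal (u x) ∂n := by
  rw [FlowRegion.wrapMeasure, Measure.map_apply D.measurable_wrap hB,
    withDensity_apply _ (D.measurable_wrap hB)]

lemma FlowRegion.wrapMeasure_real (hu : Measurable u) (h0 : ∀ x, 0 ≤ u x)
    {B : Set (Vec d)} (hB : MeasurableSet B) :
    (D.wrapMeasure n u).real B = ∫ x in D.wrap ⁻¹' B, u x ∂n := by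
  rw [Measure.real, wrapMeasure_apply hB, integral_eq_lintegral_of_nonneg_ae (.of_forall h0)
    hu.aestronglyMeasurable]

lemma FlowRegion.wrapMeasure_univ_le (hC : ∀ x, u x ≤ C) :
    D.wrapMeasure n u univ ≤ ENNReal.ofReal C * n univ := by
  rw [wrapMeasure_apply MeasurableSet.univ, preimage_univ, setLIntegral_univ, ← lintegral_const]
  exact lintegral_mono fun x => ENNReal.ofReal_le_ofReal (hC x)

lemma FlowRegion.isFiniteMeasure_wrapMeasure (hC : ∀ x, u x ≤ C) :
    IsFiniteMeasure (D.wrapMeasure n u) :=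
  ⟨(D.wrapMeasure_univ_le hC).trans_lt (ENNReal.mul_lt_top ENNReal.ofReal_lt_top
    (measure_lt_top _ _))⟩

variable {f : Vec d → ℝ}

lemma FlowRegion.integral_wrapMeasure (hn : n D.closedRegionᶜ = 0) (hu : Measurable u)
    (h0 : ∀ x, 0 ≤ u x) (hC : ∀ x, u x ≤ C) (hf : Continuous f) (hw : ∀ x, f (D.wrap x) = f x) :
    Integrable f (D.wrapMeasure n u) ∧ ∫ x, f x ∂D.wrapMeasure n u = ∫ x, f x * u x ∂n := by
  have hi : Integrable (fun x => f x * u x) n :=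
    (integrable_continuousMap D.isCompact_closedRegion hn ⟨f, hf⟩).mul_bdd (c := C)
      hu.aestronglyMeasurable (.of_forall fun x => by rw [Real.norm_of_nonneg (h0 x)]; exact hC x)
  constructor
  · rw [FlowRegion.wrapMeasure, integrable_map_measure hf.aestronglyMeasurable
      D.measurable_wrap.aemeasurable, integrable_withDensity_iff hu.ennreal_ofReal
        (.of_forall fun _ => ENNReal.ofReal_lt_top)]
    simpa [Function.comp_def, hw, ENNReal.toReal_ofReal (h0 _)] using hi
  · rw [FlowRegion.wrapMeasure, integral_map D.measurable_wrap.aemeasurable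
      hf.aestronglyMeasurable, integral_withDensity_eq_integral_toReal_smul hu.ennreal_ofReal
        (.of_forall fun _ => ENNReal.ofReal_lt_top)]
    simp [hw, ENNReal.toReal_ofReal (h0 _), mul_comm]

lemma FlowRegion.integral_wrapDensity (hn : n D.closedRegionᶜ = 0) (hu : Measurable u)
    (hC : ∀ x, |u x| ≤ C) (hf : Continuous f) (hw : ∀ x, f (D.wrap x) = f x) :
    (D.wrapDensity n u).integral f (ContinuousLinearMap.lsmul ℝ ℝ) = ∫ x, f x * u x ∂n := by
  have hC0 : ∀ x : Vec d, 0 ≤ C := fun x => (abs_nonneg _).trans (hC x)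
  have hfi : Integrable f n := integrable_continuousMap D.isCompact_closedRegion hn ⟨f, hf⟩
  have hu0 : ∀ x, 0 ≤ u x + C := fun x => by linarith [neg_le_of_abs_le (hC x)]
  have hu1 : ∀ x, u x + C ≤ 2 * C := fun x => by linarith [le_of_abs_le (hC x)]
  have hum : Measurable fun x => u x + C := hu.add_const C
  have h1 := D.isFiniteMeasure_wrapMeasure (n := n) hu1
  have h2 := D.isFiniteMeasure_wrapMeasure (n := n) (fun _ : Vec d => le_refl C)
  have hui : Integrable u n := integrable_of_abs_le hu hC
  obtain ⟨i1, e1⟩ := D.integral_wrapMeasure hn hum hu0 hu1 hf hw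
  obtain ⟨i2, e2⟩ := D.integral_wrapMeasure hn measurable_const hC0 (fun _ => le_refl C) hf hw
  rw [(integral_signedMeasure_eq_sub (μ := D.wrapMeasure n fun x => u x + C)
    (ν := D.wrapMeasure n fun _ => C) (fun B hB => ?_) i1 i2).2, e1, e2, ← integral_sub]
  · exact integral_congr_ae (.of_forall fun x => by ring)
  · simp only [mul_add]
    exact (hfi.mul_bdd hu.aestronglyMeasurable (.of_forall hC)).add (hfi.mul_const C)
  · exact hfi.mul_const C
  · rw [D.wrapDensity_apply hu hC hB, D.wrapMeasure_real hum hu0 hB,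
      D.wrapMeasure_real measurable_const hC0 hB,
      integral_add hui.integrableOn (integrable_const C).integrableOn, add_sub_cancel_right]

lemma FlowRegion.wrapDensity_variation_le (hu : Measurable u) (hC : ∀ x, |u x| ≤ C) :
    (D.wrapDensity n u).variation univ ≤ ENNReal.ofReal C * n univ := by
  refine (VectorMeasure.variation_map_le univ).trans ?_
  rw [Measure.map_apply D.measurable_wrap MeasurableSet.univ,
    Measure.variation_withDensityᵥ (integrable_of_abs_le hu hC), preimage_univ,
    withDensity_apply _ MeasurableSet.univ, setLIntegral_univ, ← lintegral_const]
  refine lintegral_mono fun x => ?_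
  rw [Real.enorm_eq_ofReal_abs]
  exact ENNReal.ofReal_le_ofReal (hC x)

variable {γ : ℝ} {r : Vec d → Matrix (Fin d) (Fin d) ℝ} {s : Vec d → ℝ}

lemma FlowRegion.posSemidef_wrapDensity (hr : ∀ i j, Measurable fun x => r x i j)
    (hC : ∀ x i j, |r x i j| ≤ C) (hpos : ∀ x, (r x).PosSemidef) {B : Set (Vec d)}
    (hB : MeasurableSet B) :
    (Matrix.of fun i j => D.wrapDensity n (fun x => r x i j) B).PosSemidef := by
  have e : ∀ i j, D.wrapDensity n (fun x => r x i j) B = ∫ x in D.wrap ⁻¹' B, r x i j ∂n :=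
    fun i j => D.wrapDensity_apply (hr i j) (fun x => hC x i j) hB
  have hi : ∀ i j, Integrable (fun x => r x i j) (n.restrict (D.wrap ⁻¹' B)) :=
    fun i j => integrable_of_abs_le (hr i j) fun x => hC x i j
  refine Matrix.PosSemidef.of_dotProduct_mulVec_nonneg ?_ fun ξ => ?_
  · ext i j
    simp only [Matrix.conjTranspose_apply, Matrix.of_apply, star_trivial, e]
    exact integral_congr_ae (.of_forall fun x => (hpos x).isHermitian.apply i j)
  · have : star ξ ⬝ᵥ (Matrix.of fun i j => D.wrapDensity n (fun x => r x i j) B).mulVec ξ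
        = ∫ x in D.wrap ⁻¹' B, star ξ ⬝ᵥ (r x).mulVec ξ ∂n := by
      simp only [dotProduct, Matrix.mulVec, Matrix.of_apply, e]
      rw [integral_finsetSum _ fun i _ => (integrable_finsetSum _ fun j _ =>
        (hi i j).mul_const _).const_mul _]
      refine Finset.sum_congr rfl fun i _ => ?_
      rw [integral_const_mul, integral_finsetSum _ fun j _ => (hi i j).mul_const _]
      simp only [integral_mul_const]
    rw [this]
    exact integral_nonneg fun x => (hpos x).dotProduct_mulVec_nonneg ξ

/-- The energy of normalized defects is the measure that they are densities of. -/
lemma FlowRegion.energy_wrapDensity (hγ : 1 < γ) (hr : ∀ i j, Measurable fun x => r x i j)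
    (hC : ∀ x i j, |r x i j| ≤ C) (hpos : ∀ x, (r x).PosSemidef) (hs : Measurable s)
    (hs0 : ∀ x, 0 ≤ s x) (hs1 : ∀ x, s x ≤ γ - 1)
    (hnorm : ∀ x, 1 / 2 * ∑ i, r x i i + 1 / (γ - 1) * s x = 1) {B : Set (Vec d)}
    (hB : MeasurableSet B) :
    ENNReal.ofReal (1 / 2 * ∑ i, D.wrapDensity n (fun x => r x i i) B)
      + ENNReal.ofReal (1 / (γ - 1)) * D.wrapMeasure n s B = n (D.wrap ⁻¹' B) := by
  have hγ1 : 0 < γ - 1 := by linarith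
  have hfin := D.isFiniteMeasure_wrapMeasure (n := n) hs1
  have hi : ∀ i, Integrable (fun x => r x i i) (n.restrict (D.wrap ⁻¹' B)) :=
    fun i => integrable_of_abs_le (hr i i) fun x => hC x i i
  have hsi : Integrable s (n.restrict (D.wrap ⁻¹' B)) :=
    integrable_of_abs_le hs (C := γ - 1) fun x => by rw [abs_of_nonneg (hs0 x)]; exact hs1 x
  have e : ∀ i, D.wrapDensity n (fun x => r x i i) B = ∫ x in D.wrap ⁻¹' B, r x i i ∂n :=
    fun i => D.wrapDensity_apply (hr i i) (fun x => hC x i i) hB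
  have h0 : 0 ≤ 1 / 2 * ∑ i, D.wrapDensity n (fun x => r x i i) B := by
    refine mul_nonneg (by norm_num) (Finset.sum_nonneg fun i _ => ?_)
    rw [e]
    exact integral_nonneg fun x => (hpos x).diag_nonneg
  rw [← ofReal_measureReal (μ := D.wrapMeasure n s), ← ENNReal.ofReal_mul (by positivity),
    ← ENNReal.ofReal_add h0 (mul_nonneg (by positivity) measureReal_nonneg),
    D.wrapMeasure_real hs hs0 hB, ← ofReal_measureReal (μ := n)]
  congr 1
  simp only [e]
  rw [← integral_finsetSum _ fun i _ => hi i, ← integral_const_mul, ← integral_const_mul,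
    ← integral_add ((integrable_finsetSum _ fun i _ => hi i).const_mul _) (hsi.const_mul _)]
  rw [integral_congr_ae (.of_forall hnorm)]
  simp

lemma FlowRegion.defectPairing_wrapDensity (hn : n D.closedRegionᶜ = 0)
    (hr : ∀ i j, Measurable fun x => r x i j) (hC : ∀ x i j, |r x i j| ≤ C) (hs : Measurable s)
    (hs0 : ∀ x, 0 ≤ s x) (hs1 : ∀ x, s x ≤ γ - 1) {Φ : ℝ → Vec d → Vec d}
    (hΦ : ContDiff ℝ 1 fun z : ℝ × Vec d => Φ z.1 z.2) (hΦp : D.IsPeriodic Φ) (t : ℝ) :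
    defectPairing (Matrix.of fun i j => D.wrapDensity n fun x => r x i j) (D.wrapMeasure n s) (Φ t)
      = ∫ x, defectFlux Φ (r x) (s x) (t, x) ∂n := by
  have hc : ∀ i j, Continuous fun x => partialD (Φ t) x i j := fun i j => by
    have := (contDiff_spaceSlice hΦ t).continuous_fderiv one_ne_zero
    exact (EuclideanSpace.proj (𝕜 := ℝ) i).continuous.comp (this.clm_apply continuous_const)
  have hdiv : Continuous fun x => divergence (Φ t) x := by
    unfold divergence
    exact continuous_finsetSum _ fun i _ => hc i i
  have hi : ∀ (f : Vec d → ℝ), Continuous f → Integrable f n := fun f hf =>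
    integrable_continuousMap D.isCompact_closedRegion hn ⟨f, hf⟩
  have j1 : ∀ i j, Integrable (fun x => partialD (Φ t) x i j * r x i j) n := fun i j =>
    (hi _ (hc i j)).mul_bdd (hr i j).aestronglyMeasurable (.of_forall fun x => hC x i j)
  have j2 : Integrable (fun x => divergence (Φ t) x * s x) n :=
    (hi _ hdiv).mul_bdd (c := γ - 1) hs.aestronglyMeasurable
      (.of_forall fun x => by rw [Real.norm_of_nonneg (hs0 x)]; exact hs1 x)
  rw [defectPairing, (D.integral_wrapMeasure hn hs hs0 hs1 hdiv
    fun x => hΦp.divergence.comp_wrap t x).2]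
  simp only [defectFlux, Matrix.of_apply]
  rw [integral_add (integrable_finsetSum _ fun i _ => integrable_finsetSum _ fun j _ => j1 i j) j2,
    integral_finsetSum _ fun i _ => integrable_finsetSum _ fun j _ => j1 i j]
  congr 1
  refine Finset.sum_congr rfl fun i _ => ?_
  rw [integral_finsetSum _ fun j _ => j1 i j]
  exact Finset.sum_congr rfl fun j _ => D.integral_wrapDensity hn (hr i j) (fun x => hC x i j)
    (hc i j) fun x => (hΦp.partialD i j).comp_wrap t x

end DefectMeasures

/-! ### From relaxed solutions to dissipative solutions -/

section Candidate

open ProbabilityTheory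

lemma memLp_of_rpow_le {X F : Type} [MeasurableSpace X] {μ : Measure X} [NormedAddCommGroup F]
    {u : X → F} {g : X → ℝ} {p K : ℝ} (hp : 0 < p) (hu : AEStronglyMeasurable u μ)
    (hg : Integrable g μ) (h : ∀ᵐ x ∂μ, ‖u x‖ ^ p ≤ g x) (hK : ∫ x, g x ∂μ ≤ K) :
    MemLp u (ENNReal.ofReal p) μ ∧ (eLpNorm u (ENNReal.ofReal p) μ).toReal ≤ K ^ p⁻¹ := by
  have hp0 : ENNReal.ofReal p ≠ 0 := by simpa using hp
  have hpr : (ENNReal.ofReal p).toReal = p := ENNReal.toReal_ofReal hp.le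
  have hi : Integrable (fun x => ‖u x‖ ^ p) μ :=
    hg.mono' (hu.norm.aemeasurable.pow_const p).aestronglyMeasurable (by
      filter_upwards [h] with x hx
      rwa [Real.norm_of_nonneg (by positivity)])
  have hm : MemLp u (ENNReal.ofReal p) μ := by
    rwa [← integrable_norm_rpow_iff hu hp0 ENNReal.ofReal_ne_top, hpr]
  refine ⟨hm, ?_⟩
  have h0 : 0 ≤ ∫ x, ‖u x‖ ^ p ∂μ := integral_nonneg fun x => by positivity
  rw [hm.eLpNorm_eq_integral_rpow_norm hp0 ENNReal.ofReal_ne_top, hpr,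
    ENNReal.toReal_ofReal (by positivity)]
  exact Real.rpow_le_rpow h0 ((integral_mono_ae hi hg h).trans hK) (by positivity)

variable {d : ℕ} {D : FlowRegion d} {a γ T : ℝ} {ρ₀ : Vec d → ℝ} {m₀ : Vec d → Vec d}

lemma IsFlow.aestronglyMeasurable_momentum {X : Type} [MeasurableSpace X] {lam : Measure X}
    {ρ : X → ℝ} {m : X → Vec d} (h : IsFlow lam γ ρ m) : AEStronglyMeasurable m lam := by
  have h1 : AEMeasurable (fun z i => m z i) lam :=
    aemeasurable_pi_lambda _ fun i => (h.integrable_momentum i).aestronglyMeasurable.aemeasurable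
  have h2 := (WithLp.measurable_toLp 2 (Fin d → ℝ)).comp_aemeasurable h1
  exact h2.aestronglyMeasurable

lemma IsFlow.memLp {ρ : Vec d → ℝ} {m : Vec d → Vec d} (ha : 0 < a) (hγ : 1 < γ) {E₀ : ℝ}
    (h : IsFlow D.vol γ ρ m) (hE : ∫ x, realEnergy a γ (ρ x) (m x) ∂D.vol ≤ E₀) :
    (MemLp ρ (ENNReal.ofReal γ) D.vol ∧ (eLpNorm ρ (ENNReal.ofReal γ) D.vol).toReal
      ≤ (energyConst a γ * E₀) ^ γ⁻¹) ∧
    MemLp m (ENNReal.ofReal (2 * γ / (γ + 1))) D.vol ∧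
    ∀ i, MemLp (fun x => m x i) (ENNReal.ofReal (2 * γ / (γ + 1))) D.vol ∧
      (eLpNorm (fun x => m x i) (ENNReal.ofReal (2 * γ / (γ + 1))) D.vol).toReal
        ≤ (energyConst a γ * E₀) ^ (2 * γ / (γ + 1))⁻¹ := by
  have h1 : 0 < γ - 1 := by linarith
  have hp : 0 < 2 * γ / (γ + 1) := by positivity
  have hg : Integrable (fun x => energyConst a γ * realEnergy a γ (ρ x) (m x)) D.vol :=
    (h.integrable_realEnergy a).const_mul _
  have hK : ∫ x, energyConst a γ * realEnergy a γ (ρ x) (m x) ∂D.vol ≤ energyConst a γ * E₀ := by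
    rw [integral_const_mul]
    exact mul_le_mul_of_nonneg_left hE (by unfold energyConst; positivity)
  have hm : ∀ᵐ x ∂D.vol, ‖m x‖ ^ (2 * γ / (γ + 1))
      ≤ energyConst a γ * realEnergy a γ (ρ x) (m x) := by
    filter_upwards [h.nonneg, h.eq_zero] with x hx hx' using norm_rpow_le_realEnergy ha hγ hx hx'
  refine ⟨memLp_of_rpow_le (by linarith) h.integrable_density.aestronglyMeasurable hg ?_ hK,
    (memLp_of_rpow_le hp h.aestronglyMeasurable_momentum hg hm hK).1, fun i =>
    memLp_of_rpow_le hp (h.integrable_momentum i).aestronglyMeasurable hg ?_ hK⟩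
  · filter_upwards [h.nonneg] with x hx
    rw [Real.norm_of_nonneg hx]
    refine (rpow_le_realEnergy (v := m x) ha hγ hx).trans ?_
    exact mul_le_mul_of_nonneg_right (by unfold energyConst; linarith)
      (realEnergy_nonneg ha hγ hx _)
  · filter_upwards [hm] with x hx
    exact (Real.rpow_le_rpow (norm_nonneg _) (PiLp.norm_apply_le _ i) hp.le).trans hx

/-- Weak continuity of density and momentum with bounded energy follows from the continuity of the
pairings with smooth test functions. -/
lemma isWeaklyContinuous_of_pairing (ha : 0 < a) (hγ : 1 < γ) {ρ : ℝ → Vec d → ℝ}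
    {m : ℝ → Vec d → Vec d} {E₀ : ℝ}
    (hρ : AEStronglyMeasurable (fun z : ℝ × Vec d => ρ z.1 z.2) (D.spaceTime T))
    (hm : AEStronglyMeasurable (fun z : ℝ × Vec d => m z.1 z.2) (D.spaceTime T))
    (hflow : ∀ t ∈ Icc 0 T, IsFlow D.vol γ (ρ t) (m t) ∧
      ∫ x, realEnergy a γ (ρ t x) (m t x) ∂D.vol ≤ E₀)
    (hpair : ∀ (f : Vec d → ℝ) (F : Vec d → Vec d), ContDiff ℝ 1 (fun z : ℝ × Vec d => f z.2) →
      (D.IsPeriodic fun _ => f) → ContDiff ℝ 1 (fun z : ℝ × Vec d => F z.2) →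
      (D.IsPeriodic fun _ => F) → (D.IsTangential T fun _ => F) →
      ContinuousOn (fun t => D.pairing (ρ t) (m t) f F) (Icc 0 T)) :
    IsWeaklyContinuous D T γ ρ ∧ IsWeaklyContinuous D T (2 * γ / (γ + 1)) m := by
  have hLp := fun t ht => (hflow t ht).1.memLp ha hγ (hflow t ht).2
  have hp : 1 < 2 * γ / (γ + 1) := by
    rw [one_lt_div (by linarith)]
    linarith
  refine ⟨⟨hρ, fun t ht => (hLp t ht).1.1, fun g hg => ?_⟩,
    ⟨hm, fun t ht => (hLp t ht).2.1, fun g hg => ?_⟩⟩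
  · simp only [RCLike.inner_apply, conj_trivial, mul_comm (g _)]
    refine continuousOn_integral_mul (Real.HolderConjugate.conjExponent hγ)
      (fun t ht => (hLp t ht).1.1) (fun t ht => (hLp t ht).1.2) (fun g hg => ?_) hg
    obtain ⟨g', hg', heq, hgp, hgv⟩ := D.exists_spatialTest
      (hg.contDiff.of_le (by exact_mod_cast le_top)) hg.compact hg.support
    have h0 := hgv T 0
    simp only [smul_zero] at h0
    refine (hpair g' (fun _ => 0) (hg'.comp contDiff_snd) hgp contDiff_const h0.1 h0.2).congr
      fun t ht => integral_congr_ae ?_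
    filter_upwards [D.ae_mem_interiorSet] with x hx
    simp [heq x hx]
  · have hcj := Real.HolderConjugate.conjExponent hp
    have hgi : ∀ i, MemLp (fun x => g x i) (ENNReal.ofReal
        (2 * γ / (γ + 1) / (2 * γ / (γ + 1) - 1))) D.vol := fun i =>
      (EuclideanSpace.proj (𝕜 := ℝ) i).comp_memLp' hg
    have hc : ContinuousOn (fun t => ∑ i, ∫ x, m t x i * g x i ∂D.vol) (Icc 0 T) := by
      refine continuousOn_finsetSum _ fun i _ => continuousOn_integral_mul hcj
        (fun t ht => ((hLp t ht).2.2 i).1) (fun t ht => ((hLp t ht).2.2 i).2) (fun g hg => ?_)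
        (hgi i)
      obtain ⟨g', hg', heq, hgp, hgv⟩ := D.exists_spatialTest
        (hg.contDiff.of_le (by exact_mod_cast le_top)) hg.compact hg.support
      have h0 := hgv T (basisVec i)
      have hz : D.IsPeriodic fun _ (_ : Vec d) => (0 : ℝ) := by
        cases D
        · trivial
        · exact fun _ _ _ => rfl
      refine (hpair (fun _ => 0) (fun x => g' x • basisVec i) contDiff_const hz
        ((hg'.comp contDiff_snd).smul contDiff_const) h0.1 h0.2).congr
        fun t ht => integral_congr_ae ?_
      filter_upwards [D.ae_mem_interiorSet] with x hx
      simp [heq x hx, inner_smul_right, basisVec, EuclideanSpace.inner_single_right, mul_comm]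
    refine hc.congr fun t ht => ?_
    have : (ENNReal.ofReal (2 * γ / (γ + 1))).HolderTriple
        (ENNReal.ofReal (2 * γ / (γ + 1) / (2 * γ / (γ + 1) - 1))) 1 :=
      hcj.ennrealOfReal
    simp only [inner_eq_sum]
    exact integral_finsetSum _ fun i _ => ((hLp t ht).2.2 i).1.integrable_mul (hgi i)

variable {S : RelaxedState (ℝ × Vec d) d} {μ : Measure (ℝ × Vec d)} {ρ : ℝ × Vec d → ℝ}
  {m : ℝ × Vec d → Vec d} {r : ℝ × Vec d → Matrix (Fin d) (Fin d) ℝ} {s : ℝ × Vec d → ℝ}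
  {ν : Kernel ℝ (Vec d)} [IsFiniteKernel ν] {ρ' : ℝ → Vec d → ℝ} {m' : ℝ → Vec d → Vec d}

/-- The candidate with the given density and momentum, and with the defects that have the densities
`r` and `s` with respect to the family of measures `ν`. -/
noncomputable def FlowRegion.candidate (D : FlowRegion d) (ρ' : ℝ → Vec d → ℝ)
    (m' : ℝ → Vec d → Vec d) (r : ℝ × Vec d → Matrix (Fin d) (Fin d) ℝ) (s : ℝ × Vec d → ℝ)
    (ν : Kernel ℝ (Vec d)) : Candidate d where
  ρ := ρ'
  m := m'
  Rv t := Matrix.of fun i j => D.wrapDensity (ν t) fun x => r (t, x) i j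
  Rp t := D.wrapMeasure (ν t) fun x => s (t, x)

lemma IsRepresentation.ae_kernel_compl
    (h : IsRepresentation (D.cylinder T) (D.spaceTime T) a γ S μ ρ m r s)
    (hν : μ = volume.restrict (Ioo 0 T) ⊗ₘ ν) :
    ∀ᵐ t ∂volume.restrict (Ioo 0 T), ν t D.closedRegionᶜ = 0 := by
  have h1 : ∀ᵐ z ∂(volume.restrict (Ioo 0 T) ⊗ₘ ν), z ∈ D.cylinder T := by
    rw [← hν]
    exact h.null_compl
  filter_upwards [Measure.ae_ae_of_ae_compProd h1] with t ht
  refine measure_mono_null (fun x hx => ?_) ht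
  exact fun hc => hx hc.2

lemma FlowRegion.vol_restrict_closedSet (D : FlowRegion d) : D.vol.restrict D.closedSet = D.vol :=
  Measure.restrict_eq_self_of_ae_mem (by
    filter_upwards [D.ae_mem_interiorSet] with x hx using D.interiorSet_subset_closedSet hx)

lemma IsRepresentation.energyOn_candidate (hγ : 1 < γ)
    (h : IsRepresentation (D.cylinder T) (D.spaceTime T) a γ S μ ρ m r s) (t : ℝ)
    {B : Set (Vec d)} (hB : MeasurableSet B) :
    energyOn D a γ (D.candidate ρ' m' r s ν) t B
      = ∫⁻ x in B, energyDensity a γ (ρ' t x) (m' t x) ∂D.vol + ν t (D.wrap ⁻¹' B) := by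
  rw [energyOn, add_assoc]
  congr 1
  exact D.energy_wrapDensity hγ (fun i j => (h.measurable_defect i j).comp measurable_prodMk_left)
    (fun x => h.abs_defect_le hγ (t, x)) (fun x => h.posSemidef _)
    (h.measurable_pressureDefect.comp measurable_prodMk_left) (fun x => h.pressureDefect_nonneg _)
    (fun x => h.pressureDefect_le hγ _) (fun x => h.normalized _) hB

lemma IsRepresentation.ae_energyOn_candidate (ha : 0 < a) (hγ : 1 < γ)
    (h : IsRepresentation (D.cylinder T) (D.spaceTime T) a γ S μ ρ m r s)
    (hν : μ = volume.restrict (Ioo 0 T) ⊗ₘ ν)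
    (hae : ∀ᵐ t ∂volume.restrict (Ioo 0 T), (∀ x, ρ' t x = ρ (t, x)) ∧ ∀ x, m' t x = m (t, x)) :
    ∀ᵐ t ∂volume.restrict (Ioo 0 T), energyOn D a γ (D.candidate ρ' m' r s ν) t D.closedSet
      = ENNReal.ofReal (∫ x, realEnergy a γ (ρ (t, x)) (m (t, x)) ∂D.vol + (ν t).real univ) := by
  filter_upwards [hae, h.ae_kernel_compl hν, h.isFlow.ae_slice] with t ⟨h1, h2⟩ h3 h4
  have e2 : ν t (D.wrap ⁻¹' D.closedSet) = ν t univ := by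
    refine measure_eq_measure_of_null_sdiff (subset_univ _)
      (measure_mono_null (fun x hx => ?_) h3)
    exact fun hc => hx.2 (D.wrap_mem hc)
  rw [h.energyOn_candidate hγ t D.measurableSet_closedSet, D.vol_restrict_closedSet, e2]
  simp only [h1, h2]
  rw [h4.lintegral_energyDensity ha hγ, ENNReal.ofReal_add ?_ measureReal_nonneg,
    ofReal_measureReal]
  exact integral_nonneg fun x => realEnergy_nonneg ha hγ (h.density_nonneg _) _

lemma IsRepresentation.energyFunctional_candidate (ha : 0 < a) (hγ : 1 < γ)
    (hS : S ∈ relaxedSolutions D a γ T ρ₀ m₀)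
    (h : IsRepresentation (D.cylinder T) (D.spaceTime T) a γ S μ ρ m r s)
    (hν : μ = volume.restrict (Ioo 0 T) ⊗ₘ ν)
    (hae : ∀ᵐ t ∂volume.restrict (Ioo 0 T), (∀ x, ρ' t x = ρ (t, x)) ∧ ∀ x, m' t x = m (t, x)) :
    energyFunctional D a γ T (D.candidate ρ' m' r s ν) = ENNReal.ofReal (S.energy γ 1) := by
  have hi := h.isFlow.integrable_realEnergy a
  have := h.finite
  rw [energyFunctional, lintegral_congr_ae (h.ae_energyOn_candidate ha hγ hν hae),
    ← ofReal_integral_eq_lintegral_ofReal (h.weakDecay hγ hS hν).1 (.of_forall fun t =>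
      add_nonneg (integral_nonneg fun x => realEnergy_nonneg ha hγ (h.density_nonneg _) _)
        measureReal_nonneg),
    h.energy_eq hγ (D.isCompact_cylinder T) (D.spaceTime_compl T)]
  have i2 : Integrable (fun _ => (1 : ℝ)) (volume.restrict (Ioo 0 T) ⊗ₘ ν) := by
    rw [← hν]
    exact integrable_const 1
  have e2 : ∫ z, (1 : C(ℝ × Vec d, ℝ)) z ∂μ = ∫ t in Ioo 0 T, (ν t).real univ := by
    rw [hν]
    refine (Measure.integral_compProd i2).trans (integral_congr_ae (.of_forall fun t => ?_))
    simp
  have i3 : Integrable (fun t => (ν t).real univ) (volume.restrict (Ioo 0 T)) := by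
    simpa using integrable_integral_kernel i2
  rw [e2, integral_add hi.integral_prod_left i3]
  congr 2
  simp only [ContinuousMap.one_apply, one_mul]
  exact (integral_prod _ hi).symm

lemma IsRepresentation.areDefectMeasures_candidate (hγ : 1 < γ)
    (h : IsRepresentation (D.cylinder T) (D.spaceTime T) a γ S μ ρ m r s)
    (hν : μ = volume.restrict (Ioo 0 T) ⊗ₘ ν) :
    AreDefectMeasures D T (D.candidate ρ' m' r s ν).Rv (D.candidate ρ' m' r s ν).Rp := by
  have hr : ∀ t i j, Measurable fun x => r (t, x) i j := fun t i j =>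
    (h.measurable_defect i j).comp measurable_prodMk_left
  obtain ⟨C, hC, hC'⟩ := IsFiniteKernel.exists_univ_le (κ := ν)
  lift C to ℝ≥0 using hC.ne
  have hnull : ∀ t, ν t D.closedRegionᶜ = 0 → ∀ B, Disjoint B D.closedSet →
      ν t (D.wrap ⁻¹' B) = 0 := fun t ht B hB => by
    refine measure_mono_null (t := D.closedRegionᶜ) (fun x hx => ?_) ht
    exact fun hc => hB.le_bot ⟨hx, D.wrap_mem hc⟩
  have hvbound : ∀ i j t, (D.wrapDensity (ν t) fun x => r (t, x) i j).variation univ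
      ≤ ((2 * C : ℝ≥0) : ℝ≥0∞) := fun i j t => by
    refine (D.wrapDensity_variation_le (hr t i j) fun x => h.abs_defect_le hγ (t, x) i j).trans ?_
    rw [ENNReal.ofReal_ofNat, ENNReal.coe_mul, ENNReal.coe_ofNat]
    gcongr
    exact hC' t
  refine
    { measurable_v := fun i j B hB => ?_
      measurable_p := fun B hB => ?_
      bounded_v := ⟨2 * C, .of_forall fun t i j => hvbound i j t⟩
      bounded_p := ⟨(γ - 1).toNNReal * C, .of_forall fun t => ?_⟩
      support_v := ?_
      support_p := ?_
      posSemidef := .of_forall fun t B hB => D.posSemidef_wrapDensity (hr t)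
        (fun x => h.abs_defect_le hγ (t, x)) (fun x => h.posSemidef _) hB }
  · have hB' := D.measurable_wrap hB
    have hm := ((h.measurable_defect i j).indicator
      (measurable_snd hB')).stronglyMeasurable.integral_kernel_prod_right' (κ := ν)
    refine (Eq.subst (motive := Measurable) (funext fun t => ?_) hm.measurable).aemeasurable
    refine Eq.trans ?_ (D.wrapDensity_apply (hr t i j)
      (fun x => h.abs_defect_le hγ (t, x) i j) hB).symm
    rw [← integral_indicator hB']
    rfl
  · have hB' := D.measurable_wrap hB
    have hm := ((h.measurable_pressureDefect.ennreal_ofReal).indicator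
      (measurable_snd hB')).lintegral_kernel_prod_right' (κ := ν)
    refine (Eq.subst (motive := Measurable) (funext fun t => ?_) hm).aemeasurable
    refine Eq.trans ?_ (D.wrapMeasure_apply hB).symm
    rw [← lintegral_indicator hB']
    rfl
  · refine (D.wrapMeasure_univ_le fun x => h.pressureDefect_le hγ (t, x)).trans ?_
    rw [ENNReal.coe_mul]
    exact mul_le_mul_right (hC' t) _
  · filter_upwards [h.ae_kernel_compl hν] with t ht i j B hB hd
    refine (D.wrapDensity_apply (hr t i j) (fun x => h.abs_defect_le hγ (t, x) i j) hB).trans ?_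
    rw [Measure.restrict_eq_zero.mpr (hnull t ht B hd), integral_zero_measure]
  · filter_upwards [h.ae_kernel_compl hν] with t ht
    refine (D.wrapMeasure_apply D.measurableSet_closedSet.compl).trans ?_
    rw [Measure.restrict_eq_zero.mpr (hnull t ht _ disjoint_compl_left), lintegral_zero_measure]

end Candidate

section DissipativeSolution

open ProbabilityTheory

variable {d : ℕ} {D : FlowRegion d} {a γ T : ℝ} {ρ₀ : Vec d → ℝ} {m₀ : Vec d → Vec d}
  {S : RelaxedState (ℝ × Vec d) d} {μ : Measure (ℝ × Vec d)} {ρ : ℝ × Vec d → ℝ}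
  {m : ℝ × Vec d → Vec d} {r : ℝ × Vec d → Matrix (Fin d) (Fin d) ℝ} {s : ℝ × Vec d → ℝ}
  {ν : Kernel ℝ (Vec d)} [IsFiniteKernel ν] {ρ' : ℝ → Vec d → ℝ} {m' : ℝ → Vec d → Vec d}

lemma FlowRegion.isPeriodic_const {F : Type} (D : FlowRegion d) (c : F) :
    D.IsPeriodic fun _ _ => c := by
  cases D
  · trivial
  · exact fun _ _ _ => rfl

lemma FlowRegion.isTangential_zero (D : FlowRegion d) (T : ℝ) : D.IsTangential T fun _ _ => 0 := by
  cases D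
  · exact fun _ _ _ _ _ _ => inner_zero_left _
  · trivial

lemma transport_zero_left (Φ : ℝ → Vec d → Vec d) (R : ℝ) (v : Vec d) (z : ℝ × Vec d) :
    transport a γ (fun _ _ => 0) Φ R v z = inner ℝ v (deriv (fun s => Φ s z.2) z.1)
      + ∑ i, ∑ j, v i * v j / R * partialD (Φ z.1) z.2 i j
      + pressure a γ R * divergence (Φ z.1) z.2 := by
  have : gradient (fun _ : Vec d => (0 : ℝ)) z.2 = 0 := by simp [gradient]
  simp [transport, this]

lemma transport_zero_right (φ : ℝ → Vec d → ℝ) (R : ℝ) (v : Vec d) (z : ℝ × Vec d) :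
    transport a γ φ (fun _ _ => 0) R v z
      = R * deriv (fun s => φ s z.2) z.1 + inner ℝ v (gradient (φ z.1) z.2) := by
  simp [transport, partialD, divergence]

lemma intervalIntegral_congr_of_ae {f g : ℝ → ℝ}
    (h : ∀ᵐ t ∂volume.restrict (Ioo 0 T), f t = g t) {τ : ℝ} (hτ : τ ∈ Ioo 0 T) :
    ∫ t in (0 : ℝ)..τ, f t = ∫ t in (0 : ℝ)..τ, g t := by
  refine intervalIntegral.integral_congr_ae ?_
  filter_upwards [(ae_restrict_iff' measurableSet_Ioo).mp h] with t ht hmem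
  rw [uIoc_of_le hτ.1.le] at hmem
  exact ht ⟨hmem.1, hmem.2.trans_lt hτ.2⟩

lemma intervalIntegrable_of_integrableOn {f : ℝ → ℝ} (h : IntegrableOn f (Ioo 0 T)) {τ : ℝ}
    (hτ : τ ∈ Ioo 0 T) : IntervalIntegrable f volume 0 τ := by
  rw [intervalIntegrable_iff_integrableOn_Ioc_of_le hτ.1.le]
  exact h.mono_set fun t ht => ⟨ht.1, ht.2.trans_lt hτ.2⟩

/-- A density and a momentum that satisfy the weak formulations at every time, with the defects of
a relaxed solution, form a dissipative solution. -/
lemma IsRepresentation.isDissipativeSolution_candidate (hT : 0 < T) (ha : 0 < a) (hγ : 1 < γ)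
    (hdata : IsFiniteEnergyData D a γ ρ₀ m₀) (hS : S ∈ relaxedSolutions D a γ T ρ₀ m₀)
    (h : IsRepresentation (D.cylinder T) (D.spaceTime T) a γ S μ ρ m r s)
    (hν : μ = volume.restrict (Ioo 0 T) ⊗ₘ ν)
    (hae : ∀ᵐ t ∂volume.restrict (Ioo 0 T), (∀ x, ρ' t x = ρ (t, x)) ∧ ∀ x, m' t x = m (t, x))
    (htraj : ∀ t ∈ Icc 0 T, IsFlow D.vol γ (ρ' t) (m' t) ∧
      ∫ x, realEnergy a γ (ρ' t x) (m' t x) ∂D.vol ≤ (initialEnergy D a γ ρ₀ m₀).toReal ∧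
      ∀ (φ : ℝ → Vec d → ℝ) (Φ : ℝ → Vec d → Vec d),
        ContDiff ℝ 1 (fun z : ℝ × Vec d => φ z.1 z.2) → D.IsPeriodic φ →
        ContDiff ℝ 1 (fun z : ℝ × Vec d => Φ z.1 z.2) → D.IsPeriodic Φ → D.IsTangential T Φ →
        D.pairing (ρ' t) (m' t) (φ t) (Φ t) = D.pairing ρ₀ m₀ (φ 0) (Φ 0)
          + ∫ s' in (0 : ℝ)..t, D.rate a γ φ Φ ρ m r s ν s') :
    IsDissipativeSolution D a γ T ρ₀ m₀ (D.candidate ρ' m' r s ν) := by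
  have hmem0 : (0 : ℝ) ∈ Icc 0 T := ⟨le_rfl, hT.le⟩
  have hflow₀ := hdata.isFlow ha hγ
  -- The increment of a pairing between the times `0` and `τ`.
  have hincr : ∀ τ ∈ Ioo 0 T, ∀ (φ : ℝ → Vec d → ℝ) (Φ : ℝ → Vec d → Vec d),
      ContDiff ℝ 1 (fun z : ℝ × Vec d => φ z.1 z.2) → D.IsPeriodic φ →
      ContDiff ℝ 1 (fun z : ℝ × Vec d => Φ z.1 z.2) → D.IsPeriodic Φ → D.IsTangential T Φ →
      D.pairing (ρ' τ) (m' τ) (φ τ) (Φ τ) - D.pairing (ρ' 0) (m' 0) (φ 0) (Φ 0)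
        = ∫ s' in (0 : ℝ)..τ, D.rate a γ φ Φ ρ m r s ν s' := by
    intro τ hτ φ Φ h1 h2 h3 h4 h5
    rw [(htraj τ (Ioo_subset_Icc_self hτ)).2.2 φ Φ h1 h2 h3 h4 h5,
      (htraj 0 hmem0).2.2 φ Φ h1 h2 h3 h4 h5]
    simp
  have hae' : ∀ᵐ z ∂D.spaceTime T, ρ' z.1 z.2 = ρ z ∧ m' z.1 z.2 = m z := by
    filter_upwards [Measure.quasiMeasurePreserving_fst.ae hae] with z hz
    exact ⟨hz.1 z.2, hz.2 z.2⟩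
  obtain ⟨hw1, hw2⟩ := isWeaklyContinuous_of_pairing (T := T) (m := m') ha hγ
    (h.measurable_density.aestronglyMeasurable.congr (by
      filter_upwards [hae'] with z hz using hz.1.symm))
    (h.measurable_momentum.aestronglyMeasurable.congr (by
      filter_upwards [hae'] with z hz using hz.2.symm))
    (fun t ht => ⟨(htraj t ht).1, (htraj t ht).2.1⟩) (fun f F h1 h2 h3 h4 h5 =>
      ((h.continuousOn_primitive_rate hT hγ hν h1 h3).const_add _).congr fun t ht =>
        (htraj t ht).2.2 (fun _ => f) (fun _ => F) h1 h2 h3 h4 h5)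
  obtain ⟨hin1, hin2⟩ : ρ' 0 =ᵐ[D.vol] ρ₀ ∧ m' 0 =ᵐ[D.vol] m₀ := by
    obtain ⟨G, -, hGt, hG⟩ := D.exists_countable_spatialTest (γ := γ) T
    refine hG _ _ _ _ (htraj 0 hmem0).1 hflow₀ fun P hP => ?_
    obtain ⟨h1, h2, h3, h4, h5⟩ := hGt P hP
    simpa using (htraj 0 hmem0).2.2 (fun _ => P.1) (fun _ => P.2) h1 h2 h3 h4 h5
  have htot : ∀ᵐ t ∂volume.restrict (Ioo 0 T), totalEnergy D a γ (D.candidate ρ' m' r s ν) t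
      = ∫ x, realEnergy a γ (ρ (t, x)) (m (t, x)) ∂D.vol + (ν t).real univ := by
    filter_upwards [h.ae_energyOn_candidate ha hγ hν hae] with t ht
    rw [totalEnergy, ht, ENNReal.toReal_ofReal]
    exact add_nonneg (integral_nonneg fun x => realEnergy_nonneg ha hγ (h.density_nonneg _) _)
      measureReal_nonneg
  refine ⟨hw1, hw2, fun t ht => (htraj t ht).1.nonneg, hin1, hin2,
    h.areDefectMeasures_candidate hγ hν, fun φ hφ τ hτ => ?_, fun Φ hΦ τ hτ => ?_, ?_, ?_, ?_⟩
  · have := hincr τ hτ φ (fun _ _ => 0) hφ.1 hφ.2.2 contDiff_const (D.isPeriodic_const 0)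
      (D.isTangential_zero T)
    simp only [FlowRegion.pairing, inner_zero_right, add_zero] at this
    refine this.trans (intervalIntegral_congr_of_ae ?_ hτ)
    filter_upwards [hae] with t ⟨h1, h2⟩
    simp [FlowRegion.rate, transport_zero_right, FlowRegion.candidate, h1, h2, defectFlux, partialD,
      divergence]
  · have := hincr τ hτ (fun _ _ => 0) Φ contDiff_const (D.isPeriodic_const 0) hΦ.1 hΦ.2.2.1
      hΦ.2.2.2
    simp only [FlowRegion.pairing, mul_zero, zero_add] at this
    refine this.trans ?_
    have i1 : IntegrableOn (fun t => ∫ x, transport a γ (fun _ _ => 0) Φ (ρ (t, x)) (m (t, x))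
        (t, x) ∂D.vol) (Ioo 0 T) :=
      (h.isFlow.integrable_transport_of_contDiff (a := a) (D.isCompact_cylinder T)
        (D.spaceTime_compl T) contDiff_const hΦ.1).integral_prod_left
    have i2 := h.integrable_defectFlux_of_contDiff hγ hΦ.1
    rw [hν] at i2
    have i2' : IntegrableOn (fun t => ∫ x, defectFlux Φ (r (t, x)) (s (t, x)) (t, x) ∂ν t)
      (Ioo 0 T) := integrable_integral_kernel i2
    unfold FlowRegion.rate
    rw [intervalIntegral.integral_add (intervalIntegrable_of_integrableOn i1 hτ)
      (intervalIntegrable_of_integrableOn i2' hτ)]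
    congr 1
    · refine intervalIntegral_congr_of_ae ?_ hτ
      filter_upwards [hae] with t ⟨h1, h2⟩
      simp [transport_zero_left, FlowRegion.candidate, h1, h2]
    · refine intervalIntegral_congr_of_ae ?_ hτ
      filter_upwards [h.ae_kernel_compl hν] with t ht
      exact (D.defectPairing_wrapDensity ht
        (fun i j => (h.measurable_defect i j).comp measurable_prodMk_left)
        (fun x => h.abs_defect_le hγ (t, x))
        (h.measurable_pressureDefect.comp measurable_prodMk_left)
        (fun x => h.pressureDefect_nonneg _) (fun x => h.pressureDefect_le hγ _)
        hΦ.1 hΦ.2.2.1 t).symm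
  · filter_upwards [h.ae_energyOn_candidate ha hγ hν hae] with t ht
    rw [ht]
    exact ENNReal.ofReal_lt_top
  · exact (h.weakDecay hγ hS hν).1.congr (by filter_upwards [htot] with t ht using ht.symm)
  · obtain ⟨hi, hdecay⟩ := h.weakDecay hγ hS hν
    refine (WeakDecay.exists_limits hT (hi.congr (by filter_upwards [htot] with t ht using ht.symm))
      (.of_forall fun t => ENNReal.toReal_nonneg) fun w hw hw0 => ?_).2
    refine le_of_eq_of_le (congrArg _ (integral_congr_ae ?_)) (hdecay w hw hw0)
    filter_upwards [htot] with t ht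
    exact congrArg (deriv w t * ·) ht

theorem exists_dissipativeSolution (hT : 0 < T) (ha : 0 < a) (hγ : 1 < γ)
    (hdata : IsFiniteEnergyData D a γ ρ₀ m₀) (hS : S ∈ relaxedSolutions D a γ T ρ₀ m₀) :
    ∃ C : Candidate d, IsDissipativeSolution D a γ T ρ₀ m₀ C ∧
      energyFunctional D a γ T C = ENNReal.ofReal (S.energy γ 1) := by
  obtain ⟨μ, ρ, m, r, s, h⟩ := hS.1.exists_representation ha hγ (D.isCompact_cylinder T)
    (D.spaceTime_compl T)
  obtain ⟨ν, hbound, hν⟩ := exists_kernel_of_mem_relaxedSolutions hT ha hγ hS h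
  have : IsFiniteKernel ν := ⟨_, ENNReal.ofReal_lt_top, hbound⟩
  obtain ⟨ρ', m', hae, htraj⟩ := h.exists_trajectory hT ha hγ hS hν (hdata.isFlow ha hγ)
  exact ⟨D.candidate ρ' m' r s ν,
    h.isDissipativeSolution_candidate hT ha hγ hdata hS hν hae htraj,
    h.energyFunctional_candidate ha hγ hS hν hae⟩

end DissipativeSolution

/-! ### From dissipative solutions to relaxed solutions -/

section Kernels

open ProbabilityTheory

/-- A weakly measurable, bounded family of measures is, up to a null set of times, a kernel. -/
lemma exists_kernel_ae_eq {Y : Type} [MeasurableSpace Y] [MeasurableSpace.CountablyGenerated Y]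
    {lam : Measure ℝ} {n : ℝ → Measure Y}
    (hn : ∀ B, MeasurableSet B → AEMeasurable (fun t => n t B) lam) {C : ℝ≥0}
    (hC : ∀ᵐ t ∂lam, n t univ ≤ C) :
    ∃ κ : Kernel ℝ Y, IsFiniteKernel κ ∧ ∀ᵐ t ∂lam, κ t = n t := by
  classical
  -- Measurability on a countable algebra of sets that generates the measurable sets is enough.
  set G := generateSetAlgebra (MeasurableSpace.countableGeneratingSet Y) with hG
  have hGc : G.Countable := countable_generateSetAlgebra
    MeasurableSpace.countable_countableGeneratingSet
  have hGa : IsSetAlgebra G := isSetAlgebra_generateSetAlgebra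
  have hGgen : ‹MeasurableSpace Y› = .generateFrom G := by
    rw [hG, generateFrom_generateSetAlgebra_eq,
      MeasurableSpace.generateFrom_countableGeneratingSet]
  have hGm : ∀ B ∈ G, MeasurableSet B := fun B hB => by
    rw [hGgen]
    exact MeasurableSpace.measurableSet_generateFrom hB
  choose! v hv hve using fun B hB => (hn B (hGm B hB) : AEMeasurable (fun t => n t B) lam)
  have hae : ∀ᵐ t ∂lam, n t univ ≤ C ∧ ∀ B ∈ G, n t B = v B t :=
    hC.and ((ae_ball_iff hGc).mpr hve)
  obtain ⟨N, hsub, hN, hN0⟩ := exists_measurable_superset_of_null (ae_iff.mp hae)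
  have hgood : ∀ t ∉ N, n t univ ≤ C ∧ ∀ B ∈ G, n t B = v B t := fun t ht => by
    by_contra h
    exact ht (hsub h)
  set κ : ℝ → Measure Y := fun t => if t ∈ N then 0 else n t with hκ
  have hκC : ∀ t, κ t univ ≤ C := fun t => by
    by_cases ht : t ∈ N
    · simp [hκ, ht]
    · simpa [hκ, ht] using (hgood t ht).1
  have : ∀ t, IsFiniteMeasure (κ t) := fun t => ⟨(hκC t).trans_lt ENNReal.coe_lt_top⟩
  have hmeas : ∀ B ∈ G, Measurable fun t => κ t B := fun B hB => by
    have : (fun t => κ t B) = fun t => if t ∈ N then 0 else v B t := by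
      ext t
      by_cases ht : t ∈ N
      · simp [hκ, ht]
      · simpa [hκ, ht] using (hgood t ht).2 B hB
    rw [this]
    exact Measurable.ite hN measurable_const (hv B hB)
  refine ⟨⟨κ, .measure_of_isPiSystem hGgen (fun s hs t ht _ => hGa.inter_mem hs ht) hmeas
    (hmeas _ hGa.univ_mem)⟩, ⟨C, ENNReal.coe_lt_top, hκC⟩, ?_⟩
  filter_upwards [measure_eq_zero_iff_ae_notMem.mp hN0] with t ht
  exact if_neg ht

lemma exists_kernel_of_signedMeasure {Y : Type} [MeasurableSpace Y]
    [MeasurableSpace.CountablyGenerated Y] {lam : Measure ℝ} {σ : ℝ → SignedMeasure Y}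
    (hσ : ∀ B, MeasurableSet B → AEMeasurable (fun t => σ t B) lam)
    (h0 : ∀ᵐ t ∂lam, ∀ B, MeasurableSet B → 0 ≤ σ t B) {C : ℝ≥0}
    (hC : ∀ᵐ t ∂lam, σ t univ ≤ C) :
    ∃ κ : Kernel ℝ Y, IsFiniteKernel κ ∧
      ∀ᵐ t ∂lam, ∀ B, MeasurableSet B → (κ t).real B = σ t B := by
  classical
  set n : ℝ → Measure Y := fun t => if h : VectorMeasure.restrict 0 univ ≤ (σ t).restrict univ
    then (σ t).toMeasureOfZeroLE univ MeasurableSet.univ h else 0 with hn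
  have hreal : ∀ t, (∀ B, MeasurableSet B → 0 ≤ σ t B) → ∀ B, MeasurableSet B →
      n t B = ENNReal.ofReal (σ t B) := fun t ht B hB => by
    have h : VectorMeasure.restrict 0 univ ≤ (σ t).restrict univ :=
      VectorMeasure.restrict_le_restrict_of_subset_le _ _ fun B hB _ => by simpa using ht B hB
    simp only [hn, dif_pos h, SignedMeasure.toMeasureOfZeroLE_apply _ h MeasurableSet.univ hB,
      univ_inter, ENNReal.ofReal]
    congr 1
    exact NNReal.eq (Real.coe_toNNReal _ (ht B hB)).symm
  obtain ⟨κ, hκ, hae⟩ := exists_kernel_ae_eq (lam := lam) (n := n) (C := C) (fun B hB => by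
      refine (hσ B hB).ennreal_ofReal.congr ?_
      filter_upwards [h0] with t ht using (hreal t ht B hB).symm) (by
      filter_upwards [h0, hC] with t ht hCt
      rw [hreal t ht _ MeasurableSet.univ]
      exact ENNReal.ofReal_le_of_le_toReal (by simpa using hCt))
  refine ⟨κ, hκ, ?_⟩
  filter_upwards [h0, hae] with t ht hκt B hB
  rw [hκt, Measure.real, hreal t ht B hB, ENNReal.toReal_ofReal (ht B hB)]

variable {d : ℕ} {D : FlowRegion d} {T : ℝ}
  {Rv : ℝ → Matrix (Fin d) (Fin d) (SignedMeasure (Vec d))} {Rp : ℝ → Measure (Vec d)}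

lemma signedMeasure_sum_apply {X ι : Type} [MeasurableSpace X] (s : Finset ι)
    (σ : ι → SignedMeasure X) (B : Set X) : (∑ k ∈ s, σ k) B = ∑ k ∈ s, σ k B := by
  classical
  induction s using Finset.induction_on with
  | empty => simp
  | insert a s ha ih => rw [Finset.sum_insert ha, Finset.sum_insert ha, _root_.add_apply, ih]

/-- The defect measures as differences of kernels, of which the second one is the trace: an entry of
a positive semidefinite matrix is bounded by the trace. -/
lemma AreDefectMeasures.exists_kernels (h : AreDefectMeasures D T Rv Rp) :
    ∃ (κ : Fin d → Fin d → Kernel ℝ (Vec d)) (κt κp : Kernel ℝ (Vec d)),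
      (∀ i j, IsFiniteKernel (κ i j)) ∧ IsFiniteKernel κt ∧ IsFiniteKernel κp ∧
      ∀ᵐ t ∂volume.restrict (Ioo 0 T), κp t = Rp t ∧
        (∀ B, MeasurableSet B → (κt t).real B = ∑ k, Rv t k k B) ∧
        (∀ i j B, MeasurableSet B → Rv t i j B = (κ i j t).real B - (κt t).real B) ∧
        κp t D.closedRegionᶜ = 0 ∧ κt t D.closedRegionᶜ = 0 ∧
        ∀ i j, κ i j t D.closedRegionᶜ = 0 := by
  obtain ⟨C, hC⟩ := h.bounded_v
  obtain ⟨Cp, hCp⟩ := h.bounded_p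
  have hle : ∀ᵐ t ∂volume.restrict (Ioo 0 T), ∀ i j, Rv t i j univ ≤ C := by
    filter_upwards [hC] with t ht i j
    refine (le_abs_self _).trans ((VectorMeasure.norm_measure_le_variation
      ((ht i j).trans_lt ENNReal.coe_lt_top).ne).trans ?_)
    exact ENNReal.toReal_le_coe_of_le_coe (ht i j)
  have htr : ∀ᵐ t ∂volume.restrict (Ioo 0 T), ∑ k, Rv t k k univ ≤ (d * C : ℝ≥0) := by
    filter_upwards [hle] with t ht
    refine (Finset.sum_le_sum fun k _ => ht k k).trans ?_
    simp
  have hmt : ∀ B, MeasurableSet B → AEMeasurable (fun t => ∑ k, Rv t k k B)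
      (volume.restrict (Ioo 0 T)) := fun B hB =>
    Finset.aemeasurable_fun_sum _ fun k _ => h.measurable_v k k B hB
  obtain ⟨κp, hκp, hp⟩ := exists_kernel_ae_eq h.measurable_p hCp
  obtain ⟨κt, hκt, ht⟩ := exists_kernel_of_signedMeasure (lam := volume.restrict (Ioo 0 T))
    (σ := fun t => ∑ k, Rv t k k) (C := d * C) (fun B hB =>
        by simpa only [signedMeasure_sum_apply] using hmt B hB)
    (by
      filter_upwards [h.posSemidef] with t ht B hB
      rw [signedMeasure_sum_apply]
      exact Finset.sum_nonneg fun k _ => (ht B hB).diag_nonneg (i := k))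
    (by simpa only [signedMeasure_sum_apply] using htr)
  choose κ hκ hk using fun i j => exists_kernel_of_signedMeasure
    (lam := volume.restrict (Ioo 0 T)) (σ := fun t => Rv t i j + ∑ k, Rv t k k) (C := C + d * C)
    (fun B hB => by
      simp only [_root_.add_apply, signedMeasure_sum_apply]
      exact (h.measurable_v i j B hB).add (hmt B hB))
    (by
      filter_upwards [h.posSemidef] with t ht B hB
      rw [_root_.add_apply, signedMeasure_sum_apply]
      have := neg_le_of_abs_le (posSemidef_abs_le (ht B hB) i j)
      simp only [Matrix.of_apply] at this
      linarith)
    (by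
      filter_upwards [hle, htr] with t h1 h2
      rw [_root_.add_apply, signedMeasure_sum_apply, NNReal.coe_add]
      exact add_le_add (h1 i j) h2)
  refine ⟨κ, κt, κp, hκ, hκt, hκp, ?_⟩
  have hcm : MeasurableSet D.closedRegionᶜ := D.isCompact_closedRegion.isClosed.measurableSet.compl
  have hdisj : Disjoint D.closedRegionᶜ D.closedSet :=
    disjoint_compl_left_iff_subset.mpr D.closedSet_subset_closedRegion
  filter_upwards [hp, ht, ae_all_iff.mpr fun i => ae_all_iff.mpr (hk i), h.support_v,
    h.support_p] with t h1 h2 h3 h4 h5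
  simp only [_root_.add_apply, signedMeasure_sum_apply] at h2 h3
  refine ⟨h1, h2, fun i j B hB => by rw [h3 i j B hB, h2 B hB]; ring, ?_, ?_, fun i j => ?_⟩
  · rw [h1]
    exact measure_mono_null (compl_subset_compl.mpr D.closedSet_subset_closedRegion) h5
  · rw [← measureReal_eq_zero_iff, h2 _ hcm]
    exact Finset.sum_eq_zero fun k _ => h4 k k _ hcm hdisj
  · rw [← measureReal_eq_zero_iff, h3 i j _ hcm, h4 i j _ hcm hdisj,
      Finset.sum_eq_zero fun k _ => h4 k k _ hcm hdisj, add_zero]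

/-- The integral of a nonnegative function against a nonnegative combination of signed measures. -/
lemma sum_mul_integral_nonneg {X : Type} [MeasurableSpace X] {σ : Fin d → Fin d → SignedMeasure X}
    {c : Fin d → Fin d → ℝ} (h : ∀ B, MeasurableSet B → 0 ≤ ∑ i, ∑ j, c i j * σ i j B)
    {K : Set X} (hK : MeasurableSet K) (hσ : ∀ i j, σ i j Kᶜ = 0) {f : X → ℝ}
    (hi : ∀ i j, (σ i j).Integrable f) (hf : ∀ x ∈ K, 0 ≤ f x) :
    0 ≤ ∑ i, ∑ j, c i j * (σ i j).integral f (ContinuousLinearMap.lsmul ℝ ℝ) := by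
  set s : SignedMeasure X := ∑ i, ∑ j, c i j • σ i j with hs
  have happ : ∀ B, s B = ∑ i, ∑ j, c i j * σ i j B := fun B => by
    simp only [hs, signedMeasure_sum_apply, _root_.smul_apply, smul_eq_mul]
  have h0 : VectorMeasure.restrict 0 univ ≤ s.restrict univ :=
    VectorMeasure.restrict_le_restrict_of_subset_le _ _ fun B hB _ => by
      simpa [happ] using h B hB
  have e : ∑ i, ∑ j, c i j * (σ i j).integral f (ContinuousLinearMap.lsmul ℝ ℝ)
      = s.integral f (ContinuousLinearMap.lsmul ℝ ℝ) := by
    have hi' : ∀ i j, (c i j • σ i j).Integrable f := fun i j => (hi i j).smul_vectorMeasure _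
    rw [hs, VectorMeasure.integral_finsetSum_vectorMeasure fun i _ =>
      VectorMeasure.Integrable.finsetSum_vectorMeasure fun j _ => hi' i j]
    refine Finset.sum_congr rfl fun i _ => ?_
    rw [VectorMeasure.integral_finsetSum_vectorMeasure fun j _ => hi' i j]
    simp
  rw [e, ← s.toMeasureOfZeroLE_toSignedMeasure h0, integral_lsmul_toSignedMeasure]
  refine integral_nonneg_of_ae ?_
  have hn : s.toMeasureOfZeroLE univ MeasurableSet.univ h0 Kᶜ = 0 := by
    rw [SignedMeasure.toMeasureOfZeroLE_apply _ h0 MeasurableSet.univ hK.compl]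
    simp [happ, hσ]
  filter_upwards [mem_ae_iff.mpr hn] with x hx using hf x hx

end Kernels

section Functionals

open ProbabilityTheory

variable {d : ℕ} {D : FlowRegion d} {T : ℝ}
  {Rv : ℝ → Matrix (Fin d) (Fin d) (SignedMeasure (Vec d))} {Rp : ℝ → Measure (Vec d)}

lemma integral_continuousMap_compProd {κ : Kernel ℝ (Vec d)} [IsFiniteKernel κ]
    (h : ∀ᵐ t ∂volume.restrict (Ioo 0 T), κ t D.closedRegionᶜ = 0) (f : C(ℝ × Vec d, ℝ)) :
    Integrable f (volume.restrict (Ioo 0 T) ⊗ₘ κ) ∧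
      IntegrableOn (fun t => ∫ x, f (t, x) ∂κ t) (Ioo 0 T) ∧
      ∫ z, f z ∂(volume.restrict (Ioo 0 T) ⊗ₘ κ) = ∫ t in Ioo 0 T, ∫ x, f (t, x) ∂κ t := by
  have hQ := D.isCompact_cylinder T
  have hnull : (volume.restrict (Ioo 0 T) ⊗ₘ κ) (D.cylinder T)ᶜ = 0 := by
    rw [← mem_ae_iff]
    refine (Measure.ae_compProd_iff hQ.isClosed.measurableSet).mpr ?_
    filter_upwards [h, ae_restrict_mem measurableSet_Ioo] with t ht hmem
    filter_upwards [mem_ae_iff.mpr ht] with x hx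
    exact ⟨Ioo_subset_Icc_self hmem, hx⟩
  have hi : Integrable f (volume.restrict (Ioo 0 T) ⊗ₘ κ) := integrable_continuousMap hQ hnull f
  exact ⟨hi, integrable_integral_kernel hi, Measure.integral_compProd hi⟩

lemma AreDefectMeasures.ae_integrable (h : AreDefectMeasures D T Rv Rp) :
    ∀ᵐ t ∂volume.restrict (Ioo 0 T), ∀ g : C(Vec d, ℝ),
      (∀ i j, (Rv t i j).Integrable g) ∧ Integrable g (Rp t) := by
  obtain ⟨κ, κt, κp, hκ, hκt, hκp, hae⟩ := h.exists_kernels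
  filter_upwards [hae] with t ⟨h1, _, h3, h4, h5, h6⟩ g
  have hi : ∀ n : Measure (Vec d), IsFiniteMeasure n → n D.closedRegionᶜ = 0 → Integrable g n :=
    fun n hn hn0 => integrable_continuousMap D.isCompact_closedRegion hn0 g
  exact ⟨fun i j => (integral_signedMeasure_eq_sub (h3 i j) (hi _ inferInstance (h6 i j))
    (hi _ inferInstance h5)).1, h1 ▸ hi _ inferInstance h4⟩

/-- The integrals in time and space against the defect measures, as functionals on the continuous
functions. -/
lemma AreDefectMeasures.exists_functionals (h : AreDefectMeasures D T Rv Rp) :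
    ∃ (N : Fin d → Fin d → C(ℝ × Vec d, ℝ) → ℝ) (p : C(ℝ × Vec d, ℝ) → ℝ),
      (∀ i j, IsLinearMap ℝ (N i j)) ∧ IsLinearMap ℝ p ∧ (∀ i j f, N i j f = N j i f) ∧
      (∀ (ξ : Fin d → ℝ) (f : C(ℝ × Vec d, ℝ)), (∀ z ∈ D.cylinder T, 0 ≤ f z) →
        0 ≤ ∑ i, ∑ j, ξ i * ξ j * N i j f) ∧
      (∀ f : C(ℝ × Vec d, ℝ), (∀ z ∈ D.cylinder T, 0 ≤ f z) → 0 ≤ p f) ∧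
      (∀ i j (f : C(ℝ × Vec d, ℝ)), IntegrableOn (fun t => (Rv t i j).integral (fun x => f (t, x))
          (ContinuousLinearMap.lsmul ℝ ℝ)) (Ioo 0 T) ∧
        N i j f = ∫ t in Ioo 0 T, (Rv t i j).integral (fun x => f (t, x))
          (ContinuousLinearMap.lsmul ℝ ℝ)) ∧
      ∀ f : C(ℝ × Vec d, ℝ), IntegrableOn (fun t => ∫ x, f (t, x) ∂(Rp t)) (Ioo 0 T) ∧
        p f = ∫ t in Ioo 0 T, ∫ x, f (t, x) ∂(Rp t) := by
  obtain ⟨κ, κt, κp, hκ, hκt, hκp, hae⟩ := h.exists_kernels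
  have k1 := fun f => integral_continuousMap_compProd (κ := κp) (f := f)
    (by filter_upwards [hae] with t ht using ht.2.2.2.1)
  have k2 := fun f => integral_continuousMap_compProd (κ := κt) (f := f)
    (by filter_upwards [hae] with t ht using ht.2.2.2.2.1)
  have k3 := fun i j f => integral_continuousMap_compProd (κ := κ i j) (f := f)
    (by filter_upwards [hae] with t ht using ht.2.2.2.2.2 i j)
  have hslice : ∀ (f : C(ℝ × Vec d, ℝ)) (t : ℝ), Continuous fun x => f (t, x) := fun f t => by
    fun_prop
  have eN : ∀ i j (f : C(ℝ × Vec d, ℝ)), ∀ᵐ t ∂volume.restrict (Ioo 0 T),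
      ∫ x, f (t, x) ∂κ i j t - ∫ x, f (t, x) ∂κt t
        = (Rv t i j).integral (fun x => f (t, x)) (ContinuousLinearMap.lsmul ℝ ℝ) := fun i j f => by
    filter_upwards [hae] with t ⟨_, _, h3, _, h5, h6⟩
    have hi : ∀ n : Measure (Vec d), IsFiniteMeasure n → n D.closedRegionᶜ = 0 →
        Integrable (fun x => f (t, x)) n :=
      fun n hn hn0 => integrable_continuousMap D.isCompact_closedRegion hn0 ⟨_, hslice f t⟩
    exact (integral_signedMeasure_eq_sub (h3 i j) (hi _ inferInstance (h6 i j))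
      (hi _ inferInstance h5)).2.symm
  have ep : ∀ f : C(ℝ × Vec d, ℝ), ∀ᵐ t ∂volume.restrict (Ioo 0 T),
      ∫ x, f (t, x) ∂κp t = ∫ x, f (t, x) ∂(Rp t) := fun f => by
    filter_upwards [hae] with t ht
    rw [ht.1]
  have hNf : ∀ i j (f : C(ℝ × Vec d, ℝ)), IntegrableOn (fun t => (Rv t i j).integral
        (fun x => f (t, x)) (ContinuousLinearMap.lsmul ℝ ℝ)) (Ioo 0 T) ∧
      ∫ z, f z ∂(volume.restrict (Ioo 0 T) ⊗ₘ κ i j) - ∫ z, f z ∂(volume.restrict (Ioo 0 T) ⊗ₘ κt)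
        = ∫ t in Ioo 0 T, (Rv t i j).integral (fun x => f (t, x))
          (ContinuousLinearMap.lsmul ℝ ℝ) := fun i j f => by
    refine ⟨((k3 i j f).2.1.sub (k2 f).2.1).congr (eN i j f), ?_⟩
    rw [(k3 i j f).2.2, (k2 f).2.2, ← integral_sub (k3 i j f).2.1 (k2 f).2.1]
    exact integral_congr_ae (eN i j f)
  have hpf : ∀ f : C(ℝ × Vec d, ℝ), IntegrableOn (fun t => ∫ x, f (t, x) ∂(Rp t)) (Ioo 0 T) ∧
      ∫ z, f z ∂(volume.restrict (Ioo 0 T) ⊗ₘ κp) = ∫ t in Ioo 0 T, ∫ x, f (t, x) ∂(Rp t) :=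
    fun f => ⟨(k1 f).2.1.congr (ep f), (k1 f).2.2.trans (integral_congr_ae (ep f))⟩
  refine ⟨fun i j f => ∫ z, f z ∂(volume.restrict (Ioo 0 T) ⊗ₘ κ i j)
      - ∫ z, f z ∂(volume.restrict (Ioo 0 T) ⊗ₘ κt),
    fun f => ∫ z, f z ∂(volume.restrict (Ioo 0 T) ⊗ₘ κp), fun i j => ⟨fun f g => ?_, fun c f => ?_⟩,
    ⟨fun f g => integral_add (k1 f).1 (k1 g).1, fun c f => integral_const_mul c _⟩,
    fun i j f => ?_, fun ξ f hf => ?_, fun f hf => ?_, hNf, hpf⟩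
  · simp only [ContinuousMap.add_apply]
    rw [integral_add (k3 i j f).1 (k3 i j g).1, integral_add (k2 f).1 (k2 g).1]
    ring
  · simp only [ContinuousMap.smul_apply, smul_eq_mul, integral_const_mul, mul_sub]
  · simp only [(hNf _ _ f).2]
    refine integral_congr_ae ?_
    filter_upwards [h.posSemidef] with t ht
    have : Rv t i j = Rv t j i := by
      ext B hB
      simpa using (ht B hB).isHermitian.apply j i
    simp only [this]
  · simp only [(hNf _ _ f).2, ← integral_const_mul]
    rw [← Finset.sum_congr rfl fun i _ => integral_finsetSum _ fun j _ =>
        ((hNf i j f).1.const_mul (ξ i * ξ j)),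
      ← integral_finsetSum _ fun i _ => integrable_finsetSum _ fun j _ =>
        ((hNf i j f).1.const_mul (ξ i * ξ j))]
    refine integral_nonneg_of_ae ?_
    have hKm := D.isCompact_closedRegion.isClosed.measurableSet
    filter_upwards [h.posSemidef, h.support_v, h.ae_integrable, ae_restrict_mem measurableSet_Ioo]
      with t h1 h2 h3 hmem
    refine sum_mul_integral_nonneg (K := D.closedRegion) (fun B hB => ?_) hKm
      (fun i j => h2 i j _ hKm.compl
        (disjoint_compl_left_iff_subset.mpr D.closedSet_subset_closedRegion))
      (fun i j => (h3 ⟨_, hslice f t⟩).1 i j)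
      fun x hx => hf (t, x) ⟨Ioo_subset_Icc_self hmem, hx⟩
    have := (h1 B hB).dotProduct_mulVec_nonneg ξ
    simp only [dotProduct, Matrix.mulVec, Matrix.of_apply, Finset.mul_sum, star_trivial] at this
    refine this.trans_eq (Finset.sum_congr rfl fun i _ => Finset.sum_congr rfl fun j _ => by ring)
  · refine (integral_nonneg_of_ae ?_).trans_eq (hpf f).2.symm
    filter_upwards [h.support_p, ae_restrict_mem measurableSet_Ioo] with t h1 hmem
    refine integral_nonneg_of_ae ?_
    filter_upwards [mem_ae_iff.mpr h1] with x hx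
    exact hf (t, x) ⟨Ioo_subset_Icc_self hmem, D.closedSet_subset_closedRegion hx⟩

end Functionals

section Solution

open ProbabilityTheory

variable {d : ℕ} {D : FlowRegion d} {a γ T : ℝ} {ρ₀ : Vec d → ℝ} {m₀ : Vec d → Vec d}
  {C : Candidate d}

lemma setIntegral_eq_intervalIntegral {f : ℝ → ℝ} {τ : ℝ} (hτ : τ ∈ Ioo 0 T)
    (h : ∀ t ∈ Ioo 0 T, τ < t → f t = 0) : ∫ t in Ioo 0 T, f t = ∫ t in (0 : ℝ)..τ, f t := by
  rw [intervalIntegral.integral_of_le hτ.1.le]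
  refine setIntegral_eq_of_subset_of_forall_sdiff_eq_zero measurableSet_Ioo
    (fun t ht => ⟨ht.1, ht.2.trans_lt hτ.2⟩) fun t ht => h t ht.1 ?_
  by_contra hle
  exact ht.2 ⟨ht.1.1, not_lt.mp hle⟩

/-- The energy inequality, in the weak form, with weights that need not vanish near the final
time. -/
lemma EnergyInequality.weakDecay (hT : 0 < T) (h : EnergyInequality D a γ T ρ₀ m₀ C) :
    WeakDecay T (initialEnergy D a γ ρ₀ m₀).toReal (totalEnergy D a γ C) := by
  obtain ⟨-, hi, El, Er, h0, -, hEr, hineq⟩ := h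
  intro w hw hw0
  have hwi := integrableOn_continuous_mul (hw.continuous_deriv le_rfl) hi
  have hle : ∀ τ ∈ Ioo 0 T, -(∫ t in (0 : ℝ)..τ, deriv w t * totalEnergy D a γ C t)
      ≤ w 0 * (initialEnergy D a γ ρ₀ m₀).toReal := by
    intro τ hτ
    -- A cutoff that is `1` up to the time `τ` and vanishes before the time `T`.
    set l := (T - τ) / 2 with hl
    have hl0 : 0 < l := by have := hτ.2; simp only [hl]; linarith
    set χ : ℝ → ℝ := fun t => Real.smoothTransition ((τ + l - t) / l) with hχ
    have hχ1 : ∀ t ≤ τ, χ t = 1 := fun t ht => Real.smoothTransition.one_of_one_le (by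
      rw [le_div_iff₀ hl0]; linarith)
    have hχC : ContDiff ℝ 1 χ :=
      (Real.smoothTransition.contDiff (n := 1)).comp (by fun_prop)
    have htest : IsTimeTest T fun t => w t * χ t := by
      refine ⟨hw.mul hχC, ⟨τ + l, by simp only [hl]; linarith [hτ.2], fun t ht => ?_⟩,
        fun t ht => mul_nonneg (hw0 t (Ico_subset_Icc_self ht))
          (Real.smoothTransition.nonneg _)⟩
      have : χ t = 0 := Real.smoothTransition.zero_of_nonpos
        (div_nonpos_of_nonpos_of_nonneg (by linarith) hl0.le)
      simp only [this, mul_zero]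
    have hpos : 0 ≤ Er τ := by
      have hne : (𝓝[>] τ ⊓ ae volume).NeBot := by
        refine inf_neBot_iff.mpr fun {U} hU {V} hV => ?_
        obtain ⟨u, hu, hsub⟩ := mem_nhdsGT_iff_exists_Ioo_subset.mp hU
        by_contra hempty
        have h0 : volume (Ioo τ u) = 0 := measure_mono_null (t := Vᶜ)
          (fun t ht hV' => hempty ⟨t, hsub ht, hV'⟩) (mem_ae_iff.mp hV)
        have hlt : τ < u := hu
        rw [Real.volume_Ioo, ENNReal.ofReal_eq_zero] at h0
        linarith
      exact ge_of_tendsto (hEr τ ⟨hτ.1.le, hτ.2⟩) (.of_forall fun t => ENNReal.toReal_nonneg)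
    have key := hineq _ htest 0 τ le_rfl hτ.1.le hτ.2
    rw [h0, hχ1 τ le_rfl, hχ1 0 hτ.1.le] at key
    have e : ∫ t in (0 : ℝ)..τ, deriv (fun t => w t * χ t) t * totalEnergy D a γ C t
        = ∫ t in (0 : ℝ)..τ, deriv w t * totalEnergy D a γ C t := by
      refine intervalIntegral.integral_congr_ae ?_
      filter_upwards [compl_mem_ae_iff.mpr (measure_singleton τ)] with t htne ht
      rw [uIoc_of_le hτ.1.le] at ht
      have hlt : t < τ := lt_of_le_of_ne ht.2 htne
      have : (fun t => w t * χ t) =ᶠ[𝓝 t] w := by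
        filter_upwards [Iio_mem_nhds hlt] with s hs
        rw [hχ1 s (le_of_lt hs), mul_one]
      rw [this.deriv_eq]
    rw [e] at key
    have := mul_nonneg (hw0 τ (Ioo_subset_Icc_self hτ)) hpos
    linarith
  have hc : ContinuousOn (fun τ => ∫ t in (0 : ℝ)..τ, deriv w t * totalEnergy D a γ C t)
      (Icc 0 T) := by
    have := intervalIntegral.continuousOn_primitive_interval (a := 0) (b := T) (μ := volume)
      (f := fun t => deriv w t * totalEnergy D a γ C t)
      (by rwa [uIcc_of_le hT.le, integrableOn_Icc_iff_integrableOn_Ioo])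
    rwa [uIcc_of_le hT.le] at this
  rw [← integral_Ioc_eq_integral_Ioo, ← intervalIntegral.integral_of_le hT.le]
  have hcT := (hc T (right_mem_Icc.mpr hT.le)).mono (Ioo_subset_Icc_self (a := (0 : ℝ)) (b := T))
  have : (𝓝[Ioo 0 T] T).NeBot := by
    rw [nhdsWithin_Ioo_eq_nhdsLT hT]
    infer_instance
  exact le_of_tendsto hcT.neg (by
    filter_upwards [self_mem_nhdsWithin] with τ hτ using hle τ hτ)

lemma IsDissipativeSolution.lintegral_energyOn (h : IsDissipativeSolution D a γ T ρ₀ m₀ C) :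
    ∫⁻ t in Ioo 0 T, energyOn D a γ C t D.closedSet
      = ENNReal.ofReal (∫ t in Ioo 0 T, totalEnergy D a γ C t) := by
  rw [ofReal_integral_eq_lintegral_ofReal h.energy.2.1
    (.of_forall fun t => ENNReal.toReal_nonneg)]
  refine lintegral_congr_ae ?_
  filter_upwards [h.energy.1] with t ht
  rw [totalEnergy, ENNReal.ofReal_toReal ht.ne]

lemma aemeasurable_energyDensity {X : Type} [MeasurableSpace X] {lam : Measure X} {ρ : X → ℝ}
    {m : X → Vec d} (hρ : AEStronglyMeasurable ρ lam) (hm : AEStronglyMeasurable m lam) :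
    AEMeasurable (fun z => energyDensity a γ (ρ z) (m z)) lam := by
  unfold energyDensity pressurePotential
  have h1 := hρ.aemeasurable
  have h2 := hm.norm.aemeasurable
  fun_prop

lemma IsDissipativeSolution.isFlow (ha : 0 < a) (hγ : 1 < γ)
    (h : IsDissipativeSolution D a γ T ρ₀ m₀ C) :
    IsFlow (D.spaceTime T) γ (fun z => C.ρ z.1 z.2) fun z => C.m z.1 z.2 := by
  have hρ : AEStronglyMeasurable (fun z : ℝ × Vec d => C.ρ z.1 z.2) (D.spaceTime T) :=
    h.density_weak.aestronglyMeasurable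
  have hm : AEStronglyMeasurable (fun z : ℝ × Vec d => C.m z.1 z.2) (D.spaceTime T) :=
    h.momentum_weak.aestronglyMeasurable
  refine isFlow_of_lintegral_energyDensity ha hγ hρ hm ?_ ?_
  · have h1 : ∀ᵐ z ∂D.spaceTime T, 0 ≤ hρ.mk _ z := by
      refine (Measure.ae_prod_iff_ae_ae
        (measurableSet_le measurable_const hρ.stronglyMeasurable_mk.measurable)).mpr ?_
      filter_upwards [Measure.ae_ae_of_ae_prod hρ.ae_eq_mk, ae_restrict_mem measurableSet_Ioo]
        with t ht hmem
      filter_upwards [ht, h.density_nonneg t (Ioo_subset_Icc_self hmem)] with x h1 h2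
      rwa [← h1]
    filter_upwards [h1, hρ.ae_eq_mk] with z h1 h2
    rwa [h2]
  · rw [FlowRegion.spaceTime, lintegral_prod _ (aemeasurable_energyDensity hρ hm)]
    refine lt_of_le_of_lt (lintegral_mono fun t => ?_)
        (h.lintegral_energyOn ▸ ENNReal.ofReal_lt_top)
    rw [energyOn, D.vol_restrict_closedSet, add_assoc]
    exact le_self_add

/-- The energy of the defects at time `t`. -/
noncomputable def defectEnergy (γ : ℝ) (C : Candidate d) (t : ℝ) : ℝ :=
  1 / 2 * ∑ i, C.Rv t i i univ + 1 / (γ - 1) * (C.Rp t).real univ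

lemma IsDissipativeSolution.ae_totalEnergy_eq (ha : 0 < a) (hγ : 1 < γ)
    (h : IsDissipativeSolution D a γ T ρ₀ m₀ C) :
    ∀ᵐ t ∂volume.restrict (Ioo 0 T), totalEnergy D a γ C t
      = ∫ x, realEnergy a γ (C.ρ t x) (C.m t x) ∂D.vol + defectEnergy γ C t := by
  have hγ1 : 0 < γ - 1 := by linarith
  obtain ⟨Cp, hCp⟩ := h.defects.bounded_p
  filter_upwards [(h.isFlow ha hγ).ae_slice, h.defects.support_v, h.defects.support_p,
    h.defects.posSemidef, hCp] with t h1 h2 h3 h4 h5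
  have hcl := D.measurableSet_closedSet
  have hv : ∀ i, C.Rv t i i D.closedSet = C.Rv t i i univ := fun i => by
    rw [← union_compl_self D.closedSet, VectorMeasure.of_union disjoint_compl_right hcl hcl.compl,
      h2 i i _ hcl.compl disjoint_compl_left, add_zero]
  have hp : C.Rp t D.closedSet = C.Rp t univ :=
    measure_eq_measure_of_null_sdiff (subset_univ _) (measure_mono_null (fun x hx => hx.2) h3)
  have hE : 0 ≤ ∫ x, realEnergy a γ (C.ρ t x) (C.m t x) ∂D.vol := integral_nonneg_of_ae (by
    filter_upwards [h1.nonneg] with x hx using realEnergy_nonneg ha hγ hx _)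
  have htr : 0 ≤ 1 / 2 * ∑ i, C.Rv t i i univ :=
    mul_nonneg (by norm_num) (Finset.sum_nonneg fun i _ =>
      (h4 univ MeasurableSet.univ).diag_nonneg (i := i))
  have hfin : C.Rp t univ ≠ ∞ := (h5.trans_lt ENNReal.coe_lt_top).ne
  simp only [totalEnergy, energyOn, D.vol_restrict_closedSet, h1.lintegral_energyDensity ha hγ, hv,
    hp]
  rw [ENNReal.toReal_add (by finiteness) (by finiteness), ENNReal.toReal_add (by finiteness)
    (by finiteness), ENNReal.toReal_ofReal hE, ENNReal.toReal_ofReal htr, ENNReal.toReal_mul,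
    ENNReal.toReal_ofReal (by positivity), defectEnergy, add_assoc]
  rfl

end Solution

section RelaxedOfSolution

open ProbabilityTheory

variable {d : ℕ} {D : FlowRegion d} {a γ T : ℝ} {ρ₀ : Vec d → ℝ} {m₀ : Vec d → Vec d}
  {C : Candidate d}

lemma defectPairing_sub_energy (τ : ConstraintTest D T) {t : ℝ}
    (hi : ∀ g : C(Vec d, ℝ), (∀ i j, (C.Rv t i j).Integrable g) ∧ Integrable g (C.Rp t))
    (hfin : ∀ i j, (C.Rv t i j).variation univ ≠ ∞) :
    (∑ i, ∑ j, (C.Rv t i j).integral (fun x => τ.blockFun (some i) (some j) (t, x))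
        (ContinuousLinearMap.lsmul ℝ ℝ)) + ∫ x, τ.pressureFun γ (t, x) ∂(C.Rp t)
      = defectPairing (C.Rv t) (C.Rp t) (τ.Φ t) - deriv τ.w t * defectEnergy γ C t := by
  have hp : ∀ i j, Continuous fun x => partialD (τ.Φ t) x i j := fun i j =>
    (continuous_partialD_spaceSlice τ.vector.1 i j).comp (Continuous.prodMk_right t)
  have hd : Continuous fun x => divergence (τ.Φ t) x :=
    (continuous_divergence_spaceSlice τ.vector.1).comp (Continuous.prodMk_right t)
  have e1 : ∀ i j, (C.Rv t i j).integral (fun x => τ.blockFun (some i) (some j) (t, x))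
        (ContinuousLinearMap.lsmul ℝ ℝ)
      = (C.Rv t i j).integral (fun x => partialD (τ.Φ t) x i j) (ContinuousLinearMap.lsmul ℝ ℝ)
        - (if i = j then deriv τ.w t / 2 else 0) * C.Rv t i j univ := fun i j => by
    have : IsFiniteMeasure (C.Rv t i j).variation := ⟨(hfin i j).lt_top⟩
    have hc := VectorMeasure.integral_const (μ := C.Rv t i j)
      (B := (ContinuousLinearMap.lsmul ℝ ℝ : ℝ →L[ℝ] ℝ →L[ℝ] ℝ))
      (if i = j then deriv τ.w t / 2 else 0)
    have hs := VectorMeasure.integral_fun_sub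
      (B := (ContinuousLinearMap.lsmul ℝ ℝ : ℝ →L[ℝ] ℝ →L[ℝ] ℝ))
      ((hi ⟨_, hp i j⟩).1 i j) ((hi (.const _ (if i = j then deriv τ.w t / 2 else 0))).1 i j)
    refine hs.trans ?_
    congr 1
  have e2 : ∫ x, τ.pressureFun γ (t, x) ∂(C.Rp t)
      = ∫ x, divergence (τ.Φ t) x ∂(C.Rp t) - deriv τ.w t / (γ - 1) * (C.Rp t).real univ := by
    refine (integral_sub (hi ⟨_, hd⟩).2 (hi (.const _ (deriv τ.w t / (γ - 1)))).2).trans ?_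
    simp [mul_comm]
  simp only [e1, e2, Finset.sum_sub_distrib, ite_mul, zero_mul, Finset.sum_ite_eq, Finset.mem_univ,
    if_true, defectPairing, defectEnergy, ← Finset.mul_sum]
  ring

/-- The weak formulations of a dissipative solution, on the whole time interval. -/
lemma IsDissipativeSolution.integral_transport_add_defectPairing (hT : 0 < T) (ha : 0 < a)
    (hγ : 1 < γ) (h : IsDissipativeSolution D a γ T ρ₀ m₀ C) {φ : ℝ → Vec d → ℝ}
    {Φ : ℝ → Vec d → Vec d} (hφ : IsScalarTest D T φ) (hΦ : IsVectorTest D T Φ) :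
    (∫ t in Ioo 0 T, ∫ x, transport a γ φ Φ (C.ρ t x) (C.m t x) (t, x) ∂D.vol)
      + ∫ t in Ioo 0 T, defectPairing (C.Rv t) (C.Rp t) (Φ t)
      = -(∫ x, ρ₀ x * φ 0 x ∂D.vol) - ∫ x, inner ℝ (m₀ x) (Φ 0 x) ∂D.vol := by
  have hflow := h.isFlow ha hγ
  have hQ := D.isCompact_cylinder T
  have i1 := hflow.integrable_transport_of_contDiff (a := a) (Φ := fun _ _ => 0) hQ
    (D.spaceTime_compl T) hφ.1 contDiff_const
  have i2 := hflow.integrable_transport_of_contDiff (a := a) (φ := fun _ _ => 0) hQ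
    (D.spaceTime_compl T) contDiff_const hΦ.1
  have hsplit : ∀ z : ℝ × Vec d, transport a γ φ Φ (C.ρ z.1 z.2) (C.m z.1 z.2) z
      = transport a γ φ (fun _ _ => 0) (C.ρ z.1 z.2) (C.m z.1 z.2) z
        + transport a γ (fun _ _ => 0) Φ (C.ρ z.1 z.2) (C.m z.1 z.2) z := fun z => by
    rw [transport_zero_left, transport_zero_right, transport]
  have e1 : ∫ t in Ioo 0 T, ∫ x, transport a γ φ Φ (C.ρ t x) (C.m t x) (t, x) ∂D.vol
      = (∫ t in Ioo 0 T, ∫ x, transport a γ φ (fun _ _ => 0) (C.ρ t x) (C.m t x) (t, x) ∂D.vol)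
        + ∫ t in Ioo 0 T, ∫ x, transport a γ (fun _ _ => 0) Φ (C.ρ t x) (C.m t x) (t, x)
          ∂D.vol := by
    rw [← integral_add i1.integral_prod_left i2.integral_prod_left]
    refine integral_congr_ae ?_
    filter_upwards [i1.prod_right_ae, i2.prod_right_ae] with t h1 h2
    rw [← integral_add h1 h2]
    exact integral_congr_ae (.of_forall fun x => hsplit (t, x))
  obtain ⟨T₁, hT₁, hφ0⟩ := hφ.2.1
  obtain ⟨T₂, hT₂, hΦ0⟩ := hΦ.2.1
  -- A time after which both test functions vanish.
  obtain ⟨τ, hτ1, hτT⟩ := exists_between (max_lt hT (max_lt hT₁ hT₂))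
  have hτ : τ ∈ Ioo 0 T := ⟨(le_max_left _ _).trans_lt hτ1, hτT⟩
  have hτ₁ : T₁ < τ := (le_max_left _ _).trans_lt ((le_max_right _ _).trans_lt hτ1)
  have hτ₂ : T₂ < τ := (le_max_right _ _).trans_lt ((le_max_right _ _).trans_lt hτ1)
  have dφ : ∀ t > τ, ∀ x, deriv (fun s => φ s x) t = 0 := fun t ht x => by
    have : (fun s => φ s x) =ᶠ[𝓝 t] fun _ => 0 := by
      filter_upwards [Ioi_mem_nhds (hτ₁.trans ht)] with s hs using hφ0 s (le_of_lt hs) x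
    rw [this.deriv_eq, deriv_const]
  have dΦ : ∀ t > τ, ∀ x, deriv (fun s => Φ s x) t = 0 := fun t ht x => by
    have : (fun s => Φ s x) =ᶠ[𝓝 t] fun _ => 0 := by
      filter_upwards [Ioi_mem_nhds (hτ₂.trans ht)] with s hs using hΦ0 s (le_of_lt hs) x
    rw [this.deriv_eq, deriv_const]
  have zφ : ∀ t > τ, φ t = fun _ => 0 := fun t ht => funext (hφ0 t (hτ₁.trans ht).le)
  have zΦ : ∀ t > τ, Φ t = fun _ => 0 := fun t ht => funext (hΦ0 t (hτ₂.trans ht).le)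
  have hgrad : ∀ x : Vec d, gradient (fun _ : Vec d => (0 : ℝ)) x = 0 := fun x => by
    simp [gradient]
  have hc := h.continuity φ hφ τ hτ
  have hm := h.momentum Φ hΦ τ hτ
  rw [integral_congr_ae (g := fun x => ρ₀ x * φ 0 x) (f := fun x => C.ρ 0 x * φ 0 x) (by
    filter_upwards [h.initial_density] with x hx; rw [hx])] at hc
  rw [integral_congr_ae (g := fun x => inner ℝ (m₀ x) (Φ 0 x))
    (f := fun x => inner ℝ (C.m 0 x) (Φ 0 x)) (by
    filter_upwards [h.initial_momentum] with x hx; rw [hx])] at hm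
  simp only [hφ0 τ hτ₁.le, mul_zero, integral_zero, zero_sub] at hc
  simp only [hΦ0 τ hτ₂.le, inner_zero_right, integral_zero, zero_sub] at hm
  rw [e1, hc, sub_eq_add_neg, hm, add_assoc]
  refine congrArg₂ (· + ·) ?_ (congrArg₂ (· + ·) ?_ ?_)
  · simp only [transport_zero_right]
    refine setIntegral_eq_intervalIntegral hτ fun t _ ht => ?_
    simp [dφ t ht, zφ t ht, hgrad]
  · simp only [transport_zero_left]
    refine setIntegral_eq_intervalIntegral hτ fun t _ ht => ?_
    simp [dΦ t ht, zΦ t ht, partialD, divergence]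
  · refine setIntegral_eq_intervalIntegral hτ fun t _ ht => ?_
    simp [zΦ t ht, partialD, divergence, defectPairing]

/-- A dissipative solution is a relaxed solution with the same time-integrated energy. -/
theorem IsDissipativeSolution.exists_relaxed (hT : 0 < T) (ha : 0 < a) (hγ : 1 < γ)
    (h : IsDissipativeSolution D a γ T ρ₀ m₀ C) :
    ∃ S ∈ relaxedSolutions D a γ T ρ₀ m₀,
      energyFunctional D a γ T C = ENNReal.ofReal (S.energy γ 1) := by
  have hflow := h.isFlow ha hγ
  have hQ := D.isCompact_cylinder T
  have hlam := D.spaceTime_compl T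
  obtain ⟨N, p, hN, hp, hsymm, hpsd, hpos, hNf, hpf⟩ := h.defects.exists_functionals
  obtain ⟨Cv, hCv⟩ := h.defects.bounded_v
  set S : RelaxedState (ℝ × Vec d) d :=
    (fun i j f => (pureState (D.spaceTime T) a γ (fun z => C.ρ z.1 z.2)
        fun z => C.m z.1 z.2).1 i j f
        + i.elim 0 fun i => j.elim 0 fun j => N i j f,
      fun f => (pureState (D.spaceTime T) a γ (fun z => C.ρ z.1 z.2) fun z => C.m z.1 z.2).2 f
        + p f) with hSdef
  have hS : IsRelaxed (D.cylinder T) (D.spaceTime T) a γ S :=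
    (hflow.isRelaxed_pureState ha hγ hQ hlam).add_defect hN hp hsymm hpsd hpos
  have hE := h.energy.2.1
  have hres : ∀ τ : ConstraintTest D T, τ.residual a γ ρ₀ m₀ S
      = -(∫ t in Ioo 0 T, deriv τ.w t * totalEnergy D a γ C t)
        - τ.w 0 * (initialEnergy D a γ ρ₀ m₀).toReal := by
    intro τ
    have hw := τ.contDiff_w.continuous_deriv le_rfl
    have hweak := h.integral_transport_add_defectPairing hT ha hγ τ.scalar τ.vector
    have iT := hflow.integrable_transport_of_contDiff (a := a) hQ hlam τ.scalar.1 τ.vector.1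
    have iR := integrable_continuousMap_mul hQ hlam ⟨_, hw.comp continuous_fst⟩
      (hflow.integrable_realEnergy a)
    have iN : ∀ i j, IntegrableOn (fun t => (C.Rv t i j).integral
        (fun x => τ.blockFun (some i) (some j) (t, x)) (ContinuousLinearMap.lsmul ℝ ℝ)) (Ioo 0 T) :=
      fun i j => (hNf i j ⟨_, τ.continuous_blockFun (some i) (some j)⟩).1
    have ip : IntegrableOn (fun t => ∫ x, τ.pressureFun γ (t, x) ∂(C.Rp t)) (Ioo 0 T) :=
      (hpf ⟨_, τ.continuous_pressureFun γ⟩).1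
    have iP : IntegrableOn (fun t => defectPairing (C.Rv t) (C.Rp t) (τ.Φ t)) (Ioo 0 T) :=
      (integrable_finsetSum _ fun i _ => integrable_finsetSum _ fun j _ =>
        (hNf i j ⟨_, continuous_partialD_spaceSlice τ.vector.1 i j⟩).1).add
        (hpf ⟨_, continuous_divergence_spaceSlice τ.vector.1⟩).1
    have e1 : τ.residual a γ ρ₀ m₀ S
        = (∫ z, (transport a γ τ.φ τ.Φ (C.ρ z.1 z.2) (C.m z.1 z.2) z
          - deriv τ.w z.1 * realEnergy a γ (C.ρ z.1 z.2) (C.m z.1 z.2)) ∂D.spaceTime T)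
        + (∑ i, ∑ j, N i j ⟨_, τ.continuous_blockFun (some i) (some j)⟩
          + p ⟨_, τ.continuous_pressureFun γ⟩) + τ.initial a γ ρ₀ m₀ := by
      rw [← hflow.residual_pureState hQ hlam τ, ConstraintTest.residual]
      simp only [hSdef, Fintype.sum_option, Option.elim_none, Option.elim_some,
        Finset.sum_add_distrib, Finset.sum_const_zero]
      ring
    have e2 : ∑ i, ∑ j, N i j ⟨_, τ.continuous_blockFun (some i) (some j)⟩
          + p ⟨_, τ.continuous_pressureFun γ⟩
        = ∫ t in Ioo 0 T, (defectPairing (C.Rv t) (C.Rp t) (τ.Φ t)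
          - deriv τ.w t * defectEnergy γ C t) := by
      have eN : ∀ i j, N i j ⟨_, τ.continuous_blockFun (some i) (some j)⟩
          = ∫ t in Ioo 0 T, (C.Rv t i j).integral (fun x => τ.blockFun (some i) (some j) (t, x))
            (ContinuousLinearMap.lsmul ℝ ℝ) := fun i j => (hNf i j _).2
      have ep : p ⟨_, τ.continuous_pressureFun γ⟩
          = ∫ t in Ioo 0 T, ∫ x, τ.pressureFun γ (t, x) ∂(C.Rp t) := (hpf _).2
      simp only [eN, ep]
      rw [← Finset.sum_congr rfl fun i _ => integral_finsetSum _ fun j _ => iN i j,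
        ← integral_finsetSum _ fun i _ => integrable_finsetSum _ fun j _ => iN i j,
        ← integral_add (integrable_finsetSum _ fun i _ => integrable_finsetSum _ fun j _ => iN i j)
          ip]
      refine integral_congr_ae ?_
      filter_upwards [h.defects.ae_integrable, hCv] with t h1 h2
      exact defectPairing_sub_energy τ h1 fun i j => ((h2 i j).trans_lt ENNReal.coe_lt_top).ne
    have iTR : Integrable (fun z : ℝ × Vec d => transport a γ τ.φ τ.Φ (C.ρ z.1 z.2) (C.m z.1 z.2) z
          - deriv τ.w z.1 * realEnergy a γ (C.ρ z.1 z.2) (C.m z.1 z.2)) (D.spaceTime T) := iT.sub iR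
    have e3 : ∫ z, (transport a γ τ.φ τ.Φ (C.ρ z.1 z.2) (C.m z.1 z.2) z
          - deriv τ.w z.1 * realEnergy a γ (C.ρ z.1 z.2) (C.m z.1 z.2)) ∂D.spaceTime T
        = ∫ t in Ioo 0 T, ((∫ x, transport a γ τ.φ τ.Φ (C.ρ t x) (C.m t x) (t, x) ∂D.vol)
          - deriv τ.w t * ∫ x, realEnergy a γ (C.ρ t x) (C.m t x) ∂D.vol) := by
      refine (integral_prod _ iTR).trans (integral_congr_ae ?_)
      filter_upwards [iT.prod_right_ae, iR.prod_right_ae] with t h1 h2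
      refine (integral_sub h1 h2).trans ?_
      congr 1
      exact integral_const_mul (deriv τ.w t) _
    have iR' : IntegrableOn (fun t => deriv τ.w t * ∫ x, realEnergy a γ (C.ρ t x) (C.m t x) ∂D.vol)
        (Ioo 0 T) := integrableOn_continuous_mul hw
      (hflow.integrable_realEnergy a).integral_prod_left
    have hae : ∀ᵐ t ∂volume.restrict (Ioo 0 T), deriv τ.w t * defectEnergy γ C t
        = deriv τ.w t * totalEnergy D a γ C t
          - deriv τ.w t * ∫ x, realEnergy a γ (C.ρ t x) (C.m t x) ∂D.vol := by
      filter_upwards [h.ae_totalEnergy_eq ha hγ] with t ht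
      rw [ht]
      ring
    have iE := integrableOn_continuous_mul hw hE
    have iD : IntegrableOn (fun t => deriv τ.w t * defectEnergy γ C t) (Ioo 0 T) :=
      (iE.sub iR').congr (by filter_upwards [hae] with t ht using ht.symm)
    have e4 : ∫ t in Ioo 0 T, deriv τ.w t * defectEnergy γ C t
        = (∫ t in Ioo 0 T, deriv τ.w t * totalEnergy D a γ C t)
          - ∫ t in Ioo 0 T, deriv τ.w t * ∫ x, realEnergy a γ (C.ρ t x) (C.m t x) ∂D.vol := by
      rw [integral_congr_ae hae, integral_sub iE iR']
    rw [e1, e2, e3, integral_sub iT.integral_prod_left iR', integral_sub iP iD, e4,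
      ConstraintTest.initial]
    linarith
  refine ⟨S, ⟨hS, fun τ => ?_⟩, ?_⟩
  · rw [hres]
    have := h.energy.weakDecay hT τ.w τ.contDiff_w τ.w_nonneg
    linarith
  · have hrem := hres (ConstraintTest.remainingTime D T)
    rw [ConstraintTest.residual_remainingTime hS] at hrem
    have hd : ∀ t, deriv (ConstraintTest.remainingTime D T).w t = -1 := fun t => by
      simp [ConstraintTest.remainingTime, ConstraintTest.ofWeight]
    have h0 : (ConstraintTest.remainingTime D T).w 0 = T := by
      simp [ConstraintTest.remainingTime, ConstraintTest.ofWeight]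
    simp only [hd, h0, neg_mul, one_mul, integral_neg, neg_neg] at hrem
    rw [energyFunctional, h.lintegral_energyOn]
    congr 1
    linarith

end RelaxedOfSolution

/-! ### Minimizers are admissible -/

section Minimizers

open ProbabilityTheory

variable {d : ℕ} {D : FlowRegion d} {a γ T : ℝ} {ρ₀ : Vec d → ℝ} {m₀ : Vec d → Vec d}
  {C : Candidate d}

lemma IsDissipativeSolution.aemeasurable_energyOn (h : IsDissipativeSolution D a γ T ρ₀ m₀ C)
    {A : Set (ℝ × Vec d)} (hA : MeasurableSet A) :
    AEMeasurable (fun t => energyOn D a γ C t {x | (t, x) ∈ A}) (volume.restrict (Ioo 0 T)) := by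
  obtain ⟨κ, κt, κp, hκ, hκt, hκp, hae⟩ := h.defects.exists_kernels
  have hE : AEMeasurable (fun z : ℝ × Vec d => energyDensity a γ (C.ρ z.1 z.2) (C.m z.1 z.2))
      ((volume.restrict (Ioo 0 T)).prod D.vol) := aemeasurable_energyDensity
    h.density_weak.aestronglyMeasurable h.momentum_weak.aestronglyMeasurable
  have h1 := (hE.indicator hA).lintegral_prod_right'
  have h2 : Measurable fun t => κt t {x | (t, x) ∈ A} := Kernel.measurable_kernel_prodMk_left hA
  have h3 : Measurable fun t => κp t {x | (t, x) ∈ A} := Kernel.measurable_kernel_prodMk_left hA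
  refine ((h1.add ((h2.ennreal_toReal.const_mul (1 / 2)).ennreal_ofReal.aemeasurable)).add
    (h3.const_mul (ENNReal.ofReal (1 / (γ - 1)))).aemeasurable).congr ?_
  filter_upwards [hae] with t ht
  have hs : MeasurableSet {x | (t, x) ∈ A} := measurable_prodMk_left hA
  have he : ∫⁻ x in {x | (t, x) ∈ A}, energyDensity a γ (C.ρ t x) (C.m t x) ∂D.vol
      = ∫⁻ x, A.indicator (fun z => energyDensity a γ (C.ρ z.1 z.2) (C.m z.1 z.2)) (t, x)
        ∂D.vol := by
    rw [← lintegral_indicator hs]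
    rfl
  rw [energyOn, he, ← ht.2.1 _ hs, ← ht.1]
  rfl

lemma IsDissipativeSolution.ae_energyOn_union (h : IsDissipativeSolution D a γ T ρ₀ m₀ C) :
    ∀ᵐ t ∂volume.restrict (Ioo 0 T), ∀ B B' : Set (Vec d), MeasurableSet B → MeasurableSet B' →
      Disjoint B B' → energyOn D a γ C t (B ∪ B')
        = energyOn D a γ C t B + energyOn D a γ C t B' := by
  filter_upwards [h.defects.posSemidef] with t ht B B' hB hB' hd
  have h0 : ∀ B, MeasurableSet B → 0 ≤ 1 / 2 * ∑ i, C.Rv t i i B := fun B hB =>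
    mul_nonneg (by norm_num) (Finset.sum_nonneg fun i _ => (ht B hB).diag_nonneg (i := i))
  simp only [energyOn, lintegral_union hB' hd, VectorMeasure.of_union hd hB hB',
    Finset.sum_add_distrib, mul_add, measure_union hd hB', ENNReal.ofReal_add (h0 B hB) (h0 B' hB')]
  abel

/-- The energy of a set and of its complement add up to the time-integrated total energy. -/
lemma IsDissipativeSolution.spaceTimeEnergy_add_compl (h : IsDissipativeSolution D a γ T ρ₀ m₀ C)
    {A : Set (ℝ × Vec d)} (hA : MeasurableSet A) (hsub : A ⊆ Icc 0 T ×ˢ D.closedSet) :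
    spaceTimeEnergy D a γ T C A + spaceTimeEnergy D a γ T C ((Icc 0 T ×ˢ D.closedSet) \ A)
      = energyFunctional D a γ T C := by
  rw [spaceTimeEnergy, spaceTimeEnergy, ← lintegral_add_left' (h.aemeasurable_energyOn hA),
    energyFunctional]
  refine lintegral_congr_ae ?_
  filter_upwards [h.ae_energyOn_union, ae_restrict_mem measurableSet_Ioo] with t ht hmem
  have hQ : MeasurableSet ((Icc 0 T ×ˢ D.closedSet) \ A) :=
    (measurableSet_Icc.prod D.measurableSet_closedSet).diff hA
  refine (ht _ _ (measurable_prodMk_left hA) (measurable_prodMk_left hQ)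
    (Set.disjoint_left.mpr fun x hx hx' => hx'.2 hx)).symm.trans (congrArg _ ?_)
  ext x
  have : (t, x) ∈ A → x ∈ D.closedSet := fun hx => (hsub hx).2
  simp only [mem_union, mem_preimage, Set.mem_sdiff, mem_prod, Ioo_subset_Icc_self hmem, true_and]
  tauto

/-- If the energy measure of a competitor is smaller while its total mass is not, then the two
measures agree, since they agree on no set without agreeing on its complement. -/
theorem IsEnergyMinimizer.isAdmissible (h : IsEnergyMinimizer D a γ T ρ₀ m₀ C) :
    IsAdmissible D a γ T ρ₀ m₀ C := by
  refine ⟨h.1, fun C' h' hle A hA hsub => le_antisymm ?_ (hle A hA hsub)⟩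
  have hQ : MeasurableSet ((Icc 0 T ×ˢ D.closedSet) \ A) :=
    (measurableSet_Icc.prod D.measurableSet_closedSet).diff hA
  have hle' := hle _ hQ sdiff_subset
  have hfin : energyFunctional D a γ T C ≠ ∞ := by
    rw [energyFunctional, h.1.lintegral_energyOn]
    exact ENNReal.ofReal_ne_top
  have hmin := h.2 C' h'
  rw [← h.1.spaceTimeEnergy_add_compl hA hsub] at hmin hfin
  rw [← h'.spaceTimeEnergy_add_compl hA hsub] at hmin
  exact (ENNReal.add_le_add_iff_right (ENNReal.add_ne_top.mp hfin).2).mp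
    (hmin.trans (add_le_add_right hle' _))

theorem exists_isEnergyMinimizer (hT : 0 < T) (ha : 0 < a) (hγ : 1 < γ)
    (hdata : IsFiniteEnergyData D a γ ρ₀ m₀) :
    ∃ C : Candidate d, IsEnergyMinimizer D a γ T ρ₀ m₀ C := by
  obtain ⟨S, hS, hmin⟩ := exists_minimal_relaxedSolution hT ha hγ hdata
  obtain ⟨C, hC, hE⟩ := exists_dissipativeSolution hT ha hγ hdata hS
  refine ⟨C, hC, fun C' hC' => ?_⟩
  obtain ⟨S', hS', hE'⟩ := hC'.exists_relaxed hT ha hγ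
  rw [hE, hE']
  exact ENNReal.ofReal_le_ofReal (hmin S' hS')

end Minimizers

end EulerDiss

theorem mainTheorem6 (d : ℕ) (hd : d = 2 ∨ d = 3) (D : FlowRegion d) (a γ T : ℝ)
    (ha : 0 < a) (hγ : 1 < γ) (hT : 0 < T) (ρ₀ : Vec d → ℝ) (m₀ : Vec d → Vec d)
    (hdata : IsFiniteEnergyData D a γ ρ₀ m₀) :
    (∃ S : Candidate d, IsAdmissible D a γ T ρ₀ m₀ S) ∧
    (∃ S : Candidate d, IsEnergyMinimizer D a γ T ρ₀ m₀ S) ∧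
    (∀ S : Candidate d, IsEnergyMinimizer D a γ T ρ₀ m₀ S → IsAdmissible D a γ T ρ₀ m₀ S) := by
  obtain ⟨S, hS⟩ := exists_isEnergyMinimizer hT ha hγ hdata
  exact ⟨⟨S, hS.isAdmissible⟩, ⟨S, hS⟩, fun _ h => h.isAdmissible⟩
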